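/- **Setting.** Let $\mathfrak h$ be a complex Hilbert space, $\Gamma(\mathfrak h)=\bigoplus_{n\ge 0}\otimes_{\rm s}^n\mathfrak h$ the bosonic Fock space with number operator $N$, $\Gamma_{\rm fin}(\mathfrak h)$ the finite particle vectors, $\phi(h)=\frac1{\sqrt2}(a^*(h)+a(h))$ the field operators and $W(h)=e^{i\phi(h)}$ the Weyl operators. Let $\omega$ be a self-adjoint operator on $\mathfrak h$, $H_0=d\Gamma(\omega)$, and let $w=w^*$ be a Hilbert–Schmidt operator on $\Gamma(\mathfrak h)$ with $\mathbb 1_{[0,d]}(N)\,w\,\mathbb 1_{[0,d]}(N)=w$ for some $d\in\mathbb N$. Let $V={\rm Wick}(w)$ be the closure of the operator on $\Gamma_{\rm fin}(\mathfrak h)$ which, for the component $w_{p,q}$ of $w$ mapping $p$ to $q$ particles, acts on $\otimes_{\rm s}^n\mathfrak h$, $n\ge p$, as $\frac{\sqrt{n!(n+q-p)!}}{(n-p)!}\,w_{p,q}\otimes_{\rm s}\mathbb 1^{\otimes(n-p)}$ (and as $0$ for $n<p$). Assume that $H_0+V$ and its closure $H=\overline{H_0+V}$ form an abstract QFT Hamiltonian,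 i.e. * (H1) $\inf\sigma(\omega)=m>0$; * (H2) $H_0+V$ is essentially self-adjoint and bounded below on $\mathcal D(H_0)\cap\mathcal D(V)$; * (H3) with a fixed $b>0$ such that $H+b\ge 1$: for every $n\in\mathbb N$ there is $p\in\mathbb N$ such that $N^nH_0(H+b)^{-p}$ is bounded, and for every $P\in\mathbb N$ there is $M>P$ such that $N^M(H+b)^{-1}(N+1)^{-P}$ is bounded. Let $\langle x\rangle\ge 1$ be a self-adjoint operator on $\mathfrak h$. For a bounded self-adjoint operator $a$ on $\mathfrak h$ let $\interleave d\Gamma(a)w\interleave=\sum_i\|(a)_iw\|_{HS}+\sum_i\|(a)_iw^*\|_{HS}$, where $(a)_i$ is $a$ acting on the $i$-th tensor factor (and $0$ on components with fewer than $i$ particles). Let $\mathfrak h_{\rm c}(\omega)$ be the continuous spectral subspace of $\omega$ (the orthogonal complement of all its eigenvectors), and $h_t=e^{-it\omega}h$. Assume * (Is) for some $s>1$: $\interleave d\Gamma(j(\langle x\rangle/R))w\interleave\in O(R^{-s})$, $R\ge1$, for all real $j\in C^\infty(\mathbb R)$ with $j\equiv0$ near $0$ and $j\equiv1$ near $\pm\infty$;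 * (S) there is a subspace $\mathfrak h_0$ dense in $\mathfrak h_{\rm c}(\omega)$ such that for every $h\in\mathfrak h_0$ there are $\epsilon>0$ and $\mu>1$ with $\|\mathbb 1_{[0,\epsilon]}(\langle x\rangle/|t|)\,e^{-it\omega}h\|\in O(t^{-\mu})$ as $t\to+\infty$. **Theorem.** 1. For all $h\in\mathfrak h_{\rm c}(\omega)$ the strong limits $W^+(h)=\text{s-}\lim_{t\to+\infty}e^{itH}W(h_t)e^{-itH}$ exist, and are unitary. There is $n_0\in\mathbb N$ such that for all $n\ge n_0$ and all $h\in\mathfrak h_{\rm c}(\omega)$, in operator norm, $W^+(h)(H+b)^{-n}=\lim_{t\to+\infty}e^{itH}W(h_t)(H+b)^{-n}e^{-itH}$. 2. The map $\mathfrak h_{\rm c}(\omega)\ni h\mapsto W^+(h)$ is strongly continuous, and for $n\ge n_0$ the map $\mathfrak h_{\rm c}(\omega)\ni h\mapsto W^+(h)(H+b)^{-n}$ is norm continuous. 3. For all $h,g\in\mathfrak h_{\rm c}(\omega)$, $W^+(h)W^+(g)=e^{-\frac i2{\rm Im}(h|g)}\,W^+(h+g)$, with $(\cdot|\cdot)$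 linear in the second argument. 4. For all $t\in\mathbb R$ and $h\in\mathfrak h_{\rm c}(\omega)$, $h_{-t}\in\mathfrak h_{\rm c}(\omega)$ and $e^{itH}W^+(h)e^{-itH}=W^+(h_{-t})$. -/

import Mathlib

open Filter Topology MeasureTheory
open scoped ENNReal

noncomputable section

/-! ### Unbounded operators on a Hilbert space

An unbounded operator is a `LinearPMap`; `IsSelfAdjoint A` is Mathlib's `A† = A`, which
includes density of the domain. -/

section Operators

variable {E : Type*} [NormedAddCommGroup E] [InnerProductSpace ℂ E] [CompleteSpace E]

/-- `A` is essentially self-adjoint: its closure is self-adjoint. -/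
def IsEssSelfAdjoint (A : E →ₗ.[ℂ] E) : Prop := IsSelfAdjoint A.closure

/-- `A ≥ c` in the sense of quadratic forms. -/
def FormBoundedBelow (A : E →ₗ.[ℂ] E) (c : ℝ) : Prop :=
  ∀ u : A.domain, c * ‖(u : E)‖ ^ 2 ≤ (inner ℂ (u : E) (A u)).re

/-- `T = (A - z)⁻¹`, a bounded two-sided inverse of `A - z : D(A) → E`. -/
def IsResolventAt (A : E →ₗ.[ℂ] E) (z : ℂ) (T : E →L[ℂ] E) : Prop :=
  (∀ u : E, ∃ x : A.domain, (x : E) = T u ∧ A x - z • (x : E) = u) ∧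
    ∀ x : A.domain, T (A x - z • (x : E)) = x

open Classical in
/-- The resolvent `(A - z)⁻¹` (zero if `z` is in the spectrum). -/
def resolventOp (A : E →ₗ.[ℂ] E) (z : ℂ) : E →L[ℂ] E :=
  if h : ∃ T, IsResolventAt A z T then h.choose else 0

/-- The real part of the spectrum of `A`, i.e. `σ(A) ∩ ℝ`, which is all of `σ(A)` for a
self-adjoint `A`. -/
def realSpectrum (A : E →ₗ.[ℂ] E) : Set ℝ :=
  {r : ℝ | ¬ ∃ T, IsResolventAt A (r : ℂ) T}

/-- `U` is the strongly continuous one-parameter unitary group `t ↦ e^{itA}`, that is, the one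
whose infinitesimal generator is `iA`. -/
structure IsUnitaryGroupOf (A : E →ₗ.[ℂ] E) (U : ℝ → E →L[ℂ] E) : Prop where
  mem_unitary : ∀ t, U t ∈ unitary (E →L[ℂ] E)
  zero : U 0 = 1
  add : ∀ s t, U (s + t) = U s * U t
  continuous : ∀ u, Continuous fun t => U t u
  generator : ∀ u v : E,
    (u, v) ∈ A.graph ↔ HasDerivAt (fun t : ℝ => U t u) (Complex.I • v) 0

open Classical in
/-- `expI A t = e^{itA}` for a self-adjoint operator `A`. -/
def expI (A : E →ₗ.[ℂ] E) : ℝ → E →L[ℂ] E :=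
  if h : ∃ U, IsUnitaryGroupOf A U then h.choose else fun _ => 0

/-- The continuous spectral subspace of `A`: the orthogonal complement of the closed span of all
eigenvectors of `A`. -/
def contSpectralSubspace (A : E →ₗ.[ℂ] E) : Submodule ℂ E :=
  (Submodule.span ℂ {v : E | ∃ z : ℂ, (v, z • v) ∈ A.graph})ᗮ

/-- A projection-valued measure on the Borel sets of `ℝ`. -/
structure ProjValuedMeasure (E : Type*) [NormedAddCommGroup E] [InnerProductSpace ℂ E]
    [CompleteSpace E] where
  proj : Set ℝ → E →L[ℂ] E
  isStarProjection : ∀ B, MeasurableSet B → IsStarProjection (proj B)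
  univ : proj Set.univ = 1
  inter : ∀ B C, MeasurableSet B → MeasurableSet C → proj (B ∩ C) = proj B * proj C
  hasSum : ∀ B : ℕ → Set ℝ, (∀ n, MeasurableSet (B n)) → Pairwise (Function.onFun Disjoint B) →
    ∀ u, HasSum (fun n => proj (B n) u) (proj (⋃ n, B n) u)

namespace ProjValuedMeasure

variable (P : ProjValuedMeasure E)

lemma re_inner_nonneg (u : E) (B : Set ℝ) (hB : MeasurableSet B) :
    0 ≤ (inner ℂ u (P.proj B u)).re := by
  have h := P.isStarProjection B hB
  have h1 : P.proj B u = P.proj B (P.proj B u) := by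
    conv_lhs => rw [← h.isIdempotentElem.eq]
    rfl
  have h2 : inner ℂ u (P.proj B (P.proj B u)) = inner ℂ (P.proj B u) (P.proj B u) := by
    have h3 := ContinuousLinearMap.adjoint_inner_left (P.proj B) (P.proj B u) u
    have h4 : ContinuousLinearMap.adjoint (P.proj B) = P.proj B := h.isSelfAdjoint
    rw [h4] at h3
    exact h3.symm
  rw [h1, h2]
  exact inner_self_nonneg (𝕜 := ℂ)

lemma proj_empty (u : E) : P.proj ∅ u = 0 := by
  have h := P.hasSum (fun _ => ∅) (fun _ => MeasurableSet.empty)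
    (fun _ _ _ => by simp [Function.onFun]) u
  exact tendsto_nhds_unique tendsto_const_nhds h.summable.tendsto_atTop_zero

/-- The spectral measure `B ↦ (u | P(B) u)` of a vector `u`. -/
def measure (u : E) : Measure ℝ :=
  Measure.ofMeasurable (fun B _ => ENNReal.ofReal (inner ℂ u (P.proj B u)).re)
    (by simp [P.proj_empty u])
    (by
      intro B hB hd
      have h : HasSum (fun n => (inner ℂ u (P.proj (B n) u)).re)
          (inner ℂ u (P.proj (⋃ n, B n) u)).re :=
        Complex.hasSum_re ((P.hasSum B hB hd u).mapL (innerSL ℂ u))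
      rw [← h.tsum_eq]
      exact ENNReal.ofReal_tsum_of_nonneg (fun n => P.re_inner_nonneg u _ (hB n)) h.summable)

/-- `P` is the spectral resolution of `A`, i.e. `A = ∫ r dP(r)` with its natural domain. -/
def IsResolutionOf (A : E →ₗ.[ℂ] E) : Prop :=
  (∀ u : E, u ∈ A.domain ↔ Integrable (fun r : ℝ => r ^ 2) (P.measure u)) ∧
    ∀ u : A.domain, inner ℂ (u : E) (A u) = ∫ r : ℝ, (r : ℂ) ∂(P.measure (u : E))

open Classical in
/-- The bounded operator `∫ f(r) dP(r)` for a bounded Borel function `f`, given by its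
quadratic form. -/
def integral (f : ℝ → ℂ) : E →L[ℂ] E :=
  if h : ∃ T : E →L[ℂ] E, ∀ u, inner ℂ u (T u) = ∫ r, f r ∂(P.measure u) then h.choose else 0

end ProjValuedMeasure

open Classical in
/-- The bounded Borel functional calculus `f(A)` of a self-adjoint operator `A`. -/
def functionOf (A : E →ₗ.[ℂ] E) (f : ℝ → ℂ) : E →L[ℂ] E :=
  if h : ∃ P : ProjValuedMeasure E, P.IsResolutionOf A then h.choose.integral f else 0

end Operators

/-! ### Bosonic Fock space

Let `b = (e_i)` be an orthonormal basis of the one-particle space `𝔥`, indexed by `ι`. The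
vectors `e_{i₁} ⊗ ⋯ ⊗ e_{iₙ}`, `n ≥ 0`, form an orthonormal basis of the full Fock space
`⨁ₙ ⊗ⁿ 𝔥`, which is thus `ℓ²` over the lists `[i₁, …, iₙ]`; the `n`-particle component of a vector
is its restriction to the lists of length `n`. -/

/-- The full Fock space `⨁ₙ ⊗ⁿ 𝔥`, in coordinates. -/
abbrev FullFock (ι : Type*) := lp (fun _ : List ι => ℂ) 2

/-- The bosonic Fock space `⨁ₙ ⊗ₛⁿ 𝔥`: the vectors with permutation invariant components. -/
def bosonicSubspace (ι : Type*) : Submodule ℂ (FullFock ι) where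
  carrier := {u | ∀ l l' : List ι, l.Perm l' → u l = u l'}
  add_mem' := by
    intro u v hu hv l l' h
    simp [hu l l' h, hv l l' h]
  zero_mem' := by intro l l' _; simp
  smul_mem' := by
    intro c u hu l l' h
    simp [hu l l' h]

abbrev Fock (ι : Type*) := ↥(bosonicSubspace ι)

section FockSpace

variable {ι : Type*}

lemma continuous_fock_coord (l : List ι) : Continuous fun u : FullFock ι => u l := by
  refine (LipschitzWith.of_dist_le_mul (K := 1) fun u v => ?_).continuous
  have h := lp.norm_apply_le_norm (p := 2) (by norm_num) (u - v) l
  simpa [dist_eq_norm] using h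

lemma isClosed_bosonicSubspace : IsClosed (bosonicSubspace ι : Set (FullFock ι)) := by
  have h : (bosonicSubspace ι : Set (FullFock ι)) =
      ⋂ (l : List ι) (l' : List ι) (_ : l.Perm l'), {u | u l = u l'} := by
    ext u
    simp only [Set.mem_iInter]
    rfl
  rw [h]
  exact isClosed_iInter fun l => isClosed_iInter fun l' => isClosed_iInter fun _ =>
    isClosed_eq (continuous_fock_coord l) (continuous_fock_coord l')

instance instCompleteSpaceFock : CompleteSpace (Fock ι) :=
  isClosed_bosonicSubspace.completeSpace_coe

/-- The coordinate of `u` at the list `l`. -/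
def fockCoord (u : Fock ι) (l : List ι) : ℂ := (u : FullFock ι) l

lemma memlp_comp_injective {α β : Type*} (u : lp (fun _ : α => ℂ) 2) (g : β → α)
    (hg : Function.Injective g) : Memℓp (fun x : β => u (g x)) 2 := by
  have h := lp.memℓp u
  rw [memℓp_gen_iff (by norm_num)] at h ⊢
  exact h.comp_injective hg

open Classical in
/-- The spectral projection `1_s(N)` of the number operator. -/
def numberProj (s : Set ℕ) : Fock ι →ₗ[ℂ] Fock ι where
  toFun u :=
    ⟨⟨fun l => if l.length ∈ s then fockCoord u l else 0, by
        have h := lp.memℓp (u : FullFock ι)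
        refine Memℓp.mono' h fun l => ?_
        split_ifs <;> simp [fockCoord]⟩, by
      intro l l' h
      have h' := u.2 l l' h
      simp only [fockCoord, h.length_eq, h']⟩
  map_add' u v := by
    refine Subtype.ext (lp.ext (funext fun l => ?_))
    change (if l.length ∈ s then fockCoord u l + fockCoord v l else 0) =
      (if l.length ∈ s then fockCoord u l else 0) + (if l.length ∈ s then fockCoord v l else 0)
    split_ifs <;> simp
  map_smul' c u := by
    ext l
    by_cases h : l.length ∈ s <;> simp [h, fockCoord]

/-- The finite particle vectors. -/
def IsFinParticle (u : Fock ι) : Prop := ∃ n : ℕ, numberProj (Set.Iic n) u = u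

/-- The function `f(N)` of the number operator `N`, on its maximal domain. -/
def numberFun (f : ℕ → ℂ) : Fock ι →ₗ.[ℂ] Fock ι :=
  Submodule.toLinearPMap
    { carrier := {x : Fock ι × Fock ι |
        ∀ l : List ι, fockCoord x.2 l = f l.length * fockCoord x.1 l}
      add_mem' := by
        intro x y hx hy l
        have h1 := hx l
        have h2 := hy l
        simp only [fockCoord, Prod.fst_add, Prod.snd_add, Submodule.coe_add, lp.coeFn_add,
          Pi.add_apply] at h1 h2 ⊢
        rw [h1, h2]
        ring
      zero_mem' := by intro l; simp [fockCoord]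
      smul_mem' := by
        intro c x hx l
        have h1 := hx l
        simp only [fockCoord, Prod.smul_fst, Prod.smul_snd, Submodule.coe_smul, lp.coeFn_smul,
          Pi.smul_apply, smul_eq_mul] at h1 ⊢
        rw [h1]
        ring }

/-- Partial evaluation of `u` on `e_l` in its last `l.length` tensor factors:
`((1 ⊗ ⋯ ⊗ 1 ⊗ (e_l|) u)(j) = u(j ++ l)`. -/
def contractTail (l : List ι) : Fock ι →ₗ[ℂ] Fock ι where
  toFun u :=
    ⟨⟨fun j => fockCoord u (j ++ l),
        memlp_comp_injective (u : FullFock ι) (fun j => j ++ l) (List.append_left_injective l)⟩, by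
      intro j j' h
      exact u.2 _ _ (h.append_right l)⟩
  map_add' u v := by ext j; simp [fockCoord]; rfl
  map_smul' c u := by ext j; simp [fockCoord]

/-- The coordinate at `l` of the symmetrization of the tensor with coordinates `F`: the mean of
`F` over the `l.length !` permutations of `l`. -/
def symmetrize (F : List ι → ℂ) (l : List ι) : ℂ :=
  ((l.length.factorial : ℂ))⁻¹ * (l.permutations.map F).sum

section OneParticle

variable {𝔥 : Type*} [NormedAddCommGroup 𝔥] [InnerProductSpace ℂ 𝔥] (b : HilbertBasis ι ℂ 𝔥)

/-- For a list `r = [r₁, …, rₙ₋₁]` and `i < n`, the vector of `𝔥` with coordinates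
`k ↦ u(r₁, …, rᵢ, k, rᵢ₊₁, …, rₙ₋₁)`, that is, `u` as a function of its tensor factor number `i`
(counted from `0`). -/
def legVector (i : ℕ) (r : List ι) (h : i ≤ r.length) (u : Fock ι) : 𝔥 :=
  b.repr.symm ⟨fun k => fockCoord u (r.insertIdx i k),
    memlp_comp_injective (u : FullFock ι) (fun k => r.insertIdx i k) (by
      intro k k' hk
      have h1 : (r.insertIdx i k)[i]? = some k := by
        simp [List.getElem?_insertIdx_self, h]
      have h2 : (r.insertIdx i k')[i]? = some k' := by
        simp [List.getElem?_insertIdx_self, h]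
      simp only at hk
      rw [hk, h2] at h1
      exact (Option.some.inj h1).symm)⟩

/-- The coordinates of `f₁ ⊗ ⋯ ⊗ fₙ`. -/
def tensorCoord (f : List 𝔥) (l : List ι) : ℂ :=
  if f.length = l.length then (List.zipWith (fun g i => b.repr g i) f l).prod else 0

/-- The coordinates of the creation operator: `a*(h) u = √n S(h ⊗ u)` if `u` has `n - 1`
particles. -/
def creationCoord (h : 𝔥) (u : Fock ι) (l : List ι) : ℂ :=
  ((Real.sqrt l.length : ℝ) : ℂ)⁻¹ *
    ∑ i : Fin l.length, b.repr h (l.get i) * fockCoord u (l.eraseIdx i)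

/-- The coordinates of the annihilation operator: `a(h) u = √n ((h| ⊗ 1) u` if `u` has `n`
particles. -/
def annihilationCoord (h : 𝔥) (u : Fock ι) (l : List ι) : ℂ :=
  ((Real.sqrt (l.length + 1) : ℝ) : ℂ) * inner ℂ h (legVector b 0 l (Nat.zero_le _) u)

/-- The field operator `φ(h) = (a*(h) + a(h)) / √2`, the closure of its restriction to the finite
particle vectors. -/
def fieldOp (h : 𝔥) : Fock ι →ₗ.[ℂ] Fock ι :=
  (Submodule.span ℂ {x : Fock ι × Fock ι | IsFinParticle x.1 ∧ ∀ l, fockCoord x.2 l =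
    ((Real.sqrt 2 : ℝ) : ℂ)⁻¹ *
      (creationCoord b h x.1 l + annihilationCoord b h x.1 l)}).topologicalClosure.toLinearPMap

/-- The Weyl operator `W(h) = e^{iφ(h)}`. -/
def weylOp (h : 𝔥) : Fock ι →L[ℂ] Fock ι := expI (fieldOp b h) 1

/-- The second quantization `dΓ(ω)`: the closure of the operator which maps the symmetrization of
`f₁ ⊗ ⋯ ⊗ fₙ` to that of `∑ⱼ f₁ ⊗ ⋯ ⊗ ω fⱼ ⊗ ⋯ ⊗ fₙ`, for `f₁, …, fₙ` in the domain of `ω`. -/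
def dGamma (ω : 𝔥 →ₗ.[ℂ] 𝔥) : Fock ι →ₗ.[ℂ] Fock ι :=
  (Submodule.span ℂ {x : Fock ι × Fock ι | ∃ f : List ω.domain,
    (∀ l, fockCoord x.1 l = symmetrize (tensorCoord b (f.map (↑))) l) ∧
    ∀ l, fockCoord x.2 l = symmetrize (fun l' =>
      ∑ j : Fin f.length, tensorCoord b ((f.map (↑)).set j (ω (f.get j))) l') l}
    ).topologicalClosure.toLinearPMap

end OneParticle

/-! ### Wick polynomials with Hilbert-Schmidt symbols -/

open Classical in
/-- The symmetrization of the basis tensor `e_l`. -/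
def symBasis (l : List ι) : Fock ι :=
  haveI : (bosonicSubspace ι).HasOrthogonalProjection :=
    Submodule.HasOrthogonalProjection.ofCompleteSpace _
  (bosonicSubspace ι).orthogonalProjectionOnto (lp.single 2 l (1 : ℂ))

/-- `w` is a Hilbert-Schmidt operator on Fock space. As the `e_l` are an orthonormal basis of the
full Fock space and `symBasis l = S e_l` with `S` the projection onto the bosonic one, the sum is
the square of the Hilbert-Schmidt norm of `w S`, hence of `w`. -/
def IsHilbertSchmidt (w : Fock ι →L[ℂ] Fock ι) : Prop :=
  ∑' l : List ι, ‖w (symBasis l)‖ₑ ^ 2 < ∞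

/-- `1_{[0,d]}(N) w 1_{[0,d]}(N) = w`. -/
def IsFinOrder (w : Fock ι →L[ℂ] Fock ι) (d : ℕ) : Prop :=
  ∀ u, numberProj (Set.Iic d) (w (numberProj (Set.Iic d) u)) = w u

/-- The coordinates of `Wick(w) u` for `w` with `1_{[0,d]}(N) w 1_{[0,d]}(N) = w`. The component
`w_{p,q}` of `w` maps `p` to `q` particles, and
`Wick(w_{p,q}) = √(n! (n+q-p)!) / (n-p)! · S (w_{p,q} ⊗ 1^{⊗(n-p)})` on `n` particles.
In the coordinate at a list of length `m = n + q - p`, one has `n - p = m - q`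
and `n = m - q + p`. -/
def wickCoord (w : Fock ι →L[ℂ] Fock ι) (d : ℕ) (u : Fock ι) (l : List ι) : ℂ :=
  ∑ p ∈ Finset.range (d + 1), ∑ q ∈ Finset.range (l.length + 1),
    (((Real.sqrt ((l.length - q + p).factorial * l.length.factorial : ℝ)) /
        ((l.length - q).factorial : ℝ) : ℝ) : ℂ) *
      symmetrize (fun k =>
        fockCoord (w (numberProj {p} (contractTail (k.drop q) u))) (k.take q)) l

/-- The Wick polynomial `Wick(w)`: the closure of its restriction to the finite particle
vectors. -/
def wickOp (w : Fock ι →L[ℂ] Fock ι) (d : ℕ) : Fock ι →ₗ.[ℂ] Fock ι :=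
  (Submodule.span ℂ {x : Fock ι × Fock ι | IsFinParticle x.1 ∧
    ∀ l, fockCoord x.2 l = wickCoord w d x.1 l}).topologicalClosure.toLinearPMap

section TripleNorm

variable {𝔥 : Type*} [NormedAddCommGroup 𝔥] [InnerProductSpace ℂ 𝔥] (b : HilbertBasis ι ℂ 𝔥)

/-- `‖(a)ᵢ u‖²`, where `(a)ᵢ` is the bounded operator `a` acting on the tensor factor number `i`
(counted from `0`). -/
def legNormSq (a : 𝔥 →L[ℂ] 𝔥) (i : ℕ) (u : Fock ι) : ℝ≥0∞ :=
  ∑' r : {r : List ι // i ≤ r.length}, ‖a (legVector b i r.1 r.2 u)‖ₑ ^ 2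

/-- `∑ᵢ ‖(a)ᵢ w‖` with Hilbert-Schmidt norms. -/
def legSum (a : 𝔥 →L[ℂ] 𝔥) (w : Fock ι →L[ℂ] Fock ι) : ℝ≥0∞ :=
  ∑' i : ℕ, (∑' l : List ι, legNormSq b a i (w (symBasis l))) ^ (1 / 2 : ℝ)

/-- The norm `⫴dΓ(a) w⫴` of a Hilbert-Schmidt symbol `w`, identified with a vector of
`Γ(𝔥) ⊗ conj Γ(𝔥)`: the sum of the norms of `(a)ᵢ ⊗ 1` and of `1 ⊗ conj (a)ᵢ` applied to `w`. The
latter is the Hilbert-Schmidt norm of `(a)ᵢ w*`. -/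
def tripleNorm (a : 𝔥 →L[ℂ] 𝔥) (w : Fock ι →L[ℂ] Fock ι) : ℝ≥0∞ :=
  legSum b a w + legSum b a (ContinuousLinearMap.adjoint w)

end TripleNorm

end FockSpace

/-! ### Abstract QFT Hamiltonians -/

section QFT

variable {ι 𝔥 : Type*} [NormedAddCommGroup 𝔥] [InnerProductSpace ℂ 𝔥] [CompleteSpace 𝔥]
  (b : HilbertBasis ι ℂ 𝔥)

/-- The operator `H₀ + V` with `H₀ = dΓ(ω)` and `V = Wick(w)`, on `D(H₀) ∩ D(V)`. -/
def preHamiltonian (ω : 𝔥 →ₗ.[ℂ] 𝔥) (w : Fock ι →L[ℂ] Fock ι) (d : ℕ) : Fock ι →ₗ.[ℂ] Fock ι :=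
  dGamma b ω + wickOp w d

/-- The Hamiltonian `H`, the closure of `H₀ + V`. -/
def hamiltonian (ω : 𝔥 →ₗ.[ℂ] 𝔥) (w : Fock ι →L[ℂ] Fock ι) (d : ℕ) : Fock ι →ₗ.[ℂ] Fock ι :=
  (preHamiltonian b ω w d).closure

/-- `H` is an abstract QFT Hamiltonian with one-particle operator `ω` and interaction
symbol `w`; `β` is a constant with `H + β ≥ 1`. -/
structure IsAbstractQFT (ω : 𝔥 →ₗ.[ℂ] 𝔥) (w : Fock ι →L[ℂ] Fock ι) (d : ℕ) (β : ℝ) : Prop where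
  omega_selfAdjoint : IsSelfAdjoint ω
  symbol_hilbertSchmidt : IsHilbertSchmidt w
  symbol_finOrder : IsFinOrder w d
  symbol_selfAdjoint : IsSelfAdjoint w
  /-- `inf σ(ω) = m > 0` -/
  mass_gap : ∃ m : ℝ, 0 < m ∧ IsGLB (realSpectrum ω) m
  essSelfAdjoint : IsEssSelfAdjoint (preHamiltonian b ω w d)
  boundedBelow : ∃ c : ℝ, FormBoundedBelow (preHamiltonian b ω w d) c
  shift_pos : 0 < β
  /-- `H + β ≥ 1` -/
  shift : FormBoundedBelow (hamiltonian b ω w d) (1 - β)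
  /-- For every `n` there is `p` such that `N^n H₀ (H + β)^{-p}` is bounded. -/
  higherOrder₁ : ∀ n : ℕ, ∃ p : ℕ, ∃ T : Fock ι →L[ℂ] Fock ι, ∀ u, ∃ v,
    ((resolventOp (hamiltonian b ω w d) (-β) ^ p) u, v) ∈ (dGamma b ω).graph ∧
      (v, T u) ∈ (numberFun (ι := ι) fun k => (k : ℂ) ^ n).graph
  /-- For every `P` there is `M > P` such that `N^M (H + β)⁻¹ (N + 1)^{-P}` is bounded. -/
  higherOrder₂ : ∀ P : ℕ, ∃ M : ℕ, P < M ∧ ∃ T : Fock ι →L[ℂ] Fock ι, ∀ u, ∃ v,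
    (u, v) ∈ (numberFun (ι := ι) fun k => ((k : ℂ) + 1)⁻¹ ^ P).graph ∧
      (resolventOp (hamiltonian b ω w d) (-β) v, T u) ∈
        (numberFun (ι := ι) fun k => (k : ℂ) ^ M).graph

/-- `⫴dΓ(j(X/R)) w⫴ = O(R^{-s})` for all smooth `j` which vanish near `0` and equal `1`
near `±∞`. -/
def ShortRange (X : 𝔥 →ₗ.[ℂ] 𝔥) (w : Fock ι →L[ℂ] Fock ι) (s : ℝ) : Prop :=
  ∀ j : ℝ → ℝ, ContDiff ℝ (⊤ : ℕ∞) j → (∀ᶠ r in 𝓝 0, j r = 0) →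
    (∀ᶠ r in atTop, j r = 1) → (∀ᶠ r in atBot, j r = 1) →
    ∃ C : ℝ, ∀ R : ℝ, 1 ≤ R →
      tripleNorm b (functionOf X fun r => (j (r / R) : ℂ)) w ≤ ENNReal.ofReal (C * R ^ (-s))

/-- There is a subspace `𝔥₀`, dense in the continuous spectral subspace of `ω`, such that for
every `h ∈ 𝔥₀` there are `ε > 0` and `μ > 1` with
`‖1_{[0,ε]}(X/|t|) e^{-itω} h‖ = O(t^{-μ})` as `t → +∞`. -/
def DynamicalEstimate (ω X : 𝔥 →ₗ.[ℂ] 𝔥) : Prop :=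
  ∃ 𝔥₀ : Submodule ℂ 𝔥, 𝔥₀ ≤ contSpectralSubspace ω ∧
    contSpectralSubspace ω ≤ 𝔥₀.topologicalClosure ∧
    ∀ h ∈ 𝔥₀, ∃ ε : ℝ, 0 < ε ∧ ∃ μ : ℝ, 1 < μ ∧ ∃ C : ℝ, ∀ t : ℝ, 1 ≤ t →
      ‖functionOf X (fun r => (Set.Icc (0 : ℝ) ε).indicator 1 (r / |t|)) (expI ω (-t) h)‖
        ≤ C * t ^ (-μ)

end QFT

end

/-! The engine is Cook's method. Since W(h_t) = Γ(e^{-itω}) W(h) Γ(e^{itω}) and H₀ generates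
Γ(e^{itω}), the free parts cancel when e^{itH} W(h_t) e^{-itH} is differentiated, and only i[V,
W(h_t)] survives between the unitaries. If this commutator, applied to J = (H+b)^{-n₀}, is O(t^{-ν})
with ν > 1, then e^{itH} W(h_t) e^{-itH} J is norm Cauchy (`norm_cook_le`, `cauchySeq_cook`). Strong
limits follow because J has dense range and everything is bounded by 1. The Weyl relations,
unitarity and covariance then pass to the limit (`exists_asymptotic_weyl`).

The commutator is computed on exponential vectors e(g) = ⊕ g^{⊗n}/√n!, which are total. A Weyl
operator is a displacement D(k) with k = ih/√2: up to a scalar it translates e(g) to e(g+k). A Wick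
polynomial satisfies (e(f)|Wick(w) e(g)) = e^{(f|g)} (c(f)|w c(g)) with c(g) = ⊕_{n≤d} g^{⊗n}.
Therefore Wick(w) D(k) = D(k) Wick(w_k), where w_k = e^{A*} w e^{A} and A is a truncated creation
operator with e^{A} c(g) = c(g+k) (`exp_capCreate_capVec`, `wickReg_displacement`). The commutator
is D(k) Wick(w_k − w), and ‖w_k − w‖ is at most a constant times ‖A* w‖: one leg of w contracted
with k. For h_t, the part with ⟨x⟩ ≤ εt is O(t^{-μ}) by (S), and the rest only sees j(⟨x⟩/t) acting
on a leg of w, which is O(t^{-s}) by (Is) (`exists_norm_capCreate_mul_le`).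

The higher order estimates make J useful (`IsAbstractQFT.exists_resolvent_pow`). J maps into D(H₀).
It factors through (N+1)^{-d}, and Wick(w)(N+1)^{-d} is bounded. It factors through (N+1)^{-1},
which makes W(h)J continuous in h, uniformly in t after conjugation with the dynamics; this extends
the limits from 𝔥₀ to its closure and gives norm continuity.

Exponentials and functions of operators are defined by choice from an existence statement, so
existence has to be proved. For ω, H and ⟨x⟩ it comes from the Borel functional calculus of a
resolvent at a real point (`exists_isUnitaryGroupOf`, `exists_isResolutionOf`). For φ(h) the group t
↦ D(tk) is exhibited and its generator identified (`graph_fieldOp`). -/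

set_option linter.unusedSectionVars false

/-! ### Quadratic forms of bounded operators -/

section Operators

variable {E : Type*} [NormedAddCommGroup E] [InnerProductSpace ℂ E]

lemma inner_polarization (T : E →L[ℂ] E) (x y : E) :
    inner ℂ x (T y) = (inner ℂ (x + y) (T (x + y)) - inner ℂ (x - y) (T (x - y)) -
      Complex.I * inner ℂ (x + Complex.I • y) (T (x + Complex.I • y)) +
      Complex.I * inner ℂ (x - Complex.I • y) (T (x - Complex.I • y))) / 4 := by
  simp only [map_add, map_sub, inner_add_left, inner_add_right, map_smul, inner_smul_left,
    inner_smul_right, Complex.conj_I, inner_sub_left, inner_sub_right]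
  linear_combination ((1 : ℂ) / 2 * inner ℂ x (T y) - 1 / 2 * inner ℂ y (T x)) * Complex.I_sq

lemma ext_of_inner_self {S T : E →L[ℂ] E} (h : ∀ u, inner ℂ u (S u) = inner ℂ u (T u)) :
    S = T := by
  ext v
  refine ext_inner_left ℂ fun u => ?_
  rw [inner_polarization S, inner_polarization T, h, h, h, h]

lemma tendsto_inner_of_tendsto_inner_self {α : Type*} {l : Filter α} {A : α → E →L[ℂ] E}
    {B : E →L[ℂ] E} (h : ∀ u, Tendsto (fun n => inner ℂ u (A n u)) l (𝓝 (inner ℂ u (B u))))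
    (u v : E) : Tendsto (fun n => inner ℂ u (A n v)) l (𝓝 (inner ℂ u (B v))) := by
  simp only [inner_polarization _ u v]
  exact ((((h _).sub (h _)).sub ((h _).const_mul _)).add ((h _).const_mul _)).div_const _

/-- Polarize between x and y = s • A x, with s chosen so that ‖y‖ = ‖x‖: 4 Re (y|Ax) = q(x+y) −
q(x−y), and by the parallelogram law the right side is at most 4M‖x‖². This is the numerical radius
bound for symmetric operators. -/
lemma norm_apply_le_of_quadratic_bound {A : E →L[ℂ] E} {M : ℝ}
    (hA : ∀ u v, inner ℂ (A u) v = inner ℂ u (A v))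
    (h : ∀ u, |(inner ℂ u (A u)).re| ≤ M * ‖u‖ ^ 2) (x : E) : ‖A x‖ ≤ M * ‖x‖ := by
  by_cases hx : ‖x‖ = 0
  · simp [norm_eq_zero.mp hx]
  by_cases hAx : ‖A x‖ = 0
  · rw [hAx]
    by_contra hneg
    have h1 := (abs_nonneg _).trans (h x)
    have hx' : 0 < ‖x‖ := lt_of_le_of_ne (norm_nonneg _) (Ne.symm hx)
    push Not at hneg
    have : M * ‖x‖ * ‖x‖ < 0 := mul_neg_of_neg_of_pos hneg hx'
    nlinarith
  have hx' : 0 < ‖x‖ := lt_of_le_of_ne (norm_nonneg _) (Ne.symm hx)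
  have hAx' : 0 < ‖A x‖ := lt_of_le_of_ne (norm_nonneg _) (Ne.symm hAx)
  set s : ℝ := ‖x‖ / ‖A x‖ with hs
  set y : E := (s : ℂ) • A x with hy
  have hny : ‖y‖ = ‖x‖ := by
    rw [hy, norm_smul, Complex.norm_real, Real.norm_of_nonneg (by positivity), hs]
    field_simp
  have h1 : 4 * (inner ℂ y (A x)).re =
      (inner ℂ (x + y) (A (x + y))).re - (inner ℂ (x - y) (A (x - y))).re := by
    have h2 : inner ℂ x (A y) = inner ℂ (A x) y := (hA x y).symm
    have h3 : (inner ℂ (A x) y).re = (inner ℂ y (A x)).re := by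
      rw [← inner_conj_symm, Complex.conj_re]
    simp only [map_add, map_sub, inner_add_left, inner_add_right, inner_sub_left,
      inner_sub_right, Complex.add_re, Complex.sub_re, h2, h3]
    ring
  have h4 : (inner ℂ y (A x)).re = s * ‖A x‖ ^ 2 := by
    rw [hy, inner_smul_left, inner_self_eq_norm_sq_to_K, Complex.conj_ofReal]
    rw [Complex.re_ofReal_mul]
    norm_cast
  have h5 := (abs_le.mp (h (x + y))).2
  have h6 := (abs_le.mp (h (x - y))).1
  have h7 : ‖x + y‖ ^ 2 + ‖x - y‖ ^ 2 = 4 * ‖x‖ ^ 2 := by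
    have := parallelogram_law_with_norm ℂ x y
    rw [hny] at this
    nlinarith
  have h8 : s * ‖A x‖ ^ 2 ≤ M * ‖x‖ ^ 2 := by
    have : M * ‖x + y‖ ^ 2 + M * ‖x - y‖ ^ 2 = M * (4 * ‖x‖ ^ 2) := by rw [← mul_add, h7]
    linarith
  have h9 : s * ‖A x‖ ^ 2 = ‖x‖ * ‖A x‖ := by rw [hs]; field_simp
  rw [h9] at h8
  nlinarith [mul_le_mul_of_nonneg_left h8 (inv_nonneg.mpr hx'.le), inv_mul_cancel₀ hx]

/-- A uniformly bounded sequence of operators whose quadratic forms converge has a weak limit. -/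
lemma exists_weak_limit [CompleteSpace E] {A : ℕ → E →L[ℂ] E} {M : ℝ} (hM : ∀ n, ‖A n‖ ≤ M)
    {q : E → ℂ} (h : ∀ u, Tendsto (fun n => inner ℂ u (A n u)) atTop (𝓝 (q u))) :
    ∃ B : E →L[ℂ] E, ∀ u, inner ℂ u (B u) = q u := by
  have key : ∀ u v, ∃ z, Tendsto (fun n => inner ℂ u (A n v)) atTop (𝓝 z) := by
    intro u v
    simp only [inner_polarization _ u v]
    exact ⟨_, ((((h _).sub (h _)).sub ((h _).const_mul _)).add ((h _).const_mul _)).div_const _⟩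
  choose b hb using key
  have hbound : ∀ u v, ‖b u v‖ ≤ M * ‖u‖ * ‖v‖ := by
    intro u v
    refine le_of_tendsto (hb u v).norm (Eventually.of_forall fun n => ?_)
    calc ‖inner ℂ u (A n v)‖ ≤ ‖u‖ * ‖A n v‖ := norm_inner_le_norm _ _
      _ ≤ ‖u‖ * (M * ‖v‖) := by
        gcongr
        exact (A n).le_of_opNorm_le (hM n) v
      _ = _ := by ring
  let L : E →ₗ⋆[ℂ] E →ₗ[ℂ] ℂ := LinearMap.mk₂'ₛₗ (starRingEnd ℂ) (RingHom.id ℂ) b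
    (fun m₁ m₂ n => tendsto_nhds_unique (hb _ _) (by
      simpa only [inner_add_left] using (hb m₁ n).add (hb m₂ n)))
    (fun c m n => tendsto_nhds_unique (hb _ _) (by
      simpa only [inner_smul_left, smul_eq_mul] using (hb m n).const_mul _))
    (fun m n₁ n₂ => tendsto_nhds_unique (hb _ _) (by
      simpa only [inner_add_right, map_add] using (hb m n₁).add (hb m n₂)))
    (fun c m n => tendsto_nhds_unique (hb _ _) (by
      simpa only [inner_smul_right, map_smul, smul_eq_mul, RingHom.id_apply] using (hb m n).const_mul _))
  let B := L.mkContinuous₂ M hbound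
  refine ⟨ContinuousLinearMap.adjoint (InnerProductSpace.continuousLinearMapOfBilin B),
    fun u => ?_⟩
  rw [ContinuousLinearMap.adjoint_inner_right, InnerProductSpace.continuousLinearMapOfBilin_apply]
  exact tendsto_nhds_unique (hb u u) (h u)

end Operators

/-! ### Induction principles for bounded Borel functions -/

section Induction

/-- Induction for bounded Borel functions, starting from indicators. -/
theorem bounded_measurable_induction {C : (ℝ → ℝ) → Prop}
    (hind : ∀ s, MeasurableSet s → C (s.indicator 1))
    (hadd : ∀ f g, Measurable f → Measurable g → (∃ M, ∀ r, |f r| ≤ M) → (∃ M, ∀ r, |g r| ≤ M) →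
      C f → C g → C (f + g))
    (hsmul : ∀ (c : ℝ) f, Measurable f → (∃ M, ∀ r, |f r| ≤ M) → C f → C (c • f))
    (hlim : ∀ (F : ℕ → ℝ → ℝ) f M, (∀ n, Measurable (F n)) → Measurable f →
      (∀ n r, |F n r| ≤ M) → (∀ r, |f r| ≤ M) →
      (∀ r, Tendsto (fun n => F n r) atTop (𝓝 (f r))) → (∀ n, C (F n)) → C f)
    {f : ℝ → ℝ} (hf : Measurable f) (hb : ∃ M, ∀ r, |f r| ≤ M) : C f := by
  obtain ⟨M, hM⟩ := hb
  have hM0 : 0 ≤ M := (abs_nonneg _).trans (hM 0)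
  have hsm := hf.stronglyMeasurable
  refine hlim (fun n => hsm.approxBounded M n) f M (fun n => SimpleFunc.measurable _) hf
    (fun n r => hsm.norm_approxBounded_le hM0 n r) hM
    (fun r => hsm.tendsto_approxBounded_of_norm_le (hM r)) fun n => ?_
  have hbdd : ∀ g : SimpleFunc ℝ ℝ, ∃ M, ∀ r, |g r| ≤ M := fun g => by
    obtain ⟨M, hM⟩ := g.exists_forall_norm_le
    exact ⟨M, hM⟩
  generalize hsm.approxBounded M n = g
  induction g using SimpleFunc.induction with
  | const c hs =>
    rename_i s
    have h1 : MeasurableSet s := hs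
    have : (SimpleFunc.piecewise s hs (SimpleFunc.const ℝ c) (SimpleFunc.const ℝ 0) : ℝ → ℝ) =
        c • s.indicator (1 : ℝ → ℝ) := by
      ext r
      by_cases hr : r ∈ s <;> simp [hr]
    rw [this]
    refine hsmul c _ (measurable_one.indicator h1) ⟨1, fun r => ?_⟩ (hind s h1)
    by_cases hr : r ∈ s <;> simp [hr]
  | add _ h1 h2 => exact hadd _ _ (SimpleFunc.measurable _) (SimpleFunc.measurable _) (hbdd _) (hbdd _) h1 h2

/-- Induction for bounded Borel functions, starting from bounded continuous functions. -/
theorem bounded_measurable_induction_of_continuous {C : (ℝ → ℝ) → Prop}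
    (hcont : ∀ f, Continuous f → (∃ M, ∀ r, |f r| ≤ M) → C f)
    (hadd : ∀ f g, Measurable f → Measurable g → (∃ M, ∀ r, |f r| ≤ M) → (∃ M, ∀ r, |g r| ≤ M) →
      C f → C g → C (f + g))
    (hsmul : ∀ (c : ℝ) f, Measurable f → (∃ M, ∀ r, |f r| ≤ M) → C f → C (c • f))
    (hlim : ∀ (F : ℕ → ℝ → ℝ) f M, (∀ n, Measurable (F n)) → Measurable f →
      (∀ n r, |F n r| ≤ M) → (∀ r, |f r| ≤ M) →
      (∀ r, Tendsto (fun n => F n r) atTop (𝓝 (f r))) → (∀ n, C (F n)) → C f)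
    {f : ℝ → ℝ} (hf : Measurable f) (hb : ∃ M, ∀ r, |f r| ≤ M) : C f := by
  have hle : ∀ (s : Set ℝ) (r : ℝ), |s.indicator (1 : ℝ → ℝ) r| ≤ 1 := fun s r => by
    by_cases hr : r ∈ s <;> simp [hr]
  refine bounded_measurable_induction (fun s hs => ?_) hadd hsmul hlim hf hb
  have hzero : C fun _ => 0 := hcont _ continuous_const ⟨0, by simp⟩
  -- π-λ argument on the closed sets. The indicator of a closed set is a pointwise limit of
  -- thickened indicators, which are continuous with values in [0,1].
  refine MeasurableSpace.induction_on_inter (C := fun s _ => C (s.indicator 1))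
    (BorelSpace.measurable_eq.trans borel_eq_generateFrom_isClosed) isPiSystem_isClosed
    (by simpa using hzero) (fun t ht => ?_) (fun t htm ih => ?_) (fun B hd hm ih => ?_) s hs
  · have ht' : IsClosed t := ht
    have hδ : ∀ n : ℕ, (0 : ℝ) < 1 / ((n : ℝ) + 1) := fun n => by positivity
    have hlim0 := thickenedIndicator_tendsto_indicator_closure hδ
      tendsto_one_div_add_atTop_nhds_zero_nat t
    have hc : ∀ n : ℕ, Continuous fun r => ((thickenedIndicator (hδ n) t r : NNReal) : ℝ) :=
      fun n => NNReal.continuous_coe.comp (thickenedIndicator (hδ n) t).continuous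
    have hb : ∀ n r, |((thickenedIndicator (hδ n) t r : NNReal) : ℝ)| ≤ 1 := fun n r => by
      rw [NNReal.abs_eq]
      exact_mod_cast thickenedIndicator_le_one (hδ n) t r
    refine hlim (fun n r => ((thickenedIndicator (hδ n) t r : NNReal) : ℝ)) _ 1
      (fun n => (hc n).measurable) (measurable_one.indicator ht'.measurableSet)
      hb (hle t) (fun r => ?_) fun n => hcont _ (hc n) ⟨1, hb n⟩
    have h1 := (tendsto_pi_nhds.mp hlim0) r
    have h2 := (NNReal.continuous_coe.tendsto _).comp h1
    rw [ht'.closure_eq] at h2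
    convert! h2 using 2
    by_cases hr : r ∈ t <;> simp [hr]
  · have h1 : tᶜ.indicator (1 : ℝ → ℝ) = 1 + (-1 : ℝ) • t.indicator 1 := by
      ext r
      by_cases hr : r ∈ t <;> simp [hr]
    rw [h1]
    exact hadd _ _ measurable_one ((measurable_one.indicator htm).const_smul _) ⟨1, by simp⟩
      ⟨1, fun r => by simpa using hle t r⟩ (hcont 1 continuous_const ⟨1, by simp⟩)
      (hsmul _ _ (measurable_one.indicator htm) ⟨1, hle t⟩ ih)
  · have hm' : ∀ n, MeasurableSet (⋃ i ∈ Finset.range n, B i) := fun n =>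
      Finset.measurableSet_biUnion _ fun i _ => hm i
    refine hlim (fun n => (⋃ i ∈ Finset.range n, B i).indicator 1) _ 1
      (fun n => measurable_one.indicator (hm' n))
      (measurable_one.indicator (MeasurableSet.iUnion hm)) (fun n => hle _) (hle _)
      (fun r => ?_) fun n => ?_
    · by_cases hr : r ∈ ⋃ i, B i
      · obtain ⟨i, hi⟩ := Set.mem_iUnion.mp hr
        refine tendsto_const_nhds.congr' ?_
        filter_upwards [eventually_gt_atTop i] with n hn
        have : r ∈ ⋃ i ∈ Finset.range n, B i := by
          simp only [Set.mem_iUnion]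
          exact ⟨i, Finset.mem_range.mpr hn, hi⟩
        rw [Set.indicator_of_mem hr, Set.indicator_of_mem this]
      · refine tendsto_const_nhds.congr fun n => ?_
        have : r ∉ ⋃ i ∈ Finset.range n, B i := by
          simp only [Set.mem_iUnion] at hr ⊢
          exact fun ⟨i, _, hi⟩ => hr ⟨i, hi⟩
        rw [Set.indicator_of_notMem hr, Set.indicator_of_notMem this]
    · induction n with
      | zero => simpa using hzero
      | succ n ihn =>
        have h1 : (⋃ i ∈ Finset.range (n + 1), B i).indicator (1 : ℝ → ℝ) =
            (B n).indicator 1 + (⋃ i ∈ Finset.range n, B i).indicator 1 := by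
          rw [Finset.range_add_one, Finset.set_biUnion_insert, Set.indicator_union_of_disjoint]
          · rfl
          · rw [Set.disjoint_iUnion₂_right]
            exact fun i hi => hd (by simp at hi; omega)
        rw [h1]
        exact hadd _ _ (measurable_one.indicator (hm n)) (measurable_one.indicator (hm' n))
          ⟨1, hle _⟩ ⟨1, hle _⟩ (ih n) ihn

end Induction

/-! ### Borel functional calculus of a bounded self-adjoint operator -/

section BorelCalculus

variable {E : Type*} [NormedAddCommGroup E] [InnerProductSpace ℂ E] [CompleteSpace E]

lemma IsSelfAdjoint.inner_clm_left {A : E →L[ℂ] E} (hA : IsSelfAdjoint A) (u v : E) :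
    inner ℂ (A u) v = inner ℂ u (A v) := by
  rw [← ContinuousLinearMap.adjoint_inner_right, hA.adjoint_eq]

lemma isSelfAdjoint_clm_iff {A : E →L[ℂ] E} :
    IsSelfAdjoint A ↔ ∀ u, inner ℂ u (A u) = ((inner ℂ u (A u)).re : ℂ) := by
  constructor
  · intro h u
    refine (Complex.conj_eq_iff_re.mp ?_).symm
    rw [inner_conj_symm, h.inner_clm_left]
  · intro h
    rw [ContinuousLinearMap.isSelfAdjoint_iff']
    refine ext_of_inner_self fun u => ?_
    rw [ContinuousLinearMap.adjoint_inner_right, ← inner_conj_symm, h u, Complex.conj_ofReal]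

open scoped CompactlySupported in
-- Riesz–Markov on the compact spectrum, for the functional g ↦ (u|g(T)u). Positivity holds because
-- g = (√g)². The measure is pushed forward to ℝ, so that all vectors share one measurable space.
lemma exists_cfc_measure {T : E →L[ℂ] E} (hT : IsSelfAdjoint T) (u : E) :
    ∃ μ : Measure ℝ, IsFiniteMeasure μ ∧ μ (spectrum ℝ T)ᶜ = 0 ∧
      ∀ f : ℝ → ℝ, Continuous f → inner ℂ u (cfc f T u) = ((∫ r, f r ∂μ : ℝ) : ℂ) := by
  have hsa : ∀ g : C(spectrum ℝ T, ℝ), IsSelfAdjoint (cfcHom hT g) := fun g => by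
    rw [IsSelfAdjoint, ← map_star]
    rfl
  let ψ : C_c(spectrum ℝ T, ℝ) → ℝ := fun g => (inner ℂ u (cfcHom hT g.toContinuousMap u)).re
  have hadd : ∀ f g, ψ (f + g) = ψ f + ψ g := fun f g => by
    have : (f + g).toContinuousMap = f.toContinuousMap + g.toContinuousMap := rfl
    simp only [ψ, this, map_add, add_apply, inner_add_right, Complex.add_re]
  have hsmul : ∀ (c : ℝ) g, ψ (c • g) = c • ψ g := fun c g => by
    have : (c • g).toContinuousMap = c • g.toContinuousMap := rfl
    simp only [ψ, this, map_smul, smul_apply, inner_smul_right_eq_smul,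
      Complex.smul_re]
  let Λ : C_c(spectrum ℝ T, ℝ) →ₚ[ℝ] ℝ := PositiveLinearMap.mk₀
    { toFun := ψ, map_add' := hadd, map_smul' := hsmul } (by
      intro g hg
      let h : C(spectrum ℝ T, ℝ) := ⟨fun x => Real.sqrt (g x), by fun_prop⟩
      have hh : g.toContinuousMap = h * h := by
        ext x
        exact (Real.mul_self_sqrt (hg x)).symm
      change 0 ≤ (inner ℂ u (cfcHom hT g.toContinuousMap u)).re
      rw [hh, map_mul, mul_apply_eq_comp, ← (hsa h).inner_clm_left]
      exact inner_self_nonneg (𝕜 := ℂ))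
  have hmeas : MeasurableSet (spectrum ℝ T) :=
    (isCompact_iff_compactSpace.mpr inferInstance).isClosed.measurableSet
  refine ⟨(RealRMK.rieszMeasure Λ).map Subtype.val, inferInstance, ?_, fun f hf => ?_⟩
  · rw [Measure.map_apply measurable_subtype_coe hmeas.compl]
    simp
  · let g : C_c(spectrum ℝ T, ℝ) :=
      ⟨⟨fun x => f x, by fun_prop⟩, HasCompactSupport.of_compactSpace _⟩
    rw [integral_map (by fun_prop) hf.aestronglyMeasurable]
    have h1 := RealRMK.integral_rieszMeasure Λ g
    have h2 : cfc f T = cfcHom hT g.toContinuousMap := cfc_apply f T hT hf.continuousOn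
    change ∫ x, f x ∂(RealRMK.rieszMeasure Λ) = (inner ℂ u (cfcHom hT g.toContinuousMap u)).re at h1
    rw [h1, h2]
    exact (isSelfAdjoint_clm_iff.mp (hsa _)) u

/-- `L` is the operator with quadratic form `u ↦ ∫ f dμ_u`. -/
def HasQuadraticForm (μ : E → Measure ℝ) (f : ℝ → ℝ) (L : E →L[ℂ] E) : Prop :=
  ∀ u, inner ℂ u (L u) = ((∫ r, f r ∂(μ u) : ℝ) : ℂ)

namespace HasQuadraticForm

variable {μ : E → Measure ℝ} {f g : ℝ → ℝ} {L L' : E →L[ℂ] E}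

lemma unique (h : HasQuadraticForm μ f L) (h' : HasQuadraticForm μ f L') : L = L' :=
  ext_of_inner_self fun u => (h u).trans (h' u).symm

lemma isSelfAdjoint (h : HasQuadraticForm μ f L) : IsSelfAdjoint L :=
  isSelfAdjoint_clm_iff.mpr fun u => by rw [h u, Complex.ofReal_re]

lemma smul (h : HasQuadraticForm μ f L) (c : ℝ) : HasQuadraticForm μ (c • f) ((c : ℂ) • L) := by
  intro u
  simp only [smul_apply, inner_smul_right, h u, Pi.smul_apply, smul_eq_mul,
    integral_const_mul, Complex.ofReal_mul]

variable [hfin : ∀ u, IsFiniteMeasure (μ u)]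

lemma integrable_of_bounded (hf : Measurable f) (hb : ∃ M, ∀ r, |f r| ≤ M) (u : E) :
    Integrable f (μ u) := by
  obtain ⟨M, hM⟩ := hb
  exact Integrable.of_bound hf.aestronglyMeasurable M (Eventually.of_forall hM)

lemma add (h : HasQuadraticForm μ f L) (h' : HasQuadraticForm μ g L') (hf : Measurable f)
    (hg : Measurable g) (hbf : ∃ M, ∀ r, |f r| ≤ M) (hbg : ∃ M, ∀ r, |g r| ≤ M) :
    HasQuadraticForm μ (f + g) (L + L') := by
  intro u
  simp only [add_apply, inner_add_right, h u, h' u, Pi.add_apply]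
  rw [integral_add (integrable_of_bounded hf hbf u) (integrable_of_bounded hg hbg u)]
  push_cast
  rfl

lemma norm_le (h : HasQuadraticForm μ f L) (hμ : ∀ u, (μ u).real Set.univ ≤ ‖u‖ ^ 2) {M : ℝ}
    (hM : ∀ r, |f r| ≤ M) : ‖L‖ ≤ M := by
  have hM0 : 0 ≤ M := (abs_nonneg _).trans (hM 0)
  refine L.opNorm_le_bound hM0 fun x =>
    norm_apply_le_of_quadratic_bound h.isSelfAdjoint.inner_clm_left (fun u => ?_) x
  rw [h u, Complex.ofReal_re, ← Real.norm_eq_abs]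
  refine (norm_integral_le_of_norm_le_const (C := M) (Eventually.of_forall hM)).trans ?_
  exact mul_le_mul_of_nonneg_left (hμ u) hM0

lemma tendsto_integral {F : ℕ → ℝ → ℝ} {M : ℝ} (hF : ∀ n, Measurable (F n))
    (hM : ∀ n r, |F n r| ≤ M) (hlim : ∀ r, Tendsto (fun n => F n r) atTop (𝓝 (f r))) (u : E) :
    Tendsto (fun n => ∫ r, F n r ∂(μ u)) atTop (𝓝 (∫ r, f r ∂(μ u))) :=
  tendsto_integral_of_dominated_convergence (fun _ => M)
    (fun n => (hF n).aestronglyMeasurable) (integrable_const _)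
    (fun n => Eventually.of_forall (hM n)) (Eventually.of_forall hlim)

lemma tendsto_inner {F : ℕ → ℝ → ℝ} {M : ℝ} {A : ℕ → E →L[ℂ] E} (hF : ∀ n, Measurable (F n))
    (hM : ∀ n r, |F n r| ≤ M) (hlim : ∀ r, Tendsto (fun n => F n r) atTop (𝓝 (f r)))
    (hA : ∀ n, HasQuadraticForm μ (F n) (A n)) (hL : HasQuadraticForm μ f L) (u v : E) :
    Tendsto (fun n => inner ℂ u (A n v)) atTop (𝓝 (inner ℂ u (L v))) := by
  refine tendsto_inner_of_tendsto_inner_self (fun u => ?_) u v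
  simp only [hA _ u, hL u]
  exact (Complex.continuous_ofReal.tendsto _).comp (tendsto_integral hF hM hlim u)

lemma exists_of_tendsto (hμ : ∀ u, (μ u).real Set.univ ≤ ‖u‖ ^ 2) {F : ℕ → ℝ → ℝ} {M : ℝ}
    (hF : ∀ n, Measurable (F n)) (hM : ∀ n r, |F n r| ≤ M)
    (hlim : ∀ r, Tendsto (fun n => F n r) atTop (𝓝 (f r)))
    (hex : ∀ n, ∃ A, HasQuadraticForm μ (F n) A) : ∃ L, HasQuadraticForm μ f L := by
  choose A hA using hex
  refine exists_weak_limit (fun n => (hA n).norm_le hμ (hM n)) fun u => ?_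
  simp only [hA _ u]
  exact (Complex.continuous_ofReal.tendsto _).comp (tendsto_integral hF hM hlim u)

/-- If `∫ 1_B dμ_u` is the quadratic form of an operator for all Borel sets `B`, then so is
`∫ f dμ_u` for all bounded Borel functions `f`. -/
lemma exists_of_indicator (hμ : ∀ u, (μ u).real Set.univ ≤ ‖u‖ ^ 2)
    (hind : ∀ s, MeasurableSet s → ∃ L, HasQuadraticForm μ (s.indicator 1) L)
    (hf : Measurable f) (hb : ∃ M, ∀ r, |f r| ≤ M) : ∃ L, HasQuadraticForm μ f L :=
  bounded_measurable_induction (C := fun f => ∃ L, HasQuadraticForm μ f L) hind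
    (fun _ _ hf hg hbf hbg ⟨_, h⟩ ⟨_, h'⟩ => ⟨_, h.add h' hf hg hbf hbg⟩)
    (fun c _ _ _ ⟨_, h⟩ => ⟨_, h.smul c⟩)
    (fun _ _ _ hF _ hM _ hlim hex => exists_of_tendsto hμ hF hM hlim hex) hf hb

end HasQuadraticForm

/-- The bounded Borel functional calculus of the bounded self-adjoint operator `T`: `Φ f = f(T)` for
real Borel functions `f` that are bounded on `[-R, R] ⊇ σ(T)`, with spectral measures `μ u`. -/
structure BorelCalculus (T : E →L[ℂ] E) where
  μ : E → Measure ℝ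
  Φ : (ℝ → ℝ) → E →L[ℂ] E
  R : ℝ
  finite : ∀ u, IsFiniteMeasure (μ u)
  support : ∀ u, ∀ᵐ r ∂(μ u), |r| ≤ R
  quad : ∀ f, Measurable f → (∃ M, ∀ r, |r| ≤ R → |f r| ≤ M) → HasQuadraticForm μ f (Φ f)
  mul : ∀ f g, Measurable f → (∃ M, ∀ r, |r| ≤ R → |f r| ≤ M) → Measurable g →
    (∃ M, ∀ r, |r| ≤ R → |g r| ≤ M) → Φ (f * g) = Φ f * Φ g
  one : Φ 1 = 1
  id : Φ id = T

open Classical in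
-- Bounded pointwise limits of functions become weak limits of operators by dominated convergence,
-- so the calculus extends from continuous to bounded Borel functions. Multiplicativity is extended
-- one factor at a time, first in `f` with `g` continuous, then in `g`.
theorem exists_borelCalculus {T : E →L[ℂ] E} (hT : IsSelfAdjoint T) :
    Nonempty (BorelCalculus T) := by
  choose μ hfin hsupp hμ using exists_cfc_measure hT
  have hcont : ∀ f : ℝ → ℝ, Continuous f → HasQuadraticForm μ f (cfc f T) :=
    fun f hf u => hμ u f hf
  have hone : cfc (1 : ℝ → ℝ) T = 1 := cfc_one ℝ T
  have hmass : ∀ u, (μ u).real Set.univ ≤ ‖u‖ ^ 2 := fun u => by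
    have h := hcont 1 continuous_const u
    rw [hone, one_apply_eq_self, inner_self_eq_norm_sq_to_K] at h
    simp only [Pi.one_apply, integral_const, smul_eq_mul, mul_one] at h
    exact le_of_eq (Complex.ofReal_injective (by rw [← h]; push_cast; rfl))
  have hex : ∀ f : ℝ → ℝ, Measurable f → (∃ M, ∀ r, |f r| ≤ M) →
      ∃ L, HasQuadraticForm μ f L := fun f hf hb =>
    bounded_measurable_induction_of_continuous (C := fun f => ∃ L, HasQuadraticForm μ f L)
      (fun f hf _ => ⟨_, hcont f hf⟩)
      (fun _ _ hf hg hbf hbg ⟨_, h⟩ ⟨_, h'⟩ => ⟨_, h.add h' hf hg hbf hbg⟩)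
      (fun c _ _ _ ⟨_, h⟩ => ⟨_, h.smul c⟩)
      (fun _ _ _ hF _ hM _ hlim hex =>
        HasQuadraticForm.exists_of_tendsto hmass hF hM hlim hex) hf hb
  have hmulb : ∀ {f g : ℝ → ℝ}, (∃ M, ∀ r, |f r| ≤ M) → (∃ M, ∀ r, |g r| ≤ M) →
      ∃ M, ∀ r, |(f * g) r| ≤ M := by
    rintro f g ⟨M, hM⟩ ⟨M', hM'⟩
    refine ⟨M * M', fun r => ?_⟩
    rw [Pi.mul_apply, abs_mul]
    exact mul_le_mul (hM r) (hM' r) (abs_nonneg _) ((abs_nonneg _).trans (hM r))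
  have hmul1 : ∀ g : ℝ → ℝ, Continuous g → (∃ M, ∀ r, |g r| ≤ M) → ∀ f : ℝ → ℝ, Measurable f →
      (∃ M, ∀ r, |f r| ≤ M) → ∀ L, HasQuadraticForm μ f L →
      HasQuadraticForm μ (f * g) (L * cfc g T) := by
    intro g hg hbg f hf hb
    refine bounded_measurable_induction_of_continuous (C := fun f => ∀ L, HasQuadraticForm μ f L →
      HasQuadraticForm μ (f * g) (L * cfc g T)) ?_ ?_ ?_ ?_ hf hb
    · intro f hf _ L hL
      rw [hL.unique (hcont f hf), ← cfc_mul f g T hf.continuousOn hg.continuousOn]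
      exact hcont _ (hf.mul hg)
    · intro f f' hf hf' hb hb' ih ih' L hL
      obtain ⟨A, hA⟩ := hex f hf hb
      obtain ⟨A', hA'⟩ := hex f' hf' hb'
      rw [hL.unique (hA.add hA' hf hf' hb hb'), add_mul, add_mul]
      exact (ih A hA).add (ih' A' hA') (hf.mul hg.measurable) (hf'.mul hg.measurable)
        (hmulb hb hbg) (hmulb hb' hbg)
    · intro c f hf hb ih L hL
      obtain ⟨A, hA⟩ := hex f hf hb
      rw [hL.unique (hA.smul c), smul_mul_assoc, smul_mul_assoc]
      exact (ih A hA).smul c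
    · intro F f M hF hf hM hMf hlim ih L hL u
      choose A hA using fun n => hex (F n) (hF n) ⟨M, hM n⟩
      have h1 := HasQuadraticForm.tendsto_inner hF hM hlim hA hL u (cfc g T u)
      obtain ⟨N, hN⟩ := hbg
      have h2 : Tendsto (fun n => ∫ r, (F n * g) r ∂(μ u)) atTop (𝓝 (∫ r, (f * g) r ∂(μ u))) := by
        refine HasQuadraticForm.tendsto_integral (M := M * N) (fun n => (hF n).mul hg.measurable)
          (fun n r => ?_) (fun r => (hlim r).mul_const _) u
        rw [Pi.mul_apply, abs_mul]
        exact mul_le_mul (hM n r) (hN r) (abs_nonneg _) ((abs_nonneg _).trans (hM n r))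
      refine tendsto_nhds_unique h1 ?_
      refine ((Complex.continuous_ofReal.tendsto _).comp h2).congr fun n => ?_
      exact (ih n (A n) (hA n) u).symm
  have hmul2 : ∀ f : ℝ → ℝ, Measurable f → (∃ M, ∀ r, |f r| ≤ M) → ∀ L, HasQuadraticForm μ f L →
      ∀ g : ℝ → ℝ, Measurable g → (∃ M, ∀ r, |g r| ≤ M) → ∀ L', HasQuadraticForm μ g L' →
      HasQuadraticForm μ (f * g) (L * L') := by
    intro f hf hb L hL g hg hbg
    refine bounded_measurable_induction_of_continuous (C := fun g => ∀ L', HasQuadraticForm μ g L' →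
      HasQuadraticForm μ (f * g) (L * L')) ?_ ?_ ?_ ?_ hg hbg
    · intro g hg hbg L' hL'
      rw [hL'.unique (hcont g hg)]
      exact hmul1 g hg hbg f hf hb L hL
    · intro g g' hg hg' hbg hbg' ih ih' L' hL'
      obtain ⟨A, hA⟩ := hex g hg hbg
      obtain ⟨A', hA'⟩ := hex g' hg' hbg'
      rw [hL'.unique (hA.add hA' hg hg' hbg hbg'), mul_add, mul_add]
      exact (ih A hA).add (ih' A' hA') (hf.mul hg) (hf.mul hg') (hmulb hb hbg) (hmulb hb hbg')
    · intro c g hg hbg ih L' hL'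
      obtain ⟨A, hA⟩ := hex g hg hbg
      rw [hL'.unique (hA.smul c), mul_smul_comm, mul_smul_comm]
      exact (ih A hA).smul c
    · intro F g M hF hg hM hMg hlim ih L' hL' u
      choose A hA using fun n => hex (F n) (hF n) ⟨M, hM n⟩
      have h1 := HasQuadraticForm.tendsto_inner hF hM hlim hA hL' (L u) u
      obtain ⟨N, hN⟩ := hb
      have h2 : Tendsto (fun n => ∫ r, (f * F n) r ∂(μ u)) atTop (𝓝 (∫ r, (f * g) r ∂(μ u))) := by
        refine HasQuadraticForm.tendsto_integral (M := N * M) (fun n => hf.mul (hF n))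
          (fun n r => ?_) (fun r => (hlim r).const_mul _) u
        rw [Pi.mul_apply, abs_mul]
        exact mul_le_mul (hN r) (hM n r) (abs_nonneg _) ((abs_nonneg _).trans (hN r))
      -- Moving `L` to the other side of the inner product lets the weak convergence of `A n` be
      -- tested against the fixed vector `L u`.
      simp only [hL.isSelfAdjoint.inner_clm_left] at h1
      refine tendsto_nhds_unique h1 ?_
      refine ((Complex.continuous_ofReal.tendsto _).comp h2).congr fun n => ?_
      exact (ih n (A n) (hA n) u).symm
  have hR : ∀ u, ∀ᵐ r ∂(μ u), |r| ≤ ‖T‖ := fun u => by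
    have h : ∀ᵐ r ∂(μ u), r ∈ spectrum ℝ T := hsupp u
    filter_upwards [h] with r hr
    rcases subsingleton_or_nontrivial E with hE | hE
    · have : Subsingleton (E →L[ℂ] E) := ⟨fun a b => by ext x; exact Subsingleton.elim _ _⟩
      simp at hr
    · exact spectrum.norm_le_norm_of_mem hr
  set I : Set ℝ := {r | |r| ≤ ‖T‖} with hI
  have hIm : MeasurableSet I := measurableSet_le measurable_norm measurable_const
  -- The spectral measures live on [-‖T‖, ‖T‖], so cutting `f` off outside changes no integral. It
  -- admits functions such as `id` that are only bounded on the spectrum.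
  let Φ : (ℝ → ℝ) → E →L[ℂ] E := fun f =>
    if h : ∃ L, HasQuadraticForm μ (I.indicator f) L then h.choose else 0
  have hbI : ∀ {f : ℝ → ℝ}, (∃ M, ∀ r, |r| ≤ ‖T‖ → |f r| ≤ M) →
      ∃ M, ∀ r, |I.indicator f r| ≤ M := by
    rintro f ⟨M, hM⟩
    have hM0 : 0 ≤ M := (abs_nonneg _).trans (hM 0 (by simp))
    refine ⟨M, fun r => ?_⟩
    by_cases hr : r ∈ I
    · rw [Set.indicator_of_mem hr]; exact hM r hr
    · rw [Set.indicator_of_notMem hr]; simpa using hM0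
  have hΦ : ∀ f, Measurable f → (∃ M, ∀ r, |r| ≤ ‖T‖ → |f r| ≤ M) →
      HasQuadraticForm μ (I.indicator f) (Φ f) := by
    intro f hf hb
    have h := hex _ (hf.indicator hIm) (hbI hb)
    have h2 := h.choose_spec
    simp only [Φ, dif_pos h]
    exact h2
  have hcongr : ∀ {f g : ℝ → ℝ} {L}, HasQuadraticForm μ f L → (∀ r, |r| ≤ ‖T‖ → f r = g r) →
      HasQuadraticForm μ g L := by
    intro f g L h hfg u
    rw [h u, integral_congr_ae]
    filter_upwards [hR u] with r hr using hfg r hr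
  have hind : ∀ f : ℝ → ℝ, ∀ r, |r| ≤ ‖T‖ → I.indicator f r = f r :=
    fun f r hr => Set.indicator_of_mem (show r ∈ I from hr) f
  have hquad : ∀ f, Measurable f → (∃ M, ∀ r, |r| ≤ ‖T‖ → |f r| ≤ M) →
      HasQuadraticForm μ f (Φ f) := fun f hf hb => hcongr (hΦ f hf hb) (hind f)
  refine ⟨⟨μ, Φ, ‖T‖, hfin, hR, hquad, fun f g hf hbf hg hbg => ?_, ?_, ?_⟩⟩
  · refine (hΦ (f * g) (hf.mul hg) ?_).unique ?_
    · obtain ⟨M, hM⟩ := hbf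
      obtain ⟨N, hN⟩ := hbg
      refine ⟨M * N, fun r hr => ?_⟩
      rw [Pi.mul_apply, abs_mul]
      exact mul_le_mul (hM r hr) (hN r hr) (abs_nonneg _) ((abs_nonneg _).trans (hM r hr))
    · rw [show I.indicator (f * g) = I.indicator f * I.indicator g from Set.indicator_mul I f g]
      exact hmul2 _ (hf.indicator hIm) (hbI hbf) _ (hΦ f hf hbf) _ (hg.indicator hIm) (hbI hbg) _
        (hΦ g hg hbg)
  · exact (hquad 1 measurable_one ⟨1, by simp⟩).unique (hone ▸ hcont 1 continuous_const)
  · refine (hquad id measurable_id ⟨‖T‖, fun r hr => hr⟩).unique ?_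
    have h := hcont id continuous_id
    rwa [cfc_id ℝ T hT] at h

end BorelCalculus

/-! ### Unitary groups, their generators and cores -/

section UnitaryGroups

variable {E : Type*} [NormedAddCommGroup E] [InnerProductSpace ℂ E] [CompleteSpace E]

/-- A strongly continuous one-parameter unitary group. -/
structure IsUnitaryGroup (U : ℝ → E →L[ℂ] E) : Prop where
  mem_unitary : ∀ t, U t ∈ unitary (E →L[ℂ] E)
  zero : U 0 = 1
  add : ∀ s t, U (s + t) = U s * U t
  continuous : ∀ u, Continuous fun t => U t u

lemma IsUnitaryGroupOf.isUnitaryGroup {A : E →ₗ.[ℂ] E} {U : ℝ → E →L[ℂ] E}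
    (h : IsUnitaryGroupOf A U) : IsUnitaryGroup U :=
  ⟨h.mem_unitary, h.zero, h.add, h.continuous⟩

/-- The graph of the self-adjoint generator `B` of the unitary group `U t = e^{itB}`. -/
def generatorGraph (U : ℝ → E →L[ℂ] E) : Submodule ℂ (E × E) where
  carrier := {p | HasDerivAt (fun t : ℝ => U t p.1) (Complex.I • p.2) 0}
  add_mem' := by
    intro p q hp hq
    have := HasDerivAt.add hp hq
    simp only [Set.mem_ofPred_eq, Prod.fst_add, Prod.snd_add, map_add, smul_add]
    exact this
  zero_mem' := by simpa using hasDerivAt_const (0 : ℝ) (0 : E)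
  smul_mem' := by
    intro c p hp
    have := HasDerivAt.const_smul c hp
    simp only [Set.mem_ofPred_eq, Prod.smul_fst, Prod.smul_snd, map_smul]
    rwa [smul_comm]

lemma mem_generatorGraph {U : ℝ → E →L[ℂ] E} {u v : E} :
    (u, v) ∈ generatorGraph U ↔ HasDerivAt (fun t : ℝ => U t u) (Complex.I • v) 0 := Iff.rfl

lemma inner_map_of_mem_unitary {S : E →L[ℂ] E} (h : S ∈ unitary (E →L[ℂ] E)) (u v : E) :
    inner ℂ (S u) (S v) = inner ℂ u v := by
  have h1 : ContinuousLinearMap.adjoint S * S = 1 := (Unitary.mem_iff.mp h).1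
  rw [← ContinuousLinearMap.adjoint_inner_right, ← mul_apply_eq_comp, h1, one_apply_eq_self]

lemma norm_map_of_mem_unitary {S : E →L[ℂ] E} (h : S ∈ unitary (E →L[ℂ] E)) (u : E) :
    ‖S u‖ = ‖u‖ := by
  rw [@norm_eq_sqrt_re_inner ℂ, @norm_eq_sqrt_re_inner ℂ _ _ _ _ u, inner_map_of_mem_unitary h]

namespace IsUnitaryGroup

variable {U : ℝ → E →L[ℂ] E} (hU : IsUnitaryGroup U)

include hU

lemma apply_add (s t : ℝ) (u : E) : U (s + t) u = U s (U t u) := by rw [hU.add]; rfl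

lemma neg_apply (t : ℝ) (u : E) : U (-t) (U t u) = u := by
  rw [← hU.apply_add, neg_add_cancel, hU.zero]; rfl

lemma apply_neg (t : ℝ) (u : E) : U t (U (-t) u) = u := by
  rw [← hU.apply_add, add_neg_cancel, hU.zero]; rfl

lemma norm_apply (t : ℝ) (u : E) : ‖U t u‖ = ‖u‖ := norm_map_of_mem_unitary (hU.mem_unitary t) u

lemma inner_apply_right (t : ℝ) (u v : E) : inner ℂ u (U t v) = inner ℂ (U (-t) u) v := by
  rw [← inner_map_of_mem_unitary (hU.mem_unitary (-t)) u, hU.neg_apply]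

lemma norm_le_one (t : ℝ) : ‖U t‖ ≤ 1 :=
  ContinuousLinearMap.opNorm_le_bound _ zero_le_one fun u => by rw [hU.norm_apply, one_mul]

lemma hasDerivAt {u v : E} (h : (u, v) ∈ generatorGraph U) (t : ℝ) :
    HasDerivAt (fun t => U t u) (U t (Complex.I • v)) t := by
  have h0 : HasDerivAt (fun t => U t u) (Complex.I • v) (t - t) := by
    rw [sub_self]; exact h
  have h1 := ((U t).restrictScalars ℝ).hasFDerivAt.comp_hasDerivAt t (h0.comp_sub_const t t)
  refine h1.congr_of_eventuallyEq (Eventually.of_forall fun s => ?_)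
  simp only [Function.comp, ContinuousLinearMap.coe_restrictScalars']
  rw [← hU.apply_add]
  congr 2
  ring

lemma apply_mem_generatorGraph {u v : E} (h : (u, v) ∈ generatorGraph U) (t : ℝ) :
    (U t u, U t v) ∈ generatorGraph U := by
  rw [mem_generatorGraph]
  have h1 := ((U t).restrictScalars ℝ).hasFDerivAt.comp_hasDerivAt (0 : ℝ) (mem_generatorGraph.mp h)
  rw [ContinuousLinearMap.coe_restrictScalars', map_smul] at h1
  refine h1.congr_of_eventuallyEq (Eventually.of_forall fun s => ?_)
  simp only [Function.comp]
  rw [← hU.apply_add, ← hU.apply_add, add_comm]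

lemma generatorGraph_symmetric {u v x y : E} (h : (u, v) ∈ generatorGraph U)
    (h' : (x, y) ∈ generatorGraph U) : inner ℂ v x = inner ℂ u y := by
  have h1 := HasDerivAt.inner ℂ (mem_generatorGraph.mp h) (mem_generatorGraph.mp h')
  have h2 : HasDerivAt (fun _ : ℝ => (inner ℂ u x : ℂ)) 0 0 := hasDerivAt_const _ _
  have h3 := h1.unique (h2.congr_of_eventuallyEq
    (Eventually.of_forall fun t => inner_map_of_mem_unitary (hU.mem_unitary t) u x))
  rw [hU.zero] at h3
  simp only [one_apply_eq_self, inner_smul_left, inner_smul_right, Complex.conj_I] at h3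
  have h4 : Complex.I * (inner ℂ u y - inner ℂ v x) = 0 := by rw [← h3]; ring
  rcases mul_eq_zero.mp h4 with h5 | h5
  · exact absurd h5 Complex.I_ne_zero
  · exact (sub_eq_zero.mp h5).symm

/-- A vector which is weakly differentiable against a total invariant set lies in the domain of
the generator. -/
lemma mem_generatorGraph_of_weak {Z : Set E} (hZ : Dense (Submodule.span ℂ Z : Set E))
    (hinv : ∀ z ∈ Z, ∀ t, U t z ∈ Z) {x y : E}
    (h : ∀ z ∈ Z, HasDerivAt (fun t : ℝ => (inner ℂ z (U t x) : ℂ)) (Complex.I * inner ℂ z y) 0) :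
    (x, y) ∈ generatorGraph U := by
  set y' : E := Complex.I • y with hy'
  have hint : ∀ t, HasDerivAt (fun t => ∫ s in (0 : ℝ)..t, U s y') (U t y') t := fun t =>
    ((hU.continuous y').integral_hasStrictDerivAt 0 t).hasDerivAt
  -- Invariance of `Z` carries the weak derivative at 0 to every time. Both sides then have the same
  -- weak derivative, hence agree, and the right side is strongly differentiable.
  have key : ∀ t, U t x = x + ∫ s in (0 : ℝ)..t, U s y' := by
    intro t
    have hz : ∀ z ∈ Z, inner ℂ z (U t x - (x + ∫ s in (0 : ℝ)..t, U s y')) = 0 := by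
      intro z hz
      have hd : ∀ t, HasDerivAt
          (fun t => (inner ℂ z (U t x - (x + ∫ s in (0 : ℝ)..t, U s y')) : ℂ)) 0 t := by
        intro t
        have h1 : HasDerivAt (fun s : ℝ => (inner ℂ (U (-t) z) (U (s - t) x) : ℂ))
            (Complex.I * inner ℂ (U (-t) z) y) t := by
          have := h _ (hinv z hz (-t))
          rw [← sub_self t] at this
          exact this.comp_sub_const t t
        have h2 : ∀ s, (inner ℂ (U (-t) z) (U (s - t) x) : ℂ) = inner ℂ z (U s x) := fun s => by
          rw [← hU.inner_apply_right, ← hU.apply_add]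
          congr 3
          ring
        simp only [h2] at h1
        have h3 := HasDerivAt.inner ℂ (hasDerivAt_const t z) (hint t)
        have h4 := (h1.sub_const (inner ℂ z x)).sub h3
        simp only [inner_zero_left, add_zero] at h4
        rw [hU.inner_apply_right, hy', inner_smul_right, sub_self] at h4
        refine h4.congr_of_eventuallyEq (Eventually.of_forall fun s => ?_)
        simp only [inner_sub_right, inner_add_right, Pi.sub_apply]
        ring
      have h5 := is_const_of_deriv_eq_zero (fun t => (hd t).differentiableAt)
        (fun t => (hd t).deriv) t 0
      simpa [hU.zero] using h5
    refine sub_eq_zero.mp (hZ.eq_zero_of_inner_right ℂ fun v hv => ?_)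
    induction hv using Submodule.span_induction with
    | mem z hzm => exact hz z hzm
    | zero => exact inner_zero_left _
    | add a b _ _ ha hb => rw [inner_add_left, ha, hb, add_zero]
    | smul c a _ ha => rw [inner_smul_left, ha, mul_zero]
  rw [mem_generatorGraph]
  have h1 := (hint 0).const_add x
  rw [hU.zero] at h1
  exact h1.congr_of_eventuallyEq (Eventually.of_forall key)

/-- The function t ↦ (z|U_t x) = (U_{-t} z|x) is differentiable as soon as z is in the domain. So
the adjoint of the generator restricted to `Z` is contained in the generator. -/
lemma mem_generatorGraph_of_adjoint {Z : Set E} (hZ : Dense (Submodule.span ℂ Z : Set E))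
    (hinv : ∀ z ∈ Z, ∀ t, U t z ∈ Z) {x y : E}
    (h : ∀ z ∈ Z, ∃ b, (z, b) ∈ generatorGraph U ∧ inner ℂ b x = inner ℂ z y) :
    (x, y) ∈ generatorGraph U := by
  refine hU.mem_generatorGraph_of_weak hZ hinv fun z hz => ?_
  obtain ⟨b, hb, hbx⟩ := h z hz
  have h1 : HasDerivAt (fun t : ℝ => U (-t) z) (-(Complex.I • b)) 0 := by
    have := (hU.hasDerivAt hb (-0)).scomp (0 : ℝ) (hasDerivAt_neg (0 : ℝ))
    simpa [hU.zero, Function.comp_def] using this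
  have h2 := HasDerivAt.inner ℂ h1 (hasDerivAt_const (0 : ℝ) x)
  simp only [← hU.inner_apply_right, inner_neg_left, inner_smul_left,
    Complex.conj_I, neg_mul, neg_neg, hbx, map_zero, inner_zero_right, zero_add] at h2
  exact h2

lemma continuous_integral_apply (t : ℝ) : Continuous fun v : E => ∫ s in (0 : ℝ)..t, U s v := by
  refine (LipschitzWith.of_dist_le_mul (K := (|t|).toNNReal) fun v w => ?_).continuous
  rw [dist_eq_norm, dist_eq_norm, ← intervalIntegral.integral_sub
    ((hU.continuous v).intervalIntegrable _ _) ((hU.continuous w).intervalIntegrable _ _),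
    Real.coe_toNNReal _ (abs_nonneg t), mul_comm]
  have h := intervalIntegral.norm_integral_le_of_norm_le_const (a := 0) (b := t) (C := ‖v - w‖)
    (f := fun s => U s v - U s w) (fun s _ => by rw [← map_sub, hU.norm_apply])
  rwa [sub_zero] at h

/-- Unlike the derivative, the integrated form is visibly a closed condition on the pair. -/
lemma mem_generatorGraph_iff_integral {u v : E} : (u, v) ∈ generatorGraph U ↔
    ∀ t, U t u = u + ∫ s in (0 : ℝ)..t, U s (Complex.I • v) := by
  constructor
  · intro h t
    rw [intervalIntegral.integral_eq_sub_of_hasDerivAt (f := fun t => U t u)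
      (fun s _ => hU.hasDerivAt h s) ((hU.continuous _).intervalIntegrable _ _), hU.zero,
      one_apply_eq_self, add_sub_cancel]
  · intro h
    have h1 := ((hU.continuous (Complex.I • v)).integral_hasStrictDerivAt 0 0).hasDerivAt.const_add u
    rw [hU.zero] at h1
    exact h1.congr_of_eventuallyEq (Eventually.of_forall h)

lemma isClosed_generatorGraph : IsClosed (generatorGraph U : Set (E × E)) := by
  have h : (generatorGraph U : Set (E × E)) =
      ⋂ t, {p | U t p.1 = p.1 + ∫ s in (0 : ℝ)..t, U s (Complex.I • p.2)} := by
    ext ⟨u, v⟩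
    simpa using hU.mem_generatorGraph_iff_integral
  rw [h]
  refine isClosed_iInter fun t => isClosed_eq (by fun_prop) (continuous_fst.add ?_)
  exact (hU.continuous_integral_apply t).comp (continuous_snd.const_smul Complex.I)

/-- A total invariant set in the domain of the generator is a core. -/
lemma generatorGraph_le_of_core {Z : Set E} (hZ : Dense (Submodule.span ℂ Z : Set E))
    (hinv : ∀ z ∈ Z, ∀ t, U t z ∈ Z) {G : Submodule ℂ (E × E)}
    (hG : IsClosed (G : Set (E × E)))
    (hgen : ∀ z ∈ Z, ∃ b, (z, b) ∈ generatorGraph U ∧ (z, b) ∈ G) : generatorGraph U ≤ G := by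
  rintro ⟨u, v⟩ huv
  set G₀ : Submodule ℂ (E × E) := generatorGraph U ⊓ G
  -- `L` is B + i on the graph of the generator B. A vector p orthogonal to the range over the
  -- common part would satisfy Bp = ip, impossible for symmetric B. Since ‖a‖² + ‖b‖² = ‖b + ia‖² on
  -- the graph, density of the range becomes density in the graph.
  let L : (E × E) →ₗ[ℂ] E := LinearMap.snd ℂ E E + Complex.I • LinearMap.fst ℂ E E
  have hdense : (G₀.map L).topologicalClosure = ⊤ := by
    rw [Submodule.topologicalClosure_eq_top_iff, Submodule.eq_bot_iff]
    intro p hp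
    have h1 : (p, Complex.I • p) ∈ generatorGraph U := by
      refine hU.mem_generatorGraph_of_adjoint hZ hinv fun z hz => ?_
      obtain ⟨b, hb, hb'⟩ := hgen z hz
      refine ⟨b, hb, ?_⟩
      have h2 := (Submodule.mem_orthogonal _ _).mp hp _
        (Submodule.mem_map_of_mem (f := L) (show (z, b) ∈ G₀ from ⟨hb, hb'⟩))
      simp only [L, LinearMap.add_apply, LinearMap.smul_apply, LinearMap.snd_apply,
        LinearMap.fst_apply, inner_add_left, inner_smul_left, Complex.conj_I] at h2
      rw [inner_smul_right]
      linear_combination h2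
    have h2 := hU.generatorGraph_symmetric h1 h1
    rw [inner_smul_left, inner_smul_right, Complex.conj_I] at h2
    have h3 : (2 * Complex.I) * inner ℂ p p = 0 := by linear_combination -h2
    simpa using h3
  have hnorm : ∀ a b : E, (a, b) ∈ generatorGraph U →
      ‖a‖ ^ 2 + ‖b‖ ^ 2 = ‖b + Complex.I • a‖ ^ 2 := by
    intro a b hab
    have h1 := hU.generatorGraph_symmetric hab hab
    rw [@norm_add_sq ℂ]
    have h2 : RCLike.re (inner ℂ b (Complex.I • a)) = 0 := by
      have h3 : (inner ℂ a b).im = 0 := by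
        rw [← Complex.conj_eq_iff_im, inner_conj_symm, h1]
      rw [inner_smul_right, h1]
      simp [h3]
    rw [h2, norm_smul, Complex.norm_I]
    ring
  have hmem : v + Complex.I • u ∈ (G₀.map L).topologicalClosure := hdense ▸ Submodule.mem_top
  refine hG.closure_subset_iff.mpr le_rfl (Metric.mem_closure_iff.mpr fun ε hε => ?_)
  obtain ⟨w, ⟨⟨a, b⟩, hab, rfl⟩, hw⟩ := Metric.mem_closure_iff.mp hmem ε hε
  refine ⟨(a, b), hab.2, ?_⟩
  have h1 := hnorm (u - a) (v - b) ((generatorGraph U).sub_mem huv hab.1)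
  have h2 : v + Complex.I • u - L (a, b) = v - b + Complex.I • (u - a) := by
    simp only [L, LinearMap.add_apply, LinearMap.smul_apply, LinearMap.snd_apply,
        LinearMap.fst_apply, smul_sub]
    abel
  rw [dist_eq_norm, h2] at hw
  rw [Prod.dist_eq, max_lt_iff, dist_eq_norm, dist_eq_norm]
  constructor <;> refine lt_of_le_of_lt ?_ hw
  · refine le_of_sq_le_sq ?_ (norm_nonneg _); nlinarith [sq_nonneg ‖v - b‖]
  · refine le_of_sq_le_sq ?_ (norm_nonneg _); nlinarith [sq_nonneg ‖u - a‖]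

/-- For x and u in the common domain, s ↦ (U'_s x|U_s u) has zero derivative by symmetry of the
generator, so U'_{-t} U_t fixes u. -/
lemma eq_of_generatorGraph {U' : ℝ → E →L[ℂ] E} (hU' : IsUnitaryGroup U')
    (h : generatorGraph U' = generatorGraph U)
    (hd : Dense {u | ∃ v, (u, v) ∈ generatorGraph U}) : U' = U := by
  ext t u
  have key : ∀ u ∈ {u | ∃ v, (u, v) ∈ generatorGraph U}, ∀ t, U' t u = U t u := by
    rintro u ⟨v, huv⟩ t
    have h1 : ∀ x ∈ {u | ∃ v, (u, v) ∈ generatorGraph U},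
        inner ℂ x (U' (-t) (U t u) - u) = 0 := by
      rintro x ⟨y, hxy⟩
      have hxy' : (x, y) ∈ generatorGraph U' := h ▸ hxy
      have hd : ∀ s, HasDerivAt (fun s => (inner ℂ (U' s x) (U s u) : ℂ)) 0 s := by
        intro s
        have h2 := HasDerivAt.inner ℂ (hU'.hasDerivAt hxy' s) (hU.hasDerivAt huv s)
        have h3 : (U' s x, U' s y) ∈ generatorGraph U := h ▸ hU'.apply_mem_generatorGraph hxy' s
        have h4 := hU.generatorGraph_symmetric h3 (hU.apply_mem_generatorGraph huv s)
        simp only [map_smul, inner_smul_left, inner_smul_right, Complex.conj_I, h4] at h2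
        convert! h2 using 1
        ring
      have h5 := is_const_of_deriv_eq_zero (fun t => (hd t).differentiableAt)
        (fun t => (hd t).deriv) t 0
      rw [inner_sub_right, hU'.inner_apply_right, neg_neg, h5, hU.zero, hU'.zero]
      simp
    have h6 : U' (-t) (U t u) - u = 0 := by
      have hc : IsClosed {x : E | (inner ℂ x (U' (-t) (U t u) - u) : ℂ) = 0} :=
        isClosed_eq (by fun_prop) (by fun_prop)
      have h7 : (U' (-t) (U t u) - u) ∈ {x : E | (inner ℂ x (U' (-t) (U t u) - u) : ℂ) = 0} :=
        closure_minimal h1 hc (hd _)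
      exact inner_self_eq_zero.mp h7
    rw [← hU'.apply_neg t (U t u), sub_eq_zero.mp h6]
  exact congrFun (Continuous.ext_on hd (U' t).continuous (U t).continuous
    fun x hx => key x hx t) u

end IsUnitaryGroup

section SelfAdjoint

variable {A : E →ₗ.[ℂ] E}

lemma IsSelfAdjoint.inner_graph (hA : IsSelfAdjoint A) {u v x y : E} (h : (u, v) ∈ A.graph)
    (h' : (x, y) ∈ A.graph) : inner ℂ v x = inner ℂ u y := by
  obtain ⟨p, hp1, hp2⟩ := (LinearPMap.mem_graph_iff A).mp h
  obtain ⟨q, hq1, hq2⟩ := (LinearPMap.mem_graph_iff A).mp h'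
  simp only at hp1 hp2 hq1 hq2
  have h1 := LinearPMap.adjoint_isFormalAdjoint hA.dense_domain
  rw [LinearPMap.isSelfAdjoint_def.mp hA] at h1
  rw [← hp1, ← hp2, ← hq1, ← hq2]
  exact h1 p q

lemma IsSelfAdjoint.mem_graph_of_inner (hA : IsSelfAdjoint A) {u v : E}
    (h : ∀ x : A.domain, inner ℂ v (x : E) = inner ℂ u (A x)) : (u, v) ∈ A.graph := by
  have h1 : u ∈ A.adjoint.domain := LinearPMap.mem_adjoint_domain_of_exists u ⟨v, h⟩
  have h2 := LinearPMap.adjoint_apply_eq hA.dense_domain ⟨u, h1⟩ h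
  rw [← LinearPMap.isSelfAdjoint_def.mp hA]
  exact (LinearPMap.mem_graph_iff _).mpr ⟨⟨u, h1⟩, rfl, h2⟩

/-- Self-adjoint operators are maximal symmetric, and the generator is a symmetric extension of `A`.
-/
lemma generatorGraph_eq_of_le {U : ℝ → E →L[ℂ] E} (hU : IsUnitaryGroup U) (hA : IsSelfAdjoint A)
    (h : A.graph ≤ generatorGraph U) : generatorGraph U = A.graph := by
  refine le_antisymm ?_ h
  rintro ⟨x, y⟩ hxy
  exact hA.mem_graph_of_inner fun u => hU.generatorGraph_symmetric hxy (h (A.mem_graph u))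

lemma isUnitaryGroupOf_of_generatorGraph_eq {U : ℝ → E →L[ℂ] E} (hU : IsUnitaryGroup U)
    (h : generatorGraph U = A.graph) : IsUnitaryGroupOf A U :=
  ⟨hU.mem_unitary, hU.zero, hU.add, hU.continuous, fun u v => by rw [← h]; rfl⟩

lemma IsUnitaryGroupOf.generatorGraph_eq {U : ℝ → E →L[ℂ] E} (hU : IsUnitaryGroupOf A U) :
    generatorGraph U = A.graph := by
  ext ⟨u, v⟩
  exact (hU.generator u v).symm

lemma IsUnitaryGroupOf.isUnitaryGroupOf_expI {U : ℝ → E →L[ℂ] E} (hU : IsUnitaryGroupOf A U) :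
    IsUnitaryGroupOf A (expI A) := by
  have h : ∃ U, IsUnitaryGroupOf A U := ⟨U, hU⟩
  rw [expI, dif_pos h]
  exact h.choose_spec

/-- By uniqueness of the group with a given generator, the group chosen in `expI` can be computed
from any explicit candidate. -/
lemma IsUnitaryGroupOf.expI_eq {U : ℝ → E →L[ℂ] E} (hU : IsUnitaryGroupOf A U)
    (hd : Dense {u | ∃ v, (u, v) ∈ A.graph}) : expI A = U := by
  have h := hU.isUnitaryGroupOf_expI
  refine hU.isUnitaryGroup.eq_of_generatorGraph h.isUnitaryGroup ?_ ?_
  · rw [h.generatorGraph_eq, hU.generatorGraph_eq]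
  · rwa [hU.generatorGraph_eq]

end SelfAdjoint

end UnitaryGroups

/-! ### Resolvents and Stone's theorem -/

section SpectralTheorem

variable {E : Type*} [NormedAddCommGroup E] [InnerProductSpace ℂ E] [CompleteSpace E]

section Resolvent

variable {A : E →ₗ.[ℂ] E}

/-- The form bound gives ‖(A−z)x‖ ≥ (c−z)‖x‖, hence injectivity and, `A` being closed, closed range.
A vector orthogonal to the range is an eigenvector of A* = A for the real value z, and so vanishes.
-/
lemma exists_isResolventAt_of_formBoundedBelow (hA : IsSelfAdjoint A) {c z : ℝ}
    (hc : FormBoundedBelow A c) (hz : z < c) : ∃ T, IsResolventAt A (z : ℂ) T := by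
  let L : A.domain →ₗ[ℂ] E := A.toFun - (z : ℂ) • A.domain.subtype
  have hL : ∀ x : A.domain, L x = A x - (z : ℂ) • (x : E) := fun x => rfl
  have hδ : 0 < c - z := sub_pos.mpr hz
  have hbound : ∀ x : A.domain, (c - z) * ‖(x : E)‖ ≤ ‖L x‖ := by
    intro x
    rcases eq_or_ne ‖(x : E)‖ 0 with h0 | h0
    · rw [h0, mul_zero]; exact norm_nonneg _
    have h1 : (inner ℂ (x : E) (L x)).re = (inner ℂ (x : E) (A x)).re - z * ‖(x : E)‖ ^ 2 := by
      rw [hL, inner_sub_right, inner_smul_right, inner_self_eq_norm_sq_to_K, Complex.sub_re,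
        Complex.re_ofReal_mul]
      norm_cast
    have h2 := hc x
    have h3 : (inner ℂ (x : E) (L x)).re ≤ ‖(x : E)‖ * ‖L x‖ :=
      (Complex.re_le_norm _).trans (norm_inner_le_norm _ _)
    have h4 : 0 < ‖(x : E)‖ := lt_of_le_of_ne (norm_nonneg _) (Ne.symm h0)
    refine le_of_mul_le_mul_left ?_ h4
    nlinarith
  have hinj : Function.Injective L := by
    rw [injective_iff_map_eq_zero]
    intro x hx
    have := hbound x
    rw [hx, norm_zero] at this
    have h1 : ‖(x : E)‖ ≤ 0 := by
      by_contra hneg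
      push Not at hneg
      nlinarith [mul_pos hδ hneg]
    exact Subtype.ext (norm_le_zero_iff.mp h1)
  have hclosed : IsClosed (LinearMap.range L : Set E) := by
    refine isClosed_of_closure_subset fun y hy => ?_
    obtain ⟨s, hs, hsy⟩ := mem_closure_iff_seq_limit.mp hy
    choose x hx using hs
    have hcau : CauchySeq fun n => (x n : E) := by
      refine Metric.cauchySeq_iff'.mpr fun ε hε => ?_
      obtain ⟨N, hN⟩ := Metric.cauchySeq_iff'.mp hsy.cauchySeq ((c - z) * ε) (mul_pos hδ hε)
      refine ⟨N, fun n hn => ?_⟩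
      have h1 := hN n hn
      rw [dist_eq_norm, ← hx, ← hx, ← map_sub] at h1
      have h2 := hbound (x n - x N)
      rw [dist_eq_norm]
      exact lt_of_mul_lt_mul_left (h2.trans_lt h1) hδ.le
    obtain ⟨x₀, hx₀⟩ := cauchySeq_tendsto_of_complete hcau
    have h1 : Tendsto (fun n => A (x n)) atTop (𝓝 (y + (z : ℂ) • x₀)) := by
      refine (hsy.add (hx₀.const_smul (z : ℂ))).congr fun n => ?_
      rw [← hx n, hL]; abel
    have h2 : (x₀, y + (z : ℂ) • x₀) ∈ A.graph :=
      hA.isClosed.mem_of_tendsto (hx₀.prodMk_nhds h1) (Eventually.of_forall fun n => A.mem_graph _)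
    obtain ⟨p, hp1, hp2⟩ := (LinearPMap.mem_graph_iff A).mp h2
    refine ⟨p, ?_⟩
    simp only at hp1 hp2
    rw [hL, hp1, hp2]; abel
  have hsurj : LinearMap.range L = ⊤ := by
    have hcompl : IsComplete (LinearMap.range L : Set E) := hclosed.isComplete
    have : CompleteSpace (LinearMap.range L) := hcompl.completeSpace_coe
    rw [← Submodule.orthogonal_eq_bot_iff, Submodule.eq_bot_iff]
    intro v hv
    have h1 : (v, (z : ℂ) • v) ∈ A.graph := by
      refine hA.mem_graph_of_inner fun x => ?_
      have h2 := (Submodule.mem_orthogonal' _ _).mp hv (L x) ⟨x, rfl⟩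
      rw [hL, inner_sub_right, inner_smul_right, sub_eq_zero] at h2
      rw [h2, inner_smul_left, Complex.conj_ofReal]
    obtain ⟨p, hp1, hp2⟩ := (LinearPMap.mem_graph_iff A).mp h1
    simp only at hp1 hp2
    have h3 : L p = 0 := by rw [hL, hp2, hp1, sub_self]
    have h4 := hinj (h3.trans (map_zero L).symm)
    rw [← hp1, h4]; rfl
  let e := LinearEquiv.ofBijective L ⟨hinj, LinearMap.range_eq_top.mp hsurj⟩
  have he : ∀ u, L (e.symm u) = u := fun u => e.apply_symm_apply u
  let T : E →L[ℂ] E := (A.domain.subtype ∘ₗ e.symm.toLinearMap).mkContinuous (c - z)⁻¹ (fun u => by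
    have := hbound (e.symm u)
    rw [he] at this
    rw [inv_mul_eq_div, le_div_iff₀ hδ, mul_comm]
    exact this)
  refine ⟨T, fun u => ⟨e.symm u, rfl, he u⟩, fun x => ?_⟩
  have : e.symm (L x) = x := e.symm_apply_apply x
  exact congrArg Subtype.val this

variable {z : ℝ} {T : E →L[ℂ] E}

lemma IsResolventAt.mem_graph {z : ℂ} (hT : IsResolventAt A z T) (x : E) :
    (T x, x + z • T x) ∈ A.graph := by
  obtain ⟨p, hp1, hp2⟩ := hT.1 x
  refine (LinearPMap.mem_graph_iff A).mpr ⟨p, hp1, ?_⟩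
  rw [← hp1, ← hp2]; simp

lemma IsResolventAt.apply_graph {z : ℂ} (hT : IsResolventAt A z T) {u v : E}
    (h : (u, v) ∈ A.graph) : T (v - z • u) = u := by
  obtain ⟨p, hp1, hp2⟩ := (LinearPMap.mem_graph_iff A).mp h
  simp only at hp1 hp2
  rw [← hp1, ← hp2]
  exact hT.2 p

lemma IsResolventAt.injective {z : ℂ} (hT : IsResolventAt A z T) {x : E} (hx : T x = 0) :
    x = 0 := by
  obtain ⟨p, hp1, hp2⟩ := hT.1 x
  have : p = 0 := Subtype.ext (hp1.trans hx)
  rw [← hp2, this]; simp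

lemma IsResolventAt.unique {z : ℂ} {T' : E →L[ℂ] E} (hT : IsResolventAt A z T)
    (hT' : IsResolventAt A z T') : T = T' := by
  ext x
  have h := hT'.apply_graph (hT.mem_graph x)
  simpa using h.symm

lemma IsResolventAt.resolventOp_eq {z : ℂ} (hT : IsResolventAt A z T) : resolventOp A z = T := by
  have h : ∃ T, IsResolventAt A z T := ⟨T, hT⟩
  rw [resolventOp, dif_pos h]
  exact h.choose_spec.unique hT

lemma IsResolventAt.isSelfAdjoint (hA : IsSelfAdjoint A) (hT : IsResolventAt A (z : ℂ) T) :
    IsSelfAdjoint T := by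
  rw [ContinuousLinearMap.isSelfAdjoint_iff']
  ext u
  refine ext_inner_right ℂ fun v => ?_
  rw [ContinuousLinearMap.adjoint_inner_left]
  have h1 := hA.inner_graph (hT.mem_graph u) (hT.mem_graph v)
  rw [inner_add_left, inner_add_right, inner_smul_left, inner_smul_right,
    Complex.conj_ofReal] at h1
  exact add_right_cancel h1

lemma IsResolventAt.denseRange (hA : IsSelfAdjoint A) (hT : IsResolventAt A (z : ℂ) T) :
    DenseRange T := by
  have h : LinearMap.range T.toLinearMap = A.domain := by
    ext x
    constructor
    · rintro ⟨y, rfl⟩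
      obtain ⟨p, hp, -⟩ := hT.1 y
      change T y ∈ A.domain
      rw [← hp]
      exact p.2
    · intro hx
      exact ⟨_, hT.2 ⟨x, hx⟩⟩
  have h2 := hA.dense_domain
  rw [← h] at h2
  exact h2

end Resolvent

namespace BorelCalculus

variable {T : E →L[ℂ] E} (C : BorelCalculus T)

instance (u : E) : IsFiniteMeasure (C.μ u) := C.finite u

/-- The Borel functions to which the calculus applies. -/
def Admissible (f : ℝ → ℝ) : Prop := Measurable f ∧ ∃ M, ∀ r, |r| ≤ C.R → |f r| ≤ M

variable {C} {f g : ℝ → ℝ}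

lemma Admissible.of_bounded (hf : Measurable f) {M : ℝ} (h : ∀ r, |f r| ≤ M) : C.Admissible f :=
  ⟨hf, M, fun r _ => h r⟩

lemma admissible_id : C.Admissible _root_.id := ⟨measurable_id, C.R, fun _ h => h⟩

lemma Admissible.mul (hf : C.Admissible f) (hg : C.Admissible g) : C.Admissible (f * g) := by
  obtain ⟨hf, M, hM⟩ := hf
  obtain ⟨hg, N, hN⟩ := hg
  refine ⟨hf.mul hg, M * N, fun r hr => ?_⟩
  rw [Pi.mul_apply, abs_mul]
  exact mul_le_mul (hM r hr) (hN r hr) (abs_nonneg _) ((abs_nonneg _).trans (hM r hr))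

lemma Admissible.add (hf : C.Admissible f) (hg : C.Admissible g) : C.Admissible (f + g) := by
  obtain ⟨hf, M, hM⟩ := hf
  obtain ⟨hg, N, hN⟩ := hg
  exact ⟨hf.add hg, M + N, fun r hr => (abs_add_le _ _).trans (add_le_add (hM r hr) (hN r hr))⟩

lemma Admissible.smul (hf : C.Admissible f) (c : ℝ) : C.Admissible (c • f) := by
  obtain ⟨hf, M, hM⟩ := hf
  refine ⟨hf.const_smul c, |c| * M, fun r hr => ?_⟩
  rw [Pi.smul_apply, smul_eq_mul, abs_mul]
  exact mul_le_mul_of_nonneg_left (hM r hr) (abs_nonneg _)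

lemma Admissible.indicator {s : Set ℝ} (hs : MeasurableSet s) : C.Admissible (s.indicator 1) :=
  .of_bounded (measurable_one.indicator hs) (M := 1) fun r => by
    by_cases hr : r ∈ s <;> simp [hr]

lemma Admissible.hasQuadraticForm (hf : C.Admissible f) : HasQuadraticForm C.μ f (C.Φ f) :=
  C.quad f hf.1 hf.2

lemma Admissible.isSelfAdjoint (hf : C.Admissible f) : IsSelfAdjoint (C.Φ f) :=
  hf.hasQuadraticForm.isSelfAdjoint

lemma Admissible.integrable (hf : C.Admissible f) (u : E) : Integrable f (C.μ u) := by
  obtain ⟨hf, M, hM⟩ := hf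
  refine Integrable.of_bound hf.aestronglyMeasurable M ?_
  filter_upwards [C.support u] with r hr using hM r hr

lemma Admissible.map_mul (hf : C.Admissible f) (hg : C.Admissible g) :
    C.Φ (f * g) = C.Φ f * C.Φ g := C.mul f g hf.1 hf.2 hg.1 hg.2

lemma Admissible.map_add (hf : C.Admissible f) (hg : C.Admissible g) :
    C.Φ (f + g) = C.Φ f + C.Φ g := by
  refine (hf.add hg).hasQuadraticForm.unique fun u => ?_
  simp only [add_apply, inner_add_right, hf.hasQuadraticForm u, hg.hasQuadraticForm u,
    Pi.add_apply]
  rw [integral_add (hf.integrable u) (hg.integrable u)]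
  push_cast
  rfl

lemma Admissible.map_smul (hf : C.Admissible f) (c : ℝ) : C.Φ (c • f) = (c : ℂ) • C.Φ f :=
  (hf.smul c).hasQuadraticForm.unique (hf.hasQuadraticForm.smul c)

lemma Admissible.norm_sq (hf : C.Admissible f) (u : E) :
    ‖C.Φ f u‖ ^ 2 = ∫ r, f r ^ 2 ∂(C.μ u) := by
  have h1 := (hf.mul hf).hasQuadraticForm u
  rw [hf.map_mul hf, mul_apply_eq_comp, ← hf.isSelfAdjoint.inner_clm_left,
    inner_self_eq_norm_sq_to_K] at h1
  have h2 : ((‖C.Φ f u‖ ^ 2 : ℝ) : ℂ) = ((∫ r, (f * f) r ∂(C.μ u) : ℝ) : ℂ) := by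
    rw [← h1]; push_cast; rfl
  rw [Complex.ofReal_injective h2]
  simp only [Pi.mul_apply, sq]

lemma map_zero : C.Φ 0 = 0 := by
  have h : C.Admissible 0 := .of_bounded measurable_zero (M := 0) (by simp)
  refine h.hasQuadraticForm.unique fun u => by simp

lemma real_univ (u : E) : (C.μ u).real Set.univ = ‖u‖ ^ 2 := by
  have h : C.Admissible 1 := .of_bounded measurable_one (M := 1) (by simp)
  have := h.norm_sq u
  rw [C.one] at this
  simpa using this.symm

/-- The product of `T` with its spectral projection onto {0} is zero, so injectivity kills the
projection. For a resolvent this makes the value of r⁻¹ at r = 0 irrelevant. -/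
lemma ae_ne_zero (hT : ∀ x, T x = 0 → x = 0) (u : E) : ∀ᵐ r ∂(C.μ u), r ≠ 0 := by
  have h0 : C.Admissible (Set.indicator {0} 1) := .indicator (measurableSet_singleton 0)
  have h1 : T (C.Φ (Set.indicator {0} 1) u) = 0 := by
    have h2 := admissible_id.map_mul h0
    have h3 : (_root_.id : ℝ → ℝ) * Set.indicator {0} 1 = 0 := by
      ext r
      by_cases hr : r = 0 <;> simp [hr]
    rw [h3, map_zero, C.id] at h2
    rw [← mul_apply_eq_comp, ← h2]; rfl
  have h2 := h0.norm_sq u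
  rw [hT _ h1, norm_zero] at h2
  have h3 : ∀ r, Set.indicator {0} (1 : ℝ → ℝ) r ^ 2 = Set.indicator {0} 1 r := fun r => by
    by_cases hr : r = 0 <;> simp [hr]
  simp only [h3] at h2
  rw [integral_indicator_one (measurableSet_singleton 0)] at h2
  rw [ae_iff]
  simp only [not_not]
  have h4 : (C.μ u).real {0} = 0 := by simpa using h2.symm
  rw [measureReal_eq_zero_iff] at h4
  exact h4

end BorelCalculus

lemma hasDerivAt_inner_of_self {A : ℝ → E →L[ℂ] E} {B : E →L[ℂ] E} {t : ℝ}
    (h : ∀ u, HasDerivAt (fun t => (inner ℂ u (A t u) : ℂ)) (inner ℂ u (B u)) t) (u v : E) :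
    HasDerivAt (fun t => (inner ℂ u (A t v) : ℂ)) (inner ℂ u (B v)) t := by
  simp only [inner_polarization _ u v]
  exact ((((h _).sub (h _)).sub ((h _).const_mul _)).add ((h _).const_mul _)).div_const _

/-- Stone's theorem, for operators with a real point in the resolvent set. -/
theorem exists_isUnitaryGroupOf {A : E →ₗ.[ℂ] E} (hA : IsSelfAdjoint A) {z : ℝ} {T : E →L[ℂ] E}
    (hT : IsResolventAt A (z : ℂ) T) : ∃ U, IsUnitaryGroupOf A U := by
  have hTs := hT.isSelfAdjoint hA
  obtain ⟨C⟩ := exists_borelCalculus hTs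
  -- A spectral value r of T = (A−z)⁻¹ corresponds to the value r⁻¹ + z of A. The calculus is real,
  -- so e^{itA} is assembled from its cosine and sine.
  let c : ℝ → ℝ → ℝ := fun t r => Real.cos (t * (r⁻¹ + z))
  let s : ℝ → ℝ → ℝ := fun t r => Real.sin (t * (r⁻¹ + z))
  have hc : ∀ t, C.Admissible (c t) := fun t => .of_bounded (by fun_prop) (M := 1)
    fun r => Real.abs_cos_le_one _
  have hs : ∀ t, C.Admissible (s t) := fun t => .of_bounded (by fun_prop) (M := 1)
    fun r => Real.abs_sin_le_one _
  let U : ℝ → E →L[ℂ] E := fun t => C.Φ (c t) + Complex.I • C.Φ (s t)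
  have hI : Complex.I * Complex.I = -1 := Complex.I_mul_I
  have hadd : ∀ a b, U (a + b) = U a * U b := by
    intro a b
    have h1 : c (a + b) = c a * c b + (-1 : ℝ) • (s a * s b) := by
      ext r
      simp only [c, s, add_mul, Real.cos_add, Pi.add_apply, Pi.mul_apply, Pi.smul_apply, smul_eq_mul]
      ring
    have h2 : s (a + b) = s a * c b + c a * s b := by
      ext r
      simp only [c, s, add_mul, Real.sin_add, Pi.add_apply, Pi.mul_apply]
    simp only [U]
    rw [h1, h2, ((hc a).mul (hc b)).map_add (((hs a).mul (hs b)).smul _),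
      ((hs a).mul (hs b)).map_smul, ((hs a).mul (hc b)).map_add ((hc a).mul (hs b)),
      (hc a).map_mul (hc b), (hs a).map_mul (hs b), (hs a).map_mul (hc b), (hc a).map_mul (hs b)]
    simp only [add_mul, mul_add, smul_mul_assoc, mul_smul_comm, smul_add, smul_smul, hI]
    push_cast
    abel
  have hzero : U 0 = 1 := by
    have h1 : c 0 = 1 := by ext r; simp [c]
    have h2 : s 0 = 0 := by ext r; simp [s]
    simp only [U, h1, h2, C.one, BorelCalculus.map_zero, smul_zero, add_zero]
  have hadj : ∀ t, star (U t) = U (-t) := by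
    intro t
    have h1 : c (-t) = c t := by ext r; simp [c]
    have h2 : s (-t) = (-1 : ℝ) • s t := by ext r; simp [s]
    simp only [U, h1, h2, star_add, star_smul, (hc t).isSelfAdjoint.star_eq,
      (hs t).isSelfAdjoint.star_eq, (hs t).map_smul]
    simp
  have hunit : ∀ t, U t ∈ unitary (E →L[ℂ] E) := fun t => by
    rw [Unitary.mem_iff, hadj, ← hadd, ← hadd, neg_add_cancel, add_neg_cancel, hzero]
    exact ⟨rfl, rfl⟩
  have hquad : ∀ t u, inner ℂ u (U t u) =
      ((∫ r, c t r ∂(C.μ u) : ℝ) : ℂ) + Complex.I * ((∫ r, s t r ∂(C.μ u) : ℝ) : ℂ) := by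
    intro t u
    simp only [U, add_apply, smul_apply, inner_add_right, inner_smul_right,
      (hc t).hasQuadraticForm u, (hs t).hasQuadraticForm u]
  have hcont0 : ∀ u, Tendsto (fun t => ‖U t u - u‖ ^ 2) (𝓝 0) (𝓝 0) := by
    intro u
    have h1 : ∀ t, ‖U t u - u‖ ^ 2 = 2 * ‖u‖ ^ 2 - 2 * ∫ r, c t r ∂(C.μ u) := by
      intro t
      rw [@norm_sub_sq ℂ, norm_map_of_mem_unitary (hunit t)]
      have h2 : RCLike.re (inner ℂ (U t u) u) = ∫ r, c t r ∂(C.μ u) := by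
        rw [← inner_conj_symm, RCLike.conj_re, hquad]
        simp
      rw [h2]; ring
    simp only [h1]
    have h3 : Tendsto (fun t => ∫ r, c t r ∂(C.μ u)) (𝓝 0) (𝓝 (∫ r, (1 : ℝ) ∂(C.μ u))) := by
      refine tendsto_integral_filter_of_dominated_convergence (fun _ => 1)
        (Eventually.of_forall fun t => (hc t).1.aestronglyMeasurable)
        (Eventually.of_forall fun t => Eventually.of_forall fun r => Real.abs_cos_le_one _)
        (integrable_const _) (Eventually.of_forall fun r => ?_)
      have : Continuous fun t => c t r := by simp only [c]; fun_prop
      simpa [c] using this.tendsto 0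
    have h4 : (∫ r, (1 : ℝ) ∂(C.μ u)) = ‖u‖ ^ 2 := by
      rw [← BorelCalculus.real_univ (C := C)]; simp
    rw [h4] at h3
    have h5 := (h3.const_mul 2).const_sub (2 * ‖u‖ ^ 2)
    simpa using h5
  have hcont : ∀ u, Continuous fun t => U t u := by
    intro u
    rw [continuous_iff_continuousAt]
    intro t
    rw [ContinuousAt, tendsto_iff_norm_sub_tendsto_zero]
    have h1 : Tendsto (fun a : ℝ => a - t) (𝓝 t) (𝓝 0) := by
      simpa using (continuous_id.sub continuous_const).tendsto (x := t) (f := fun a : ℝ => a - t)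
    have h2 := ((hcont0 u).comp h1).sqrt
    simp only [Real.sqrt_zero] at h2
    refine h2.congr fun a => ?_
    have h3 : U a u - U t u = U t (U (a - t) u - u) := by
      rw [map_sub, ← mul_apply_eq_comp, ← hadd]
      congr 3; ring
    rw [h3, norm_map_of_mem_unitary (hunit t), Function.comp, Real.sqrt_sq (norm_nonneg _)]
  have hU : IsUnitaryGroup U := ⟨hunit, hzero, hadd, hcont⟩
  -- The factor T contributes r, and r(r⁻¹ + z) is bounded on the spectrum, which dominates the
  -- differentiated integrand. The derivative at 0 is i(1 + zT) = iAT.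
  have hderiv : ∀ u, HasDerivAt (fun t => (inner ℂ u ((U t * T) u) : ℂ))
      (inner ℂ u ((Complex.I • (1 + (z : ℂ) • T)) u)) 0 := by
    intro u
    have hbm : ∀ r : ℝ, |r| ≤ C.R → |r * (r⁻¹ + z)| ≤ 1 + C.R * |z| := fun r hr => by
      rw [mul_add]
      refine (abs_add_le _ _).trans (add_le_add ?_ ?_)
      · rcases eq_or_ne r 0 with h | h
        · simp [h]
        · rw [mul_inv_cancel₀ h, abs_one]
      · rw [abs_mul]; gcongr
    have hcd : HasDerivAt (fun t => ∫ r, r * c t r ∂(C.μ u))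
        (∫ r, r * (-Real.sin (0 * (r⁻¹ + z)) * (r⁻¹ + z)) ∂(C.μ u)) 0 := by
      refine (hasDerivAt_integral_of_dominated_loc_of_deriv_le (s := Set.univ) (x₀ := (0 : ℝ))
        (F := fun t r => r * c t r)
        (F' := fun t r => r * (-Real.sin (t * (r⁻¹ + z)) * (r⁻¹ + z)))
        (bound := fun _ => 1 + C.R * |z|) univ_mem
        (Eventually.of_forall fun t => (measurable_id.mul (hc t).1).aestronglyMeasurable)
        ((BorelCalculus.admissible_id.mul (hc 0)).integrable u)
        (Measurable.aestronglyMeasurable (by fun_prop)) ?_ (integrable_const _) ?_).2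
      · filter_upwards [C.support u] with r hr t _
        have h1 : r * (-Real.sin (t * (r⁻¹ + z)) * (r⁻¹ + z)) =
          (r * (r⁻¹ + z)) * (-Real.sin (t * (r⁻¹ + z))) := by ring
        rw [h1, Real.norm_eq_abs, abs_mul, abs_neg]
        calc _ ≤ |r * (r⁻¹ + z)| * 1 := by gcongr; exact Real.abs_sin_le_one _
          _ ≤ _ := by rw [mul_one]; exact hbm r hr
      · refine Eventually.of_forall fun r t _ => ?_
        have h1 := ((hasDerivAt_id t).mul_const (r⁻¹ + z)).cos.const_mul r
        simpa using h1
    have hsd : HasDerivAt (fun t => ∫ r, r * s t r ∂(C.μ u))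
        (∫ r, r * (Real.cos (0 * (r⁻¹ + z)) * (r⁻¹ + z)) ∂(C.μ u)) 0 := by
      refine (hasDerivAt_integral_of_dominated_loc_of_deriv_le (s := Set.univ) (x₀ := (0 : ℝ))
        (F := fun t r => r * s t r)
        (F' := fun t r => r * (Real.cos (t * (r⁻¹ + z)) * (r⁻¹ + z)))
        (bound := fun _ => 1 + C.R * |z|) univ_mem
        (Eventually.of_forall fun t => (measurable_id.mul (hs t).1).aestronglyMeasurable)
        ((BorelCalculus.admissible_id.mul (hs 0)).integrable u)
        (Measurable.aestronglyMeasurable (by fun_prop)) ?_ (integrable_const _) ?_).2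
      · filter_upwards [C.support u] with r hr t _
        have h1 : r * (Real.cos (t * (r⁻¹ + z)) * (r⁻¹ + z)) =
          (r * (r⁻¹ + z)) * (Real.cos (t * (r⁻¹ + z))) := by ring
        rw [h1, Real.norm_eq_abs, abs_mul]
        calc _ ≤ |r * (r⁻¹ + z)| * 1 := by gcongr; exact Real.abs_cos_le_one _
          _ ≤ _ := by rw [mul_one]; exact hbm r hr
      · refine Eventually.of_forall fun r t _ => ?_
        have h1 := ((hasDerivAt_id t).mul_const (r⁻¹ + z)).sin.const_mul r
        simpa using h1
    have h1 : (∫ r, r * (-Real.sin (0 * (r⁻¹ + z)) * (r⁻¹ + z)) ∂(C.μ u)) = 0 := by simp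
    have h2 : ∫ r, r * (Real.cos (0 * (r⁻¹ + z)) * (r⁻¹ + z)) ∂(C.μ u) =
        ∫ r, ((1 : ℝ → ℝ) + z • (_root_.id : ℝ → ℝ)) r ∂(C.μ u) := by
      refine integral_congr_ae ?_
      filter_upwards [BorelCalculus.ae_ne_zero (C := C) (fun x => hT.injective) u] with r hr
      simp [mul_add, hr, mul_comm]
    rw [h1] at hcd
    rw [h2] at hsd
    have h3 : C.Admissible (1 + z • _root_.id) :=
      (BorelCalculus.Admissible.of_bounded measurable_one (M := 1) (by simp)).add
        (BorelCalculus.admissible_id.smul z)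
    have h4 : C.Φ (1 + z • _root_.id) = 1 + (z : ℂ) • T := by
      rw [BorelCalculus.Admissible.map_add
        (.of_bounded measurable_one (M := 1) (by simp)) (BorelCalculus.admissible_id.smul z),
        BorelCalculus.admissible_id.map_smul, C.one, C.id]
    have h5 := hcd.ofReal_comp.add (hsd.ofReal_comp.const_mul Complex.I)
    have h6 : inner ℂ u ((Complex.I • (1 + (z : ℂ) • T)) u) =
        Complex.I * ((∫ r, ((1 : ℝ → ℝ) + z • (_root_.id : ℝ → ℝ)) r ∂(C.μ u) : ℝ) : ℂ) := by
      rw [← h3.hasQuadraticForm u, h4, smul_apply, inner_smul_right]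
    rw [h6]
    rw [Complex.ofReal_zero, zero_add] at h5
    refine h5.congr_of_eventuallyEq (Eventually.of_forall fun t => ?_)
    have h7 : U t * T = C.Φ (_root_.id * c t) + Complex.I • C.Φ (_root_.id * s t) := by
      rw [mul_comm _root_.id, mul_comm _root_.id, (hc t).map_mul BorelCalculus.admissible_id,
        (hs t).map_mul BorelCalculus.admissible_id, C.id]
      simp only [U, add_mul, smul_mul_assoc]
    simp only [h7, add_apply, smul_apply, inner_add_right, inner_smul_right,
      (BorelCalculus.admissible_id.mul (hc t)).hasQuadraticForm u,
      (BorelCalculus.admissible_id.mul (hs t)).hasQuadraticForm u]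
    rfl
  -- Every u in D(A) is T(Au − zu), so the weak derivative of U_t T suffices. Equality then follows
  -- from maximality of `A`.
  have hle : A.graph ≤ generatorGraph U := by
    rintro ⟨u, v⟩ huv
    refine hU.mem_generatorGraph_of_weak (Z := Set.univ) (by simp) (fun _ _ _ => trivial)
      fun y _ => ?_
    have h1 := hasDerivAt_inner_of_self hderiv y (v - (z : ℂ) • u)
    simp only [mul_apply_eq_comp, smul_apply, add_apply, one_apply_eq_self,
      hT.apply_graph huv, inner_smul_right] at h1
    simpa using h1
  exact ⟨U, isUnitaryGroupOf_of_generatorGraph_eq hU (generatorGraph_eq_of_le hU hA hle)⟩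

end SpectralTheorem

/-! ### Spectral resolutions of unbounded operators and spectral cutoffs -/

section FunctionalCalculus

variable {E : Type*} [NormedAddCommGroup E] [InnerProductSpace ℂ E] [CompleteSpace E]

namespace ProjValuedMeasure

variable (P : ProjValuedMeasure E)

lemma measure_apply (u : E) {B : Set ℝ} (hB : MeasurableSet B) :
    P.measure u B = ENNReal.ofReal (inner ℂ u (P.proj B u)).re :=
  Measure.ofMeasurable_apply B hB

lemma inner_proj (u : E) {B : Set ℝ} (hB : MeasurableSet B) :
    inner ℂ u (P.proj B u) = (((P.measure u).real B : ℝ) : ℂ) := by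
  rw [measureReal_def, P.measure_apply u hB, ENNReal.toReal_ofReal (P.re_inner_nonneg u B hB)]
  exact isSelfAdjoint_clm_iff.mp (P.isStarProjection B hB).isSelfAdjoint u

instance (u : E) : IsFiniteMeasure (P.measure u) :=
  ⟨by rw [P.measure_apply u MeasurableSet.univ]; exact ENNReal.ofReal_lt_top⟩

lemma real_univ (u : E) : (P.measure u).real Set.univ = ‖u‖ ^ 2 := by
  have h := P.inner_proj u MeasurableSet.univ
  rw [P.univ, one_apply_eq_self, inner_self_eq_norm_sq_to_K] at h
  refine (Complex.ofReal_injective ?_).symm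
  rw [← h]; push_cast; rfl

lemma hasQuadraticForm_indicator {B : Set ℝ} (hB : MeasurableSet B) :
    HasQuadraticForm P.measure (B.indicator 1) (P.proj B) := fun u => by
  rw [integral_indicator_one hB, P.inner_proj u hB]

lemma exists_hasQuadraticForm {f : ℝ → ℝ} (hf : Measurable f) (hb : ∃ M, ∀ r, |f r| ≤ M) :
    ∃ L, HasQuadraticForm P.measure f L :=
  HasQuadraticForm.exists_of_indicator (fun u => (P.real_univ u).le)
    (fun _ hs => ⟨_, P.hasQuadraticForm_indicator hs⟩) hf hb

lemma integral_eq {f : ℝ → ℝ} {L : E →L[ℂ] E} (h : HasQuadraticForm P.measure f L) :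
    P.integral (fun r => (f r : ℂ)) = L := by
  have h1 : ∀ u, inner ℂ u (L u) = ∫ r, (f r : ℂ) ∂(P.measure u) := fun u => by
    rw [h u, integral_complex_ofReal]
  have hex : ∃ T : E →L[ℂ] E, ∀ u, inner ℂ u (T u) = ∫ r, (f r : ℂ) ∂(P.measure u) := ⟨L, h1⟩
  rw [ProjValuedMeasure.integral, dif_pos hex]
  exact ext_of_inner_self fun u => (hex.choose_spec u).trans (h1 u).symm

lemma proj_proj (B C : Set ℝ) (hB : MeasurableSet B) (hC : MeasurableSet C) (u : E) :
    P.proj B (P.proj C u) = P.proj (B ∩ C) u := by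
  rw [P.inter B C hB hC]; rfl

lemma ae_mem_of_proj {B : Set ℝ} (hB : MeasurableSet B) (u : E) :
    ∀ᵐ r ∂(P.measure (P.proj B u)), r ∈ B := by
  rw [ae_iff]
  change P.measure (P.proj B u) Bᶜ = 0
  rw [P.measure_apply _ hB.compl, P.proj_proj _ _ hB.compl hB, Set.compl_inter_self, P.proj_empty]
  simp

/-- A resolution of an operator `A ≥ 1` is supported in `[0, ∞)`. -/
lemma IsResolutionOf.ae_nonneg {P : ProjValuedMeasure E} {A : E →ₗ.[ℂ] E}
    (hP : P.IsResolutionOf A) (hA : FormBoundedBelow A 1) (u : E) :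
    ∀ᵐ r ∂(P.measure u), 0 ≤ r := by
  -- Bounded slices keep the projected vector v in the domain. There (v|Av) ≤ 0 by its spectral
  -- support and (v|Av) ≥ ‖v‖² by A ≥ 1.
  have h0 : ∀ n : ℕ, P.proj (Set.Ioo (-n : ℝ) 0) u = 0 := by
    intro n
    set v := P.proj (Set.Ioo (-n : ℝ) 0) u with hv
    have hmem := P.ae_mem_of_proj (measurableSet_Ioo (a := (-n : ℝ)) (b := 0)) u
    rw [← hv] at hmem
    have h1 : v ∈ A.domain := by
      refine (hP.1 v).mpr (Integrable.of_bound (by fun_prop) ((n : ℝ) ^ 2) ?_)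
      filter_upwards [hmem] with r hr
      rw [Real.norm_eq_abs, abs_of_nonneg (sq_nonneg r)]
      nlinarith [hr.1, hr.2]
    have h2 := hP.2 ⟨v, h1⟩
    have h3 := hA ⟨v, h1⟩
    rw [h2, integral_complex_ofReal, Complex.ofReal_re] at h3
    have h4 : ∫ r : ℝ, r ∂(P.measure v) ≤ 0 := by
      refine integral_nonpos_of_ae ?_
      filter_upwards [hmem] with r hr using hr.2.le
    have h5 : ‖v‖ ^ 2 ≤ 0 := by simpa using h3.trans h4
    have h6 : ‖v‖ = 0 := by nlinarith [norm_nonneg v]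
    exact norm_eq_zero.mp h6
  have h1 : ∀ n : ℕ, ∀ᵐ r ∂(P.measure u), r ∉ Set.Ioo (-n : ℝ) 0 := by
    intro n
    rw [ae_iff]
    simp only [not_not]
    change P.measure u (Set.Ioo (-n : ℝ) 0) = 0
    rw [P.measure_apply _ measurableSet_Ioo, h0 n]
    simp
  filter_upwards [ae_all_iff.mpr h1] with r hr
  by_contra hneg
  push Not at hneg
  obtain ⟨n, hn⟩ := exists_nat_gt (-r)
  exact hr n ⟨by linarith, hneg⟩

end ProjValuedMeasure

/-- The spectral theorem for self-adjoint operators with `0` in the resolvent set. -/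
theorem exists_isResolutionOf {A : E →ₗ.[ℂ] E} (hA : IsSelfAdjoint A) {T : E →L[ℂ] E}
    (hT : IsResolventAt A ((0 : ℝ) : ℂ) T) : ∃ P : ProjValuedMeasure E, P.IsResolutionOf A := by
  have hTs := hT.isSelfAdjoint hA
  obtain ⟨C⟩ := exists_borelCalculus hTs
  have hm : ∀ {B : Set ℝ}, MeasurableSet B → MeasurableSet (Inv.inv ⁻¹' B) :=
    fun hB => measurable_inv hB
  have hadm : ∀ {B : Set ℝ}, MeasurableSet B →
      C.Admissible ((Inv.inv ⁻¹' B).indicator 1) := fun hB => .indicator (hm hB)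
  have hquad : ∀ {B : Set ℝ}, MeasurableSet B → ∀ u,
      inner ℂ u (C.Φ ((Inv.inv ⁻¹' B).indicator 1) u) =
        (((C.μ u).real (Inv.inv ⁻¹' B) : ℝ) : ℂ) := fun hB u => by
    rw [(hadm hB).hasQuadraticForm u, integral_indicator_one (hm hB)]
  -- As A = T⁻¹, the spectral measure of A is that of T transported by r ↦ r⁻¹. The convention 0⁻¹ =
  -- 0 does no harm, since {0} is a null set.
  let P : ProjValuedMeasure E :=
    { proj := fun B => C.Φ ((Inv.inv ⁻¹' B).indicator 1)
      isStarProjection := fun B hB => by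
        refine ⟨?_, (hadm hB).isSelfAdjoint⟩
        rw [IsIdempotentElem, ← (hadm hB).map_mul (hadm hB), ← Set.inter_indicator_one,
          Set.inter_self]
      univ := by simp [C.one]
      inter := fun B B' hB hB' => by
        rw [← (hadm hB).map_mul (hadm hB'), Set.preimage_inter, Set.inter_indicator_one]
      hasSum := fun B hB hd u => by
        have hd' : Pairwise (Function.onFun Disjoint fun n => Inv.inv ⁻¹' B n) :=
          fun i j hij => (hd hij).preimage _
        have hU : MeasurableSet (⋃ n, B n) := MeasurableSet.iUnion hB
        have hsum : ∀ s : Finset ℕ, ∑ n ∈ s, C.Φ ((Inv.inv ⁻¹' B n).indicator 1) =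
            C.Φ ((⋃ n ∈ s, Inv.inv ⁻¹' B n).indicator 1) := by
          intro s
          induction s using Finset.induction_on with
          | empty => simp only [Finset.sum_empty, Finset.notMem_empty, Set.iUnion_of_empty,
              Set.iUnion_empty, Set.indicator_empty]; exact BorelCalculus.map_zero.symm
          | insert a s ha ih =>
            have h1 : MeasurableSet (⋃ n ∈ s, Inv.inv ⁻¹' B n) :=
              Finset.measurableSet_biUnion _ fun i _ => hm (hB i)
            rw [Finset.sum_insert ha, ih, Finset.set_biUnion_insert,
              ← (hadm (hB a)).map_add (.indicator h1), Set.indicator_union_of_disjoint]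
            · rfl
            · rw [Set.disjoint_iUnion₂_right]
              exact fun i hi => hd' (fun h => ha (h ▸ hi))
        -- The squared norm of the error is the scalar measure of the part not yet covered. Strong
        -- countable additivity thus reduces to that of μ_u.
        have hdiff : ∀ s : Finset ℕ, ‖∑ n ∈ s, C.Φ ((Inv.inv ⁻¹' B n).indicator 1) u -
            C.Φ ((Inv.inv ⁻¹' ⋃ n, B n).indicator 1) u‖ ^ 2 =
            (C.μ u).real (Inv.inv ⁻¹' ⋃ n, B n) - ∑ n ∈ s, (C.μ u).real (Inv.inv ⁻¹' B n) := by
          intro s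
          have h1 : MeasurableSet (⋃ n ∈ s, Inv.inv ⁻¹' B n) :=
            Finset.measurableSet_biUnion _ fun i _ => hm (hB i)
          have hsub : (⋃ n ∈ s, Inv.inv ⁻¹' B n) ⊆ Inv.inv ⁻¹' ⋃ n, B n := by
            rw [Set.preimage_iUnion]
            exact Set.iUnion₂_subset fun i _ => Set.subset_iUnion (fun n => Inv.inv ⁻¹' B n) i
          have h2 : C.Admissible ((-1 : ℝ) • (Inv.inv ⁻¹' ⋃ n, B n).indicator 1) :=
            (hadm hU).smul _
          rw [← sum_apply, hsum, ← sub_apply]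
          have h3 : C.Φ ((⋃ n ∈ s, Inv.inv ⁻¹' B n).indicator 1) -
              C.Φ ((Inv.inv ⁻¹' ⋃ n, B n).indicator 1) =
              C.Φ ((⋃ n ∈ s, Inv.inv ⁻¹' B n).indicator 1 +
                (-1 : ℝ) • (Inv.inv ⁻¹' ⋃ n, B n).indicator 1) := by
            rw [BorelCalculus.Admissible.map_add (.indicator h1) h2, (hadm hU).map_smul]
            simp [sub_eq_add_neg]
          rw [h3, (BorelCalculus.Admissible.add (.indicator h1) h2).norm_sq,
            ← measureReal_biUnion_finset (fun i _ j _ hij => hd' hij) (fun i _ => hm (hB i)),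
            ← integral_indicator_one h1, ← integral_indicator_one (hm hU), ← integral_sub]
          · refine integral_congr_ae (Eventually.of_forall fun r => ?_)
            by_cases hr : r ∈ ⋃ n ∈ s, Inv.inv ⁻¹' B n
            · simp only [Pi.add_apply, Pi.smul_apply, Set.indicator_of_mem hr,
                Set.indicator_of_mem (hsub hr)]
              norm_num
            · by_cases hr' : r ∈ Inv.inv ⁻¹' ⋃ n, B n
              · simp only [Pi.add_apply, Pi.smul_apply, Set.indicator_of_notMem hr,
                  Set.indicator_of_mem hr']
                norm_num
              · simp only [Pi.add_apply, Pi.smul_apply, Set.indicator_of_notMem hr,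
                  Set.indicator_of_notMem hr']
                norm_num
          · exact (hadm hU).integrable u
          · exact BorelCalculus.Admissible.integrable (.indicator h1) u
        rw [HasSum, tendsto_iff_norm_sub_tendsto_zero]
        have h1 : HasSum (fun n => (C.μ u).real (Inv.inv ⁻¹' B n))
            ((C.μ u).real (Inv.inv ⁻¹' ⋃ n, B n)) := by
          rw [Set.preimage_iUnion]
          have h2 := measure_iUnion (μ := C.μ u) hd' (fun n => hm (hB n))
          have h3 : ∑' n, C.μ u (Inv.inv ⁻¹' B n) ≠ ∞ := h2 ▸ measure_ne_top _ _
          rw [measureReal_def, h2, ENNReal.tsum_toReal_eq fun n => measure_ne_top _ _]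
          exact ENNReal.hasSum_toReal h3
        have h2 := (h1.const_sub ((C.μ u).real (Inv.inv ⁻¹' ⋃ n, B n))).sqrt
        rw [sub_self, Real.sqrt_zero] at h2
        refine h2.congr fun s => ?_
        rw [← hdiff s, Real.sqrt_sq (norm_nonneg _)] }
  have hPm : ∀ u, P.measure u = (C.μ u).map Inv.inv := by
    intro u
    ext B hB
    rw [P.measure_apply u hB, Measure.map_apply measurable_inv hB]
    change ENNReal.ofReal (inner ℂ u (C.Φ ((Inv.inv ⁻¹' B).indicator 1) u)).re = _
    rw [hquad hB, Complex.ofReal_re, measureReal_def, ENNReal.ofReal_toReal (measure_ne_top _ _)]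
  -- This density turns the domain condition into integrability of r⁻²: for u = Tx the integrand
  -- becomes r⁻² r² ≤ 1.
  have hdens : ∀ x, C.μ (T x) = (C.μ x).withDensity fun r => ((Real.toNNReal (r ^ 2)) : ℝ≥0∞) := by
    intro x
    ext B hB
    have h0 : C.Admissible (B.indicator 1) := .indicator hB
    have h1 : C.Admissible (_root_.id * (B.indicator 1 * _root_.id)) :=
      BorelCalculus.admissible_id.mul (h0.mul BorelCalculus.admissible_id)
    have h2 := h1.hasQuadraticForm x
    rw [BorelCalculus.admissible_id.map_mul (h0.mul BorelCalculus.admissible_id),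
      h0.map_mul BorelCalculus.admissible_id, C.id, mul_apply_eq_comp, mul_apply_eq_comp,
      ← hTs.inner_clm_left, h0.hasQuadraticForm (T x), integral_indicator_one hB] at h2
    have h3 := Complex.ofReal_injective h2
    rw [withDensity_apply _ hB, ← ENNReal.ofReal_toReal (measure_ne_top (C.μ (T x)) B),
      ← measureReal_def, h3, ofReal_integral_eq_lintegral_ofReal (h1.integrable x)]
    · rw [← lintegral_indicator hB]
      refine lintegral_congr fun r => ?_
      by_cases hr : r ∈ B
      · simp only [Pi.mul_apply, Set.indicator_of_mem hr, Pi.one_apply, one_mul, id, sq]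
        rfl
      · simp [Set.indicator_of_notMem hr]
    · refine Eventually.of_forall fun r => ?_
      by_cases hr : r ∈ B
      · simpa [hr] using mul_self_nonneg r
      · simp [hr]
  refine ⟨P, fun u => ?_, fun u => ?_⟩
  · rw [hPm, integrable_map_measure (by fun_prop) (by fun_prop)]
    constructor
    · intro hu
      have h1 := hT.2 ⟨u, hu⟩
      simp only [Complex.ofReal_zero, zero_smul, sub_zero] at h1
      rw [← h1, hdens]
      refine ⟨Measurable.aestronglyMeasurable (by fun_prop), ?_⟩
      rw [HasFiniteIntegral, lintegral_withDensity_eq_lintegral_mul _ (by fun_prop) (by fun_prop)]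
      refine lt_of_le_of_lt (lintegral_mono (g := fun _ => 1) fun r => ?_) (by simp)
      simp only [Function.comp, Pi.mul_apply]
      rw [Real.enorm_eq_ofReal (sq_nonneg _)]
      change ENNReal.ofReal (r ^ 2) * _ ≤ 1
      rw [← ENNReal.ofReal_mul (sq_nonneg _), ← mul_pow]
      refine ENNReal.ofReal_le_one.mpr ?_
      rcases eq_or_ne r 0 with h | h
      · simp [h]
      · simp [mul_inv_cancel₀ h]
    · intro hint
      -- Converse inclusion: u is placed in D(A*) = D(A) through |(u|y)| ≤ √K ‖Ty‖. The cutoff |r| >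
      -- 1/(n+1) makes r⁻¹ bounded, so that f_n(T) T is a spectral projection, tending weakly to 1.
      let I : ℕ → Set ℝ := fun n => {r | 1 / ((n : ℝ) + 1) < |r|}
      have hI : ∀ n, MeasurableSet (I n) := fun n => measurableSet_lt measurable_const measurable_norm
      let f : ℕ → ℝ → ℝ := fun n => (I n).indicator fun r => r⁻¹
      have hf : ∀ n, C.Admissible (f n) := fun n =>
        .of_bounded (measurable_inv.indicator (hI n)) (M := (n : ℝ) + 1) fun r => by
          by_cases hr : r ∈ I n
          · simp only [f, Set.indicator_of_mem hr, abs_inv]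
            have h1 : 1 / ((n : ℝ) + 1) < |r| := hr
            rw [inv_le_comm₀ (lt_trans (by positivity) h1) (by positivity)]
            simpa using h1.le
          · simp only [f, Set.indicator_of_notMem hr, abs_zero]
            positivity
      set K := ∫ r, (r⁻¹) ^ 2 ∂(C.μ u) with hK
      have hnorm : ∀ n, ‖C.Φ (f n) u‖ ≤ Real.sqrt K := by
        intro n
        refine Real.le_sqrt_of_sq_le ?_
        rw [(hf n).norm_sq]
        refine integral_mono_of_nonneg (Eventually.of_forall fun r => sq_nonneg _) hint
          (Eventually.of_forall fun r => ?_)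
        by_cases hr : r ∈ I n
        · simp [f, Set.indicator_of_mem hr]
        · simpa [f, Set.indicator_of_notMem hr] using sq_nonneg (r⁻¹)
      have hbound : ∀ y, ‖inner ℂ u y‖ ≤ Real.sqrt K * ‖T y‖ := by
        intro y
        have h1 : ∀ n, inner ℂ (C.Φ (f n) u) (T y) = inner ℂ u (C.Φ ((I n).indicator 1) y) := by
          intro n
          rw [(hf n).isSelfAdjoint.inner_clm_left, ← mul_apply_eq_comp]
          have h2 : C.Φ (f n) * T = C.Φ (f n * _root_.id) := by
            rw [(hf n).map_mul BorelCalculus.admissible_id, C.id]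
          have h3 : f n * _root_.id = (I n).indicator 1 := by
            ext r
            by_cases hr : r ∈ I n
            · have h0 : r ≠ 0 := by
                rintro rfl
                have h1 : 1 / ((n : ℝ) + 1) < |(0 : ℝ)| := hr
                rw [abs_zero] at h1
                exact absurd h1 (not_lt.mpr (by positivity))
              simp [f, Set.indicator_of_mem hr, inv_mul_cancel₀ h0]
            · simp [f, Set.indicator_of_notMem hr]
          rw [h2, h3]
        have hae : HasQuadraticForm C.μ ((Set.indicator {0}ᶜ) (1 : ℝ → ℝ)) 1 := by
          intro w
          have h2 : C.Admissible 1 := .of_bounded measurable_one (M := 1) (by simp)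
          rw [← C.one, h2.hasQuadraticForm w]
          congr 1
          refine integral_congr_ae ?_
          filter_upwards [BorelCalculus.ae_ne_zero (C := C) (fun x => hT.injective) w] with r hr
          simp [hr]
        have h2 : Tendsto (fun n => inner ℂ u (C.Φ ((I n).indicator 1) y)) atTop
            (𝓝 (inner ℂ u ((1 : E →L[ℂ] E) y))) := by
          refine HasQuadraticForm.tendsto_inner (M := 1)
            (fun n => measurable_one.indicator (hI n)) (fun n r => ?_) (fun r => ?_)
            (fun n => BorelCalculus.Admissible.hasQuadraticForm (.indicator (hI n))) hae u y
          · by_cases hr : r ∈ I n <;> simp [hr]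
          · rcases eq_or_ne r 0 with h0 | h0
            · have h3 : ∀ n, r ∉ I n := fun n hr => by
                have h1 : 1 / ((n : ℝ) + 1) < |r| := hr
                rw [h0, abs_zero] at h1
                exact absurd h1 (not_lt.mpr (by positivity))
              simp [h0 ▸ h3, h0]
            · refine tendsto_const_nhds.congr' ?_
              have h3 := (tendsto_one_div_add_atTop_nhds_zero_nat (𝕜 := ℝ)).eventually_lt_const
                (abs_pos.mpr h0)
              filter_upwards [h3] with n hn
              have : r ∈ I n := hn
              simp [h0, this]
        refine le_of_tendsto h2.norm (Eventually.of_forall fun n => ?_)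
        rw [← h1 n]
        exact (norm_inner_le_norm _ _).trans (mul_le_mul_of_nonneg_right (hnorm n) (norm_nonneg _))
      have h1 : u ∈ A.adjoint.domain := by
        rw [LinearPMap.mem_adjoint_domain_iff]
        refine AddMonoidHomClass.continuous_of_bound ((innerₛₗ ℂ u).comp A.toFun) (Real.sqrt K)
          fun x => ?_
        have h2 := hbound (A x)
        have h3 := hT.2 x
        simp only [Complex.ofReal_zero, zero_smul, sub_zero] at h3
        rw [h3] at h2
        exact h2
      rwa [LinearPMap.isSelfAdjoint_def.mp hA] at h1
  · have h1 := hT.2 u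
    simp only [Complex.ofReal_zero, zero_smul, sub_zero] at h1
    rw [hPm, integral_map (by fun_prop) (by fun_prop)]
    have h2 : inner ℂ (u : E) (A u) = ((∫ r, _root_.id r ∂(C.μ (A u)) : ℝ) : ℂ) := by
      rw [← BorelCalculus.admissible_id.hasQuadraticForm (A u), C.id, ← hTs.inner_clm_left, h1]
    have h3 : C.μ (u : E) = C.μ (T (A u)) := by rw [h1]
    rw [h2, h3, hdens, integral_withDensity_eq_integral_smul (by fun_prop), ← integral_complex_ofReal]
    refine integral_congr_ae (Eventually.of_forall fun r => ?_)
    simp only [id, NNReal.smul_def, Real.coe_toNNReal _ (sq_nonneg r)]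
    rcases eq_or_ne r 0 with h | h
    · simp [h]
    · have : (r : ℂ) ≠ 0 := by exact_mod_cast h
      rw [Complex.real_smul]
      push_cast
      field_simp

open Classical in
/-- Splitting of `(h|v)` by a spectral cutoff of `X`. -/
lemma norm_inner_le_functionOf {X : E →ₗ.[ℂ] E} (hX : IsSelfAdjoint X)
    (hX1 : FormBoundedBelow X 1) {j : ℝ → ℝ} (hj : Measurable j) (hj0 : ∀ r, 0 ≤ j r)
    (hj1 : ∀ r, j r ≤ 1) {ε t : ℝ} (ht : 0 < t) (hjε : ∀ r, ε < r → j r = 1) (h v : E) :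
    ‖inner ℂ h v‖ ≤
      ‖functionOf X (fun r => (Set.Icc (0 : ℝ) ε).indicator 1 (r / |t|)) h‖ * ‖v‖ +
        ‖h‖ * ‖functionOf X (fun r => (j (r / t) : ℂ)) v‖ := by
  obtain ⟨T, hT⟩ := exists_isResolventAt_of_formBoundedBelow hX hX1 zero_lt_one
  have hex := exists_isResolutionOf hX hT
  -- Both functions of `X` unfold to the same chosen resolution, so uniqueness of the resolution is
  -- not needed.
  simp only [functionOf, dif_pos hex]
  have hP := hex.choose_spec
  generalize hex.choose = P at hP
  set B : Set ℝ := {r | r / |t| ∈ Set.Icc (0 : ℝ) ε} with hB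
  have hBm : MeasurableSet B := (measurable_id.div_const _) measurableSet_Icc
  have h1 : P.integral (fun r => (Set.Icc (0 : ℝ) ε).indicator 1 (r / |t|)) = P.proj B := by
    rw [← P.integral_eq (P.hasQuadraticForm_indicator hBm)]
    congr 1
    ext r
    by_cases hr : r / |t| ∈ Set.Icc (0 : ℝ) ε
    · have : r ∈ B := hr
      simp [hr, this]
    · have : r ∉ B := hr
      simp only [Set.indicator_of_notMem hr, Set.indicator_of_notMem this]
      simp
  have hjm : Measurable fun r => j (r / t) := hj.comp (measurable_id.div_const _)
  have hjb : ∀ r, |j (r / t)| ≤ 1 := fun r => by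
    rw [abs_of_nonneg (hj0 _)]; exact hj1 _
  obtain ⟨L, hL⟩ := P.exists_hasQuadraticForm hjm ⟨1, hjb⟩
  rw [h1, P.integral_eq hL]
  set y := P.proj Bᶜ h with hy
  have hsplit : h = P.proj B h + y := by
    have := P.hasQuadraticForm_indicator hBm
    have h2 : P.proj B + P.proj Bᶜ = 1 := by
      refine ext_of_inner_self fun u => ?_
      rw [add_apply, inner_add_right, P.inner_proj u hBm, P.inner_proj u hBm.compl,
        ← P.univ, P.inner_proj u MeasurableSet.univ, ← Complex.ofReal_add,
        measureReal_add_measureReal_compl hBm]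
    rw [hy, ← add_apply, h2]; rfl
  -- The vector `y` lives where X/t > ε, because X ≥ 0; there j = 1 and (y|Ly) = ‖y‖². Together with
  -- ‖L‖ ≤ 1 this forces Ly = y.
  have hLy : L y = y := by
    have h2 : inner ℂ y (L y) = ((‖y‖ ^ 2 : ℝ) : ℂ) := by
      rw [hL y, ← P.real_univ y]
      congr 1
      have h3 : ∫ r, j (r / t) ∂(P.measure y) = ∫ r, (1 : ℝ) ∂(P.measure y) := by
        refine integral_congr_ae ?_
        filter_upwards [P.ae_mem_of_proj hBm.compl h, hP.ae_nonneg hX1 y] with r hr hr0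
        refine hjε _ ?_
        by_contra hneg
        push Not at hneg
        refine hr ?_
        change r / |t| ∈ Set.Icc (0 : ℝ) ε
        rw [abs_of_pos ht]
        exact ⟨div_nonneg hr0 ht.le, hneg⟩
      rw [h3]; simp
    have h4 : ‖L y‖ ≤ ‖y‖ := by
      have := L.le_of_opNorm_le (hL.norm_le (fun u => (P.real_univ u).le) hjb) y
      simpa using this
    have h5 : ‖L y - y‖ ^ 2 ≤ 0 := by
      rw [@norm_sub_sq ℂ, hL.isSelfAdjoint.inner_clm_left, h2]
      change ‖L y‖ ^ 2 - 2 * ((‖y‖ ^ 2 : ℝ) : ℂ).re + ‖y‖ ^ 2 ≤ 0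
      rw [Complex.ofReal_re]
      nlinarith [norm_nonneg (L y)]
    have h6 : ‖L y - y‖ = 0 := by nlinarith [norm_nonneg (L y - y)]
    exact sub_eq_zero.mp (norm_eq_zero.mp h6)
  have hyn : ‖y‖ ≤ ‖h‖ := by
    have h2 := P.isStarProjection Bᶜ hBm.compl
    have h3 : ‖y‖ ^ 2 = (inner ℂ h y).re := by
      have h4 : inner ℂ y y = inner ℂ h y := by
        conv_lhs => rw [hy, h2.isSelfAdjoint.inner_clm_left, P.proj_proj _ _ hBm.compl hBm.compl,
          Set.inter_self]
      rw [← h4]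
      exact norm_sq_eq_re_inner (𝕜 := ℂ) y
    have h5 : (inner ℂ h y).re ≤ ‖h‖ * ‖y‖ := (Complex.re_le_norm _).trans (norm_inner_le_norm _ _)
    by_contra hneg
    push Not at hneg
    nlinarith [norm_nonneg h]
  have h7 : inner ℂ h v = inner ℂ (P.proj B h) v + inner ℂ y (L v) := by
    conv_lhs => rw [hsplit]
    rw [inner_add_left, ← hL.isSelfAdjoint.inner_clm_left, hLy]
  rw [h7]
  refine (norm_add_le _ _).trans (add_le_add (norm_inner_le_norm _ _) ?_)
  exact (norm_inner_le_norm _ _).trans (mul_le_mul_of_nonneg_right hyn (norm_nonneg _))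

end FunctionalCalculus

/-! ### Fock space in coordinates -/

section FockCoordinates

variable {ι : Type*}

lemma lp_enorm_sq {α : Type*} {G : α → Type*} [∀ i, NormedAddCommGroup (G i)] (f : lp G 2) :
    ‖f‖ₑ ^ 2 = ∑' i, ‖f i‖ₑ ^ 2 := by
  have h := lp.hasSum_norm (p := 2) (by norm_num) f
  simp only [ENNReal.toReal_ofNat, Real.rpow_ofNat] at h
  have h1 : ∀ x : ℝ, 0 ≤ x → ENNReal.ofReal x ^ 2 = ENNReal.ofReal (x ^ 2) := fun x hx =>
    (ENNReal.ofReal_pow hx 2).symm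
  simp only [← ofReal_norm, h1 _ (norm_nonneg _)]
  rw [← h.tsum_eq, ENNReal.ofReal_tsum_of_nonneg (fun _ => sq_nonneg _) h.summable]

lemma memlp_two_of_tsum {α : Type*} {G : α → Type*} [∀ i, NormedAddCommGroup (G i)]
    {f : ∀ i, G i} (h : ∑' i, ‖f i‖ₑ ^ 2 ≠ ∞) : Memℓp f 2 := by
  rw [memℓp_gen_iff (by norm_num)]
  have h1 := ENNReal.summable_toReal h
  refine h1.congr fun i => ?_
  simp

lemma fock_ext {u v : Fock ι} (h : ∀ l, fockCoord u l = fockCoord v l) : u = v :=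
  Subtype.ext (lp.ext (funext h))

lemma fockCoord_perm (u : Fock ι) {l l' : List ι} (h : l.Perm l') :
    fockCoord u l = fockCoord u l' := u.2 l l' h

@[simp] lemma fockCoord_zero (l : List ι) : fockCoord (0 : Fock ι) l = 0 := by simp [fockCoord]

@[simp] lemma fockCoord_add (u v : Fock ι) (l : List ι) :
    fockCoord (u + v) l = fockCoord u l + fockCoord v l := by simp [fockCoord]

@[simp] lemma fockCoord_sub (u v : Fock ι) (l : List ι) :
    fockCoord (u - v) l = fockCoord u l - fockCoord v l := by simp [fockCoord]

@[simp] lemma fockCoord_smul (c : ℂ) (u : Fock ι) (l : List ι) :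
    fockCoord (c • u) l = c * fockCoord u l := by simp [fockCoord]

lemma fock_hasSum_inner (u v : Fock ι) :
    HasSum (fun l => starRingEnd ℂ (fockCoord u l) * fockCoord v l) (inner ℂ u v) := by
  have h := lp.hasSum_inner (𝕜 := ℂ) (u : FullFock ι) (v : FullFock ι)
  refine h.congr_fun fun l => ?_
  simp only [fockCoord, RCLike.inner_apply]
  exact mul_comm _ _

lemma fock_enorm_sq (u : Fock ι) : ‖u‖ₑ ^ 2 = ∑' l, ‖fockCoord u l‖ₑ ^ 2 :=
  lp_enorm_sq (u : FullFock ι)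

lemma norm_le_of_enorm_sq_le {E F : Type*} [NormedAddCommGroup E] [NormedAddCommGroup F] {x : E}
    {y : F} {M : ℝ} (hM : 0 ≤ M) (h : ‖x‖ₑ ^ 2 ≤ ENNReal.ofReal M ^ 2 * ‖y‖ₑ ^ 2) :
    ‖x‖ ≤ M * ‖y‖ := by
  rw [← mul_pow, ← ofReal_norm, ← ofReal_norm, ← ENNReal.ofReal_mul hM] at h
  have h1 := (ENNReal.pow_le_pow_left_iff two_ne_zero).mp h
  exact (ENNReal.ofReal_le_ofReal_iff (by positivity)).mp h1

lemma enorm_sq_le_of_norm_le {E F : Type*} [NormedAddCommGroup E] [NormedAddCommGroup F] {x : E}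
    {y : F} {M : ℝ} (hM : 0 ≤ M) (h : ‖x‖ ≤ M * ‖y‖) :
    ‖x‖ₑ ^ 2 ≤ ENNReal.ofReal M ^ 2 * ‖y‖ₑ ^ 2 := by
  rw [← mul_pow, ← ofReal_norm, ← ofReal_norm, ← ENNReal.ofReal_mul hM]
  gcongr

/-- The vector with given symmetric square summable coordinates. -/
def Fock.mk (F : List ι → ℂ) (hF : ∑' l, ‖F l‖ₑ ^ 2 ≠ ∞)
    (hs : ∀ l l' : List ι, l.Perm l' → F l = F l') : Fock ι :=
  ⟨⟨F, memlp_two_of_tsum hF⟩, hs⟩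

@[simp] lemma fockCoord_mk (F : List ι → ℂ) (hF) (hs) (l : List ι) :
    fockCoord (Fock.mk F hF hs) l = F l := rfl

/-- A bounded operator with values in the Fock space, given by its coordinates. -/
noncomputable def clmOfCoord {E : Type*} [NormedAddCommGroup E] [NormedSpace ℂ E]
    (G : E →ₗ[ℂ] List ι → ℂ) (hs : ∀ u l l', l.Perm l' → G u l = G u l') {M : ℝ} (hM : 0 ≤ M)
    (hb : ∀ u, ∑' l, ‖G u l‖ₑ ^ 2 ≤ ENNReal.ofReal M ^ 2 * ‖u‖ₑ ^ 2) : E →L[ℂ] Fock ι :=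
  LinearMap.mkContinuous
    { toFun := fun u => Fock.mk (G u) (ne_top_of_le_ne_top (by finiteness) (hb u)) (hs u)
      map_add' := fun u v => fock_ext fun l => by simp
      map_smul' := fun c u => fock_ext fun l => by simp } M
    (fun u => norm_le_of_enorm_sq_le hM (by rw [fock_enorm_sq]; exact hb u))

section
variable {E : Type*} [NormedAddCommGroup E] [NormedSpace ℂ E]
    {G : E →ₗ[ℂ] List ι → ℂ} {hs : ∀ u l l', l.Perm l' → G u l = G u l'} {M : ℝ} {hM : 0 ≤ M}
    {hb : ∀ u, ∑' l, ‖G u l‖ₑ ^ 2 ≤ ENNReal.ofReal M ^ 2 * ‖u‖ₑ ^ 2}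

lemma norm_clmOfCoord_le : ‖clmOfCoord G hs hM hb‖ ≤ M := LinearMap.mkContinuous_norm_le _ hM _
end

/-- The function `θ(N)` of the number operator, for bounded `θ`. -/
noncomputable def numberMul (θ : ℕ → ℂ) {M : ℝ} (hθ : ∀ n, ‖θ n‖ ≤ M) : Fock ι →L[ℂ] Fock ι :=
  clmOfCoord (M := M)
    { toFun := fun u l => θ l.length * fockCoord u l
      map_add' := fun u v => by ext l; simp [mul_add]
      map_smul' := fun c u => by ext l; simp; ring }
    (fun u l l' h => by simp [h.length_eq, fockCoord_perm u h])
    ((norm_nonneg _).trans (hθ 0)) (fun u => by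
      rw [fock_enorm_sq, ← ENNReal.tsum_mul_left]
      refine ENNReal.tsum_le_tsum fun l => ?_
      simp only [LinearMap.coe_mk, AddHom.coe_mk, enorm_mul, mul_pow]
      gcongr
      rw [← ofReal_norm]
      exact ENNReal.ofReal_le_ofReal (hθ _))

@[simp] lemma fockCoord_numberMul (θ : ℕ → ℂ) {M : ℝ} (hθ : ∀ n, ‖θ n‖ ≤ M) (u : Fock ι)
    (l : List ι) : fockCoord (numberMul θ hθ u) l = θ l.length * fockCoord u l := rfl

open Classical in
@[simp] lemma fockCoord_numberProj (s : Set ℕ) (u : Fock ι) (l : List ι) :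
    fockCoord (numberProj s u) l = if l.length ∈ s then fockCoord u l else 0 := rfl

@[simp] lemma fockCoord_contractTail (c : List ι) (u : Fock ι) (l : List ι) :
    fockCoord (contractTail c u) l = fockCoord u (l ++ c) := rfl

lemma tsum_cons {f : List ι → ℝ≥0∞} (h : f [] = 0) :
    ∑' l, f l = ∑' (l : List ι) (k : ι), f (k :: l) := by
  have hinj : Function.Injective fun p : List ι × ι => p.2 :: p.1 := fun p q h => by
    simp only [List.cons.injEq] at h
    exact Prod.ext h.2 h.1
  rw [← ENNReal.tsum_prod, ← hinj.tsum_eq (f := f)]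
  intro l hl
  cases l with
  | nil => exact absurd h hl
  | cons k l => exact ⟨(l, k), rfl⟩

lemma tsum_cons_le (f : List ι → ℝ≥0∞) : ∑' (l : List ι) (k : ι), f (k :: l) ≤ ∑' l, f l := by
  have hinj : Function.Injective fun p : List ι × ι => p.2 :: p.1 := fun p q h => by
    simp only [List.cons.injEq] at h
    exact Prod.ext h.2 h.1
  rw [← ENNReal.tsum_prod]
  exact ENNReal.tsum_comp_le_tsum_of_injective hinj f

lemma insertIdx_eraseIdx_getElem {i : ℕ} : ∀ {l : List ι} (hi : i < l.length),
    (l.eraseIdx i).insertIdx i l[i] = l := by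
  induction i with
  | zero => intro l hi; cases l with
    | nil => simp at hi
    | cons a l => simp
  | succ i ih => intro l hi; cases l with
    | nil => simp at hi
    | cons a l => simpa using ih (l := l) (by simpa using hi)

/-- Pairs of a list with a distinguished position, and pairs of a letter and a list with a position
at which the letter is to be inserted. -/
def eraseInsertEquiv (ι : Type*) :
    (Σ l : List ι, Fin l.length) ≃ Σ p : ι × List ι, Fin (p.2.length + 1) where
  toFun x := ⟨(x.1.get x.2, x.1.eraseIdx x.2), ⟨x.2, by
    rw [List.length_eraseIdx_of_lt x.2.2]
    have := x.2.2
    omega⟩⟩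
  invFun y := ⟨y.1.2.insertIdx y.2 y.1.1, ⟨y.2, by
    have h := Nat.lt_succ_iff.mp y.2.2
    rw [List.length_insertIdx_of_le_length h]
    omega⟩⟩
  left_inv x := by
    obtain ⟨l, i, hi⟩ := x
    have h : (l.eraseIdx i).insertIdx i l[i] = l := by
      exact insertIdx_eraseIdx_getElem hi
    refine Sigma.ext h ?_
    refine (Fin.heq_ext_iff (congrArg List.length h)).mpr rfl
  right_inv y := by
    obtain ⟨⟨k, l⟩, i, hi⟩ := y
    have h1 : (l.insertIdx i k).eraseIdx i = l := List.eraseIdx_insertIdx_self k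
    refine Sigma.ext (Prod.ext ?_ h1) ?_
    · simp
    · refine (Fin.heq_ext_iff ?_).mpr rfl
      simp [h1]

/-- Removing a marked letter is inverse to inserting it, and a letter can be inserted into l at
`l.length + 1` positions: this is the weight on the right. -/
lemma tsum_sum_erase (f : ι → List ι → ℝ≥0∞) :
    ∑' l : List ι, ∑ i : Fin l.length, f (l.get i) (l.eraseIdx i) =
      ∑' (l : List ι) (k : ι), ((l.length : ℝ≥0∞) + 1) * f k l := by
  have h1 : ∑' l : List ι, ∑ i : Fin l.length, f (l.get i) (l.eraseIdx i) =
      ∑' x : Σ l : List ι, Fin l.length, f (x.1.get x.2) (x.1.eraseIdx x.2) := by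
    rw [ENNReal.tsum_sigma']
    exact tsum_congr fun l => (tsum_fintype _).symm
  rw [h1, ← ENNReal.tsum_comm, ← ENNReal.tsum_prod (f := fun k (l : List ι) =>
    ((l.length : ℝ≥0∞) + 1) * f k l)]
  have h2 : ∀ p : ι × List ι, ((p.2.length : ℝ≥0∞) + 1) * f p.1 p.2 =
      ∑' _ : Fin (p.2.length + 1), f p.1 p.2 := fun p => by
    rw [tsum_fintype]
    simp
  rw [tsum_congr h2, ← ENNReal.tsum_sigma' (β := fun p : ι × List ι => Fin (p.2.length + 1))
    (fun x => f x.1.1 x.1.2), ← (eraseInsertEquiv ι).tsum_eq]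
  rfl

lemma hasSum_sum_erase {f : ι → List ι → ℂ} {S : ℂ}
    (hf : Summable fun p : ι × List ι => ‖((p.2.length : ℂ) + 1) * f p.1 p.2‖)
    (hS : HasSum (fun p : ι × List ι => ((p.2.length : ℂ) + 1) * f p.1 p.2) S) :
    HasSum (fun l : List ι => ∑ i : Fin l.length, f (l.get i) (l.eraseIdx i)) S := by
  have h1 : Summable fun y : Σ p : ι × List ι, Fin (p.2.length + 1) => f y.1.1 y.1.2 := by
    refine Summable.of_norm ((summable_sigma_of_nonneg fun _ => norm_nonneg _).mpr
      ⟨fun p => (hasSum_fintype _).summable, hf.congr fun p => ?_⟩)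
    rw [tsum_fintype]
    have : ‖(p.2.length : ℂ) + 1‖ = (p.2.length : ℝ) + 1 := by
      rw [← Nat.cast_one, ← Nat.cast_add, Complex.norm_natCast]; simp
    simp [this]
  have h2 : HasSum (fun y : Σ p : ι × List ι, Fin (p.2.length + 1) => f y.1.1 y.1.2) S := by
    have h3 := h1.hasSum.sigma (fun p => hasSum_fintype _)
    have h4 : (fun p : ι × List ι => ∑ _ : Fin (p.2.length + 1), f p.1 p.2) =
        fun p => ((p.2.length : ℂ) + 1) * f p.1 p.2 := by
      ext p; simp
    rw [h4] at h3
    rw [hS.unique h3]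
    exact h1.hasSum
  have h3 := (eraseInsertEquiv ι).hasSum_iff.mpr h2
  exact h3.sigma fun _ => hasSum_fintype _

/-- By symmetry of `u`, deleting a position has the same effect as deleting the first occurrence of
its letter. The sum then depends only on the multiset of letters. -/
lemma sum_erase_perm (h : ι → ℂ) (u : Fock ι) {l l' : List ι} (hl : l.Perm l') :
    ∑ i : Fin l.length, h (l.get i) * fockCoord u (l.eraseIdx i) =
      ∑ i : Fin l'.length, h (l'.get i) * fockCoord u (l'.eraseIdx i) := by
  classical
  have h1 : ∀ l : List ι, ∑ i : Fin l.length, h (l.get i) * fockCoord u (l.eraseIdx i) =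
      (l.map fun k => h k * fockCoord u (l.erase k)).sum := by
    intro l
    have h2 : ∀ g : ι → ℂ, (l.map g).sum = ∑ i : Fin l.length, g (l.get i) := fun g => by
      conv_lhs => rw [← List.ofFn_get l, List.map_ofFn, List.sum_ofFn]
      rfl
    rw [h2]
    refine Finset.sum_congr rfl fun i _ => ?_
    congr 1
    refine fockCoord_perm u (List.Perm.cons_inv (a := l.get i) ?_)
    exact (List.getElem_cons_eraseIdx_perm i.2).trans (List.perm_cons_erase (List.get_mem l i))
  rw [h1, h1]
  have h2 : (fun k => h k * fockCoord u (l.erase k)) = fun k => h k * fockCoord u (l'.erase k) := by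
    ext k
    rw [fockCoord_perm u (hl.erase k)]
  rw [h2]
  exact (hl.map _).sum_eq

end FockCoordinates

/-! ### Regularized creation and annihilation operators -/

section CreationAnnihilation

variable {ι 𝔥 : Type*} [NormedAddCommGroup 𝔥] [InnerProductSpace ℂ 𝔥] (b : HilbertBasis ι ℂ 𝔥)

lemma HilbertBasis.hasSum_conj_repr_mul (x y : 𝔥) :
    HasSum (fun k => starRingEnd ℂ (b.repr x k) * b.repr y k) (inner ℂ x y) := by
  have h := lp.hasSum_inner (𝕜 := ℂ) (b.repr x) (b.repr y)
  rw [b.repr.inner_map_map] at h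
  refine h.congr_fun fun k => ?_
  simp only [RCLike.inner_apply]
  exact mul_comm _ _

lemma HilbertBasis.enorm_sq (x : 𝔥) : ‖x‖ₑ ^ 2 = ∑' k, ‖b.repr x k‖ₑ ^ 2 := by
  rw [← lp_enorm_sq (b.repr x), ← ofReal_norm, ← ofReal_norm, b.repr.norm_map]

lemma HilbertBasis.repr_ext {x y : 𝔥} (h : ∀ k, b.repr x k = b.repr y k) : x = y :=
  b.repr.injective (lp.ext (funext h))

lemma repr_legVector (i : ℕ) (r : List ι) (h : i ≤ r.length) (u : Fock ι) (k : ι) :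
    b.repr (legVector b i r h u) k = fockCoord u (r.insertIdx i k) := by
  simp [legVector]

@[simp] lemma repr_legVector_zero (r : List ι) (h : 0 ≤ r.length) (u : Fock ι) (k : ι) :
    b.repr (legVector b 0 r h u) k = fockCoord u (k :: r) := by
  rw [repr_legVector, List.insertIdx_zero]

/-- The map `u ↦ legVector b 0 r u` as a bounded operator. -/
noncomputable def legCLM (r : List ι) : Fock ι →L[ℂ] 𝔥 :=
  LinearMap.mkContinuous
    { toFun := fun u => legVector b 0 r (Nat.zero_le _) u
      map_add' := fun u v => b.repr_ext fun k => by simp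
      map_smul' := fun c u => b.repr_ext fun k => by simp } 1
    (fun u => norm_le_of_enorm_sq_le zero_le_one (by
      simp only [LinearMap.coe_mk, AddHom.coe_mk, ENNReal.ofReal_one, one_pow, one_mul]
      rw [b.enorm_sq, fock_enorm_sq]
      simp only [repr_legVector_zero]
      exact ENNReal.tsum_comp_le_tsum_of_injective (f := fun k => k :: r)
        (fun k k' h => by simpa using h) (fun l => ‖fockCoord u l‖ₑ ^ 2)))

@[simp] lemma legCLM_apply (r : List ι) (u : Fock ι) :
    legCLM b r u = legVector b 0 r (Nat.zero_le _) u := rfl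

lemma tsum_enorm_legCLM_le (u : Fock ι) : ∑' r, ‖legCLM b r u‖ₑ ^ 2 ≤ ‖u‖ₑ ^ 2 := by
  rw [fock_enorm_sq]
  refine le_trans (le_of_eq (tsum_congr fun r => ?_)) (tsum_cons_le _)
  rw [b.enorm_sq]
  simp

/-- The bounded operator `u ↦ ϑ(N) ((h| ⊗ 1) u`. -/
noncomputable def annihilate (ϑ : ℕ → ℂ) {M : ℝ} (hϑ : ∀ n, ‖ϑ n‖ ≤ M) (h : 𝔥) :
    Fock ι →L[ℂ] Fock ι :=
  clmOfCoord (M := M * ‖h‖)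
    { toFun := fun u l => ϑ l.length * inner ℂ h (legCLM b l u)
      map_add' := fun u v => by ext l; simp only [map_add, inner_add_right, mul_add]; rfl
      map_smul' := fun c u => by
        ext l
        simp only [map_smul, inner_smul_right, RingHom.id_apply, Pi.smul_apply, smul_eq_mul]
        ring }
    (fun u l l' hl => by
      simp only [LinearMap.coe_mk, AddHom.coe_mk, hl.length_eq]
      congr 2
      exact b.repr_ext fun k => by simpa using fockCoord_perm u (hl.cons k))
    (mul_nonneg ((norm_nonneg _).trans (hϑ 0)) (norm_nonneg _)) (fun u => by
      have hM : 0 ≤ M := (norm_nonneg _).trans (hϑ 0)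
      calc _ ≤ ∑' l, ENNReal.ofReal (M * ‖h‖) ^ 2 * ‖legCLM b l u‖ₑ ^ 2 := by
            refine ENNReal.tsum_le_tsum fun l => ?_
            refine enorm_sq_le_of_norm_le (by positivity) ?_
            simp only [LinearMap.coe_mk, AddHom.coe_mk, norm_mul]
            rw [mul_assoc]
            exact mul_le_mul (hϑ _) (norm_inner_le_norm _ _) (norm_nonneg _) hM
        _ ≤ _ := by
            rw [ENNReal.tsum_mul_left]
            gcongr
            exact tsum_enorm_legCLM_le b u)

@[simp] lemma fockCoord_annihilate (ϑ : ℕ → ℂ) {M : ℝ} (hϑ : ∀ n, ‖ϑ n‖ ≤ M) (h : 𝔥) (u : Fock ι)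
    (l : List ι) : fockCoord (annihilate b ϑ hϑ h u) l = ϑ l.length * inner ℂ h (legCLM b l u) :=
  rfl

lemma norm_annihilate_le (ϑ : ℕ → ℂ) {M : ℝ} (hϑ : ∀ n, ‖ϑ n‖ ≤ M) (h : 𝔥) :
    ‖annihilate b ϑ hϑ h‖ ≤ M * ‖h‖ := norm_clmOfCoord_le

lemma length_eraseIdx_fin (l : List ι) (i : Fin l.length) :
    (l.eraseIdx i).length + 1 = l.length := by
  have h := i.2
  rw [List.length_eraseIdx_of_lt h]
  omega

/-- The bounded operator `u ↦ θ(N) N S(h ⊗ u)`. -/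
noncomputable def create (θ : ℕ → ℂ) {M : ℝ} (hθ : ∀ n : ℕ, n * ‖θ n‖ ≤ M) (h : 𝔥) :
    Fock ι →L[ℂ] Fock ι :=
  clmOfCoord (M := M * ‖h‖)
    { toFun := fun u l => θ l.length *
        ∑ i : Fin l.length, b.repr h (l.get i) * fockCoord u (l.eraseIdx i)
      map_add' := fun u v => by
        ext l
        simp only [fockCoord_add, mul_add, Finset.sum_add_distrib, Pi.add_apply]
      map_smul' := fun c u => by
        ext l
        simp only [fockCoord_smul, RingHom.id_apply, Pi.smul_apply, smul_eq_mul, Finset.mul_sum]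
        exact Finset.sum_congr rfl fun i _ => by ring }
    (fun u l l' hl => by
      simp only [LinearMap.coe_mk, AddHom.coe_mk, hl.length_eq]
      rw [sum_erase_perm _ u hl])
    (mul_nonneg (by simpa using hθ 0) (norm_nonneg _)) (fun u => by
      have hM : 0 ≤ M := by simpa using hθ 0
      -- Cauchy–Schwarz over the positions costs a factor n, and counting insertions costs another
      -- one. The square of the bound n‖θ n‖ ≤ M absorbs both.
      have h1 : ∀ l : List ι, ‖θ l.length *
          ∑ i : Fin l.length, b.repr h (l.get i) * fockCoord u (l.eraseIdx i)‖ₑ ^ 2 ≤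
          ∑ i : Fin l.length, ENNReal.ofReal ((((l.eraseIdx i).length + 1 : ℕ) : ℝ) *
            ‖θ ((l.eraseIdx i).length + 1)‖ ^ 2 *
              (‖b.repr h (l.get i)‖ ^ 2 * ‖fockCoord u (l.eraseIdx i)‖ ^ 2)) := by
        intro l
        rw [← ofReal_norm, ← ENNReal.ofReal_pow (norm_nonneg _),
          ← ENNReal.ofReal_sum_of_nonneg (fun i _ => by positivity)]
        refine ENNReal.ofReal_le_ofReal ?_
        simp only [length_eraseIdx_fin]
        rw [norm_mul, mul_pow, ← Finset.mul_sum, mul_comm (l.length : ℝ), mul_assoc]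
        refine mul_le_mul_of_nonneg_left ?_ (by positivity)
        have h2 := (norm_sum_le (Finset.univ : Finset (Fin l.length))
          fun i => b.repr h (l.get i) * fockCoord u (l.eraseIdx i))
        have h3 := sq_sum_le_card_mul_sum_sq (s := (Finset.univ : Finset (Fin l.length)))
          (f := fun i => ‖b.repr h (l.get i) * fockCoord u (l.eraseIdx i)‖)
        refine (pow_le_pow_left₀ (norm_nonneg _) h2 2).trans (h3.trans (le_of_eq ?_))
        simp [mul_pow]
      refine (ENNReal.tsum_le_tsum h1).trans ?_
      rw [tsum_sum_erase (fun k l => ENNReal.ofReal (((l.length + 1 : ℕ) : ℝ) *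
            ‖θ (l.length + 1)‖ ^ 2 * (‖b.repr h k‖ ^ 2 * ‖fockCoord u l‖ ^ 2)))]
      have h4 : ENNReal.ofReal (M * ‖h‖) ^ 2 * ‖u‖ₑ ^ 2 =
          ∑' (l : List ι) (k : ι), ENNReal.ofReal M ^ 2 *
            (‖fockCoord u l‖ₑ ^ 2 * ‖b.repr h k‖ₑ ^ 2) := by
        simp only [ENNReal.tsum_mul_left, ENNReal.tsum_mul_right]
        rw [← fock_enorm_sq, ← b.enorm_sq, ENNReal.ofReal_mul hM, ofReal_norm]
        ring
      rw [h4]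
      refine ENNReal.tsum_le_tsum fun l => ENNReal.tsum_le_tsum fun k => ?_
      have h5 : (l.length : ℝ≥0∞) + 1 = ENNReal.ofReal ((l.length + 1 : ℕ) : ℝ) := by
        rw [ENNReal.ofReal_natCast]; push_cast; rfl
      rw [h5, ← ENNReal.ofReal_mul (by positivity), ← ofReal_norm, ← ofReal_norm,
        ← ENNReal.ofReal_pow hM, ← ENNReal.ofReal_pow (norm_nonneg _),
        ← ENNReal.ofReal_pow (norm_nonneg _), ← ENNReal.ofReal_mul (by positivity),
        ← ENNReal.ofReal_mul (by positivity)]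
      refine ENNReal.ofReal_le_ofReal ?_
      have h6 := pow_le_pow_left₀ (by positivity) (hθ (l.length + 1)) 2
      calc _ = ((((l.length + 1 : ℕ) : ℝ) * ‖θ (l.length + 1)‖) ^ 2) *
            (‖fockCoord u l‖ ^ 2 * ‖b.repr h k‖ ^ 2) := by ring
        _ ≤ _ := mul_le_mul_of_nonneg_right h6 (by positivity))

@[simp] lemma fockCoord_create (θ : ℕ → ℂ) {M : ℝ} (hθ : ∀ n : ℕ, n * ‖θ n‖ ≤ M) (h : 𝔥)
    (u : Fock ι) (l : List ι) : fockCoord (create b θ hθ h u) l = θ l.length *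
      ∑ i : Fin l.length, b.repr h (l.get i) * fockCoord u (l.eraseIdx i) := rfl

lemma norm_create_le (θ : ℕ → ℂ) {M : ℝ} (hθ : ∀ n : ℕ, n * ‖θ n‖ ≤ M) (h : 𝔥) :
    ‖create b θ hθ h‖ ≤ M * ‖h‖ := norm_clmOfCoord_le

lemma summable_norm_sq_repr (h : 𝔥) : Summable fun k => ‖b.repr h k‖ ^ 2 := by
  have h1 := (lp.hasSum_norm (p := 2) (by norm_num) (b.repr h)).summable
  simpa using h1

lemma summable_norm_sq_fockCoord (u : Fock ι) : Summable fun l => ‖fockCoord u l‖ ^ 2 := by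
  have h1 := (lp.hasSum_norm (p := 2) (by norm_num) (u : FullFock ι)).summable
  simpa [fockCoord] using h1

lemma injective_cons_prod : Function.Injective fun p : ι × List ι => p.1 :: p.2 := fun p q h => by
  simp only [List.cons.injEq] at h
  exact Prod.ext h.1 h.2

lemma mul_le_sq_add_sq (x y : ℝ) : x * y ≤ x ^ 2 + y ^ 2 := by
  nlinarith [sq_nonneg (x - y), sq_nonneg x, sq_nonneg y]

set_option maxHeartbeats 800000 in
-- Both sides are the same absolutely convergent sum over a letter and a list. On the creation side
-- each pair occurs once per insertion position, which accounts for the factor n + 1 in `hc`.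
lemma inner_create_left (θ ϑ : ℕ → ℂ) {M M' : ℝ} (hθ : ∀ n : ℕ, n * ‖θ n‖ ≤ M)
    (hϑ : ∀ n, ‖ϑ n‖ ≤ M')
    (h : 𝔥) (hc : ∀ n : ℕ, starRingEnd ℂ (θ (n + 1)) * (n + 1) = ϑ n) (u v : Fock ι) :
    inner ℂ (create b θ hθ h u) v = inner ℂ u (annihilate b ϑ hϑ h v) := by
  set f : ι → List ι → ℂ := fun k l => starRingEnd ℂ (θ (l.length + 1)) *
    starRingEnd ℂ (b.repr h k * fockCoord u l) * fockCoord v (k :: l) with hf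
  have e1 : ∀ p : ι × List ι, ((p.2.length : ℂ) + 1) * f p.1 p.2 = ϑ p.2.length *
      (starRingEnd ℂ (b.repr h p.1 * fockCoord u p.2) * fockCoord v (p.1 :: p.2)) := fun p => by
    rw [← hc, hf]
    ring
  have s0 : Summable fun p : ι × List ι => ‖((p.2.length : ℂ) + 1) * f p.1 p.2‖ := by
    have t1 : Summable fun p : ι × List ι => ‖b.repr h p.1‖ ^ 2 * ‖fockCoord u p.2‖ ^ 2 :=
      (summable_norm_sq_repr b h).mul_of_nonneg (summable_norm_sq_fockCoord u)
        (fun _ => sq_nonneg _) (fun _ => sq_nonneg _)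
    have t2 : Summable fun p : ι × List ι => ‖fockCoord v (p.1 :: p.2)‖ ^ 2 :=
      (summable_norm_sq_fockCoord v).comp_injective injective_cons_prod
    refine Summable.of_nonneg_of_le (fun _ => norm_nonneg _) (fun p => ?_) ((t1.add t2).mul_left M')
    rw [e1, norm_mul]
    refine mul_le_mul (hϑ _) ?_ (norm_nonneg _) ((norm_nonneg _).trans (hϑ 0))
    rw [norm_mul, RCLike.norm_conj, norm_mul]
    rw [← mul_pow]
    exact mul_le_sq_add_sq _ _
  have s1 := s0.of_norm.hasSum
  have r1 := hasSum_sum_erase s0 s1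
  have l1 := fock_hasSum_inner (create b θ hθ h u) v
  have l2 : (fun l => starRingEnd ℂ (fockCoord (create b θ hθ h u) l) * fockCoord v l) =
      fun l : List ι => ∑ i : Fin l.length, f (l.get i) (l.eraseIdx i) := by
    ext l
    simp only [fockCoord_create, map_mul, map_sum, hf, Finset.mul_sum, Finset.sum_mul]
    refine Finset.sum_congr rfl fun i _ => ?_
    have hp : fockCoord v (l.get i :: l.eraseIdx i) = fockCoord v l :=
      fockCoord_perm v (List.getElem_cons_eraseIdx_perm i.2)
    rw [length_eraseIdx_fin, hp]
  rw [l2] at l1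
  rw [l1.unique r1]
  have s2 : HasSum (fun p : List ι × ι => ((p.1.length : ℂ) + 1) * f p.2 p.1)
      (∑' p : ι × List ι, ((p.2.length : ℂ) + 1) * f p.1 p.2) :=
    (Equiv.prodComm (List ι) ι).hasSum_iff.mpr s1
  have s3 := s2.prod_fiberwise (g := fun l => starRingEnd ℂ (fockCoord u l) *
      fockCoord (annihilate b ϑ hϑ h v) l) (fun l => by
    have := ((b.hasSum_conj_repr_mul h (legCLM b l v)).mul_left (ϑ l.length)).mul_left
      (starRingEnd ℂ (fockCoord u l))
    rw [← fockCoord_annihilate] at this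
    refine this.congr_fun fun k => ?_
    have := e1 (k, l)
    simp only at this
    rw [this]
    simp only [map_mul, legCLM_apply, repr_legVector_zero]
    ring)
  exact s3.unique (fock_hasSum_inner _ _)

end CreationAnnihilation

/-! ### Sums over lists graded by length -/

section ListSums

variable {ι : Type*}

open Classical in
lemma tsum_by_length (F : List ι → ℝ≥0∞) :
    ∑' l, F l = ∑' n : ℕ, ∑' l : List ι, if l.length = n then F l else 0 := by
  rw [ENNReal.tsum_comm]
  exact tsum_congr fun l => (tsum_ite_eq' l.length (fun _ => F l)).symm

lemma tsum_length_prod (f : ι → ℝ≥0∞) (n : ℕ) :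
    (∑' l : List ι, if l.length = n then (l.map f).prod else 0) = (∑' k, f k) ^ n := by
  induction n with
  | zero =>
    rw [tsum_eq_single []]
    · simp
    · intro l hl
      simp [hl]
  | succ n ih =>
    rw [tsum_cons (by simp)]
    simp only [List.length_cons, add_left_inj, List.map_cons, List.prod_cons]
    have : ∀ l : List ι, (∑' k, if l.length = n then f k * (l.map f).prod else 0) =
        (∑' k, f k) * if l.length = n then (l.map f).prod else 0 := fun l => by
      split_ifs
      · rw [ENNReal.tsum_mul_right]
      · simp
    rw [tsum_congr this, ENNReal.tsum_mul_left, ih, pow_succ']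

lemma hasSum_by_length {G : List ι → ℂ} {S : ℂ} {s : ℕ → ℂ} (hG : HasSum G S)
    (hs : ∀ n, HasSum (fun l : List ι => if l.length = n then G l else 0) (s n)) : HasSum s S := by
  have h1 : HasSum (fun x : Σ n : ℕ, {l : List ι // l.length = n} => G x.2) S :=
    (Equiv.sigmaFiberEquiv (List.length (α := ι))).hasSum_iff.mpr hG
  refine h1.sigma fun n => ?_
  have h2 := hs n
  have h3 : (fun l : List ι => if l.length = n then G l else 0) =
      Set.indicator {l : List ι | l.length = n} G := by
    ext l
    simp [Set.indicator_apply]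
  rw [h3, ← hasSum_subtype_iff_indicator] at h2
  exact h2

/-- Uniqueness of power series coefficients. With g replaced by z • g it separates the particle
numbers in an exponential vector. -/
lemma eq_zero_of_hasSum_pow_mul {a : ℕ → ℂ} (h : ∀ z : ℂ, HasSum (fun n => z ^ n * a n) 0) (n : ℕ) :
    a n = 0 := by
  have h1 : HasFPowerSeriesAt (0 : ℂ → ℂ) (FormalMultilinearSeries.ofScalars ℂ a) 0 := by
    rw [hasFPowerSeriesAt_iff]
    refine Eventually.of_forall fun z => ?_
    simpa [FormalMultilinearSeries.coeff_ofScalars] using h z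
  have h2 := h1.eq_zero
  have h3 := congrArg (fun p => FormalMultilinearSeries.coeff p n) h2
  have h4 : (0 : FormalMultilinearSeries ℂ ℂ ℂ).coeff n = 0 := rfl
  rw [h4, FormalMultilinearSeries.coeff_ofScalars] at h3
  exact h3

end ListSums

/-! ### Product tensors and totality of exponential vectors -/

section Tensor

variable {ι 𝔥 : Type*} [NormedAddCommGroup 𝔥] [InnerProductSpace ℂ 𝔥] (b : HilbertBasis ι ℂ 𝔥)

lemma tensorCoord_cons_cons (f : 𝔥) (F : List 𝔥) (k : ι) (l : List ι) :
    tensorCoord b (f :: F) (k :: l) = b.repr f k * tensorCoord b F l := by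
  simp [tensorCoord]

lemma tensorCoord_nil_cons (k : ι) (l : List ι) : tensorCoord b [] (k :: l) = 0 := by
  simp [tensorCoord]

lemma tensorCoord_cons_nil (f : 𝔥) (F : List 𝔥) : tensorCoord b (f :: F) [] = 0 := by
  simp [tensorCoord]

lemma tensorCoord_nil_nil : tensorCoord b [] [] = 1 := by
  simp [tensorCoord]

lemma tensorCoord_of_ne {F : List 𝔥} {l : List ι} (h : F.length ≠ l.length) :
    tensorCoord b F l = 0 := if_neg h

/-- The coordinate at `l` of `g ⊗ ⋯ ⊗ g`. -/
noncomputable def powCoord (g : 𝔥) (l : List ι) : ℂ := (l.map fun k => b.repr g k).prod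

@[simp] lemma powCoord_nil (g : 𝔥) : powCoord b g [] = 1 := by simp [powCoord]

@[simp] lemma powCoord_cons (g : 𝔥) (k : ι) (l : List ι) :
    powCoord b g (k :: l) = b.repr g k * powCoord b g l := by simp [powCoord]

@[simp] lemma powCoord_append (g : 𝔥) (l l' : List ι) :
    powCoord b g (l ++ l') = powCoord b g l * powCoord b g l' := by simp [powCoord]

lemma powCoord_perm (g : 𝔥) {l l' : List ι} (h : l.Perm l') : powCoord b g l = powCoord b g l' :=
  (h.map _).prod_eq

lemma powCoord_smul (c : ℂ) (g : 𝔥) (l : List ι) :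
    powCoord b (c • g) l = c ^ l.length * powCoord b g l := by
  induction l with
  | nil => simp
  | cons k l ih =>
    rw [powCoord_cons, ih, powCoord_cons, map_smul, lp.coeFn_smul, Pi.smul_apply, smul_eq_mul,
      List.length_cons]
    ring

lemma tensorCoord_replicate (g : 𝔥) : ∀ (n : ℕ) (l : List ι),
    tensorCoord b (List.replicate n g) l = if l.length = n then powCoord b g l else 0
  | 0, [] => by simp [tensorCoord_nil_nil]
  | 0, k :: l => by simp [tensorCoord_nil_cons]
  | n + 1, [] => by rw [List.replicate_succ, tensorCoord_cons_nil]; simp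
  | n + 1, k :: l => by
    rw [List.replicate_succ, tensorCoord_cons_cons, tensorCoord_replicate g n l]
    simp

lemma hasSum_powCoord_tensorCoord (g : 𝔥) (F : List 𝔥) :
    (Summable fun l => ‖starRingEnd ℂ (powCoord b g l) * tensorCoord b F l‖) ∧
      HasSum (fun l => starRingEnd ℂ (powCoord b g l) * tensorCoord b F l)
        (F.map fun f => inner ℂ g f).prod := by
  induction F with
  | nil =>
    have h0 : ∀ l : List ι, l ≠ [] → starRingEnd ℂ (powCoord b g l) * tensorCoord b [] l = 0 := by
      intro l hl
      cases l with
      | nil => exact absurd rfl hl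
      | cons k l => simp [tensorCoord_nil_cons]
    have h1 := hasSum_single ([] : List ι) (f := fun l =>
      starRingEnd ℂ (powCoord b g l) * tensorCoord b [] l) h0
    refine ⟨(hasSum_single ([] : List ι) (f := fun l =>
      ‖starRingEnd ℂ (powCoord b g l) * tensorCoord b [] l‖)
      (fun l hl => by rw [h0 l hl, norm_zero])).summable, ?_⟩
    simpa [tensorCoord_nil_nil] using h1
  | cons f F ih =>
    have s1 : Summable fun k => ‖starRingEnd ℂ (b.repr g k) * b.repr f k‖ := by
      refine Summable.of_nonneg_of_le (fun _ => norm_nonneg _) (fun k => ?_)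
        ((summable_norm_sq_repr b g).add (summable_norm_sq_repr b f))
      rw [norm_mul, RCLike.norm_conj]
      exact mul_le_sq_add_sq _ _
    have e : ∀ p : ι × List ι, starRingEnd ℂ (powCoord b g (p.1 :: p.2)) *
        tensorCoord b (f :: F) (p.1 :: p.2) = (starRingEnd ℂ (b.repr g p.1) * b.repr f p.1) *
          (starRingEnd ℂ (powCoord b g p.2) * tensorCoord b F p.2) := fun p => by
      rw [tensorCoord_cons_cons, powCoord_cons, map_mul]
      ring
    have s2 := s1.mul_norm ih.1
    have s3 := (b.hasSum_conj_repr_mul g f).mul ih.2 s2.of_norm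
    have h0 : ∀ l : List ι, l ∉ Set.range (fun p : ι × List ι => p.1 :: p.2) →
        starRingEnd ℂ (powCoord b g l) * tensorCoord b (f :: F) l = 0 := by
      intro l hl
      cases l with
      | nil => simp [tensorCoord_cons_nil]
      | cons k l => exact absurd ⟨(k, l), rfl⟩ hl
    constructor
    · refine (injective_cons_prod.summable_iff fun l hl => by rw [h0 l hl, norm_zero]).mp ?_
      exact s2.congr fun p => by simp only [Function.comp]; rw [e]
    · refine (injective_cons_prod.hasSum_iff h0).mp ?_
      rw [List.map_cons, List.prod_cons]
      exact s3.congr_fun fun p => by simp only [Function.comp]; rw [e]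

lemma hasSum_powCoord (f g : 𝔥) (n : ℕ) :
    HasSum (fun l : List ι => if l.length = n then
      starRingEnd ℂ (powCoord b f l) * powCoord b g l else 0) (inner ℂ f g ^ n) := by
  have h := (hasSum_powCoord_tensorCoord b f (List.replicate n g)).2
  simp only [tensorCoord_replicate, mul_ite, mul_zero, List.map_replicate, List.prod_replicate] at h
  exact h

lemma tsum_enorm_powCoord (g : 𝔥) (n : ℕ) :
    (∑' l : List ι, if l.length = n then ‖powCoord b g l‖ₑ ^ 2 else 0) = (‖g‖ₑ ^ 2) ^ n := by
  rw [b.enorm_sq, ← tsum_length_prod]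
  refine tsum_congr fun l => ?_
  have h : ∀ l : List ι, ‖powCoord b g l‖ₑ ^ 2 = (l.map fun k => ‖b.repr g k‖ₑ ^ 2).prod := by
    intro l
    induction l with
    | nil => simp
    | cons k l ih => rw [powCoord_cons, enorm_mul, mul_pow, ih, List.map_cons, List.prod_cons]
  rw [h]

/-- The weights of the exponential vectors. -/
def IsEntireWeight (θ : ℕ → ℂ) : Prop := ∀ r : ℝ, 0 ≤ r → Summable fun n => ‖θ n‖ ^ 2 * r ^ n

/-- The vector `⨁ₙ θ(n) g ⊗ ⋯ ⊗ g`. -/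
noncomputable def expVec {θ : ℕ → ℂ} (hθ : IsEntireWeight θ) (g : 𝔥) : Fock ι :=
  Fock.mk (fun l => θ l.length * powCoord b g l) (by
    rw [tsum_by_length]
    have h : ∀ n : ℕ, (∑' l : List ι, if l.length = n then ‖θ l.length * powCoord b g l‖ₑ ^ 2
        else 0) = ENNReal.ofReal (‖θ n‖ ^ 2 * (‖g‖ ^ 2) ^ n) := fun n => by
      rw [ENNReal.ofReal_mul (sq_nonneg _), ENNReal.ofReal_pow (norm_nonneg (θ n)),
        ENNReal.ofReal_pow (sq_nonneg ‖g‖), ENNReal.ofReal_pow (norm_nonneg g), ofReal_norm,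
        ofReal_norm, ← tsum_enorm_powCoord b g n, ← ENNReal.tsum_mul_left]
      refine tsum_congr fun l => ?_
      split_ifs with hl
      · rw [hl, enorm_mul, mul_pow]
      · simp
    rw [tsum_congr h]
    exact (hθ _ (sq_nonneg _)).tsum_ofReal_ne_top)
    (fun l l' h => by rw [h.length_eq, powCoord_perm b g h])

@[simp] lemma fockCoord_expVec {θ : ℕ → ℂ} (hθ : IsEntireWeight θ) (g : 𝔥) (l : List ι) :
    fockCoord (expVec b hθ g) l = θ l.length * powCoord b g l := rfl

lemma hasSum_inner_expVec {θ θ' : ℕ → ℂ} (hθ : IsEntireWeight θ) (hθ' : IsEntireWeight θ')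
    (f g : 𝔥) : HasSum (fun n => starRingEnd ℂ (θ n) * θ' n * inner ℂ f g ^ n)
      (inner ℂ (expVec b hθ f) (expVec b hθ' g)) := by
  refine hasSum_by_length (fock_hasSum_inner _ _) fun n => ?_
  refine ((hasSum_powCoord b f g n).mul_left (starRingEnd ℂ (θ n) * θ' n)).congr_fun fun l => ?_
  split_ifs with hl
  · simp only [fockCoord_expVec, hl, map_mul]
    ring
  · simp

lemma legCLM_expVec {θ : ℕ → ℂ} (hθ : IsEntireWeight θ) (g : 𝔥) (l : List ι) :
    legCLM b l (expVec b hθ g) = (θ (l.length + 1) * powCoord b g l) • g := by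
  refine b.repr_ext fun k => ?_
  simp
  ring

open Classical in
-- Scaling g isolates each particle number, and θ n ≠ 0 allows division by the weight. Restricting g
-- to the span of finitely many basis vectors gives a vanishing polynomial in its coordinates, whose
-- coefficients are positive multiples of the conjugated coordinates of v.
lemma eq_zero_of_inner_expVec {θ : ℕ → ℂ} (hθ : IsEntireWeight θ) (hθ0 : ∀ n, θ n ≠ 0)
    {v : Fock ι} (hv : ∀ g, inner ℂ v (expVec b hθ g) = 0) : v = 0 := by
  have key : ∀ (n : ℕ) (g : 𝔥), HasSum (fun l : List ι => if l.length = n then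
      starRingEnd ℂ (fockCoord v l) * powCoord b g l else 0) 0 := by
    intro n g
    have hs : ∀ n, Summable (fun l : List ι => if l.length = n then
        starRingEnd ℂ (fockCoord v l) * (θ l.length * powCoord b g l) else 0) := fun n => by
      have h1 := (fock_hasSum_inner v (expVec b hθ g)).summable.indicator
        {l : List ι | l.length = n}
      refine h1.congr fun l => ?_
      simp [Set.indicator_apply]
    have h2 : ∀ z : ℂ, HasSum (fun n => z ^ n * ∑' l : List ι, if l.length = n then
        starRingEnd ℂ (fockCoord v l) * (θ l.length * powCoord b g l) else 0) 0 := by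
      intro z
      suffices h : HasSum (fun n => z ^ n * ∑' l : List ι, if l.length = n then
          starRingEnd ℂ (fockCoord v l) * (θ l.length * powCoord b g l) else 0)
          (inner ℂ v (expVec b hθ (z • g))) by rwa [hv] at h
      refine hasSum_by_length (fock_hasSum_inner _ _) fun n => ?_
      refine ((hs n).hasSum.mul_left (z ^ n)).congr_fun fun l => ?_
      split_ifs with hl
      · rw [fockCoord_expVec, powCoord_smul, hl]
        ring
      · simp
    have h3 := eq_zero_of_hasSum_pow_mul h2 n
    have h4 := ((hs n).hasSum.mul_left (θ n)⁻¹)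
    rw [h3, mul_zero] at h4
    refine h4.congr_fun fun l => ?_
    split_ifs with hl
    · rw [hl]
      field_simp [hθ0 n]
    · simp
  refine fock_ext fun l₀ => ?_
  rw [fockCoord_zero]
  set s := l₀.toFinset
  set n := l₀.length with hn
  -- `P` is (v|g^{⊗n}) as a polynomial in the coordinates of g along the letters of `l₀`; other
  -- lists contribute nothing for such g.
  set P : MvPolynomial ι ℂ := ∑ x ∈ Fintype.piFinset (fun _ : Fin n => s),
    MvPolynomial.C (starRingEnd ℂ (fockCoord v (List.ofFn x))) *
      ((List.ofFn x).map MvPolynomial.X).prod with hP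
  have hP0 : P = 0 := by
    refine MvPolynomial.funext fun y => ?_
    set g : 𝔥 := ∑ i ∈ s, y i • b i with hg
    have hgk : ∀ k, b.repr g k = if k ∈ s then y k else 0 := by
      intro k
      rw [hg, map_sum, lp.coeFn_sum, Finset.sum_apply]
      simp only [map_smul, lp.coeFn_smul, Pi.smul_apply, b.repr_self, smul_eq_mul,
        lp.single_apply, Pi.single_apply, mul_ite, mul_one, mul_zero, Finset.sum_ite_eq]
    have hpow1 : ∀ l : List ι, (∀ k ∈ l, k ∈ s) → powCoord b g l = (l.map y).prod := by
      intro l hl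
      unfold powCoord
      congr 1
      exact List.map_congr_left fun k hk => by rw [hgk, if_pos (hl k hk)]
    have hpow0 : ∀ l : List ι, (∃ k ∈ l, k ∉ s) → powCoord b g l = 0 := by
      rintro l ⟨k, hk, hks⟩
      refine List.prod_eq_zero (List.mem_map.mpr ⟨k, hk, ?_⟩)
      rw [hgk, if_neg hks]
    have h1 := key n g
    have h2 := hasSum_sum_of_ne_finset_zero (L := SummationFilter.unconditional _) (f := fun l : List ι => if l.length = n then
      starRingEnd ℂ (fockCoord v l) * powCoord b g l else 0)
      (s := (Fintype.piFinset (fun _ : Fin n => s)).image List.ofFn) (fun l hl => by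
        split_ifs with hln
        · rw [hpow0 l, mul_zero]
          by_contra hc
          push Not at hc
          refine hl (Finset.mem_image.mpr ⟨fun i => l.get (i.cast hln.symm), ?_, ?_⟩)
          · exact Fintype.mem_piFinset.mpr fun i => hc _ (List.get_mem _ _)
          · exact List.ext_getElem (by simp [hln]) (by simp)
        · rfl)
    have h3 := h2.unique h1
    rw [Finset.sum_image (fun x _ y _ h => List.ofFn_injective h)] at h3
    rw [map_zero, ← h3, hP, map_sum]
    refine Finset.sum_congr rfl fun x hx => ?_
    rw [if_pos (by simp), hpow1 _ (fun k hk => ?_)]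
    · simp [map_list_prod, Function.comp_def]
    · rw [List.mem_ofFn] at hk
      obtain ⟨i, rfl⟩ := hk
      exact Fintype.mem_piFinset.mp hx i
  have hmon : ∀ l : List ι, (l.map (MvPolynomial.X (R := ℂ))).prod =
      MvPolynomial.monomial (Multiset.toFinsupp (l : Multiset ι)) 1 := by
    intro l
    induction l with
    | nil => simp
    | cons k l ih =>
      rw [List.map_cons, List.prod_cons, ih, MvPolynomial.X, MvPolynomial.monomial_mul, mul_one,
        ← Multiset.cons_coe, ← Multiset.singleton_add, map_add, Multiset.toFinsupp_singleton]
  have hc := congrArg (MvPolynomial.coeff (Multiset.toFinsupp (l₀ : Multiset ι))) hP0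
  rw [hP, MvPolynomial.coeff_sum, MvPolynomial.coeff_zero] at hc
  have hterm : ∀ x : Fin n → ι, MvPolynomial.coeff (Multiset.toFinsupp (l₀ : Multiset ι))
      (MvPolynomial.C (starRingEnd ℂ (fockCoord v (List.ofFn x))) *
        ((List.ofFn x).map MvPolynomial.X).prod) =
      if (List.ofFn x).Perm l₀ then starRingEnd ℂ (fockCoord v l₀) else 0 := by
    intro x
    rw [hmon, MvPolynomial.coeff_C_mul, MvPolynomial.coeff_monomial]
    by_cases hx : (List.ofFn x).Perm l₀
    · rw [if_pos hx, if_pos (by rw [Multiset.coe_eq_coe.mpr hx]), mul_one, fockCoord_perm v hx]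
    · rw [if_neg hx, if_neg (fun h => hx (Multiset.coe_eq_coe.mp (Multiset.toFinsupp.injective h))),
        mul_zero]
  simp only [hterm] at hc
  rw [← Finset.sum_filter, Finset.sum_const, nsmul_eq_mul, mul_eq_zero] at hc
  rcases hc with hc | hc
  · rw [Nat.cast_eq_zero, Finset.card_eq_zero] at hc
    -- The coefficient of the monomial of `l₀` counts the rearrangements of `l₀`, and `l₀` itself is
    -- one.
    have : l₀.get ∈ (∅ : Finset (Fin n → ι)) := by
      rw [← hc, Finset.mem_filter, Fintype.mem_piFinset]
      exact ⟨fun i => by simp [s], by rw [List.ofFn_get]⟩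
    simp at this
  · simpa using hc

lemma expVec_total {θ : ℕ → ℂ} (hθ : IsEntireWeight θ) (hθ0 : ∀ n, θ n ≠ 0) :
    (Submodule.span ℂ (Set.range (expVec b hθ))).topologicalClosure = ⊤ := by
  rw [Submodule.topologicalClosure_eq_top_iff, Submodule.eq_bot_iff]
  intro v hv
  refine eq_zero_of_inner_expVec b hθ hθ0 fun g => ?_
  have := (Submodule.mem_orthogonal _ v).mp hv (expVec b hθ g)
    (Submodule.subset_span ⟨g, rfl⟩)
  exact inner_eq_zero_symm.mp this

end Tensor

lemma inner_smul_smul_eq {E : Type*} [NormedAddCommGroup E] [InnerProductSpace ℂ E] (c d : ℂ) (x y : E) :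
    inner ℂ (c • x) (d • y) = starRingEnd ℂ c * d * inner ℂ x y := by
  rw [inner_smul_left, inner_smul_right, mul_assoc]

lemma fock_inner_smul_left {ι : Type*} (c : ℂ) (x y : Fock ι) :
    inner ℂ (c • x) y = starRingEnd ℂ c * inner ℂ x y := inner_smul_left (E := Fock ι) x y c

lemma fock_inner_smul_right {ι : Type*} (c : ℂ) (x y : Fock ι) :
    inner ℂ x (c • y) = c * inner ℂ x y := inner_smul_right (E := Fock ι) x y c

lemma fock_inner_add_right {ι : Type*} (x y z : Fock ι) :
    inner ℂ x (y + z) = inner ℂ x y + inner ℂ x z := inner_add_right (E := Fock ι) x y z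

lemma fock_inner_sub_right {ι : Type*} (x y z : Fock ι) :
    inner ℂ x (y - z) = inner ℂ x y - inner ℂ x z := inner_sub_right (E := Fock ι) x y z

lemma fock_inner_conj_symm {ι : Type*} (x y : Fock ι) :
    starRingEnd ℂ (inner ℂ y x) = inner ℂ x y := inner_conj_symm (E := Fock ι) x y

/-! ### Operators determined on total sets -/

section Gram

variable {E : Type*} [NormedAddCommGroup E] [InnerProductSpace ℂ E] [CompleteSpace E]

lemma dense_span_of_topologicalClosure {Z : Set E}
    (hZ : (Submodule.span ℂ Z).topologicalClosure = ⊤) : Dense (Submodule.span ℂ Z : Set E) :=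
  (Submodule.dense_iff_topologicalClosure_eq_top).mpr hZ

lemma clm_ext_of_dense_span {F : Type*} [NormedAddCommGroup F] [NormedSpace ℂ F] {Z : Set E}
    (hZ : Dense (Submodule.span ℂ Z : Set E)) {S T : E →L[ℂ] F} (h : ∀ z ∈ Z, S z = T z) :
    S = T :=
  ContinuousLinearMap.ext_on hZ h

lemma continuous_apply_of_dense_span {F : Type*} [NormedAddCommGroup F] [NormedSpace ℂ F]
    {Θ : Type*} [TopologicalSpace Θ] {U : Θ → E →L[ℂ] F} {M : ℝ} (hM : ∀ t, ‖U t‖ ≤ M) {Z : Set E}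
    (hZ : Dense (Submodule.span ℂ Z : Set E)) (h : ∀ z ∈ Z, Continuous fun t => U t z) (u : E) :
    Continuous fun t => U t u := by
  have h1 : ∀ u ∈ Submodule.span ℂ Z, Continuous fun t => U t u := by
    intro u hu
    induction hu using Submodule.span_induction with
    | mem z hz => exact h z hz
    | zero => simpa using continuous_const
    | add x y _ _ hx hy => simp only [map_add]; exact hx.add hy
    | smul c x _ hx => simp only [map_smul]; exact hx.const_smul c
  refine continuous_iff_continuousAt.mpr fun t₀ => ?_
  have hM0 : 0 ≤ M := (norm_nonneg _).trans (hM t₀)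
  refine continuousAt_of_locally_uniform_approx_of_continuousAt fun V hV => ?_
  obtain ⟨ε, hε, hεV⟩ := Metric.mem_uniformity_dist.mp hV
  obtain ⟨x, hx, hxu⟩ := Metric.dense_iff.mp hZ u (ε / (M + 1)) (by positivity)
  refine ⟨Set.univ, univ_mem, fun t => U t x, (h1 x hxu).continuousAt, fun t _ => hεV ?_⟩
  rw [dist_eq_norm, ← map_sub]
  have h2 : ‖u - x‖ < ε / (M + 1) := by
    rw [← dist_eq_norm, dist_comm]; exact hx
  calc ‖U t (u - x)‖ ≤ M * ‖u - x‖ := (U t).le_of_opNorm_le (hM t) _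
    _ ≤ (M + 1) * ‖u - x‖ := by gcongr; linarith
    _ < ε := by rw [lt_div_iff₀' (by positivity)] at h2; exact h2

/-- Two families with the same Gram matrix are related by an isometry. -/
lemma exists_isometry_of_gram {α : Type*} {x y : α → E}
    (hx : Dense (Submodule.span ℂ (Set.range x) : Set E))
    (h : ∀ a a', inner ℂ (y a) (y a') = inner ℂ (x a) (x a')) :
    ∃ T : E →L[ℂ] E, (∀ a, T (x a) = y a) ∧ ∀ u v, inner ℂ (T u) (T v) = inner ℂ u v := by
  set X := Finsupp.linearCombination ℂ x
  set Y := Finsupp.linearCombination ℂ y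
  have hXY : ∀ c c', inner ℂ (Y c) (Y c') = inner ℂ (X c) (X c') := by
    intro c c'
    simp only [X, Y, Finsupp.linearCombination_apply, Finsupp.sum, sum_inner, inner_sum,
      inner_smul_left, inner_smul_right, h]
  have hn : ∀ c, ‖Y c‖ = ‖X c‖ := fun c => by
    rw [@norm_eq_sqrt_re_inner ℂ, @norm_eq_sqrt_re_inner ℂ _ _ _ _ (X c), hXY]
  have hd : DenseRange X := by
    rw [DenseRange]
    have : Set.range X = (Submodule.span ℂ (Set.range x) : Set E) := by
      rw [← Finsupp.range_linearCombination]; rfl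
    rw [this]
    exact hx
  have hT : ∀ c, Y.extendOfNorm X (X c) = Y c := fun c =>
    LinearMap.extendOfNorm_eq hd ⟨1, fun c => by rw [hn, one_mul]⟩ c
  refine ⟨Y.extendOfNorm X, fun a => ?_, fun u v => ?_⟩
  · have := hT (Finsupp.single a 1)
    simpa [X, Y] using this
  · refine hd.induction_on₂ (p := fun u v => inner ℂ (Y.extendOfNorm X u) (Y.extendOfNorm X v) =
      inner ℂ u v) ?_ (fun c c' => by rw [hT, hT, hXY]) u v
    exact isClosed_eq (by fun_prop) (by fun_prop)

lemma mem_unitary_of_inner_of_mul_eq_one {S T : E →L[ℂ] E}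
    (h : ∀ u v, inner ℂ (S u) (S v) = inner ℂ u v) (hST : S * T = 1) :
    S ∈ unitary (E →L[ℂ] E) := by
  have h1 : ContinuousLinearMap.adjoint S = T := by
    refine ContinuousLinearMap.ext fun u => ext_inner_left ℂ fun v => ?_
    rw [ContinuousLinearMap.adjoint_inner_right, ← h v (T u), ← mul_apply_eq_comp, hST,
      one_apply_eq_self]
  have h2 : T * S = 1 := by
    refine ContinuousLinearMap.ext fun u => ext_inner_left ℂ fun v => ?_
    rw [mul_apply_eq_comp, ← h1, ContinuousLinearMap.adjoint_inner_right, h, one_apply_eq_self]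
  rw [Unitary.mem_iff, ContinuousLinearMap.star_eq_adjoint, h1]
  exact ⟨h2, hST⟩

end Gram

/-! ### Exponential vectors -/

section Exponential

variable {ι 𝔥 : Type*} [NormedAddCommGroup 𝔥] [InnerProductSpace ℂ 𝔥] (b : HilbertBasis ι ℂ 𝔥)

/-- The weights of `(N + 1)^d e(g)`, with `e(g)` the exponential vector of `g`. -/
noncomputable def expWeight (d n : ℕ) : ℂ :=
  ((n : ℂ) + 1) ^ d * ((Real.sqrt n.factorial : ℝ) : ℂ)⁻¹

lemma natCast_add_one_ne_zero (n : ℕ) : (n : ℂ) + 1 ≠ 0 := Nat.cast_add_one_ne_zero n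

lemma norm_natCast_add_one (n : ℕ) : ‖(n : ℂ) + 1‖ = (n : ℝ) + 1 := by
  rw [← Nat.cast_one, ← Nat.cast_add, Complex.norm_natCast]; simp

lemma sqrt_factorial_ne_zero (n : ℕ) : ((Real.sqrt n.factorial : ℝ) : ℂ) ≠ 0 := by
  rw [Complex.ofReal_ne_zero]
  exact Real.sqrt_ne_zero'.mpr (by positivity)

lemma expWeight_ne_zero (d n : ℕ) : expWeight d n ≠ 0 :=
  mul_ne_zero (pow_ne_zero _ (natCast_add_one_ne_zero n)) (inv_ne_zero (sqrt_factorial_ne_zero n))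

/-- The polynomial (n+1)^{2d} is at most (2d)! e^{n+1}, so the series is dominated by the
exponential series at e·r. -/
lemma isEntireWeight_expWeight (d : ℕ) : IsEntireWeight (expWeight d) := by
  intro r hr
  refine Summable.of_nonneg_of_le (fun n => by positivity) (fun n => ?_)
    ((Real.summable_pow_div_factorial (Real.exp 1 * r)).mul_left
      ((2 * d).factorial * Real.exp 1))
  have h1 : ‖expWeight d n‖ ^ 2 = ((n : ℝ) + 1) ^ (2 * d) / n.factorial := by
    rw [expWeight, norm_mul, norm_pow, norm_natCast_add_one, norm_inv, Complex.norm_real,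
      Real.norm_of_nonneg (Real.sqrt_nonneg _), mul_pow, inv_pow, Real.sq_sqrt (by positivity),
      ← pow_mul, mul_comm d 2]
    rfl
  have h2 := Real.pow_div_factorial_le_exp ((n : ℝ) + 1) (by positivity) (2 * d)
  rw [div_le_iff₀ (by positivity), Real.exp_add, ← mul_one (n : ℝ), Real.exp_nat_mul, mul_one] at h2
  rw [h1, mul_pow]
  calc ((n : ℝ) + 1) ^ (2 * d) / n.factorial * r ^ n
      ≤ (Real.exp 1 ^ n * Real.exp 1 * (2 * d).factorial) / n.factorial * r ^ n := by gcongr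
    _ = _ := by ring

/-- The vector `(N + 1)^d e(g)`, with `e(g)` the exponential vector of `g`. -/
noncomputable def coherent (d : ℕ) (g : 𝔥) : Fock ι := expVec b (isEntireWeight_expWeight d) g

lemma fockCoord_coherent (d : ℕ) (g : 𝔥) (l : List ι) :
    fockCoord (coherent b d g) l = expWeight d l.length * powCoord b g l := rfl

lemma dense_span_coherent (d : ℕ) :
    Dense (Submodule.span ℂ (Set.range (coherent b d)) : Set (Fock ι)) :=
  dense_span_of_topologicalClosure
    (expVec_total b (isEntireWeight_expWeight d) (expWeight_ne_zero d))

lemma inner_coherent (f g : 𝔥) :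
    inner ℂ (coherent b 0 f) (coherent b 0 g) = Complex.exp (inner ℂ f g) := by
  have h1 := hasSum_inner_expVec b (isEntireWeight_expWeight 0) (isEntireWeight_expWeight 0) f g
  have h2 := NormedSpace.expSeries_div_hasSum_exp (inner ℂ f g)
  rw [Complex.exp_eq_exp_ℂ]
  refine h1.unique (h2.congr_fun fun n => ?_)
  have h3 : ((Real.sqrt n.factorial : ℝ) : ℂ) * ((Real.sqrt n.factorial : ℝ) : ℂ) =
      n.factorial := by
    rw [← Complex.ofReal_mul, Real.mul_self_sqrt (by positivity), Complex.ofReal_natCast]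
  simp only [expWeight, pow_zero, one_mul, map_inv₀, Complex.conj_ofReal]
  rw [← mul_inv, h3]
  ring

lemma norm_inv_natCast_add_one_pow_le (d n : ℕ) : ‖(((n : ℂ) + 1) ^ d)⁻¹‖ ≤ 1 := by
  rw [norm_inv, norm_pow, norm_natCast_add_one]
  exact inv_le_one_of_one_le₀ (one_le_pow₀ (by linarith [Nat.cast_nonneg (α := ℝ) n]))

/-- The operator `(N + 1)^{-d}`. -/
noncomputable def numberInv (d : ℕ) : Fock ι →L[ℂ] Fock ι :=
  numberMul (fun n => (((n : ℂ) + 1) ^ d)⁻¹) (norm_inv_natCast_add_one_pow_le d)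

@[simp] lemma fockCoord_numberInv (d : ℕ) (u : Fock ι) (l : List ι) :
    fockCoord (numberInv d u) l = (((l.length : ℂ) + 1) ^ d)⁻¹ * fockCoord u l := rfl

/-- An operator that is only bounded relative to N^d is handled through its product with (N+1)^{-d}.
Testing that product on `coherent b d g` is testing the operator itself on the exponential vector of
g. -/
lemma numberInv_coherent (d : ℕ) (g : 𝔥) : numberInv d (coherent b d g) = coherent b 0 g := by
  refine fock_ext fun l => ?_
  rw [fockCoord_numberInv, fockCoord_coherent, fockCoord_coherent]
  have := natCast_add_one_ne_zero l.length
  simp only [expWeight, pow_zero]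
  field_simp

lemma inner_numberInv_left (d : ℕ) (u v : Fock ι) :
    inner ℂ (numberInv d u) v = inner ℂ u (numberInv d v) := by
  refine (fock_hasSum_inner _ _).unique ((fock_hasSum_inner _ _).congr_fun fun l => ?_)
  simp only [fockCoord_numberInv, map_mul, map_inv₀, map_pow, map_add, map_natCast, map_one]
  ring

lemma norm_coherent_sub_sq (f g : 𝔥) : ‖coherent b 0 f - coherent b 0 g‖ ^ 2 =
    (Complex.exp (inner ℂ f f) - Complex.exp (inner ℂ f g) - Complex.exp (inner ℂ g f) +
      Complex.exp (inner ℂ g g)).re := by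
  rw [@norm_sq_eq_re_inner ℂ]
  simp only [inner_sub_left, inner_sub_right, inner_coherent]
  rw [RCLike.re_eq_complex_re]
  congr 1
  ring

lemma continuous_coherent : Continuous (coherent b 0 : 𝔥 → Fock ι) := by
  refine continuous_iff_continuousAt.mpr fun g => ?_
  rw [ContinuousAt, tendsto_iff_norm_sub_tendsto_zero]
  have h1 : Tendsto (fun f => ‖coherent b 0 f - coherent b 0 g‖ ^ 2) (𝓝 g) (𝓝 0) := by
    simp only [norm_coherent_sub_sq]
    refine (Continuous.tendsto' (by fun_prop) _ _ ?_)
    simp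
  have h2 := h1.sqrt
  simpa using h2

end Exponential

/-! ### Displacement operators -/

section Displacement

variable {ι 𝔥 : Type*} [NormedAddCommGroup 𝔥] [InnerProductSpace ℂ 𝔥] (b : HilbertBasis ι ℂ 𝔥)

/-- The normalization factor in the action of displacement operators on exponential vectors. -/
noncomputable def displacementFactor (k g : 𝔥) : ℂ :=
  Complex.exp (-((‖k‖ : ℂ) ^ 2) / 2 - inner ℂ k g)

/-- The scalar factor cancels the extra terms in exp (f+k|g+k), so the translated vectors keep the
Gram matrix exp (f|g). -/
lemma exists_displacement (k : 𝔥) : ∃ T : Fock ι →L[ℂ] Fock ι,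
    (∀ g, T (coherent b 0 g) = displacementFactor k g • coherent b 0 (g + k)) ∧
      ∀ u v, inner ℂ (T u) (T v) = inner ℂ u v := by
  refine exists_isometry_of_gram (dense_span_coherent b 0) fun f g => ?_
  refine (inner_smul_smul_eq (E := Fock ι) _ _ _ _).trans ?_
  rw [inner_coherent, inner_coherent, displacementFactor,
    displacementFactor, ← Complex.exp_conj, ← Complex.exp_add, ← Complex.exp_add]
  congr 1
  simp only [map_sub, map_div₀, map_neg, map_pow, Complex.conj_ofReal, inner_conj_symm,
    inner_add_left, inner_add_right, map_ofNat]
  rw [inner_self_eq_norm_sq_to_K]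
  simp
  ring

/-- The displacement operator: `D(k) e(g) = exp(-‖k‖²/2 - (k|g)) e(g + k)`. -/
noncomputable def displacement (k : 𝔥) : Fock ι →L[ℂ] Fock ι := (exists_displacement b k).choose

lemma displacement_coherent (k g : 𝔥) : displacement b k (coherent b 0 g) =
    displacementFactor k g • coherent b 0 (g + k) := (exists_displacement b k).choose_spec.1 g

lemma inner_displacement (k : 𝔥) (u v : Fock ι) :
    inner ℂ (displacement b k u) (displacement b k v) = inner ℂ u v :=
  (exists_displacement b k).choose_spec.2 u v

lemma displacement_zero : displacement b (0 : 𝔥) = 1 := by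
  refine clm_ext_of_dense_span (dense_span_coherent b 0) ?_
  rintro _ ⟨g, rfl⟩
  rw [displacement_coherent]
  simp [displacementFactor]

lemma displacement_mul (k k' : 𝔥) : displacement b k * displacement b k' =
    Complex.exp (-Complex.I * ((inner ℂ k k').im : ℂ)) • displacement b (k + k') := by
  refine clm_ext_of_dense_span (dense_span_coherent b 0) ?_
  rintro _ ⟨g, rfl⟩
  rw [mul_apply_eq_comp, displacement_coherent, map_smul, displacement_coherent,
    smul_apply, displacement_coherent, smul_smul, smul_smul,
    add_assoc, add_comm k' k, displacementFactor, displacementFactor, displacementFactor,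
    ← Complex.exp_add, ← Complex.exp_add]
  congr 2
  have h1 : ((‖k + k'‖ : ℂ)) ^ 2 = (‖k‖ : ℂ) ^ 2 + 2 * ((inner ℂ k k').re : ℂ) + (‖k'‖ : ℂ) ^ 2 := by
    have := @norm_add_sq ℂ _ _ _ _ k k'
    exact_mod_cast this
  rw [h1, inner_add_left, inner_add_right]
  have h2 := Complex.re_add_im (inner ℂ k k')
  linear_combination h2

lemma displacement_mem_unitary (k : 𝔥) : displacement b k ∈ unitary (Fock ι →L[ℂ] Fock ι) := by
  refine mem_unitary_of_inner_of_mul_eq_one (T := displacement b (-k)) (inner_displacement b k) ?_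
  rw [displacement_mul, add_neg_cancel, displacement_zero, inner_neg_right,
    inner_self_eq_norm_sq_to_K]
  simp [← Complex.ofReal_pow]

lemma isUnitaryGroup_displacement (k : 𝔥) :
    IsUnitaryGroup fun t : ℝ => displacement b ((t : ℂ) • k) where
  mem_unitary t := displacement_mem_unitary b _
  zero := by simp [displacement_zero]
  add s t := by
    rw [displacement_mul, inner_smul_left, inner_smul_right, Complex.conj_ofReal,
      inner_self_eq_norm_sq_to_K, ← add_smul, Complex.ofReal_add]
    simp [← Complex.ofReal_pow]
  continuous := by
    refine continuous_apply_of_dense_span (M := 1) (fun t => ?_) (dense_span_coherent b 0) ?_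
    · exact ContinuousLinearMap.opNorm_le_bound _ zero_le_one fun u => by
        rw [norm_map_of_mem_unitary (displacement_mem_unitary b _), one_mul]
    · rintro _ ⟨g, rfl⟩
      simp only [displacement_coherent, displacementFactor, norm_smul]
      have := continuous_coherent b
      fun_prop

end Displacement

/-! ### Field operators as generators of displacements; Weyl operators -/

section Field

variable {ι 𝔥 : Type*} [NormedAddCommGroup 𝔥] [InnerProductSpace ℂ 𝔥] (b : HilbertBasis ι ℂ 𝔥)

lemma dense_span_smul_coherent :
    Dense (Submodule.span ℂ {z : Fock ι | ∃ (c : ℂ) (g : 𝔥), z = c • coherent b 0 g} :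
      Set (Fock ι)) :=
  (dense_span_coherent b 0).mono (Submodule.span_mono (by
    rintro _ ⟨g, rfl⟩
    exact ⟨1, g, (one_smul _ _).symm⟩))

/-- n is the number of particles after creation: n^{-1/2} belongs to a*(h), and n⁻¹ is (N+1)⁻¹ on
the n − 1 particles before. -/
noncomputable def createWeight (n : ℕ) : ℂ := ((Real.sqrt n : ℝ) : ℂ)⁻¹ * (n : ℂ)⁻¹

/-- Again n counts the outgoing particles, so (N+1)⁻¹ acts on n + 1 particles. -/
noncomputable def annihilateWeight (n : ℕ) : ℂ := ((Real.sqrt (n + 1) : ℝ) : ℂ) * ((n : ℂ) + 2)⁻¹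

/-- The weight of (N+1)⁻¹ a(h), the adjoint of a*(h)(N+1)⁻¹. -/
noncomputable def createWeight' (n : ℕ) : ℂ := ((Real.sqrt (n + 1) : ℝ) : ℂ)⁻¹

lemma norm_createWeight_le (n : ℕ) : n * ‖createWeight n‖ ≤ 1 := by
  rcases Nat.eq_zero_or_pos n with rfl | hn
  · simp
  have h1 : (1 : ℝ) ≤ n := by exact_mod_cast hn
  rw [createWeight, norm_mul, norm_inv, norm_inv, Complex.norm_real, Complex.norm_natCast,
    Real.norm_of_nonneg (Real.sqrt_nonneg _), mul_comm, mul_assoc, inv_mul_cancel₀ (by positivity),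
    mul_one]
  exact inv_le_one_of_one_le₀ (Real.one_le_sqrt.mpr h1)

lemma norm_annihilateWeight_le (n : ℕ) : ‖annihilateWeight n‖ ≤ 1 := by
  have h1 : (n : ℂ) + 2 = ((n + 2 : ℝ) : ℂ) := by push_cast; rfl
  rw [annihilateWeight, h1, norm_mul, norm_inv, Complex.norm_real, Complex.norm_real,
    Real.norm_of_nonneg (Real.sqrt_nonneg _), Real.norm_of_nonneg (by positivity),
    mul_inv_le_iff₀ (by positivity), one_mul, Real.sqrt_le_left (by positivity)]
  nlinarith [Nat.cast_nonneg (α := ℝ) n]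

lemma norm_createWeight'_le (n : ℕ) : ‖createWeight' n‖ ≤ 1 := by
  rw [createWeight', norm_inv, Complex.norm_real, Real.norm_of_nonneg (Real.sqrt_nonneg _)]
  exact inv_le_one_of_one_le₀ (Real.one_le_sqrt.mpr (by linarith [Nat.cast_nonneg (α := ℝ) n]))

/-- The bounded operator `a*(h) (N + 1)⁻¹`. -/
noncomputable def createReg (h : 𝔥) : Fock ι →L[ℂ] Fock ι :=
  create b createWeight norm_createWeight_le h

/-- The bounded operator `a(h) (N + 1)⁻¹`. -/
noncomputable def annihilateReg (h : 𝔥) : Fock ι →L[ℂ] Fock ι :=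
  annihilate b annihilateWeight norm_annihilateWeight_le h

/-- The bounded operator `φ(h) (N + 1)⁻¹`. -/
noncomputable def fieldReg (h : 𝔥) : Fock ι →L[ℂ] Fock ι :=
  ((Real.sqrt 2 : ℝ) : ℂ)⁻¹ • (createReg b h + annihilateReg b h)

lemma norm_fieldReg_le (h : 𝔥) : ‖fieldReg b h‖ ≤ 2 * ‖h‖ := by
  have h1 := norm_create_le b createWeight norm_createWeight_le h
  have h2 := norm_annihilate_le b annihilateWeight norm_annihilateWeight_le h
  have h3 : ‖((Real.sqrt 2 : ℝ) : ℂ)⁻¹‖ ≤ 1 := by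
    rw [norm_inv, Complex.norm_real, Real.norm_of_nonneg (Real.sqrt_nonneg _)]
    exact inv_le_one_of_one_le₀ (Real.one_le_sqrt.mpr (by norm_num))
  refine ContinuousLinearMap.opNorm_le_bound _ (by positivity) fun u => ?_
  rw [fieldReg, smul_apply, add_apply, norm_smul]
  calc _ ≤ 1 * (‖createReg b h u‖ + ‖annihilateReg b h u‖) :=
        mul_le_mul h3 (norm_add_le _ _) (norm_nonneg _) zero_le_one
    _ ≤ 1 * (1 * ‖h‖ * ‖u‖ + 1 * ‖h‖ * ‖u‖) := by
        gcongr
        · exact (createReg b h).le_of_opNorm_le h1 u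
        · exact (annihilateReg b h).le_of_opNorm_le h2 u
    _ = _ := by ring

lemma fockCoord_createReg (h : 𝔥) (x : Fock ι) (l : List ι) :
    fockCoord (createReg b h x) l = creationCoord b h (numberInv 1 x) l := by
  unfold createReg creationCoord
  rw [fockCoord_create, createWeight, mul_assoc, Finset.mul_sum]
  congr 1
  refine Finset.sum_congr rfl fun i _ => ?_
  rw [fockCoord_numberInv, pow_one, ← Nat.cast_add_one, length_eraseIdx_fin]
  ring

lemma fockCoord_annihilateReg (h : 𝔥) (x : Fock ι) (l : List ι) :
    fockCoord (annihilateReg b h x) l = annihilationCoord b h (numberInv 1 x) l := by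
  unfold annihilateReg annihilationCoord
  have h1 : legVector b 0 l (Nat.zero_le _) (numberInv 1 x) =
      ((l.length : ℂ) + 2)⁻¹ • legCLM b l x := by
    refine b.repr_ext fun k => ?_
    simp only [repr_legVector_zero, fockCoord_numberInv, map_smul, lp.coeFn_smul, Pi.smul_apply,
      legCLM_apply, List.length_cons, smul_eq_mul, pow_one]
    push_cast
    ring
  rw [fockCoord_annihilate, h1, inner_smul_right, annihilateWeight, mul_assoc]

lemma inner_createReg_left (h : 𝔥) (x y : Fock ι) :
    inner ℂ (createReg b h y) (numberInv 1 x) = inner ℂ (numberInv 1 y) (annihilateReg b h x) := by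
  have hc : ∀ n : ℕ, starRingEnd ℂ (createWeight (n + 1)) * (n + 1) = createWeight' n := by
    intro n
    have := natCast_add_one_ne_zero n
    rw [createWeight, createWeight', map_mul, map_inv₀, map_inv₀, Complex.conj_ofReal, map_natCast,
      mul_assoc]
    push_cast
    rw [inv_mul_cancel₀ this, mul_one]
  rw [createReg, inner_create_left b _ createWeight' norm_createWeight_le norm_createWeight'_le h hc,
    inner_numberInv_left]
  congr 1
  refine fock_ext fun l => ?_
  rw [fockCoord_numberInv, fockCoord_annihilateReg, annihilationCoord, fockCoord_annihilate,
    ← legCLM_apply, createWeight', pow_one, ← mul_assoc]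
  congr 1
  have h1 : ((Real.sqrt (l.length + 1) : ℝ) : ℂ) * ((Real.sqrt (l.length + 1) : ℝ) : ℂ) =
      (l.length : ℂ) + 1 := by
    rw [← Complex.ofReal_mul, Real.mul_self_sqrt (by positivity)]
    push_cast; rfl
  have h2 : ((Real.sqrt (l.length + 1) : ℝ) : ℂ) ≠ 0 := by
    rw [Complex.ofReal_ne_zero]
    exact Real.sqrt_ne_zero'.mpr (by positivity)
  rw [← h1]
  field_simp

lemma inner_annihilateReg_left (h : 𝔥) (x y : Fock ι) :
    inner ℂ (annihilateReg b h y) (numberInv 1 x) = inner ℂ (numberInv 1 y) (createReg b h x) := by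
  have h1 := congrArg (starRingEnd ℂ) (inner_createReg_left b h y x)
  rw [fock_inner_conj_symm, fock_inner_conj_symm] at h1
  exact h1.symm

lemma inner_smul_add_smul_add {E : Type*} [NormedAddCommGroup E] [InnerProductSpace ℂ E] (r : ℝ)
    {x₁ x₂ y y' x₁' x₂' : E} (h₁ : inner ℂ x₁ y = inner ℂ y' x₁')
    (h₂ : inner ℂ x₂ y = inner ℂ y' x₂') :
    inner ℂ ((r : ℂ)⁻¹ • (x₁ + x₂)) y = inner ℂ y' ((r : ℂ)⁻¹ • (x₂' + x₁')) := by
  rw [inner_smul_left, inner_smul_right, inner_add_left, inner_add_right, h₁, h₂, map_inv₀,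
    Complex.conj_ofReal, add_comm]

lemma inner_fieldReg_left (h : 𝔥) (x y : Fock ι) :
    inner ℂ (fieldReg b h y) (numberInv 1 x) = inner ℂ (numberInv 1 y) (fieldReg b h x) :=
  inner_smul_add_smul_add _ (inner_createReg_left b h x y) (inner_annihilateReg_left b h x y)

lemma annihilateReg_coherent (h g : 𝔥) :
    annihilateReg b h (coherent b 1 g) = inner ℂ h g • coherent b 0 g := by
  refine fock_ext fun l => ?_
  rw [fockCoord_annihilateReg, numberInv_coherent, annihilationCoord, ← legCLM_apply, coherent,
    legCLM_expVec, inner_smul_right, fockCoord_smul, fockCoord_expVec, expWeight, expWeight]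
  have h1 : ((Real.sqrt (l.length + 1) : ℝ) : ℂ) ≠ 0 := by
    rw [Complex.ofReal_ne_zero]
    exact Real.sqrt_ne_zero'.mpr (by positivity)
  have h2 := sqrt_factorial_ne_zero l.length
  have h3 : ((Real.sqrt ((l.length + 1).factorial) : ℝ) : ℂ) =
      ((Real.sqrt (l.length + 1) : ℝ) : ℂ) * ((Real.sqrt l.length.factorial : ℝ) : ℂ) := by
    rw [Nat.factorial_succ, Nat.cast_mul, Real.sqrt_mul (by positivity)]
    push_cast; rfl
  rw [h3]
  field_simp

lemma inner_coherent_fieldReg (h f g : 𝔥) :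
    inner ℂ (coherent b 0 f) (fieldReg b h (coherent b 1 g)) =
      ((Real.sqrt 2 : ℝ) : ℂ)⁻¹ * (inner ℂ f h + inner ℂ h g) * Complex.exp (inner ℂ f g) := by
  have h1 : inner ℂ (coherent b 0 f) (createReg b h (coherent b 1 g)) =
      inner ℂ f h * Complex.exp (inner ℂ f g) := by
    rw [← numberInv_coherent b 1 f, ← inner_annihilateReg_left, annihilateReg_coherent,
      numberInv_coherent, ← inner_coherent b f g]
    rw [fock_inner_smul_left, inner_conj_symm]
  have h2 : inner ℂ (coherent b 0 f) (annihilateReg b h (coherent b 1 g)) =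
      inner ℂ h g * Complex.exp (inner ℂ f g) := by
    rw [annihilateReg_coherent, ← inner_coherent b f g]
    exact fock_inner_smul_right _ _ _
  rw [fieldReg, smul_apply, add_apply, fock_inner_smul_right, fock_inner_add_right, h1, h2]
  ring

/-- The parameter of the displacement operator equal to `W(h)`. -/
noncomputable def weylShift (h : 𝔥) : 𝔥 := (Complex.I * ((Real.sqrt 2 : ℝ) : ℂ)⁻¹) • h

lemma inner_displacement_coherent (k f g : 𝔥) :
    inner ℂ (coherent b 0 f) (displacement b k (coherent b 0 g)) =
      Complex.exp (-((‖k‖ : ℂ) ^ 2) / 2 - inner ℂ k g + inner ℂ f g + inner ℂ f k) := by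
  rw [displacement_coherent]
  rw [fock_inner_smul_right, inner_coherent, displacementFactor, ← Complex.exp_add, inner_add_right, add_assoc]

/-- Between exponential vectors the matrix elements of D(tk) are exponentials of a quadratic
polynomial in t. For k = ih/√2 its linear coefficient is i times the symbol of φ(h). -/
lemma coherent_mem_generatorGraph (h g : 𝔥) :
    (coherent b 0 g, fieldReg b h (coherent b 1 g)) ∈
      generatorGraph fun t : ℝ => displacement b ((t : ℂ) • weylShift h) := by
  refine (isUnitaryGroup_displacement b (weylShift h)).mem_generatorGraph_of_weak
    (dense_span_smul_coherent b) ?_ ?_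
  · rintro _ ⟨c, g, rfl⟩ t
    rw [map_smul, displacement_coherent, smul_smul]
    exact ⟨_, _, rfl⟩
  · rintro _ ⟨c, f, rfl⟩
    have e1 : ∀ y : Fock ι, inner ℂ (c • coherent b 0 f) y =
      starRingEnd ℂ c * inner ℂ (coherent b 0 f) y := fun y => fock_inner_smul_left _ _ _
    simp only [e1, inner_displacement_coherent, inner_coherent_fieldReg]
    rw [mul_left_comm]
    refine HasDerivAt.const_mul _ ?_
    set k := weylShift h with hk
    have e2 : ∀ t : ℝ, -((‖(t : ℂ) • k‖ : ℂ) ^ 2) / 2 - inner ℂ ((t : ℂ) • k) g + inner ℂ f g +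
        inner ℂ f ((t : ℂ) • k) = -((‖k‖ : ℂ) ^ 2) / 2 * (t : ℂ) ^ 2 +
          (inner ℂ f k - inner ℂ k g) * (t : ℂ) + inner ℂ f g := by
      intro t
      rw [norm_smul, inner_smul_left, inner_smul_right, Complex.conj_ofReal, Complex.norm_real,
        Complex.ofReal_mul, mul_pow, ← Complex.ofReal_pow, Real.norm_eq_abs, sq_abs]
      push_cast
      ring
    simp only [e2]
    have d0 : HasDerivAt (fun t : ℝ => (t : ℂ)) 1 0 := Complex.ofRealCLM.hasDerivAt
    have d1 := ((((d0.fun_pow 2).const_mul (-((‖k‖ : ℂ) ^ 2) / 2)).add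
      (d0.const_mul (inner ℂ f k - inner ℂ k g))).add_const (inner ℂ f g)).cexp
    refine d1.congr_deriv ?_
    have e3 : inner ℂ f k = Complex.I * ((Real.sqrt 2 : ℝ) : ℂ)⁻¹ * inner ℂ f h := by
      rw [hk, weylShift, inner_smul_right]
    have e4 : inner ℂ k g = -Complex.I * ((Real.sqrt 2 : ℝ) : ℂ)⁻¹ * inner ℂ h g := by
      rw [hk, weylShift, inner_smul_left, map_mul, map_inv₀, Complex.conj_ofReal, Complex.conj_I]
    rw [e3, e4]
    simp
    ring

lemma displacement_smul_coherent_mem (h : 𝔥) :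
    ∀ z ∈ {z : Fock ι | ∃ (c : ℂ) (g : 𝔥), z = c • coherent b 0 g}, ∀ t : ℝ,
      displacement b ((t : ℂ) • weylShift h) z ∈
        {z : Fock ι | ∃ (c : ℂ) (g : 𝔥), z = c • coherent b 0 g} := by
  rintro _ ⟨c, g, rfl⟩ t
  rw [map_smul, displacement_coherent, smul_smul]
  exact ⟨_, _, rfl⟩

/-- φ(h) is symmetric on the range of (N+1)⁻¹ and agrees with the generator on the exponential
vectors. These are total and, up to scalars, invariant, so the adjoint criterion applies. -/
lemma numberInv_fieldReg_mem_generatorGraph (h : 𝔥) (x : Fock ι) :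
    (numberInv 1 x, fieldReg b h x) ∈
      generatorGraph fun t : ℝ => displacement b ((t : ℂ) • weylShift h) := by
  refine (isUnitaryGroup_displacement b (weylShift h)).mem_generatorGraph_of_adjoint
    (dense_span_smul_coherent b) (displacement_smul_coherent_mem b h) ?_
  rintro _ ⟨c, g, rfl⟩
  refine ⟨c • fieldReg b h (coherent b 1 g),
    Submodule.smul_mem _ c (coherent_mem_generatorGraph b h g), ?_⟩
  rw [fock_inner_smul_left, fock_inner_smul_left, inner_fieldReg_left, numberInv_coherent]

/-- The truncation `1_{N ≤ n} x`. -/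
noncomputable def truncate (n : ℕ) : Fock ι →L[ℂ] Fock ι :=
  numberMul (fun m => if m ≤ n then 1 else 0) (M := 1) (fun m => by split_ifs <;> simp)

@[simp] lemma fockCoord_truncate (n : ℕ) (u : Fock ι) (l : List ι) :
    fockCoord (truncate n u) l = if l.length ≤ n then fockCoord u l else 0 := by
  rw [truncate, fockCoord_numberMul]
  split_ifs <;> simp

lemma isFinParticle_of_fockCoord {n : ℕ} {u : Fock ι} (h : ∀ l, n < l.length → fockCoord u l = 0) :
    IsFinParticle u := by
  refine ⟨n, fock_ext fun l => ?_⟩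
  rw [fockCoord_numberProj]
  split_ifs with hl
  · rfl
  · exact (h l (by simpa using hl)).symm

lemma tendsto_truncate (u : Fock ι) : Tendsto (fun n => truncate n u) atTop (𝓝 u) := by
  rw [tendsto_iff_norm_sub_tendsto_zero]
  have h1 : Tendsto (fun n => ∑' l, ‖fockCoord (truncate n u - u) l‖ ^ 2) atTop
      (𝓝 (∑' _ : List ι, 0)) := by
    refine tendsto_tsum_of_dominated_convergence (summable_norm_sq_fockCoord u) (fun l => ?_)
      (Eventually.of_forall fun n l => ?_)
    · refine tendsto_const_nhds.congr' ?_
      filter_upwards [eventually_ge_atTop l.length] with n hn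
      simp [hn]
    · rw [fockCoord_sub, fockCoord_truncate]
      split_ifs <;> simp
  have h2 : ∀ v : Fock ι, ∑' l, ‖fockCoord v l‖ ^ 2 = ‖v‖ ^ 2 := by
    intro v
    have := (lp.hasSum_norm (p := 2) (by norm_num) (v : FullFock ι)).tsum_eq
    simpa [fockCoord] using this
  simp only [h2, tsum_zero] at h1
  simpa using h1.sqrt

/-- Finite particle vectors lie in the range of (N+1)⁻¹, hence in the domain of the generator.
Conversely the exponential vectors form a core, and their truncations converge in the graph norm
because φ(h)(N+1)⁻¹ is bounded. -/
lemma fieldOp_span_eq (h : 𝔥) : (Submodule.span ℂ {x : Fock ι × Fock ι | IsFinParticle x.1 ∧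
    ∀ l, fockCoord x.2 l = ((Real.sqrt 2 : ℝ) : ℂ)⁻¹ *
      (creationCoord b h x.1 l + annihilationCoord b h x.1 l)}).topologicalClosure =
    generatorGraph fun t : ℝ => displacement b ((t : ℂ) • weylShift h) := by
  have hU := isUnitaryGroup_displacement b (weylShift h)
  have hfin : ∀ x : Fock ι, (∀ l, fockCoord (fieldReg b h x) l = ((Real.sqrt 2 : ℝ) : ℂ)⁻¹ *
      (creationCoord b h (numberInv 1 x) l + annihilationCoord b h (numberInv 1 x) l)) := by
    intro x l
    rw [fieldReg, smul_apply, add_apply, fockCoord_smul, fockCoord_add, fockCoord_createReg,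
      fockCoord_annihilateReg]
  have hcoh : ∀ z ∈ {z : Fock ι | ∃ (c : ℂ) (g : 𝔥), z = c • coherent b 0 g}, ∃ x : Fock ι,
      z = numberInv 1 x := by
    rintro _ ⟨c, g, rfl⟩
    exact ⟨c • coherent b 1 g, by rw [map_smul, numberInv_coherent]⟩
  refine le_antisymm ?_ ?_
  · refine Submodule.topologicalClosure_minimal _ (Submodule.span_le.mpr ?_)
      hU.isClosed_generatorGraph
    · rintro ⟨u, v⟩ ⟨⟨n, hn⟩, hv⟩
      simp only at hn hv
      have hu0 : ∀ l : List ι, n < l.length → fockCoord u l = 0 := fun l hl => by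
        rw [← hn, fockCoord_numberProj, if_neg (by simpa using hl)]
      have hux : ∃ x : Fock ι, u = numberInv 1 x := by
        refine ⟨numberMul (fun m => if m ≤ n then (m : ℂ) + 1 else 0) (M := n + 1)
          (fun m => ?_) u, fock_ext fun l => ?_⟩
        · split_ifs with hm
          · rw [norm_natCast_add_one]
            have : (m : ℝ) ≤ n := by exact_mod_cast hm
            linarith
          · rw [norm_zero]; positivity
        · rw [fockCoord_numberInv, fockCoord_numberMul]
          by_cases hl : l.length ≤ n
          · rw [if_pos hl]
            have := natCast_add_one_ne_zero l.length
            field_simp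
          · rw [hu0 l (not_le.mp hl)]
            simp
      obtain ⟨x, rfl⟩ := hux
      have : v = fieldReg b h x := fock_ext fun l => by rw [hv, hfin]
      rw [this]
      exact numberInv_fieldReg_mem_generatorGraph b h x
  · refine hU.generatorGraph_le_of_core (dense_span_smul_coherent b)
      (displacement_smul_coherent_mem b h) (Submodule.isClosed_topologicalClosure _) fun z hz => ?_
    obtain ⟨x, rfl⟩ := hcoh z hz
    refine ⟨fieldReg b h x, numberInv_fieldReg_mem_generatorGraph b h x, ?_⟩
    have h1 : Tendsto (fun n => (numberInv 1 (truncate n x), fieldReg b h (truncate n x))) atTop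
        (𝓝 (numberInv 1 x, fieldReg b h x)) :=
      (((numberInv 1).continuous.tendsto x).comp (tendsto_truncate x)).prodMk_nhds
        (((fieldReg b h).continuous.tendsto x).comp (tendsto_truncate x))
    refine mem_closure_of_tendsto h1 (Eventually.of_forall fun n => Submodule.subset_span ⟨?_, ?_⟩)
    · refine isFinParticle_of_fockCoord (n := n) fun l hl => ?_
      simp [not_le.mpr hl]
    · exact hfin _

/-- `Submodule.toLinearPMap` returns the given subspace only if (0, v) in it forces v = 0. This is
inherited from the generator. -/
lemma graph_fieldOp (h : 𝔥) : (fieldOp b h).graph =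
    generatorGraph fun t : ℝ => displacement b ((t : ℂ) • weylShift h) := by
  rw [fieldOp, Submodule.toLinearPMap_graph_eq, fieldOp_span_eq]
  rintro ⟨u, v⟩ huv hu
  rw [fieldOp_span_eq] at huv
  simp only at hu
  subst hu
  have h1 := mem_generatorGraph.mp huv
  simp only [map_zero] at h1
  have h2 := h1.unique (hasDerivAt_const _ _)
  simpa using h2

lemma dense_numberInv (d : ℕ) : DenseRange (numberInv d : Fock ι → Fock ι) := by
  intro u
  have h1 := tendsto_truncate u
  refine mem_closure_of_tendsto h1 (Eventually.of_forall fun n => ?_)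
  refine ⟨numberMul (fun m => if m ≤ n then ((m : ℂ) + 1) ^ d else 0) (M := (n + 1) ^ d)
    (fun m => ?_) u, fock_ext fun l => ?_⟩
  · split_ifs with hm
    · rw [norm_pow, norm_natCast_add_one]
      have : (m : ℝ) ≤ n := by exact_mod_cast hm
      gcongr
    · rw [norm_zero]; positivity
  · rw [fockCoord_numberInv, fockCoord_numberMul, fockCoord_truncate]
    have := natCast_add_one_ne_zero l.length
    split_ifs
    · field_simp
    · simp

theorem weylOp_eq_displacement (h : 𝔥) : weylOp b h = displacement b (weylShift h) := by
  have h1 := isUnitaryGroupOf_of_generatorGraph_eq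
    (isUnitaryGroup_displacement b (weylShift h)) (graph_fieldOp b h).symm
  have h2 := h1.expI_eq ((dense_numberInv 1).mono (by
    rintro _ ⟨x, rfl⟩
    exact ⟨fieldReg b h x, by
      rw [graph_fieldOp]; exact numberInv_fieldReg_mem_generatorGraph b h x⟩))
  rw [weylOp, h2]
  simp

lemma weylOp_mem_unitary (h : 𝔥) : weylOp b h ∈ unitary (Fock ι →L[ℂ] Fock ι) := by
  rw [weylOp_eq_displacement]
  exact displacement_mem_unitary b _

lemma weylOp_mul (h g : 𝔥) : weylOp b h * weylOp b g =
    Complex.exp (-Complex.I * (1 / 2) * ((inner ℂ h g).im : ℂ)) • weylOp b (h + g) := by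
  rw [weylOp_eq_displacement, weylOp_eq_displacement, weylOp_eq_displacement, displacement_mul]
  have h1 : weylShift h + weylShift g = weylShift (h + g) := (smul_add _ _ _).symm
  have h2 : inner ℂ (weylShift h) (weylShift g) = ((1 / 2 : ℝ) : ℂ) * inner ℂ h g := by
    rw [weylShift, weylShift, inner_smul_left, inner_smul_right, map_mul, map_inv₀,
      Complex.conj_ofReal, Complex.conj_I]
    have h3 : ((Real.sqrt 2 : ℝ) : ℂ)⁻¹ * ((Real.sqrt 2 : ℝ) : ℂ)⁻¹ = ((1 / 2 : ℝ) : ℂ) := by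
      rw [← mul_inv, ← Complex.ofReal_mul, Real.mul_self_sqrt (by norm_num)]
      norm_num
    rw [← h3]
    linear_combination (-((Real.sqrt 2 : ℝ) : ℂ)⁻¹ * ((Real.sqrt 2 : ℝ) : ℂ)⁻¹ * inner ℂ h g) *
      Complex.I_mul_I
  rw [h1, h2, Complex.im_ofReal_mul]
  congr 2
  push_cast
  ring

/-- Mean value inequality along t ↦ W(th), whose derivative is W(th) iφ(h). It is the source of all
continuity in h. -/
lemma norm_weylOp_numberInv_sub_le (h : 𝔥) (x : Fock ι) :
    ‖weylOp b h (numberInv 1 x) - numberInv 1 x‖ ≤ 2 * ‖h‖ * ‖x‖ := by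
  have hU := isUnitaryGroup_displacement b (weylShift h)
  have h1 := hU.hasDerivAt (numberInv_fieldReg_mem_generatorGraph b h x)
  have h2 := norm_image_sub_le_of_norm_deriv_le_segment_01'
    (f := fun t : ℝ => displacement b ((t : ℂ) • weylShift h) (numberInv 1 x))
    (f' := fun t : ℝ => displacement b ((t : ℂ) • weylShift h) (Complex.I • fieldReg b h x))
    (C := 2 * ‖h‖ * ‖x‖) (fun t _ => (h1 t).hasDerivWithinAt) (fun t _ => by
      rw [norm_map_of_mem_unitary (displacement_mem_unitary b _), norm_smul, Complex.norm_I,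
        one_mul]
      exact (fieldReg b h).le_of_opNorm_le (norm_fieldReg_le b h) x)
  rw [weylOp_eq_displacement]
  simpa [displacement_zero] using h2

end Field

/-! ### Symmetrization over permutations -/

section Symmetrization

variable {ι : Type*}

lemma sum_permutations_finRange (n : ℕ) (G : List (Fin n) → ℂ) :
    ((List.finRange n).permutations.map G).sum = ∑ σ : Equiv.Perm (Fin n), G (List.ofFn σ) := by
  classical
  rw [← List.sum_toFinset G (List.nodup_permutations _ (List.nodup_finRange n))]
  symm
  refine Finset.sum_bij (fun σ _ => List.ofFn σ) (fun σ _ => ?_) (fun σ _ τ _ h => ?_)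
    (fun p hp => ?_) (fun _ _ => rfl)
  · rw [List.mem_toFinset, List.mem_permutations, ← List.ofFn_id]
    exact Equiv.Perm.ofFn_comp_perm σ id
  · exact Equiv.coe_fn_injective (List.ofFn_injective h)
  · rw [List.mem_toFinset, List.mem_permutations] at hp
    have hn : p.length = n := by rw [hp.length_eq, List.length_finRange]
    have hi : Function.Injective fun i : Fin n => p.get (i.cast hn.symm) :=
      (List.nodup_iff_injective_get.mp (hp.nodup_iff.mpr (List.nodup_finRange n))).comp
        (Fin.cast_injective _)
    refine ⟨Equiv.ofBijective _ (Finite.injective_iff_bijective.mp hi), Finset.mem_univ _, ?_⟩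
    exact List.ext_getElem (by simp [hn]) (by simp)

lemma symmetrize_ofFn {n : ℕ} (F : List ι → ℂ) (x : Fin n → ι) :
    symmetrize F (List.ofFn x) =
      (n.factorial : ℂ)⁻¹ * ∑ σ : Equiv.Perm (Fin n), F (List.ofFn (x ∘ σ)) := by
  rw [symmetrize, List.length_ofFn, List.ofFn_eq_map, ← List.map_permutations, List.map_map,
    sum_permutations_finRange]
  congr 1
  refine Finset.sum_congr rfl fun σ _ => ?_
  simp [List.map_ofFn]

lemma symmetrize_perm (F : List ι → ℂ) {l l' : List ι} (h : l.Perm l') :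
    symmetrize F l = symmetrize F l' := by
  rw [symmetrize, symmetrize, h.length_eq, (h.permutations.map F).sum_eq]

lemma hasSum_ofFn_iff {n : ℕ} {G : List ι → ℂ} {s : ℂ} :
    HasSum (fun l : List ι => if l.length = n then G l else 0) s ↔
      HasSum (fun x : Fin n → ι => G (List.ofFn x)) s := by
  rw [← (List.ofFn_injective (n := n)).hasSum_iff (f := fun l : List ι => if l.length = n then G l else 0)]
  · simp [Function.comp_def]
  · intro l hl
    rw [if_neg]
    rintro rfl
    exact hl ⟨l.get, List.ofFn_get l⟩

/-- Symmetrization is irrelevant in an inner product with a symmetric vector. -/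
lemma inner_eq_of_symmetrize {v y : Fock ι} {F : List ι → ℂ} {S : ℂ}
    (hy : ∀ l, fockCoord y l = symmetrize F l)
    (hS : HasSum (fun l => starRingEnd ℂ (fockCoord v l) * F l) S) : inner ℂ v y = S := by
  have h0 : ∀ n : ℕ, Summable fun l : List ι =>
      if l.length = n then starRingEnd ℂ (fockCoord v l) * F l else 0 := fun n => by
    refine (hS.summable.indicator {l : List ι | l.length = n}).congr fun l => ?_
    simp [Set.indicator_apply]
  have h1 := hasSum_by_length hS fun n => (h0 n).hasSum
  refine (hasSum_by_length (fock_hasSum_inner v y) fun n => ?_).unique h1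
  have h2 := (h0 n).hasSum
  rw [hasSum_ofFn_iff] at h2 ⊢
  -- Permuting the n positions reindexes the sum and leaves the symmetric factor `v` unchanged, so
  -- averaging over the n! permutations changes nothing.
  have h3 : ∀ σ : Equiv.Perm (Fin n), HasSum (fun x : Fin n → ι =>
      starRingEnd ℂ (fockCoord v (List.ofFn x)) * F (List.ofFn (x ∘ σ)))
      (∑' l : List ι, if l.length = n then starRingEnd ℂ (fockCoord v l) * F l else 0) := by
    intro σ
    have h4 := (σ.symm.arrowCongr (Equiv.refl ι)).hasSum_iff.mpr h2
    refine h4.congr_fun fun x => ?_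
    have h5 : (σ.symm.arrowCongr (Equiv.refl ι)) x = x ∘ σ := by
      ext i; simp
    simp only [Function.comp_apply, h5]
    rw [fockCoord_perm v (Equiv.Perm.ofFn_comp_perm σ x)]
  have h6 := (hasSum_sum (s := Finset.univ) fun σ _ => h3 σ).mul_left (n.factorial : ℂ)⁻¹
  rw [Finset.sum_const, Finset.card_univ, Fintype.card_perm, Fintype.card_fin, nsmul_eq_mul,
    inv_mul_cancel_left₀ (by exact_mod_cast n.factorial_ne_zero)] at h6
  refine h6.congr_fun fun x => ?_
  rw [hy, symmetrize_ofFn, mul_left_comm, Finset.mul_sum]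

end Symmetrization

/-! ### Second quantization of the free dynamics -/

section SecondQuantization

variable {ι 𝔥 : Type*} [NormedAddCommGroup 𝔥] [InnerProductSpace ℂ 𝔥] [CompleteSpace 𝔥]
  (b : HilbertBasis ι ℂ 𝔥)

lemma exists_secondQuant {S : 𝔥 →L[ℂ] 𝔥} (hS : S ∈ unitary (𝔥 →L[ℂ] 𝔥)) :
    ∃ T : Fock ι →L[ℂ] Fock ι, (∀ g, T (coherent b 0 g) = coherent b 0 (S g)) ∧
      ∀ u v, inner ℂ (T u) (T v) = inner ℂ u v :=
  exists_isometry_of_gram (dense_span_coherent b 0) fun f g => by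
    rw [inner_coherent, inner_coherent, inner_map_of_mem_unitary hS]

open Classical in
/-- The second quantization `Γ(S)` of a unitary operator: `Γ(S) e(g) = e(S g)`. -/
noncomputable def secondQuant (S : 𝔥 →L[ℂ] 𝔥) : Fock ι →L[ℂ] Fock ι :=
  if hS : S ∈ unitary (𝔥 →L[ℂ] 𝔥) then (exists_secondQuant b hS).choose else 0

lemma secondQuant_coherent {S : 𝔥 →L[ℂ] 𝔥} (hS : S ∈ unitary (𝔥 →L[ℂ] 𝔥)) (g : 𝔥) :
    secondQuant b S (coherent b 0 g) = coherent b 0 (S g) := by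
  rw [secondQuant, dif_pos hS]
  exact (exists_secondQuant b hS).choose_spec.1 g

lemma inner_secondQuant {S : 𝔥 →L[ℂ] 𝔥} (hS : S ∈ unitary (𝔥 →L[ℂ] 𝔥)) (u v : Fock ι) :
    inner ℂ (secondQuant b S u) (secondQuant b S v) = inner ℂ u v := by
  rw [secondQuant, dif_pos hS]
  exact (exists_secondQuant b hS).choose_spec.2 u v

lemma secondQuant_mul {S T : 𝔥 →L[ℂ] 𝔥} (hS : S ∈ unitary (𝔥 →L[ℂ] 𝔥))
    (hT : T ∈ unitary (𝔥 →L[ℂ] 𝔥)) :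
    secondQuant b S * secondQuant b T = secondQuant b (S * T) := by
  refine clm_ext_of_dense_span (dense_span_coherent b 0) ?_
  rintro _ ⟨g, rfl⟩
  rw [mul_apply_eq_comp, secondQuant_coherent b hT, secondQuant_coherent b hS,
    secondQuant_coherent b (mul_mem hS hT)]
  rfl

lemma secondQuant_one : secondQuant b (1 : 𝔥 →L[ℂ] 𝔥) = 1 := by
  refine clm_ext_of_dense_span (dense_span_coherent b 0) ?_
  rintro _ ⟨g, rfl⟩
  rw [secondQuant_coherent b (one_mem _)]
  rfl

lemma isUnitaryGroup_secondQuant {U : ℝ → 𝔥 →L[ℂ] 𝔥} (hU : IsUnitaryGroup U) :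
    IsUnitaryGroup fun t => secondQuant b (U t) := by
  have hmul : ∀ s t, secondQuant b (U s) * secondQuant b (U t) = secondQuant b (U (s + t)) :=
    fun s t => by rw [secondQuant_mul b (hU.mem_unitary s) (hU.mem_unitary t), hU.add]
  have h0 : secondQuant b (U 0) = 1 := by rw [hU.zero, secondQuant_one]
  have hmem : ∀ t, secondQuant b (U t) ∈ unitary (Fock ι →L[ℂ] Fock ι) := fun t =>
    mem_unitary_of_inner_of_mul_eq_one (T := secondQuant b (U (-t)))
      (inner_secondQuant b (hU.mem_unitary t)) (by rw [hmul, add_neg_cancel, h0])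
  refine ⟨hmem, h0, fun s t => (hmul s t).symm, ?_⟩
  refine continuous_apply_of_dense_span (M := 1) (fun t => ?_) (dense_span_coherent b 0) ?_
  · exact ContinuousLinearMap.opNorm_le_bound _ zero_le_one fun u => by
      rw [norm_map_of_mem_unitary (hmem t), one_mul]
  · rintro _ ⟨g, rfl⟩
    simp only [secondQuant_coherent b (hU.mem_unitary _)]
    exact (continuous_coherent b).comp (hU.continuous g)

lemma secondQuant_mul_displacement {S : 𝔥 →L[ℂ] 𝔥} (hS : S ∈ unitary (𝔥 →L[ℂ] 𝔥)) (k : 𝔥) :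
    secondQuant b S * displacement b k = displacement b (S k) * secondQuant b S := by
  refine clm_ext_of_dense_span (dense_span_coherent b 0) ?_
  rintro _ ⟨g, rfl⟩
  rw [mul_apply_eq_comp, mul_apply_eq_comp, displacement_coherent, map_smul,
    secondQuant_coherent b hS, secondQuant_coherent b hS, displacement_coherent, map_add,
    displacementFactor, displacementFactor, inner_map_of_mem_unitary hS,
    norm_map_of_mem_unitary hS]

lemma secondQuant_mul_weylOp {S : 𝔥 →L[ℂ] 𝔥} (hS : S ∈ unitary (𝔥 →L[ℂ] 𝔥)) (h : 𝔥) :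
    secondQuant b S * weylOp b h = weylOp b (S h) * secondQuant b S := by
  rw [weylOp_eq_displacement, weylOp_eq_displacement, secondQuant_mul_displacement b hS,
    weylShift, weylShift, map_smul]

lemma hasSum_coherent_tensorCoord (g : 𝔥) (F : List 𝔥) :
    HasSum (fun l => starRingEnd ℂ (fockCoord (coherent b 0 g) l) * tensorCoord b F l)
      (starRingEnd ℂ (expWeight 0 F.length) * (F.map fun f => inner ℂ g f).prod) := by
  refine ((hasSum_powCoord_tensorCoord b g F).2.mul_left _).congr_fun fun l => ?_
  rw [fockCoord_coherent, map_mul]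
  by_cases h : F.length = l.length
  · rw [h, mul_assoc]
  · rw [tensorCoord_of_ne b h]
    simp

lemma hasDerivAt_list_prod {U : ℝ → 𝔥 →L[ℂ] 𝔥} (hU : IsUnitaryGroup U) {ω : 𝔥 →ₗ.[ℂ] 𝔥}
    (hω : ω.graph ≤ generatorGraph U) (g : 𝔥) (f : List ω.domain) :
    HasDerivAt (fun t : ℝ => ((f.map (↑)).map fun x : 𝔥 => (inner ℂ g (U t x) : ℂ)).prod)
      (∑ j : Fin f.length, Complex.I *
        ((((f.map (↑)).set j (ω (f.get j))).map fun x : 𝔥 => (inner ℂ g x : ℂ)).prod)) 0 := by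
  induction f with
  | nil => simpa using hasDerivAt_const (0 : ℝ) (1 : ℂ)
  | cons a f ih =>
    simp only [List.map_cons, List.prod_cons]
    have h1 : HasDerivAt (fun t : ℝ => (inner ℂ g (U t (a : 𝔥)) : ℂ))
        (inner ℂ g (Complex.I • ω a)) 0 := by
      have h2 := mem_generatorGraph.mp (hω (ω.mem_graph a))
      have h3 := HasDerivAt.inner ℂ (hasDerivAt_const (0 : ℝ) g) h2
      rwa [inner_zero_left, add_zero] at h3
    refine (h1.mul ih).congr_deriv ?_
    simp only [hU.zero, one_apply_eq_self]
    change _ = ∑ j : Fin (f.length + 1), _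
    rw [Fin.sum_univ_succ]
    simp only [Fin.val_zero, List.set_cons_zero, List.map_cons, List.prod_cons, Fin.val_succ,
      List.set_cons_succ, Finset.mul_sum]
    rw [inner_smul_right]
    congr 1
    · simp [mul_assoc]
    · refine Finset.sum_congr rfl fun j _ => ?_
      rw [mul_left_comm]
      rfl

/-- Against an exponential vector of g, a symmetrized product tensor gives a constant times ∏
(g|f_j). The sum over j in dΓ(ω) is the product rule for t ↦ ∏ (g|U_t f_j). -/
lemma dGamma_span_le {U : ℝ → 𝔥 →L[ℂ] 𝔥} (hU : IsUnitaryGroup U) {ω : 𝔥 →ₗ.[ℂ] 𝔥}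
    (hω : ω.graph ≤ generatorGraph U) :
    Submodule.span ℂ {x : Fock ι × Fock ι | ∃ f : List ω.domain,
      (∀ l, fockCoord x.1 l = symmetrize (tensorCoord b (f.map (↑))) l) ∧
      ∀ l, fockCoord x.2 l = symmetrize (fun l' =>
        ∑ j : Fin f.length, tensorCoord b ((f.map (↑)).set j (ω (f.get j))) l') l} ≤
    generatorGraph fun t => secondQuant b (U t) := by
  refine Submodule.span_le.mpr ?_
  rintro ⟨x, y⟩ ⟨f, hx, hy⟩
  simp only at hx hy
  have hΓ := isUnitaryGroup_secondQuant b hU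
  have h1 : ∀ g, inner ℂ (coherent b 0 g) x = starRingEnd ℂ (expWeight 0 f.length) *
      ((f.map (↑)).map fun z : 𝔥 => (inner ℂ g z : ℂ)).prod := by
    intro g
    have := inner_eq_of_symmetrize hx (hasSum_coherent_tensorCoord b g _)
    rwa [List.length_map] at this
  have h2 : ∀ g, inner ℂ (coherent b 0 g) y = ∑ j : Fin f.length,
      starRingEnd ℂ (expWeight 0 f.length) *
        (((f.map (↑)).set j (ω (f.get j))).map fun z : 𝔥 => (inner ℂ g z : ℂ)).prod := by
    intro g
    refine inner_eq_of_symmetrize hy ?_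
    simp only [Finset.mul_sum]
    refine hasSum_sum fun j _ => ?_
    have := hasSum_coherent_tensorCoord b g ((f.map (↑)).set j (ω (f.get j)))
    rwa [List.length_set, List.length_map] at this
  refine hΓ.mem_generatorGraph_of_weak (dense_span_smul_coherent b) ?_ ?_
  · rintro _ ⟨c, g, rfl⟩ t
    rw [map_smul, secondQuant_coherent b (hU.mem_unitary t)]
    exact ⟨_, _, rfl⟩
  · rintro _ ⟨c, g, rfl⟩
    simp only [fock_inner_smul_left]
    rw [mul_left_comm]
    refine HasDerivAt.const_mul _ ?_
    have h3 : ∀ t, inner ℂ (coherent b 0 g) (secondQuant b (U t) x) =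
        starRingEnd ℂ (expWeight 0 f.length) *
          ((f.map (↑)).map fun z : 𝔥 => (inner ℂ g (U t z) : ℂ)).prod := by
      intro t
      rw [hΓ.inner_apply_right, secondQuant_coherent b (hU.mem_unitary _), h1]
      simp only [hU.inner_apply_right]
    simp only [h3, h2, Finset.mul_sum]
    refine ((hasDerivAt_list_prod hU hω g f).const_mul _).congr_deriv ?_
    rw [Finset.mul_sum]
    exact Finset.sum_congr rfl fun j _ => by ring

/-- The inclusion is enough: Cook's argument differentiates Γ only along vectors already known to
lie in D(H₀). -/
lemma dGamma_graph_le {U : ℝ → 𝔥 →L[ℂ] 𝔥} (hU : IsUnitaryGroup U) {ω : 𝔥 →ₗ.[ℂ] 𝔥}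
    (hω : ω.graph ≤ generatorGraph U) :
    (dGamma b ω).graph ≤ generatorGraph fun t => secondQuant b (U t) := by
  have h1 := Submodule.topologicalClosure_minimal _ (dGamma_span_le b hU hω)
    (isUnitaryGroup_secondQuant b hU).isClosed_generatorGraph
  rw [dGamma, Submodule.toLinearPMap_graph_eq]
  · exact h1
  · rintro ⟨u, v⟩ huv hu
    have huv := h1 huv
    simp only at hu
    subst hu
    have h2 := mem_generatorGraph.mp huv
    simp only [map_zero] at h2
    simpa using h2.unique (hasDerivAt_const _ _)

end SecondQuantization

/-! ### Partial evaluations and sesquilinear Wick forms -/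

section Contraction

variable {ι : Type*}

lemma fockCoord_finset_sum {κ : Type*} (s : Finset κ) (z : κ → Fock ι) (l : List ι) :
    fockCoord (∑ i ∈ s, z i) l = ∑ i ∈ s, fockCoord (z i) l := by
  classical
  induction s using Finset.induction_on with
  | empty => simp
  | insert i s hi ih => rw [Finset.sum_insert hi, fockCoord_add, ih, Finset.sum_insert hi]

/-- Lists with a position at which they are split, and pairs of lists. -/
def splitEquiv (ι : Type*) : (Σ l : List ι, Fin (l.length + 1)) ≃ List ι × List ι where
  toFun x := (x.1.take x.2, x.1.drop x.2)
  invFun p := ⟨p.1 ++ p.2, ⟨p.1.length, by rw [List.length_append]; omega⟩⟩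
  left_inv x := by
    obtain ⟨l, q, hq⟩ := x
    refine Sigma.ext (List.take_append_drop q l) ?_
    refine (Fin.heq_ext_iff
      (congrArg (fun l => List.length l + 1) (List.take_append_drop q l))).mpr ?_
    simp only [List.length_take]
    omega
  right_inv p := by simp

lemma tsum_sum_split (f : List ι → List ι → ℝ≥0∞) :
    ∑' (c : List ι) (a : List ι), f a c =
      ∑' l : List ι, ∑ q : Fin (l.length + 1), f (l.take q) (l.drop q) := by
  rw [ENNReal.tsum_comm, ← ENNReal.tsum_prod (f := fun a c => f a c), ← (splitEquiv ι).tsum_eq,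
    ENNReal.tsum_sigma']
  exact tsum_congr fun l => tsum_fintype _

lemma hasSum_sum_split {f : List ι → List ι → ℂ} {S : ℂ}
    (hf : HasSum (fun p : List ι × List ι => f p.1 p.2) S) :
    HasSum (fun l : List ι => ∑ q : Fin (l.length + 1), f (l.take q) (l.drop q)) S :=
  ((splitEquiv ι).hasSum_iff.mpr hf).sigma fun _ => hasSum_fintype _

/-- Bounds for a family of weights supported on the first `d + 1` values of the first argument. -/
structure IsWickWeight (d : ℕ) (M : ℝ) (α : ℕ → ℕ → ℝ) : Prop where
  bound : ∀ p n, |α p n| ≤ M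
  support : ∀ p n, d < p → α p n = 0

lemma IsWickWeight.nonneg {d : ℕ} {M : ℝ} {α : ℕ → ℕ → ℝ} (h : IsWickWeight d M α) : 0 ≤ M :=
  (abs_nonneg _).trans (h.bound 0 0)

/-- A pair (a, c) is a list a ++ c with a cut. The weight vanishes unless a has at most d letters,
so each list has at most d + 1 relevant cuts. -/
lemma IsWickWeight.tsum_le {d : ℕ} {M : ℝ} {α : ℕ → ℕ → ℝ} (h : IsWickWeight d M α) (u : Fock ι) :
    ∑' (c : List ι) (a : List ι), ‖(α a.length c.length : ℂ) * fockCoord u (a ++ c)‖ₑ ^ 2 ≤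
      ENNReal.ofReal (M * (d + 1)) ^ 2 * ‖u‖ₑ ^ 2 := by
  rw [tsum_sum_split (fun a c => ‖(α a.length c.length : ℂ) * fockCoord u (a ++ c)‖ₑ ^ 2),
    fock_enorm_sq, ← ENNReal.tsum_mul_left]
  refine ENNReal.tsum_le_tsum fun l => ?_
  have h1 : ∀ q : Fin (l.length + 1),
      ‖(α (l.take q).length (l.drop q).length : ℂ) * fockCoord u (l.take q ++ l.drop q)‖ₑ ^ 2 ≤
        if (q : ℕ) < d + 1 then ENNReal.ofReal M ^ 2 * ‖fockCoord u l‖ₑ ^ 2 else 0 := by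
    intro q
    have hq : (l.take q).length = q := by
      rw [List.length_take]; have := q.2; omega
    rw [List.take_append_drop, hq]
    split_ifs with hqd
    · refine enorm_sq_le_of_norm_le h.nonneg ?_
      rw [norm_mul, Complex.norm_real]
      gcongr
      exact h.bound _ _
    · rw [h.support _ _ (by omega)]
      simp
  refine (Finset.sum_le_sum fun q _ => h1 q).trans ?_
  rw [Fin.sum_univ_eq_sum_range (fun q => if q < d + 1 then
    ENNReal.ofReal M ^ 2 * ‖fockCoord u l‖ₑ ^ 2 else 0), ← Finset.sum_filter, Finset.sum_const,
    nsmul_eq_mul, ENNReal.ofReal_mul h.nonneg, mul_pow, ← mul_assoc,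
    mul_comm _ (ENNReal.ofReal M ^ 2)]
  gcongr
  have h2 : ((Finset.range (l.length + 1)).filter (· < d + 1)).card ≤ d + 1 := by
    calc _ ≤ (Finset.range (d + 1)).card := Finset.card_le_card fun q hq => by
          rw [Finset.mem_filter] at hq
          exact Finset.mem_range.mpr hq.2
      _ = _ := Finset.card_range _
  have h3 : ENNReal.ofReal ((d : ℝ) + 1) = ((d + 1 : ℕ) : ℝ≥0∞) := by
    rw [← ENNReal.ofReal_natCast]; push_cast; rfl
  rw [h3]
  have h4 : d + 1 ≤ (d + 1) ^ 2 := Nat.le_self_pow two_ne_zero _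
  exact_mod_cast h2.trans h4

variable {d : ℕ} {M : ℝ} {α : ℕ → ℕ → ℝ}

/-- The weighted partial evaluation `(contract c u)(a) = α(|a|, |c|) u(a ++ c)`. -/
noncomputable def contract (h : IsWickWeight d M α) (c : List ι) : Fock ι →L[ℂ] Fock ι :=
  clmOfCoord (M := M * (d + 1))
    { toFun := fun u a => (α a.length c.length : ℂ) * fockCoord u (a ++ c)
      map_add' := fun u v => by ext; simp [mul_add]
      map_smul' := fun z u => by ext; simp; ring }
    (fun u a a' ha => by simp [ha.length_eq, fockCoord_perm u (ha.append_right c)])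
    (mul_nonneg h.nonneg (by positivity))
    (fun u => le_trans (ENNReal.le_tsum c) (h.tsum_le u))

@[simp] lemma fockCoord_contract (h : IsWickWeight d M α) (c : List ι) (u : Fock ι) (a : List ι) :
    fockCoord (contract h c u) a = (α a.length c.length : ℂ) * fockCoord u (a ++ c) := rfl

lemma tsum_contract_le (h : IsWickWeight d M α) (u : Fock ι) :
    ∑' c, ‖contract h c u‖ₑ ^ 2 ≤ ENNReal.ofReal (M * (d + 1)) ^ 2 * ‖u‖ₑ ^ 2 := by
  refine le_trans (le_of_eq (tsum_congr fun c => ?_)) (h.tsum_le u)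
  rw [fock_enorm_sq]
  simp

/-- A square summable family of bounded operators. -/
noncomputable def familyCLM (T : List ι → Fock ι →L[ℂ] Fock ι) {C : ℝ} (hC : 0 ≤ C)
    (hT : ∀ u, ∑' c, ‖T c u‖ₑ ^ 2 ≤ ENNReal.ofReal C ^ 2 * ‖u‖ₑ ^ 2) :
    Fock ι →L[ℂ] lp (fun _ : List ι => Fock ι) 2 :=
  LinearMap.mkContinuous
    { toFun := fun u => ⟨fun c => T c u,
        memlp_two_of_tsum (ne_top_of_le_ne_top (by finiteness) (hT u))⟩
      map_add' := fun u v => lp.ext (funext fun c => by simp; rfl)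
      map_smul' := fun z u => lp.ext (funext fun c => by simp) } C
    (fun u => norm_le_of_enorm_sq_le hC (by rw [lp_enorm_sq]; exact hT u))

lemma norm_familyCLM_le (T : List ι → Fock ι →L[ℂ] Fock ι) {C : ℝ} (hC : 0 ≤ C)
    (hT : ∀ u, ∑' c, ‖T c u‖ₑ ^ 2 ≤ ENNReal.ofReal C ^ 2 * ‖u‖ₑ ^ 2) :
    ‖familyCLM T hC hT‖ ≤ C := LinearMap.mkContinuous_norm_le _ hC _

/-- The operator is A*B for bounded maps A, B into the square summable families indexed by the
spectator list c. This realizes w ⊗ 1 without constructing the tensor product. -/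
lemma exists_wickForm {α β : ℕ → ℕ → ℝ} (hα : IsWickWeight d M α) (hβ : IsWickWeight d M β)
    (w : Fock ι →L[ℂ] Fock ι) : ∃ T : Fock ι →L[ℂ] Fock ι,
      (∀ v x, HasSum (fun c => inner ℂ (contract hα c v) (w (contract hβ c x)))
        (inner ℂ v (T x))) ∧ ‖T‖ ≤ (M * (d + 1)) ^ 2 * ‖w‖ := by
  have hC : 0 ≤ M * (d + 1) := mul_nonneg hα.nonneg (by positivity)
  have h2 : ∀ u, ∑' c, ‖(w ∘L contract hβ c) u‖ₑ ^ 2 ≤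
      ENNReal.ofReal (‖w‖ * (M * (d + 1))) ^ 2 * ‖u‖ₑ ^ 2 := by
    intro u
    calc _ ≤ ∑' c, ENNReal.ofReal ‖w‖ ^ 2 * ‖contract hβ c u‖ₑ ^ 2 :=
          ENNReal.tsum_le_tsum fun c =>
            enorm_sq_le_of_norm_le (norm_nonneg w) (w.le_opNorm _)
      _ ≤ _ := by
          rw [ENNReal.tsum_mul_left, ENNReal.ofReal_mul (norm_nonneg w), mul_pow, mul_assoc]
          gcongr
          exact tsum_contract_le hβ u
  set A := familyCLM (contract hα) hC (tsum_contract_le hα)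
  set B := familyCLM (fun c => w ∘L contract hβ c) (mul_nonneg (norm_nonneg w) hC) h2
  refine ⟨ContinuousLinearMap.adjoint A ∘L B, fun v x => ?_, ?_⟩
  · rw [ContinuousLinearMap.comp_apply, ContinuousLinearMap.adjoint_inner_right]
    exact lp.hasSum_inner (𝕜 := ℂ) (A v) (B x)
  · calc _ ≤ ‖ContinuousLinearMap.adjoint A‖ * ‖B‖ := ContinuousLinearMap.opNorm_comp_le _ _
      _ ≤ (M * (d + 1)) * (‖w‖ * (M * (d + 1))) := by
          rw [LinearIsometryEquiv.norm_map]
          exact mul_le_mul (norm_familyCLM_le _ _ _) (norm_familyCLM_le _ _ _)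
            (ContinuousLinearMap.opNorm_nonneg _) hC
      _ = _ := by ring

end Contraction

/-! ### Combinatorial weights of Wick monomials -/

section WickWeights

lemma factorial_div_le {d p : ℕ} (n : ℕ) (hp : p ≤ d) :
    ((p + n).factorial : ℝ) / n.factorial ≤ ((d : ℝ) + 1) ^ d * ((n : ℝ) + 1) ^ d := by
  have h1 : (p + n).factorial ≤ n.factorial * (n + p) ^ p := by
    rw [add_comm p n, ← Nat.factorial_mul_ascFactorial]
    exact Nat.mul_le_mul_left _ (Nat.ascFactorial_le_pow_add n p)
  have h2 : (n + p) ^ p ≤ ((d + 1) * (n + 1)) ^ d := by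
    calc (n + p) ^ p ≤ ((d + 1) * (n + 1)) ^ p := by gcongr; nlinarith
      _ ≤ _ := Nat.pow_le_pow_right (by positivity) hp
  rw [div_le_iff₀ (by positivity), ← mul_pow]
  calc ((p + n).factorial : ℝ) ≤ ((n.factorial * (n + p) ^ p : ℕ) : ℝ) := by exact_mod_cast h1
    _ ≤ ((n.factorial * ((d + 1) * (n + 1)) ^ d : ℕ) : ℝ) := by gcongr
    _ = _ := by push_cast; ring

/-- With n spectators, the Wick coefficient for p incoming and q outgoing particles is `wickRoot q n
* wickRoot p n`: it splits into one factor for each side of w. -/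
noncomputable def wickRoot (p n : ℕ) : ℝ := Real.sqrt ((p + n).factorial / n.factorial)

lemma wickRoot_nonneg (p n : ℕ) : 0 ≤ wickRoot p n := Real.sqrt_nonneg _

/-- An auxiliary factor that cancels between the two sides. It moves half of the growth (n+1)^d from
the left to the right, where (N+1)^{-d} pays for all of it, so that both weights are bounded. -/
noncomputable def wickBalance (d n : ℕ) : ℝ := Real.sqrt (((n : ℝ) + 1) ^ d)

lemma wickBalance_pos (d n : ℕ) : 0 < wickBalance d n := Real.sqrt_pos.mpr (by positivity)

lemma wickRoot_le {d p : ℕ} (n : ℕ) (hp : p ≤ d) :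
    wickRoot p n ≤ ((d : ℝ) + 1) ^ d * wickBalance d n := by
  rw [wickRoot, wickBalance, Real.sqrt_le_left (by positivity), mul_pow,
    Real.sq_sqrt (by positivity)]
  refine (factorial_div_le n hp).trans ?_
  gcongr
  exact le_self_pow₀ (one_le_pow₀ (by linarith [Nat.cast_nonneg (α := ℝ) d])) two_ne_zero

noncomputable def wickLeft (d p n : ℕ) : ℝ := if p ≤ d then wickRoot p n / wickBalance d n else 0

noncomputable def wickRight (d p n : ℕ) : ℝ :=
  if p ≤ d then wickRoot p n * wickBalance d n / ((p : ℝ) + n + 1) ^ d else 0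

lemma isWickWeight_left (d : ℕ) : IsWickWeight d (((d : ℝ) + 1) ^ d) (wickLeft d) where
  bound p n := by
    rw [wickLeft]
    split_ifs with h
    · have := wickBalance_pos d n
      rw [abs_of_nonneg (div_nonneg (wickRoot_nonneg p n) this.le), div_le_iff₀ this]
      exact wickRoot_le n h
    · rw [abs_zero]; positivity
  support p n h := if_neg (by omega)

lemma isWickWeight_right (d : ℕ) : IsWickWeight d (((d : ℝ) + 1) ^ d) (wickRight d) where
  bound p n := by
    rw [wickRight]
    split_ifs with h
    · have h0 := wickBalance_pos d n
      rw [abs_of_nonneg (div_nonneg (mul_nonneg (wickRoot_nonneg p n) h0.le) (by positivity)),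
        div_le_iff₀ (by positivity)]
      calc wickRoot p n * wickBalance d n
          ≤ (((d : ℝ) + 1) ^ d * wickBalance d n) * wickBalance d n := by
            gcongr; exact wickRoot_le n h
        _ = ((d : ℝ) + 1) ^ d * ((n : ℝ) + 1) ^ d := by
            rw [mul_assoc, wickBalance, Real.mul_self_sqrt (by positivity)]
        _ ≤ _ := by
            gcongr
            linarith [Nat.cast_nonneg (α := ℝ) p]
    · rw [abs_zero]; positivity
  support p n h := if_neg (by omega)

end WickWeights

/-! ### The bounded operator Wick(w)(N+1)^{-d} and its coordinates -/

section WickOperator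

variable {ι : Type*}

/-- The bounded operator `Wick(w) (N + 1)^{-d}`. -/
noncomputable def wickReg (d : ℕ) (w : Fock ι →L[ℂ] Fock ι) : Fock ι →L[ℂ] Fock ι :=
  (exists_wickForm (isWickWeight_left d) (isWickWeight_right d) w).choose

lemma hasSum_inner_wickReg (d : ℕ) (w : Fock ι →L[ℂ] Fock ι) (v x : Fock ι) :
    HasSum (fun c => inner ℂ (contract (isWickWeight_left d) c v)
      (w (contract (isWickWeight_right d) c x))) (inner ℂ v (wickReg d w x)) :=
  (exists_wickForm (isWickWeight_left d) (isWickWeight_right d) w).choose_spec.1 v x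

lemma norm_wickReg_le (d : ℕ) (w : Fock ι →L[ℂ] Fock ι) :
    ‖wickReg d w‖ ≤ (((d : ℝ) + 1) ^ d * (d + 1)) ^ 2 * ‖w‖ :=
  (exists_wickForm (isWickWeight_left d) (isWickWeight_right d) w).choose_spec.2

lemma wickReg_sub (d : ℕ) (w w' : Fock ι →L[ℂ] Fock ι) :
    wickReg d (w - w') = wickReg d w - wickReg d w' := by
  refine ContinuousLinearMap.ext fun x => ext_inner_left ℂ fun v => ?_
  rw [sub_apply, fock_inner_sub_right]
  refine (hasSum_inner_wickReg d (w - w') v x).unique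
    (((hasSum_inner_wickReg d w v x).sub (hasSum_inner_wickReg d w' v x)).congr_fun fun c => ?_)
  rw [sub_apply, fock_inner_sub_right]

open Classical in
/-- The sum of the basis tensors of the distinct permutations of a list. -/
noncomputable def permIndicator (l₀ : List ι) : Fock ι :=
  Fock.mk (fun l => if l.Perm l₀ then 1 else 0)
    (by
      rw [tsum_eq_sum (s := l₀.permutations.toFinset) (fun l hl => by
        rw [List.mem_toFinset, List.mem_permutations] at hl
        simp [hl])]
      exact ENNReal.sum_ne_top.mpr fun l _ => by finiteness)
    (fun l l' h => by simp only [h.congr_left l₀])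

open Classical in
lemma fockCoord_permIndicator (l₀ l : List ι) :
    fockCoord (permIndicator l₀) l = if l.Perm l₀ then 1 else 0 := rfl

open Classical in
lemma inner_permIndicator (l₀ : List ι) (u : Fock ι) : inner ℂ (permIndicator l₀) u =
    (l₀.permutations.toFinset.card : ℂ) * fockCoord u l₀ := by
  refine (fock_hasSum_inner _ _).unique ?_
  have h := hasSum_sum_of_ne_finset_zero (L := SummationFilter.unconditional _)
    (f := fun l => starRingEnd ℂ (fockCoord (permIndicator l₀) l) * fockCoord u l)
    (s := l₀.permutations.toFinset) (fun l hl => by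
      rw [List.mem_toFinset, List.mem_permutations] at hl
      rw [fockCoord_permIndicator, if_neg hl, map_zero, zero_mul])
  convert! h
  rw [← nsmul_eq_mul, ← Finset.sum_const]
  refine Finset.sum_congr rfl fun l hl => ?_
  rw [List.mem_toFinset, List.mem_permutations] at hl
  rw [fockCoord_permIndicator, if_pos hl, map_one, one_mul, fockCoord_perm u hl]

lemma symmetrize_congr {F F' : List ι → ℂ} {l : List ι} (h : ∀ k, k.Perm l → F k = F' k) :
    symmetrize F l = symmetrize F' l := by
  rw [symmetrize, symmetrize, List.map_congr_left fun k hk => h k (List.mem_permutations.mp hk)]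

lemma symmetrize_finset_sum {κ : Type*} (s : Finset κ) (F : κ → List ι → ℂ) (l : List ι) :
    symmetrize (fun k => ∑ i ∈ s, F i k) l = ∑ i ∈ s, symmetrize (F i) l := by
  rw [← List.ofFn_get l]
  simp only [symmetrize_ofFn]
  rw [Finset.sum_comm, Finset.mul_sum]

lemma symmetrize_const_mul (c : ℂ) (F : List ι → ℂ) (l : List ι) :
    symmetrize (fun k => c * F k) l = c * symmetrize F l := by
  rw [← List.ofFn_get l]
  simp only [symmetrize_ofFn]
  rw [← Finset.mul_sum, mul_left_comm]

/-- Testing with the symmetric vector supported on the rearrangements of one list recovers a single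
coordinate. This converts identities of forms into the coordinate formula for Wick polynomials. -/
lemma fockCoord_eq_symmetrize {y : Fock ι} {G : List ι → ℂ}
    (h : ∀ v : Fock ι, HasSum (fun l => starRingEnd ℂ (fockCoord v l) * G l) (inner ℂ v y))
    (l₀ : List ι) : fockCoord y l₀ = symmetrize G l₀ := by
  classical
  have h1 : inner ℂ (permIndicator l₀) (symmetrize G l₀ • permIndicator l₀) =
      inner ℂ (permIndicator l₀) y := by
    refine inner_eq_of_symmetrize (F := fun l => if l.Perm l₀ then G l else 0) (fun l => ?_) ?_
    · rw [fockCoord_smul, fockCoord_permIndicator]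
      split_ifs with hl
      · rw [mul_one, ← symmetrize_perm G hl]
        exact symmetrize_congr fun k hk => (if_pos (hk.trans hl)).symm
      · rw [mul_zero, symmetrize_congr (F' := fun _ => 0 * 0)
          (fun k hk => by rw [if_neg (fun h => hl (hk.symm.trans h)), zero_mul]),
          symmetrize_const_mul, zero_mul]
    · refine (h (permIndicator l₀)).congr_fun fun l => ?_
      rw [fockCoord_permIndicator]
      split_ifs <;> simp
  rw [inner_permIndicator, inner_permIndicator, fockCoord_smul, fockCoord_permIndicator,
    if_pos (List.Perm.refl _), mul_one] at h1
  refine (mul_left_cancel₀ ?_ h1).symm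
  rw [Nat.cast_ne_zero, Finset.card_ne_zero]
  exact ⟨l₀, by rw [List.mem_toFinset, List.mem_permutations]⟩

lemma summable_norm_sq_family {T : List ι → Fock ι} (hT : ∑' c, ‖T c‖ₑ ^ 2 ≠ ∞) :
    Summable fun p : List ι × List ι => ‖fockCoord (T p.2) p.1‖ ^ 2 := by
  have h1 : ∑' p : List ι × List ι, ‖fockCoord (T p.2) p.1‖ₑ ^ 2 ≠ ∞ := by
    rw [ENNReal.tsum_prod (f := fun a c => ‖fockCoord (T c) a‖ₑ ^ 2), ENNReal.tsum_comm]
    simpa only [fock_enorm_sq] using hT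
  refine (ENNReal.summable_toReal h1).congr fun p => ?_
  simp

/-- Square summability makes the double sum over (a, c) absolutely convergent, so it may be
regrouped according to the concatenation a ++ c. -/
lemma hasSum_inner_family {A B : List ι → Fock ι} (hA : ∑' c, ‖A c‖ₑ ^ 2 ≠ ∞)
    (hB : ∑' c, ‖B c‖ₑ ^ 2 ≠ ∞) {S : ℂ} (hS : HasSum (fun c => inner ℂ (A c) (B c)) S) :
    HasSum (fun l : List ι => ∑ q : Fin (l.length + 1),
      starRingEnd ℂ (fockCoord (A (l.drop q)) (l.take q)) *
        fockCoord (B (l.drop q)) (l.take q)) S := by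
  have s3 : Summable fun p : List ι × List ι =>
      starRingEnd ℂ (fockCoord (A p.2) p.1) * fockCoord (B p.2) p.1 := by
    refine Summable.of_norm (Summable.of_nonneg_of_le (fun _ => norm_nonneg _) (fun p => ?_)
      ((summable_norm_sq_family hA).add (summable_norm_sq_family hB)))
    rw [norm_mul, RCLike.norm_conj]
    exact mul_le_sq_add_sq _ _
  obtain ⟨S', hS'⟩ := s3
  have h2 : HasSum (fun p : List ι × List ι =>
      starRingEnd ℂ (fockCoord (A p.1) p.2) * fockCoord (B p.1) p.2) S' :=
    (Equiv.prodComm (List ι) (List ι)).hasSum_iff.mpr hS'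
  have h3 := (h2.prod_fiberwise fun c => fock_hasSum_inner (A c) (B c)).unique hS
  rw [← h3]
  exact hasSum_sum_split
    (f := fun a c => starRingEnd ℂ (fockCoord (A c) a) * fockCoord (B c) a) hS'

lemma hasSum_wickReg_coord (d : ℕ) (w : Fock ι →L[ℂ] Fock ι) (v x : Fock ι) :
    HasSum (fun l : List ι => starRingEnd ℂ (fockCoord v l) *
      ∑ q : Fin (l.length + 1), (wickLeft d q (l.length - q) : ℂ) *
        fockCoord (w (contract (isWickWeight_right d) (l.drop q) x)) (l.take q))
      (inner ℂ v (wickReg d w x)) := by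
  have hB : ∑' c, ‖w (contract (isWickWeight_right d) c x)‖ₑ ^ 2 ≠ ∞ := by
    refine ne_top_of_le_ne_top ?_ (ENNReal.tsum_le_tsum fun c =>
      enorm_sq_le_of_norm_le (norm_nonneg w) (w.le_opNorm (contract (isWickWeight_right d) c x)))
    rw [ENNReal.tsum_mul_left]
    exact ENNReal.mul_ne_top (by finiteness)
      (ne_top_of_le_ne_top (by finiteness) (tsum_contract_le (isWickWeight_right d) x))
  have h4 := hasSum_inner_family (A := fun c => contract (isWickWeight_left d) c v)
    (ne_top_of_le_ne_top (by finiteness) (tsum_contract_le (isWickWeight_left d) v)) hB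
    (hasSum_inner_wickReg d w v x)
  refine h4.congr_fun fun l => ?_
  rw [Finset.mul_sum]
  refine Finset.sum_congr rfl fun q _ => ?_
  have hq : (l.take q).length = q := by
    rw [List.length_take]; have := q.2; omega
  rw [fockCoord_contract, List.take_append_drop, hq, List.length_drop, map_mul,
    Complex.conj_ofReal]
  ring

/-- After symmetrization is pulled out of the sums, the comparison is termwise in the cut q. The
balancing factors cancel, and the two roots multiply to the Wick coefficient. -/
lemma fockCoord_wickReg (d : ℕ) {w : Fock ι →L[ℂ] Fock ι} (hw : IsFinOrder w d) (x : Fock ι)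
    (l : List ι) : fockCoord (wickReg d w x) l = wickCoord w d (numberInv d x) l := by
  rw [fockCoord_eq_symmetrize (fun v => hasSum_wickReg_coord d w v x) l, wickCoord]
  simp only [← symmetrize_const_mul, ← symmetrize_finset_sum]
  refine symmetrize_congr fun k hk => ?_
  rw [← hk.length_eq, Finset.sum_comm, Fin.sum_univ_eq_sum_range (fun q =>
    (wickLeft d q (k.length - q) : ℂ) *
      fockCoord (w (contract (isWickWeight_right d) (k.drop q) x)) (k.take q))]
  refine Finset.sum_congr rfl fun q hq => ?_
  have hq' : q ≤ k.length := Nat.lt_succ_iff.mp (Finset.mem_range.mp hq)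
  have hlen : (k.take q).length = q := by rw [List.length_take]; omega
  by_cases hqd : q ≤ d
  · set c := k.drop q with hc
    have hcl : c.length = k.length - q := List.length_drop
    set n := k.length - q with hn
    have h1 : contract (isWickWeight_right d) c x = ∑ p ∈ Finset.range (d + 1),
        ((wickRoot p n * wickBalance d n : ℝ) : ℂ) •
          numberProj {p} (contractTail c (numberInv d x)) := by
      refine fock_ext fun a => ?_
      rw [fockCoord_finset_sum]
      simp only [fockCoord_smul, fockCoord_numberProj, Set.mem_singleton_iff,
        fockCoord_contractTail, fockCoord_numberInv, mul_ite, mul_zero, Finset.sum_ite_eq,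
        Finset.mem_range, fockCoord_contract, wickRight, hcl, List.length_append]
      by_cases ha : a.length ≤ d
      · rw [if_pos ha, if_pos (by omega)]
        push_cast
        ring
      · rw [if_neg ha, if_neg (by omega)]
        simp
    rw [h1, map_sum]
    rw [fockCoord_finset_sum, Finset.mul_sum]
    refine Finset.sum_congr rfl fun p _ => ?_
    rw [map_smul, fockCoord_smul, ← mul_assoc, ← Complex.ofReal_mul]
    congr 2
    rw [wickLeft, if_pos hqd]
    have h2 := wickBalance_pos d n
    have h3 : q + n = k.length := by omega
    have h4 : wickRoot q n * wickRoot p n =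
        Real.sqrt ((n + p).factorial * k.length.factorial) / n.factorial := by
      rw [wickRoot, wickRoot, h3, ← Real.sqrt_mul (by positivity), div_mul_div_comm,
        Real.sqrt_div (by positivity), Real.sqrt_mul_self (by positivity), add_comm n p,
        mul_comm (k.length.factorial : ℝ)]
    rw [← h4]
    field_simp
  -- For q > d the left weight is zero by definition, and the Wick terms vanish because w has no
  -- outgoing component above d.
  · rw [wickLeft, if_neg hqd, Complex.ofReal_zero, zero_mul]
    refine (Finset.sum_eq_zero fun p _ => ?_).symm
    rw [← hw, fockCoord_numberProj, hlen, if_neg (by simpa using hqd), mul_zero]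

end WickOperator

/-! ### Exponentials of bounded operators -/

section OperatorExponential

variable {E : Type*} [NormedAddCommGroup E] [InnerProductSpace ℂ E]

lemma continuous_inner_right_of (x : E) : Continuous fun y : E => (inner ℂ x y : ℂ) := by fun_prop

lemma continuous_inner_left_of (x : E) : Continuous fun y : E => (inner ℂ y x : ℂ) := by fun_prop

variable [CompleteSpace E]

/-- The exponential of a bounded operator. -/
noncomputable def expCLM (T : E →L[ℂ] E) : E →L[ℂ] E := NormedSpace.exp T

lemma expCLM_zero : expCLM (0 : E →L[ℂ] E) = 1 := NormedSpace.exp_zero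

lemma expCLM_zero_smul_apply (T : E →L[ℂ] E) (u : E) : expCLM ((0 : ℂ) • T) u = u := by
  rw [zero_smul, expCLM_zero, one_apply_eq_self]

lemma hasDerivAt_expCLM_apply (T : E →L[ℂ] E) (u : E) (s : ℂ) :
    HasDerivAt (fun s : ℂ => expCLM (s • T) u) (T (expCLM (s • T) u)) s :=
  (ContinuousLinearMap.apply ℂ E u).hasFDerivAt.comp_hasDerivAt s (hasDerivAt_exp_smul_const' T s)

lemma norm_expCLM_le (T : E →L[ℂ] E) : ‖expCLM T‖ ≤ Real.exp ‖T‖ := by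
  have h1 := NormedSpace.expSeries_div_hasSum_exp ‖T‖
  rw [← Real.exp_eq_exp_ℝ] at h1
  have h2 := NormedSpace.exp_series_hasSum_exp' (𝕂 := ℂ) T
  refine h2.norm_le_of_bounded h1 fun n => ?_
  rw [norm_smul, norm_inv, Complex.norm_natCast, div_eq_inv_mul]
  gcongr
  rcases Nat.eq_zero_or_pos n with rfl | hn
  · rw [pow_zero, pow_zero]
    exact ContinuousLinearMap.norm_id_le
  · exact norm_pow_le' T hn

lemma adjoint_expCLM (T : E →L[ℂ] E) : ContinuousLinearMap.adjoint (expCLM T) =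
    expCLM (ContinuousLinearMap.adjoint T) := NormedSpace.star_exp T

lemma norm_expCLM_mul_sub_le (A B : E →L[ℂ] E) :
    ‖expCLM A * B - B‖ ≤ Real.exp ‖A‖ * ‖A * B‖ := by
  have h1 : ∀ s : ℝ, HasDerivAt (fun s : ℝ => expCLM (s • A) * B) (expCLM (s • A) * A * B) s :=
    fun s => (hasDerivAt_exp_smul_const A s).mul_const B
  have h2 := norm_image_sub_le_of_norm_deriv_le_segment_01'
    (f := fun s : ℝ => expCLM (s • A) * B) (f' := fun s : ℝ => expCLM (s • A) * A * B)
    (C := Real.exp ‖A‖ * ‖A * B‖) (fun s _ => (h1 s).hasDerivWithinAt) (fun s hs => by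
      rw [mul_assoc]
      refine (norm_mul_le _ _).trans ?_
      gcongr
      refine (norm_expCLM_le _).trans ?_
      rw [norm_smul, Real.norm_of_nonneg hs.1]
      gcongr
      exact mul_le_of_le_one_left (norm_nonneg _) hs.2.le)
  simpa [expCLM_zero] using h2

/-- The one-sided errors e^{T*}w − w and w e^{T} − w are adjoint to each other, so a bound in terms
of T*w controls both. This is why only annihilation of a leg of w has to be small. -/
lemma norm_conj_expCLM_sub_le {w : E →L[ℂ] E} (hw : IsSelfAdjoint w) (T : E →L[ℂ] E) :
    ‖ContinuousLinearMap.adjoint (expCLM T) * w * expCLM T - w‖ ≤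
      2 * Real.exp (2 * ‖T‖) * ‖ContinuousLinearMap.adjoint T * w‖ := by
  set A := ContinuousLinearMap.adjoint T with hA
  have hnA : ‖A‖ = ‖T‖ := LinearIsometryEquiv.norm_map _ T
  have h1 := norm_expCLM_mul_sub_le A w
  have h2 : ContinuousLinearMap.adjoint (expCLM A * w - w) = w * expCLM T - w := by
    rw [map_sub, hw.adjoint_eq]
    change star (expCLM A * w) - w = _
    rw [star_mul, hw.star_eq, ContinuousLinearMap.star_eq_adjoint, hA, ← adjoint_expCLM,
      ContinuousLinearMap.adjoint_adjoint]
  have h3 : ‖w * expCLM T - w‖ ≤ Real.exp ‖T‖ * ‖A * w‖ := by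
    rw [← h2, LinearIsometryEquiv.norm_map, ← hnA]
    exact h1
  have h4 : ContinuousLinearMap.adjoint (expCLM T) * w * expCLM T - w =
      expCLM A * (w * expCLM T - w) + (expCLM A * w - w) := by
    rw [adjoint_expCLM]
    noncomm_ring
  rw [h4]
  have h5 : ‖expCLM A‖ ≤ Real.exp ‖T‖ := by rw [← hnA]; exact norm_expCLM_le A
  have h6 : Real.exp (2 * ‖T‖) = Real.exp ‖T‖ * Real.exp ‖T‖ := by rw [two_mul, Real.exp_add]
  have h7 : 1 ≤ Real.exp ‖T‖ := Real.one_le_exp (norm_nonneg _)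
  calc _ ≤ ‖expCLM A‖ * ‖w * expCLM T - w‖ + ‖expCLM A * w - w‖ :=
        (norm_add_le _ _).trans (by gcongr; exact norm_mul_le _ _)
    _ ≤ Real.exp ‖T‖ * (Real.exp ‖T‖ * ‖A * w‖) + 1 * (Real.exp ‖T‖ * ‖A * w‖) := by
        rw [hnA] at h1
        gcongr
        rw [one_mul]
        exact h1
    _ ≤ Real.exp ‖T‖ * (Real.exp ‖T‖ * ‖A * w‖) + Real.exp ‖T‖ * (Real.exp ‖T‖ * ‖A * w‖) := by
        gcongr
    _ = _ := by rw [h6]; ring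

end OperatorExponential

/-! ### Wick polynomials between exponential vectors; the domain of V -/

section WickCoherent

variable {ι 𝔥 : Type*} [NormedAddCommGroup 𝔥] [InnerProductSpace ℂ 𝔥] (b : HilbertBasis ι ℂ 𝔥)

noncomputable def capWeight (d n : ℕ) : ℂ := if n ≤ d then 1 else 0

lemma isEntireWeight_capWeight (d : ℕ) : IsEntireWeight (capWeight d) := by
  intro r _
  refine summable_of_ne_finset_zero (s := Finset.range (d + 1)) fun n hn => ?_
  rw [Finset.mem_range] at hn
  rw [capWeight, if_neg (by omega)]
  simp

/-- The vector `⨁_{n ≤ d} g ⊗ ⋯ ⊗ g`. -/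
noncomputable def capVec (d : ℕ) (g : 𝔥) : Fock ι := expVec b (isEntireWeight_capWeight d) g

lemma fockCoord_capVec (d : ℕ) (g : 𝔥) (l : List ι) :
    fockCoord (capVec b d g) l = capWeight d l.length * powCoord b g l := rfl

lemma wickRoot_mul_inv_sqrt (p n : ℕ) :
    wickRoot p n * (Real.sqrt (p + n).factorial)⁻¹ = (Real.sqrt n.factorial)⁻¹ := by
  rw [wickRoot, Real.sqrt_div (by positivity)]
  have h1 : Real.sqrt ((p + n).factorial : ℝ) ≠ 0 := Real.sqrt_ne_zero'.mpr (by positivity)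
  field_simp

/-- The coordinates of g^{⊗n} are multiplicative under concatenation, and `wickRoot` turns 1/√(p+n)!
into 1/√n!. The particles met by w thus factor from the spectators. -/
lemma contract_left_coherent (d : ℕ) (c : List ι) (g : 𝔥) :
    contract (isWickWeight_left d) c (coherent b 0 g) =
      (((wickBalance d c.length)⁻¹ : ℝ) * fockCoord (coherent b 0 g) c) • capVec b d g := by
  refine fock_ext fun a => ?_
  rw [fockCoord_contract, fockCoord_smul, fockCoord_capVec, fockCoord_coherent, fockCoord_coherent,
    powCoord_append, List.length_append, wickLeft, capWeight]
  split_ifs with h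
  · rw [expWeight, expWeight, pow_zero, one_mul, pow_zero, one_mul, ← Complex.ofReal_inv,
      ← Complex.ofReal_inv, ← wickRoot_mul_inv_sqrt a.length c.length]
    push_cast
    ring
  · simp

lemma contract_right_coherent (d : ℕ) (c : List ι) (g : 𝔥) :
    contract (isWickWeight_right d) c (coherent b d g) =
      ((wickBalance d c.length : ℝ) * fockCoord (coherent b 0 g) c) • capVec b d g := by
  refine fock_ext fun a => ?_
  rw [fockCoord_contract, fockCoord_smul, fockCoord_capVec, fockCoord_coherent, fockCoord_coherent,
    powCoord_append, List.length_append, wickRight, capWeight]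
  split_ifs with h
  · rw [expWeight, expWeight, pow_zero, one_mul, ← Complex.ofReal_inv, ← Complex.ofReal_inv,
      ← wickRoot_mul_inv_sqrt a.length c.length]
    have h1 : (((a.length + c.length : ℕ) : ℂ) + 1) ^ d ≠ 0 :=
      pow_ne_zero _ (natCast_add_one_ne_zero _)
    push_cast at h1 ⊢
    field_simp
  · simp

/-- Normal ordering: the spectator sum reproduces the scalar product exp (f|g), and w only meets the
truncated vectors. By totality all later identities for Wick polynomials are read off from this
formula. -/
lemma inner_coherent_wickReg (d : ℕ) (w : Fock ι →L[ℂ] Fock ι) (f g : 𝔥) :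
    inner ℂ (coherent b 0 f) (wickReg d w (coherent b d g)) =
      Complex.exp (inner ℂ f g) * inner ℂ (capVec b d f) (w (capVec b d g)) := by
  rw [← inner_coherent b f g]
  refine (hasSum_inner_wickReg d w (coherent b 0 f) (coherent b d g)).unique
    (((fock_hasSum_inner (coherent b 0 f) (coherent b 0 g)).mul_right _).congr_fun fun c => ?_)
  rw [contract_left_coherent, contract_right_coherent, map_smul, fock_inner_smul_left,
    fock_inner_smul_right, map_mul, Complex.conj_ofReal]
  have := (wickBalance_pos d c.length).ne'
  have h1 : (((wickBalance d c.length)⁻¹ : ℝ) : ℂ) * (wickBalance d c.length : ℂ) = 1 := by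
    rw [← Complex.ofReal_mul, inv_mul_cancel₀ this, Complex.ofReal_one]
  linear_combination (starRingEnd ℂ (fockCoord (coherent b 0 f) c) * fockCoord (coherent b 0 g) c *
    inner ℂ (capVec b d f) (w (capVec b d g))) * h1

lemma clm_ext_coherent {d : ℕ} {S T : Fock ι →L[ℂ] Fock ι}
    (h : ∀ f g, inner ℂ (coherent b d f) (S (coherent b d g)) =
      inner ℂ (coherent b d f) (T (coherent b d g))) : S = T := by
  refine clm_ext_of_dense_span (dense_span_coherent b d) ?_
  rintro _ ⟨g, rfl⟩
  have h1 : innerSL ℂ (S (coherent b d g)) = innerSL ℂ (T (coherent b d g)) := by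
    refine clm_ext_of_dense_span (dense_span_coherent b d) ?_
    rintro _ ⟨f, rfl⟩
    have h2 := congrArg (starRingEnd ℂ) (h f g)
    rw [fock_inner_conj_symm, fock_inner_conj_symm] at h2
    exact h2
  exact ext_inner_right ℂ fun v => congrArg (fun L => L v) h1

lemma inner_apply_of_isSelfAdjoint {E : Type*} [NormedAddCommGroup E] [InnerProductSpace ℂ E]
    [CompleteSpace E] {w : E →L[ℂ] E} (hw : IsSelfAdjoint w) (x y : E) :
    inner ℂ (w x) y = inner ℂ x (w y) := by
  rw [← ContinuousLinearMap.adjoint_inner_right, hw.adjoint_eq]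

/-- Symmetry of V on the range of (N+1)^{-d}. On exponential vectors it is immediate from the symbol
formula and w = w*. -/
lemma inner_wickReg_left (b : HilbertBasis ι ℂ 𝔥) (d : ℕ) {w : Fock ι →L[ℂ] Fock ι} (hw : IsSelfAdjoint w) (y x : Fock ι) :
    inner ℂ (wickReg d w y) (numberInv d x) = inner ℂ (numberInv d y) (wickReg d w x) := by
  have h : ContinuousLinearMap.adjoint (wickReg d w) ∘L numberInv d = numberInv d ∘L wickReg d w := by
    refine clm_ext_coherent b (d := d) fun f g => ?_
    rw [ContinuousLinearMap.comp_apply, ContinuousLinearMap.comp_apply,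
      ContinuousLinearMap.adjoint_inner_right, ← inner_numberInv_left d (coherent b d f),
      numberInv_coherent,
      numberInv_coherent, inner_coherent_wickReg, ← fock_inner_conj_symm, inner_coherent_wickReg,
      map_mul, ← Complex.exp_conj, inner_conj_symm, fock_inner_conj_symm,
      inner_apply_of_isSelfAdjoint hw]
  rw [← ContinuousLinearMap.adjoint_inner_right, inner_numberInv_left]
  exact congrArg (fun L : Fock ι →L[ℂ] Fock ι => inner ℂ y (L x)) h

lemma numberInv_truncate_isFin (d n : ℕ) (x : Fock ι) :
    IsFinParticle (numberInv d (truncate n x)) :=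
  isFinParticle_of_fockCoord (n := n) fun l hl => by simp [not_le.mpr hl]

lemma exists_eq_numberInv_of_isFin (d : ℕ) {u : Fock ι} (hu : IsFinParticle u) :
    ∃ x, u = numberInv d x := by
  obtain ⟨n, hn⟩ := hu
  refine ⟨numberMul (fun m => if m ≤ n then ((m : ℂ) + 1) ^ d else 0) (M := (n + 1) ^ d)
    (fun m => ?_) u, fock_ext fun l => ?_⟩
  · split_ifs with hm
    · rw [norm_pow, norm_natCast_add_one]
      have : (m : ℝ) ≤ n := by exact_mod_cast hm
      gcongr
    · rw [norm_zero]; positivity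
  · have h0 := congrArg (fun u => fockCoord u l) hn
    simp only [fockCoord_numberProj, Set.mem_Iic] at h0
    rw [fockCoord_numberInv, fockCoord_numberMul]
    have := natCast_add_one_ne_zero l.length
    split_ifs with hl
    · field_simp
    · rw [if_neg hl] at h0
      rw [← h0]
      simp

/-- Truncations of x give finite particle vectors converging in the graph norm, because V(N+1)^{-d}
is bounded. -/
theorem mem_graph_wickOp (b : HilbertBasis ι ℂ 𝔥) {d : ℕ} {w : Fock ι →L[ℂ] Fock ι} (hw : IsFinOrder w d)
    (hsa : IsSelfAdjoint w) (x : Fock ι) : (numberInv d x, wickReg d w x) ∈ (wickOp w d).graph := by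
  rw [wickOp, Submodule.toLinearPMap_graph_eq]
  · have h1 : Tendsto (fun n => (numberInv d (truncate n x), wickReg d w (truncate n x))) atTop
        (𝓝 (numberInv d x, wickReg d w x)) :=
      (((numberInv d).continuous.tendsto x).comp (tendsto_truncate x)).prodMk_nhds
        (((wickReg d w).continuous.tendsto x).comp (tendsto_truncate x))
    exact mem_closure_of_tendsto h1 (Eventually.of_forall fun n => Submodule.subset_span
      ⟨numberInv_truncate_isFin d n x, fun l => fockCoord_wickReg d hw _ l⟩)
  · rintro ⟨u, v⟩ huv hu
    simp only at hu
    subst hu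
    -- `G` is the graph of the adjoint of V restricted to the range of (N+1)^{-d}. By symmetry it
    -- contains the closure, and (0, v) in `G` makes v orthogonal to a dense set. So the closure is
    -- a graph.
    let G : Submodule ℂ (Fock ι × Fock ι) :=
      { carrier := {p | ∀ x, inner ℂ (numberInv d x) p.2 = inner ℂ (wickReg d w x) p.1}
        add_mem' := fun {p q} hp hq x => by
          rw [Prod.snd_add, Prod.fst_add, fock_inner_add_right, fock_inner_add_right, hp, hq]
        zero_mem' := fun x => by simp
        smul_mem' := fun c p hp x => by
          rw [Prod.smul_snd, Prod.smul_fst, fock_inner_smul_right, fock_inner_smul_right, hp] }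
    have hGc : IsClosed (G : Set (Fock ι × Fock ι)) := by
      have : (G : Set (Fock ι × Fock ι)) =
          ⋂ x, {p | inner ℂ (numberInv d x) p.2 = inner ℂ (wickReg d w x) p.1} := by
        ext p
        simp only [Set.mem_iInter]
        rfl
      rw [this]
      exact isClosed_iInter fun x => isClosed_eq
        ((continuous_inner_right_of (numberInv d x)).comp continuous_snd)
        ((continuous_inner_right_of (wickReg d w x)).comp continuous_fst)
    have hle := Submodule.topologicalClosure_minimal (t := G) _ (Submodule.span_le.mpr (by
      rintro ⟨u, y⟩ ⟨hu, hy⟩ x'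
      simp only at hu hy ⊢
      obtain ⟨x, rfl⟩ := exists_eq_numberInv_of_isFin d hu
      have : y = wickReg d w x := fock_ext fun l => by rw [hy, fockCoord_wickReg d hw]
      rw [this, inner_wickReg_left b d hsa])) hGc huv
    simp only at hle ⊢
    have h2 : ∀ x, inner ℂ (numberInv d x) v = 0 := fun x => by
      have := hle x
      simpa using this
    have h3 : ∀ y : Fock ι, inner ℂ y v = 0 := by
      intro y
      refine (dense_numberInv d).induction_on (p := fun y => inner ℂ y v = 0) y ?_ h2
      exact isClosed_eq (continuous_inner_left_of v) continuous_const
    exact inner_self_eq_zero.mp (h3 v)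

end WickCoherent

/-! ### A bounded operator translating truncated exponential vectors -/

section Shift

variable {ι 𝔥 : Type*} [NormedAddCommGroup 𝔥] [InnerProductSpace ℂ 𝔥] (b : HilbertBasis ι ℂ 𝔥)

lemma norm_capWeight_le (d n : ℕ) : n * ‖capWeight d n‖ ≤ (d : ℝ) := by
  rw [capWeight]
  split_ifs with h
  · simpa using h
  · simp

/-- The nilpotent operator `u ↦ 1_{N ≤ d} N S(k ⊗ u)`. -/
noncomputable def capCreate (d : ℕ) (k : 𝔥) : Fock ι →L[ℂ] Fock ι :=
  create b (capWeight d) (norm_capWeight_le d) k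

noncomputable def capAnnihilateWeight (d n : ℕ) : ℂ := if n + 1 ≤ d then (n : ℂ) + 1 else 0

lemma norm_capAnnihilateWeight_le (d n : ℕ) : ‖capAnnihilateWeight d n‖ ≤ (d : ℝ) := by
  rw [capAnnihilateWeight]
  split_ifs with h
  · rw [norm_natCast_add_one]; exact_mod_cast h
  · simp

lemma adjoint_capCreate (d : ℕ) (k : 𝔥) : ContinuousLinearMap.adjoint (capCreate b d k) =
    annihilate b (capAnnihilateWeight d) (norm_capAnnihilateWeight_le d) k := by
  refine ContinuousLinearMap.ext fun v => ext_inner_left ℂ fun u => ?_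
  rw [ContinuousLinearMap.adjoint_inner_right, capCreate]
  refine inner_create_left b _ _ _ _ k (fun n => ?_) u v
  rw [capWeight, capAnnihilateWeight]
  split_ifs <;> simp

/-- The coordinate functional at `l`. -/
noncomputable def fockCoordCLM (l : List ι) : Fock ι →L[ℂ] ℂ :=
  LinearMap.mkContinuous
    { toFun := fun u => fockCoord u l
      map_add' := fun u v => fockCoord_add u v l
      map_smul' := fun c u => fockCoord_smul c u l } 1
    (fun u => by
      rw [one_mul]
      exact lp.norm_apply_le_norm (by norm_num) (u : FullFock ι) l)

lemma hasDerivAt_powCoord (g k : 𝔥) (l : List ι) (s : ℂ) :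
    HasDerivAt (fun s : ℂ => powCoord b (g + s • k) l)
      (∑ i : Fin l.length, b.repr k (l.get i) * powCoord b (g + s • k) (l.eraseIdx i)) s := by
  induction l with
  | nil => simpa using hasDerivAt_const s (1 : ℂ)
  | cons a l ih =>
    have h0 : ∀ s : ℂ, b.repr (g + s • k) a = b.repr g a + s * b.repr k a := fun s => by
      rw [map_add, map_smul]
      rfl
    have h1 : HasDerivAt (fun s : ℂ => b.repr (g + s • k) a) (b.repr k a) s := by
      simp only [h0]
      simpa using ((hasDerivAt_id s).mul_const (b.repr k a)).const_add (b.repr g a)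
    have h2 := h1.mul ih
    have h3 : (fun s : ℂ => powCoord b (g + s • k) (a :: l)) =
        (fun s : ℂ => b.repr (g + s • k) a) * fun s : ℂ => powCoord b (g + s • k) l := by
      ext s
      rw [powCoord_cons]
      rfl
    rw [h3]
    refine h2.congr_deriv ?_
    change _ = ∑ i : Fin (l.length + 1), _
    rw [Fin.sum_univ_succ, Finset.mul_sum]
    congr 1
    refine Finset.sum_congr rfl fun i _ => ?_
    simp only [Fin.val_succ, List.eraseIdx_cons_succ, powCoord_cons]
    rw [mul_left_comm]
    rfl

/-- In the parameter s both sides solve the same linear differential equation, since the derivative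
of (g+sk)^{⊗n} is n S(k ⊗ (g+sk)^{⊗(n−1)}). A coordinate's derivative involves only shorter lists,
so induction on the length gives equality, and the truncation at d is harmless because `capCreate`
raises the particle number. -/
lemma exp_capCreate_capVec (d : ℕ) (k g : 𝔥) :
    expCLM (capCreate b d k) (capVec b d g) = capVec b d (g + k) := by
  have key : ∀ (n : ℕ) (l : List ι), l.length = n → ∀ s : ℂ,
      fockCoord (expCLM (s • capCreate b d k) (capVec b d g)) l =
        fockCoord (capVec b d (g + s • k)) l := by
    intro n
    induction n using Nat.strong_induction_on with
    | _ n ih =>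
      intro l hl s
      have h1 : ∀ s : ℂ, HasDerivAt (fun s : ℂ =>
          fockCoord (expCLM (s • capCreate b d k) (capVec b d g)) l)
          (fockCoord (capCreate b d k (expCLM (s • capCreate b d k) (capVec b d g))) l)
          s := by
        intro s
        exact (fockCoordCLM l).hasFDerivAt.comp_hasDerivAt s
          (hasDerivAt_expCLM_apply (E := Fock ι) (capCreate b d k) (capVec b d g) s)
      have h4 : ∀ s : ℂ, HasDerivAt (fun s : ℂ => fockCoord (capVec b d (g + s • k)) l)
          (fockCoord (capCreate b d k (expCLM (s • capCreate b d k) (capVec b d g))) l)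
          s := by
        intro s
        have h5 := (hasDerivAt_powCoord b g k l s).const_mul (capWeight d l.length)
        refine h5.congr_deriv ?_
        rw [capCreate, fockCoord_create]
        by_cases hd : l.length ≤ d
        · congr 1
          refine Finset.sum_congr rfl fun i _ => ?_
          have hlen := length_eraseIdx_fin l i
          rw [← capCreate, ih (l.eraseIdx i).length (by omega) _ rfl s, fockCoord_capVec, capWeight,
            if_pos (by omega), one_mul]
        · rw [capWeight, if_neg hd, zero_mul, zero_mul]
      have h6 : ∀ s : ℂ, HasDerivAt (fun s : ℂ =>
          fockCoord (expCLM (s • capCreate b d k) (capVec b d g)) l -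
            fockCoord (capVec b d (g + s • k)) l) 0 s := fun s => by
        have h := (h1 s).sub (h4 s)
        rw [sub_self] at h
        exact h
      have h7 := is_const_of_deriv_eq_zero (fun s => (h6 s).differentiableAt)
        (fun s => (h6 s).deriv) s 0
      rw [expCLM_zero_smul_apply (E := Fock ι), zero_smul, add_zero, sub_self] at h7
      exact sub_eq_zero.mp h7
  refine fock_ext fun l => ?_
  simpa using key _ l rfl 1

end Shift

/-! ### The commutator of a Weyl operator with a Wick polynomial -/

section WeylWick

variable {ι 𝔥 : Type*} [NormedAddCommGroup 𝔥] [InnerProductSpace ℂ 𝔥] (b : HilbertBasis ι ℂ 𝔥)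

lemma inner_displacement_right (k : 𝔥) (u v : Fock ι) :
    inner ℂ u (displacement b k v) = inner ℂ (displacement b (-k) u) v := by
  have h := (isUnitaryGroup_displacement b k).inner_apply_right 1 u v
  simpa using h

/-- The symbol conjugated with the shift `e(g) ↦ e(g + k)` of truncated exponential vectors. -/
noncomputable def shiftSymbol (d : ℕ) (k : 𝔥) (w : Fock ι →L[ℂ] Fock ι) : Fock ι →L[ℂ] Fock ι :=
  ContinuousLinearMap.adjoint (expCLM (E := Fock ι) (capCreate b d k)) * w *
    expCLM (E := Fock ι) (capCreate b d k)

/-- Wick(w) D(k) sees w between f and g + k, while D(k) Wick(w_k) sees w_k between f − k and g. The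
conjugation makes the two agree. -/
lemma inner_shiftSymbol (d : ℕ) (k : 𝔥) (w : Fock ι →L[ℂ] Fock ι) (f g : 𝔥) :
    inner ℂ (capVec b d (f - k)) (shiftSymbol b d k w (capVec b d g)) =
      inner ℂ (capVec b d f) (w (capVec b d (g + k))) := by
  rw [shiftSymbol, mul_apply_eq_comp, mul_apply_eq_comp, ContinuousLinearMap.adjoint_inner_right,
    exp_capCreate_capVec, exp_capCreate_capVec, sub_add_cancel]

/-- Conjugation of a Wick polynomial with a displacement operator shifts its symbol. -/
lemma wickReg_displacement (d : ℕ) (k : 𝔥) {w : Fock ι →L[ℂ] Fock ι} (hw : IsSelfAdjoint w)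
    (x y : Fock ι) : inner ℂ (wickReg d w y) (displacement b k (numberInv d x)) =
      inner ℂ (numberInv d y) (displacement b k (wickReg d (shiftSymbol b d k w) x)) := by
  have h : ContinuousLinearMap.adjoint (wickReg d w) ∘L displacement b k ∘L numberInv d =
      numberInv d ∘L displacement b k ∘L wickReg d (shiftSymbol b d k w) := by
    refine clm_ext_coherent b (d := d) fun f g => ?_
    simp only [ContinuousLinearMap.comp_apply]
    rw [ContinuousLinearMap.adjoint_inner_right, ← inner_numberInv_left d (coherent b d f),
      numberInv_coherent, numberInv_coherent, inner_displacement_right b k (coherent b 0 f), displacement_coherent,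
      displacement_coherent, fock_inner_smul_left, fock_inner_smul_right, ← sub_eq_add_neg,
      inner_coherent_wickReg, inner_shiftSymbol, ← fock_inner_conj_symm, inner_coherent_wickReg,
      map_mul, fock_inner_conj_symm, inner_apply_of_isSelfAdjoint (E := Fock ι) hw,
      ← Complex.exp_conj, inner_conj_symm, ← mul_assoc, ← mul_assoc, displacementFactor,
      displacementFactor, ← Complex.exp_conj, ← Complex.exp_add, ← Complex.exp_add]
    congr 2
    simp only [map_sub, map_neg, map_div₀, map_pow, Complex.conj_ofReal, map_ofNat, inner_neg_left,
      inner_conj_symm, inner_add_right, inner_sub_left, norm_neg]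
    ring
  rw [← ContinuousLinearMap.adjoint_inner_right, inner_numberInv_left]
  exact congrArg (fun L : Fock ι →L[ℂ] Fock ι => inner ℂ y (L x)) h

lemma weyl_wick_commutator (d : ℕ) (k : 𝔥) {w : Fock ι →L[ℂ] Fock ι} (hw : IsSelfAdjoint w)
    (x y : Fock ι) : inner ℂ (wickReg d w y) (displacement b k (numberInv d x)) -
      inner ℂ (numberInv d y) (displacement b k (wickReg d w x)) =
      inner ℂ (numberInv d y) (displacement b k (wickReg d (shiftSymbol b d k w - w) x)) := by
  rw [wickReg_displacement b d k hw, wickReg_sub, sub_apply, map_sub, fock_inner_sub_right]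

/-- D(k) is unitary, and Wick(·)(N+1)^{-d} is bounded by the norm of the symbol, so only w_k − w
matters. The exponent comes from `d * ‖k‖` bounding the truncated creation operator. -/
lemma norm_commutator_le (d : ℕ) (k : 𝔥) {w : Fock ι →L[ℂ] Fock ι} (hw : IsSelfAdjoint w)
    (x y : Fock ι) : ‖inner ℂ (wickReg d w y) (displacement b k (numberInv d x)) -
      inner ℂ (numberInv d y) (displacement b k (wickReg d w x))‖ ≤
      (((d : ℝ) + 1) ^ d * (d + 1)) ^ 2 * (2 * Real.exp (2 * (d * ‖k‖)) *
        ‖ContinuousLinearMap.adjoint (capCreate b d k) * w‖) * ‖x‖ * ‖numberInv d y‖ := by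
  rw [weyl_wick_commutator b d k hw]
  refine (norm_inner_le_norm (E := Fock ι) _ _).trans ?_
  rw [norm_map_of_mem_unitary (displacement_mem_unitary b k), mul_comm]
  gcongr
  refine (ContinuousLinearMap.le_of_opNorm_le _ (norm_wickReg_le d _) x).trans ?_
  gcongr
  refine (norm_conj_expCLM_sub_le (E := Fock ι) hw (capCreate b d k)).trans ?_
  gcongr
  exact norm_create_le b _ _ k

end WeylWick

/-! ### Contracting one leg of a Hilbert–Schmidt symbol -/

section HilbertSchmidtLeg

lemma ennreal_tsum_mul_sq_le {α : Type*} (f g : α → ℝ≥0∞) :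
    (∑' i, f i * g i) ^ 2 ≤ (∑' i, f i ^ 2) * ∑' i, g i ^ 2 := by
  have h1 : ∑' i, f i * g i ≤ (∑' i, f i ^ 2) ^ (1 / 2 : ℝ) * (∑' i, g i ^ 2) ^ (1 / 2 : ℝ) := by
    rw [ENNReal.tsum_eq_iSup_sum]
    refine iSup_le fun s => ?_
    have h2 := ENNReal.inner_le_Lp_mul_Lq s f g (p := 2) (q := 2)
      (Real.holderConjugate_iff.mpr ⟨by norm_num, by norm_num⟩)
    simp only [ENNReal.rpow_ofNat] at h2
    refine h2.trans ?_
    gcongr <;> exact ENNReal.sum_le_tsum s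
  have h3 : ∀ x : ℝ≥0∞, (x ^ (1 / 2 : ℝ)) ^ 2 = x := fun x => by
    rw [← ENNReal.rpow_natCast, ← ENNReal.rpow_mul]
    norm_num
  calc _ ≤ _ := pow_le_pow_left' h1 2
    _ = _ := by rw [mul_pow, h3, h3]

lemma enorm_sq_le_of_hasSum_smul {α F : Type*} [NormedAddCommGroup F] [NormedSpace ℂ F] {c : α → ℂ}
    {z : α → F} {Z : F} (h : HasSum (fun i => c i • z i) Z) :
    ‖Z‖ₑ ^ 2 ≤ (∑' i, ‖c i‖ₑ ^ 2) * ∑' i, ‖z i‖ₑ ^ 2 := by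
  refine le_trans (pow_le_pow_left' ?_ 2) (ennreal_tsum_mul_sq_le (fun i => ‖c i‖ₑ) fun i => ‖z i‖ₑ)
  have h1 : Tendsto (fun s : Finset α => ‖∑ i ∈ s, c i • z i‖ₑ) atTop (𝓝 ‖Z‖ₑ) :=
    (continuous_enorm.tendsto Z).comp h
  refine le_of_tendsto h1 (Eventually.of_forall fun s => ?_)
  calc _ ≤ ∑ i ∈ s, ‖c i • z i‖ₑ := enorm_sum_le _ _
    _ = ∑ i ∈ s, ‖c i‖ₑ * ‖z i‖ₑ := by simp only [enorm_smul]
    _ ≤ _ := ENNReal.sum_le_tsum s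

variable {ι 𝔥 : Type*} [NormedAddCommGroup 𝔥] [InnerProductSpace ℂ 𝔥] (b : HilbertBasis ι ℂ 𝔥)

/-- Project the basis expansion of u in the full Fock space. The vectors `symBasis l` are not
independent, but the coefficients still have square sum ‖u‖². -/
lemma hasSum_smul_symBasis (u : Fock ι) : HasSum (fun l => fockCoord u l • symBasis l) u := by
  classical
  have : (bosonicSubspace ι).HasOrthogonalProjection :=
    Submodule.HasOrthogonalProjection.ofCompleteSpace _
  have h1 := lp.hasSum_single (p := 2) (by norm_num) (u : FullFock ι)
  have h2 := h1.mapL (bosonicSubspace ι).orthogonalProjectionOnto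
  rw [Submodule.orthogonalProjectionOnto_mem_subspace_eq_self] at h2
  refine h2.congr_fun fun l => ?_
  have h3 : (lp.single 2 l ((u : FullFock ι) l) : FullFock ι) =
      fockCoord u l • lp.single 2 l (1 : ℂ) := by
    rw [← lp.single_smul, smul_eq_mul, mul_one]
    rfl
  rw [h3, map_smul, symBasis]

lemma legNormSq_zero_eq (a : 𝔥 →L[ℂ] 𝔥) (u : Fock ι) :
    legNormSq b a 0 u = ∑' r, ‖a (legCLM b r u)‖ₑ ^ 2 := by
  rw [legNormSq, ← (Equiv.subtypeUnivEquiv (p := fun r : List ι => 0 ≤ r.length)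
    (fun r => Nat.zero_le _)).tsum_eq]
  rfl

/-- Hilbert–Schmidt norms dominate operator norms: expand u and apply Cauchy–Schwarz. By bosonic
symmetry the first leg represents all of them. -/
lemma tsum_leg_le (a : 𝔥 →L[ℂ] 𝔥) (w : Fock ι →L[ℂ] Fock ι) (u : Fock ι) :
    ∑' r, ‖a (legCLM b r (w u))‖ₑ ^ 2 ≤ legSum b a w ^ 2 * ‖u‖ₑ ^ 2 := by
  have h1 : ∀ r, ‖a (legCLM b r (w u))‖ₑ ^ 2 ≤
      ‖u‖ₑ ^ 2 * ∑' l, ‖a (legCLM b r (w (symBasis l)))‖ₑ ^ 2 := by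
    intro r
    rw [fock_enorm_sq u]
    refine enorm_sq_le_of_hasSum_smul ?_
    have h2 := (hasSum_smul_symBasis u).mapL (a ∘L legCLM b r ∘L w)
    simp only [map_smul] at h2
    exact h2
  refine (ENNReal.tsum_le_tsum h1).trans ?_
  rw [ENNReal.tsum_mul_left, ENNReal.tsum_comm, mul_comm]
  gcongr
  have h3 : ∑' l : List ι, legNormSq b a 0 (w (symBasis l)) ≤ legSum b a w ^ 2 := by
    have h4 : (∑' l : List ι, legNormSq b a 0 (w (symBasis l))) ^ (1 / 2 : ℝ) ≤ legSum b a w :=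
      ENNReal.le_tsum (f := fun i => (∑' l : List ι, legNormSq b a i (w (symBasis l))) ^
        (1 / 2 : ℝ)) 0
    refine le_trans (le_of_eq ?_) (pow_le_pow_left' h4 2)
    rw [← ENNReal.rpow_natCast, ← ENNReal.rpow_mul]
    norm_num
  simpa only [legNormSq_zero_eq] using h3

/-- The adjoint takes the inner product of k with the first leg of w u, with weight at most d. In
`hk` the A-part is paid by ‖w‖ and the B-part by the decay of a on the leg; the factor 2 leaves room
for (x+y)² ≤ 2x² + 2y². -/
lemma norm_adjoint_capCreate_mul_le (d : ℕ) (k : 𝔥) (a : 𝔥 →L[ℂ] 𝔥) (w : Fock ι →L[ℂ] Fock ι)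
    {A B L : ℝ} (hA : 0 ≤ A) (hB : 0 ≤ B) (hL : 0 ≤ L)
    (hk : ∀ v, ‖(inner ℂ k v : ℂ)‖ ≤ A * ‖v‖ + B * ‖a v‖) (hw : legSum b a w ≤ ENNReal.ofReal L) :
    ‖ContinuousLinearMap.adjoint (capCreate b d k) * w‖ ≤ 2 * d * (A * ‖w‖ + B * L) := by
  have hX : 0 ≤ A * ‖w‖ + B * L := by positivity
  refine ContinuousLinearMap.opNorm_le_bound _ (by positivity) fun u => ?_
  refine norm_le_of_enorm_sq_le (by positivity) ?_
  rw [mul_apply_eq_comp, adjoint_capCreate, fock_enorm_sq]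
  have h1 : ∀ l, ‖fockCoord (annihilate b (capAnnihilateWeight d) (norm_capAnnihilateWeight_le d) k
      (w u)) l‖ₑ ^ 2 ≤ ENNReal.ofReal (2 * d ^ 2 * A ^ 2) * ‖legCLM b l (w u)‖ₑ ^ 2 +
        ENNReal.ofReal (2 * d ^ 2 * B ^ 2) * ‖a (legCLM b l (w u))‖ₑ ^ 2 := by
    intro l
    rw [fockCoord_annihilate, ← ofReal_norm, ← ofReal_norm, ← ofReal_norm,
      ← ENNReal.ofReal_pow (norm_nonneg _), ← ENNReal.ofReal_pow (norm_nonneg _),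
      ← ENNReal.ofReal_pow (norm_nonneg _), ← ENNReal.ofReal_mul (by positivity),
      ← ENNReal.ofReal_mul (by positivity), ← ENNReal.ofReal_add (by positivity) (by positivity)]
    refine ENNReal.ofReal_le_ofReal ?_
    rw [norm_mul, mul_pow]
    set v := legCLM b l (w u)
    have h2 : ‖capAnnihilateWeight d l.length‖ ^ 2 ≤ (d : ℝ) ^ 2 :=
      pow_le_pow_left₀ (norm_nonneg _) (norm_capAnnihilateWeight_le d _) 2
    have h3 : ‖(inner ℂ k v : ℂ)‖ ^ 2 ≤ 2 * (A * ‖v‖) ^ 2 + 2 * (B * ‖a v‖) ^ 2 :=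
      (pow_le_pow_left₀ (norm_nonneg _) (hk v) 2).trans (by
        nlinarith [sq_nonneg (A * ‖v‖ - B * ‖a v‖)])
    calc _ ≤ (d : ℝ) ^ 2 * (2 * (A * ‖v‖) ^ 2 + 2 * (B * ‖a v‖) ^ 2) :=
          mul_le_mul h2 h3 (sq_nonneg _) (sq_nonneg _)
      _ = _ := by ring
  refine (ENNReal.tsum_le_tsum h1).trans ?_
  rw [ENNReal.tsum_add, ENNReal.tsum_mul_left, ENNReal.tsum_mul_left]
  have h4 : ∑' l, ‖legCLM b l (w u)‖ₑ ^ 2 ≤ ENNReal.ofReal ‖w‖ ^ 2 * ‖u‖ₑ ^ 2 :=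
    (tsum_enorm_legCLM_le b (w u)).trans (enorm_sq_le_of_norm_le (norm_nonneg w) (w.le_opNorm u))
  have h5 : ∑' l, ‖a (legCLM b l (w u))‖ₑ ^ 2 ≤ ENNReal.ofReal L ^ 2 * ‖u‖ₑ ^ 2 :=
    (tsum_leg_le b a w u).trans (by gcongr)
  refine (add_le_add (mul_le_mul_right h4 _) (mul_le_mul_right h5 _)).trans ?_
  rw [← mul_assoc, ← mul_assoc, ← add_mul, ← ENNReal.ofReal_pow (norm_nonneg w),
    ← ENNReal.ofReal_pow hL, ← ENNReal.ofReal_mul (by positivity),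
    ← ENNReal.ofReal_mul (by positivity), ← ENNReal.ofReal_add (by positivity) (by positivity),
    ← ENNReal.ofReal_pow (by positivity)]
  gcongr
  have h6 : 0 ≤ (d : ℝ) ^ 2 * (A * ‖w‖) * (B * L) := by positivity
  nlinarith [sq_nonneg ((d : ℝ) * (A * ‖w‖)), sq_nonneg ((d : ℝ) * (B * L))]

end HilbertSchmidtLeg

/-! ### Cook's method -/

section Cook

variable {E : Type*} [NormedAddCommGroup E] [InnerProductSpace ℂ E] [CompleteSpace E]

lemma tendsto_apply_of_norm_le {α : Type*} {l : Filter α} {A : α → E →L[ℂ] E} {M : ℝ}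
    (hA : ∀ t, ‖A t‖ ≤ M) {z : α → E} {u v : E} (hz : Tendsto z l (𝓝 u))
    (h : Tendsto (fun t => A t u) l (𝓝 v)) : Tendsto (fun t => A t (z t)) l (𝓝 v) := by
  have h1 : Tendsto (fun t => M * ‖z t - u‖) l (𝓝 0) := by
    simpa using ((tendsto_iff_norm_sub_tendsto_zero.mp hz).const_mul M)
  have h2 : Tendsto (fun t => A t (z t - u)) l (𝓝 0) :=
    squeeze_zero_norm (fun t => (A t).le_of_opNorm_le (hA t) _) h1
  simpa using h2.add h

/-- Product rule for a group that is only strongly continuous: the difference quotient of v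
converges, and Γ is uniformly bounded. -/
lemma IsUnitaryGroup.hasDerivAt_apply {Γ : ℝ → E →L[ℂ] E} (hΓ : IsUnitaryGroup Γ) {v : ℝ → E}
    {v' a : E} {τ : ℝ} (hv : HasDerivAt v v' τ) (ha : (v τ, a) ∈ generatorGraph Γ) :
    HasDerivAt (fun t => Γ t (v t)) (Γ τ (Complex.I • a) + Γ τ v') τ := by
  rw [hasDerivAt_iff_tendsto_slope] at hv ⊢
  have h1 := hasDerivAt_iff_tendsto_slope.mp (hΓ.hasDerivAt ha τ)
  have h2 : Tendsto (fun t => Γ t (slope v τ t)) (𝓝[≠] τ) (𝓝 (Γ τ v')) :=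
    tendsto_apply_of_norm_le hΓ.norm_le_one hv
      ((hΓ.continuous v').tendsto τ |>.mono_left nhdsWithin_le_nhds)
  refine (h1.add h2).congr fun t => ?_
  simp only [slope, vsub_eq_sub]
  have h3 : Γ t ((t - τ)⁻¹ • (v t - v τ)) = (t - τ)⁻¹ • Γ t (v t - v τ) :=
    ((Γ t).restrictScalars ℝ).map_smul _ _
  rw [h3, map_sub, ← smul_add]
  congr 1
  abel

section

variable {U Γ : ℝ → E →L[ℂ] E} (hU : IsUnitaryGroup U) (hΓ : IsUnitaryGroup Γ)
  {J Q V W : E →L[ℂ] E} (hJU : ∀ t u, J (U t u) = U t (J u))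
  (hgen : ∀ u, ∃ a, (J u, a) ∈ generatorGraph Γ ∧ (J u, a + V (Q u)) ∈ generatorGraph U)

include hU hΓ hJU hgen

/-- The free term `a` occurs in both generators and cancels, leaving the interaction. `V (Q u)`
plays the role of the unbounded interaction applied to `J u`. -/
lemma hasDerivAt_interaction (x : E) (τ : ℝ) : HasDerivAt (fun t => Γ t (U (-t) (J x)))
    (-(Complex.I • Γ τ (V (Q (U (-τ) x))))) τ := by
  obtain ⟨a, ha, ha'⟩ := hgen (U (-τ) x)
  rw [hJU] at ha ha'
  have h1 : HasDerivAt (fun t => U (-t) (J x)) (-(Complex.I • (a + V (Q (U (-τ) x))))) τ := by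
    have h2 : HasDerivAt (fun t => U t (U (-τ) (J x))) (Complex.I • (a + V (Q (U (-τ) x))))
        (τ - τ) := by
      rw [sub_self]; exact ha'
    have h3 := h2.scomp τ ((hasDerivAt_id τ).const_sub τ)
    rw [neg_smul, one_smul] at h3
    refine h3.congr_of_eventuallyEq (Eventually.of_forall fun t => ?_)
    simp only [Function.comp]
    rw [← hU.apply_add]
    congr 2
    ring
  refine (hΓ.hasDerivAt_apply h1 ha).congr_deriv ?_
  rw [← map_add, ← map_smul, ← map_neg]
  congr 1
  rw [smul_add]
  abel

/-- In the matrix element between J y and J x the time derivative is i times the commutator form at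
evolved vectors. The constant is the integral of Cτ^{-ν} over (s, ∞). -/
lemma norm_cook_le (hJ : DenseRange J) {C ν : ℝ} (hν : 1 < ν) (hC : 0 ≤ C)
    (hcomm : ∀ t, 1 ≤ t → ∀ x y, ‖(inner ℂ (V (Q y)) (Γ (-t) (W (Γ t (J x)))) : ℂ) -
      inner ℂ (J y) (Γ (-t) (W (Γ t (V (Q x)))))‖ ≤ C * t ^ (-ν) * ‖x‖ * ‖J y‖)
    {s t : ℝ} (hs : 1 ≤ s) (hst : s ≤ t) :
    ‖U t * (Γ (-t) * W * Γ t) * U (-t) * J - U s * (Γ (-s) * W * Γ s) * U (-s) * J‖ ≤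
      C / (ν - 1) * s ^ (1 - ν) := by
  have hν' : 0 < ν - 1 := sub_pos.mpr hν
  have hs0 : 0 < s := by linarith
  refine ContinuousLinearMap.opNorm_le_bound _ (by positivity) fun x => ?_
  set Δ := (U t * (Γ (-t) * W * Γ t) * U (-t) * J - U s * (Γ (-s) * W * Γ s) * U (-s) * J) x with hΔ
  have key : ∀ y, ‖(inner ℂ (J y) Δ : ℂ)‖ ≤ C / (ν - 1) * s ^ (1 - ν) * ‖x‖ * ‖J y‖ := by
    intro y
    set F : ℝ → ℂ := fun τ => inner ℂ (Γ τ (U (-τ) (J y))) (W (Γ τ (U (-τ) (J x)))) with hF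
    set F' : ℝ → ℂ := fun τ => inner ℂ (Γ τ (U (-τ) (J y)))
      (W (-(Complex.I • Γ τ (V (Q (U (-τ) x)))))) +
        inner ℂ (-(Complex.I • Γ τ (V (Q (U (-τ) y))))) (W (Γ τ (U (-τ) (J x)))) with hF'
    have hd : ∀ τ, HasDerivAt F (F' τ) τ := fun τ =>
      (hasDerivAt_interaction hU hΓ hJU hgen y τ).inner ℂ
        ((W.restrictScalars ℝ).hasFDerivAt.comp_hasDerivAt τ
          (hasDerivAt_interaction hU hΓ hJU hgen x τ))
    have hb : ∀ τ, 1 ≤ τ → ‖F' τ‖ ≤ C * τ ^ (-ν) * ‖x‖ * ‖J y‖ := by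
      intro τ hτ
      have h1 : F' τ = Complex.I * ((inner ℂ (V (Q (U (-τ) y)))
          (Γ (-τ) (W (Γ τ (J (U (-τ) x))))) : ℂ) -
            inner ℂ (J (U (-τ) y)) (Γ (-τ) (W (Γ τ (V (Q (U (-τ) x))))))) := by
        have hm : ∀ p q, (inner ℂ (Γ τ p) q : ℂ) = inner ℂ p (Γ (-τ) q) := fun p q => by
          rw [hΓ.inner_apply_right, neg_neg]
        simp only [hF', hJU, map_neg, map_smul, inner_neg_right, inner_neg_left, inner_smul_left,
          inner_smul_right, Complex.conj_I, hm]
        ring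
      rw [h1, norm_mul, Complex.norm_I, one_mul]
      refine (hcomm τ hτ _ _).trans (le_of_eq ?_)
      rw [hJU, hU.norm_apply, hU.norm_apply]
    -- The comparison function is the explicit antiderivative of the bound, vanishing at s, so no
    -- integral of the derivative is formed.
    have hbd := image_norm_le_of_norm_deriv_right_le_deriv_boundary' (a := s) (b := t)
      (f := fun τ => F τ - F s) (f' := F')
      (B := fun τ => C / (ν - 1) * ‖x‖ * ‖J y‖ * (s ^ (1 - ν) - τ ^ (1 - ν)))
      (B' := fun τ => C * τ ^ (-ν) * ‖x‖ * ‖J y‖)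
      (fun τ _ => ((hd τ).sub_const _).continuousAt.continuousWithinAt)
      (fun τ _ => ((hd τ).sub_const _).hasDerivWithinAt) (by simp) (fun τ hτ => ?_) (fun τ hτ => ?_)
      (fun τ hτ => hb τ (hs.trans hτ.1)) (Set.right_mem_Icc.mpr hst)
    · have h2 : inner ℂ (J y) Δ = F t - F s := by
        simp only [hΔ, hF, sub_apply, mul_apply_eq_comp, inner_sub_right]
        congr 1 <;>
        rw [hU.inner_apply_right, hΓ.inner_apply_right, neg_neg]
      rw [h2]
      refine hbd.trans ?_
      have h3 : 0 ≤ t ^ (1 - ν) := Real.rpow_nonneg (by linarith) _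
      have h4 : 0 ≤ C / (ν - 1) * ‖x‖ * ‖J y‖ := by positivity
      nlinarith [mul_nonneg h4 h3]
    · exact ContinuousAt.continuousWithinAt (by
        have := (Real.continuousAt_rpow_const τ (1 - ν) (Or.inl (by linarith [hτ.1])))
        fun_prop)
    · have hτ0 : τ ≠ 0 := by linarith [hτ.1]
      have h5 := ((Real.hasDerivAt_rpow_const (p := 1 - ν) (Or.inl hτ0)).const_sub
        (s ^ (1 - ν))).const_mul (C / (ν - 1) * ‖x‖ * ‖J y‖)
      refine (h5.congr_deriv ?_).hasDerivWithinAt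
      have h6 : 1 - ν - 1 = -ν := by ring
      rw [h6]
      field_simp
      ring
  -- The bound involves ‖J y‖ and not ‖y‖, so on the left J disappears by density, while on the
  -- right it stays.
  have key2 : ∀ z, ‖(inner ℂ z Δ : ℂ)‖ ≤ C / (ν - 1) * s ^ (1 - ν) * ‖x‖ * ‖z‖ := by
    intro z
    refine hJ.induction_on (p := fun z => ‖(inner ℂ z Δ : ℂ)‖ ≤
      C / (ν - 1) * s ^ (1 - ν) * ‖x‖ * ‖z‖) z ?_ key
    exact isClosed_le (by fun_prop) (by fun_prop)
  have h7 := key2 Δ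
  rw [inner_self_eq_norm_sq_to_K, norm_pow, RCLike.norm_ofReal, abs_norm, sq] at h7
  by_cases h0 : ‖Δ‖ = 0
  · rw [h0]; positivity
  · exact le_of_mul_le_mul_right h7 (lt_of_le_of_ne (norm_nonneg _) (Ne.symm h0))

lemma cauchySeq_cook (hJ : DenseRange J) {C ν : ℝ} (hν : 1 < ν) (hC : 0 ≤ C)
    (hcomm : ∀ t, 1 ≤ t → ∀ x y, ‖(inner ℂ (V (Q y)) (Γ (-t) (W (Γ t (J x)))) : ℂ) -
      inner ℂ (J y) (Γ (-t) (W (Γ t (V (Q x)))))‖ ≤ C * t ^ (-ν) * ‖x‖ * ‖J y‖) :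
    CauchySeq fun t => U t * (Γ (-t) * W * Γ t) * U (-t) * J := by
  rw [Metric.cauchySeq_iff']
  intro ε hε
  have h1 : Tendsto (fun s : ℝ => C / (ν - 1) * s ^ (1 - ν)) atTop (𝓝 0) := by
    have := (tendsto_rpow_neg_atTop (sub_pos.mpr hν)).const_mul (C / (ν - 1))
    simpa using this
  obtain ⟨s, hs, hs1⟩ := ((h1.eventually (gt_mem_nhds hε)).and (eventually_ge_atTop 1)).exists
  refine ⟨s, fun t ht => ?_⟩
  rw [dist_eq_norm]
  exact (norm_cook_le hU hΓ hJU hgen hJ hν hC hcomm hs1 ht).trans_lt hs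

end

lemma cauchySeq_of_approx {F : Type*} [NormedAddCommGroup F] {A : ℝ → F}
    (h : ∀ ε > 0, ∃ B : ℝ → F, CauchySeq B ∧ ∀ t, ‖A t - B t‖ ≤ ε) : CauchySeq A := by
  rw [Metric.cauchySeq_iff']
  intro ε hε
  obtain ⟨B, hB, hAB⟩ := h (ε / 4) (by positivity)
  obtain ⟨N, hN⟩ := Metric.cauchySeq_iff'.mp hB (ε / 4) (by positivity)
  refine ⟨N, fun t ht => ?_⟩
  have h1 := hN t ht
  rw [dist_eq_norm] at h1 ⊢
  calc ‖A t - A N‖ = ‖(A t - B t) + (B t - B N) - (A N - B N)‖ := by congr 1; abel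
    _ ≤ ‖A t - B t‖ + ‖B t - B N‖ + ‖A N - B N‖ :=
        (norm_sub_le _ _).trans (by gcongr; exact norm_add_le _ _)
    _ < ε := by linarith [hAB t, hAB N]

lemma exists_strong_limit {A : ℝ → E →L[ℂ] E} (hA : ∀ t, ‖A t‖ ≤ 1) {J : E →L[ℂ] E}
    (hJ : DenseRange J) (hc : CauchySeq fun t => A t * J) :
    ∃ L : E →L[ℂ] E, (∀ u, Tendsto (fun t => A t u) atTop (𝓝 (L u))) ∧ ‖L‖ ≤ 1 ∧
      Tendsto (fun t => A t * J) atTop (𝓝 (L * J)) := by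
  have h1 : ∀ u, ∃ v, Tendsto (fun t => A t u) atTop (𝓝 v) := by
    intro u
    refine cauchySeq_tendsto_of_complete (cauchySeq_of_approx fun ε hε => ?_)
    obtain ⟨x, hx⟩ := hJ.exists_dist_lt u hε
    refine ⟨fun t => A t (J x), ?_, fun t => ?_⟩
    · exact (ContinuousLinearMap.apply ℂ E x).uniformContinuous.comp_cauchySeq hc
    · rw [← map_sub]
      refine ((A t).le_of_opNorm_le (hA t) _).trans ?_
      rw [one_mul, ← dist_eq_norm]
      exact hx.le
  choose f hf using h1
  obtain ⟨L', hL'⟩ := cauchySeq_tendsto_of_complete hc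
  set L := continuousLinearMapOfTendsto (fun t => A t) (tendsto_pi_nhds.mpr hf) with hL
  have hLf : ∀ u, Tendsto (fun t => A t u) atTop (𝓝 (L u)) := hf
  refine ⟨L, hLf, ContinuousLinearMap.opNorm_le_bound _ zero_le_one fun u => ?_, ?_⟩
  · exact le_of_tendsto (hLf u).norm (Eventually.of_forall fun t => (A t).le_of_opNorm_le (hA t) u)
  · have h2 : L' = L * J := by
      refine ContinuousLinearMap.ext fun x => tendsto_nhds_unique
        (((ContinuousLinearMap.apply ℂ E x).continuous.tendsto L').comp hL') ?_
      exact hLf (J x)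
    rw [← h2]
    exact hL'

lemma denseRange_pow {K : E →L[ℂ] E} (hK : DenseRange K) (n : ℕ) : DenseRange (K ^ n : E →L[ℂ] E) := by
  induction n with
  | zero => exact Function.surjective_id.denseRange
  | succ n ih =>
    rw [pow_succ]
    exact ih.comp hK (K ^ n).continuous

/-- The group multiplies each eigenvector by a nonzero scalar, so it preserves the orthogonal
complement of the eigenvectors. -/
lemma expI_apply_mem_contSpectralSubspace {ω : E →ₗ.[ℂ] E} (hω : IsUnitaryGroupOf ω (expI ω))
    (s : ℝ) {h : E} (hh : h ∈ contSpectralSubspace ω) : expI ω s h ∈ contSpectralSubspace ω := by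
  have hU := hω.isUnitaryGroup
  rw [contSpectralSubspace, Submodule.mem_orthogonal] at hh ⊢
  intro u hu
  induction hu using Submodule.span_induction with
  | zero => exact inner_zero_left _
  | add x y _ _ hx hy => rw [inner_add_left, hx, hy, add_zero]
  | smul c x _ hx => rw [inner_smul_left, hx, mul_zero]
  | mem v hv =>
    obtain ⟨z, hz⟩ := hv
    rw [← hω.generatorGraph_eq] at hz
    -- Constancy of e^{-izt} e^{itω} v is the eigenvalue equation in exponentiated form; reality of
    -- z plays no role.
    have hd : ∀ t : ℝ, HasDerivAt (fun t : ℝ => Complex.exp (-(Complex.I * z) * t) • expI ω t v)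
        0 t := by
      intro t
      have h1 : HasDerivAt (fun t : ℝ => Complex.exp (-(Complex.I * z) * t))
          (Complex.exp (-(Complex.I * z) * t) * (-(Complex.I * z))) t := by
        have h0 : HasDerivAt (fun t : ℝ => (t : ℂ)) 1 t := Complex.ofRealCLM.hasDerivAt
        simpa using (h0.const_mul (-(Complex.I * z))).cexp
      refine (h1.smul (hU.hasDerivAt hz t)).congr_deriv ?_
      rw [map_smul, map_smul, smul_smul, smul_smul, ← add_smul]
      rw [← zero_smul ℂ (expI ω t v)]
      congr 1
      ring
    have h2 := is_const_of_deriv_eq_zero (fun t => (hd t).differentiableAt)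
      (fun t => (hd t).deriv) (-s) 0
    simp only [Complex.ofReal_zero, mul_zero, Complex.exp_zero, one_smul, hU.zero,
      one_apply_eq_self] at h2
    have h3 := hh v (Submodule.subset_span ⟨z, by rw [← hω.generatorGraph_eq]; exact hz⟩)
    rw [hU.inner_apply_right]
    rw [← h2, inner_smul_left, mul_eq_zero] at h3
    rcases h3 with h3 | h3
    · rw [map_eq_zero] at h3
      exact absurd h3 (Complex.exp_ne_zero _)
    · exact h3

end Cook

/-! ### Asymptotic limits of a Weyl system -/

section AsymptoticWeyl

variable {E 𝔥 : Type*} [NormedAddCommGroup E] [InnerProductSpace ℂ E] [CompleteSpace E]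
  [NormedAddCommGroup 𝔥] [InnerProductSpace ℂ 𝔥]

/-- A representation of the Weyl relations. -/
structure IsWeylSystem (W : 𝔥 → E →L[ℂ] E) : Prop where
  mem_unitary : ∀ h, W h ∈ unitary (E →L[ℂ] E)
  zero : W 0 = 1
  mul : ∀ h g, W h * W g =
    Complex.exp (-Complex.I * (1 / 2) * ((inner ℂ h g).im : ℂ)) • W (h + g)

lemma norm_weylPhase (r : ℝ) : ‖Complex.exp (-Complex.I * (1 / 2) * (r : ℂ))‖ = 1 := by
  have h1 : -Complex.I * (1 / 2) * (r : ℂ) = ((-r / 2 : ℝ) : ℂ) * Complex.I := by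
    push_cast; ring
  rw [h1, Complex.norm_exp_ofReal_mul_I]

lemma norm_weylPhase_sub_one_le (r : ℝ) :
    ‖Complex.exp (-Complex.I * (1 / 2) * (r : ℂ)) - 1‖ ≤ |r| := by
  have h1 : -Complex.I * (1 / 2) * (r : ℂ) = Complex.I * ((-r / 2 : ℝ) : ℂ) := by
    push_cast; ring
  rw [h1]
  refine (Real.norm_exp_I_mul_ofReal_sub_one_le).trans ?_
  rw [Real.norm_eq_abs, abs_div, abs_neg]
  have := abs_nonneg r
  norm_num

namespace IsWeylSystem

variable {W : 𝔥 → E →L[ℂ] E}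

/-- By the Weyl relation W(g) is a phase times W(h) W(g−h). The phase differs from 1 by at most
‖h‖‖g−h‖, and W(g−h) − 1 is small on the range of J. -/
lemma norm_sub_apply_le (hW : IsWeylSystem W) {J : E →L[ℂ] E} {c : ℝ}
    (hJ : ∀ h x, ‖W h (J x) - J x‖ ≤ c * ‖h‖ * ‖x‖) (h g : 𝔥) (x : E) :
    ‖W g (J x) - W h (J x)‖ ≤ (c + ‖h‖ * ‖J‖) * ‖g - h‖ * ‖x‖ := by
  have h1 := congrArg (fun T : E →L[ℂ] E => T (J x)) (hW.mul h (g - h))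
  simp only [add_sub_cancel, smul_apply, mul_apply_eq_comp] at h1
  set z := Complex.exp (-Complex.I * (1 / 2) * ((inner ℂ h (g - h)).im : ℂ)) with hz
  have h2 : z • (W g (J x) - W h (J x)) =
      W h (W (g - h) (J x) - J x) - (z - 1) • W h (J x) := by
    rw [map_sub, h1, smul_sub, sub_smul, one_smul]
    abel
  have h3 : ‖W g (J x) - W h (J x)‖ = ‖z • (W g (J x) - W h (J x))‖ := by
    rw [norm_smul, norm_weylPhase, one_mul]
  have h4 : ‖z - 1‖ ≤ ‖h‖ * ‖g - h‖ := (norm_weylPhase_sub_one_le _).trans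
    ((Complex.abs_im_le_norm _).trans (norm_inner_le_norm _ _))
  rw [h3, h2]
  refine (norm_sub_le _ _).trans ?_
  rw [norm_smul, norm_map_of_mem_unitary (hW.mem_unitary h),
    norm_map_of_mem_unitary (hW.mem_unitary h)]
  calc ‖W (g - h) (J x) - J x‖ + ‖z - 1‖ * ‖J x‖
      ≤ c * ‖g - h‖ * ‖x‖ + (‖h‖ * ‖g - h‖) * (‖J‖ * ‖x‖) := by
        gcongr
        · exact hJ _ _
        · exact J.le_opNorm x
    _ = _ := by ring

end IsWeylSystem

variable [CompleteSpace 𝔥] {U : ℝ → E →L[ℂ] E} {e : ℝ → 𝔥 →L[ℂ] 𝔥} {W : 𝔥 → E →L[ℂ] E}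

/-- The Weyl operators `W(h_t)` in the interaction picture. -/
def interactionWeyl (U : ℝ → E →L[ℂ] E) (e : ℝ → 𝔥 →L[ℂ] 𝔥) (W : 𝔥 → E →L[ℂ] E) (h : 𝔥) (t : ℝ) :
    E →L[ℂ] E :=
  U t * W (e (-t) h) * U (-t)

lemma interactionWeyl_apply (h : 𝔥) (t : ℝ) (u : E) :
    interactionWeyl U e W h t u = U t (W (e (-t) h) (U (-t) u)) := rfl

section

variable (hU : IsUnitaryGroup U) (he : IsUnitaryGroup e) (hW : IsWeylSystem W)
include hU he hW

lemma norm_interactionWeyl_le (h : 𝔥) (t : ℝ) : ‖interactionWeyl U e W h t‖ ≤ 1 :=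
  ContinuousLinearMap.opNorm_le_bound _ zero_le_one fun u => by
    rw [interactionWeyl_apply, hU.norm_apply, norm_map_of_mem_unitary (hW.mem_unitary _),
      hU.norm_apply, one_mul]

lemma interactionWeyl_zero (t : ℝ) : interactionWeyl U e W 0 t = 1 := by
  refine ContinuousLinearMap.ext fun u => ?_
  rw [interactionWeyl_apply, map_zero, hW.zero, one_apply_eq_self, hU.apply_neg, one_apply_eq_self]

lemma interactionWeyl_mul (h g : 𝔥) (t : ℝ) :
    interactionWeyl U e W h t * interactionWeyl U e W g t =
      Complex.exp (-Complex.I * (1 / 2) * ((inner ℂ h g).im : ℂ)) •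
        interactionWeyl U e W (h + g) t := by
  refine ContinuousLinearMap.ext fun u => ?_
  have h1 := congrArg (fun T : E →L[ℂ] E => T (U (-t) u)) (hW.mul (e (-t) h) (e (-t) g))
  simp only [smul_apply, mul_apply_eq_comp, inner_map_of_mem_unitary (he.mem_unitary _),
    ← map_add] at h1
  rw [mul_apply_eq_comp, interactionWeyl_apply, interactionWeyl_apply, hU.neg_apply, h1, map_smul]
  rfl

lemma conj_interactionWeyl (h : 𝔥) (s t : ℝ) :
    U s * interactionWeyl U e W h t * U (-s) = interactionWeyl U e W (e s h) (t + s) := by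
  refine ContinuousLinearMap.ext fun u => ?_
  have h1 : e (-(t + s)) (e s h) = e (-t) h := by
    rw [← he.apply_add]; congr 2; ring
  rw [interactionWeyl_apply, h1, mul_apply_eq_comp, mul_apply_eq_comp, interactionWeyl_apply,
    ← hU.apply_add, ← hU.apply_add, add_comm s t, neg_add]

variable {J : E →L[ℂ] E} {c : ℝ} (hJU : ∀ t u, J (U t u) = U t (J u))
  (hJW : ∀ h x, ‖W h (J x) - J x‖ ≤ c * ‖h‖ * ‖x‖) (hc : 0 ≤ c)
include hJU hJW hc

/-- Uniformity in t comes from unitarity of both evolutions and from J commuting with U. It extends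
convergence to the closure and yields norm continuity of the limit. -/
lemma norm_interactionWeyl_sub_le (h g : 𝔥) (t : ℝ) :
    ‖interactionWeyl U e W g t * J - interactionWeyl U e W h t * J‖ ≤
      (c + ‖h‖ * ‖J‖) * ‖g - h‖ := by
  refine ContinuousLinearMap.opNorm_le_bound _ (by positivity) fun x => ?_
  rw [sub_apply, mul_apply_eq_comp, mul_apply_eq_comp, interactionWeyl_apply, interactionWeyl_apply,
    ← map_sub, hU.norm_apply, ← hJU]
  have h1 := hW.norm_sub_apply_le hJW (e (-t) h) (e (-t) g) (U (-t) x)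
  rwa [← map_sub, he.norm_apply, he.norm_apply, hU.norm_apply] at h1

lemma cauchySeq_interactionWeyl_of_mem_closure {D : Set 𝔥}
    (hD : ∀ h ∈ D, CauchySeq fun t => interactionWeyl U e W h t * J) {h : 𝔥} (hh : h ∈ closure D) :
    CauchySeq fun t => interactionWeyl U e W h t * J := by
  refine cauchySeq_of_approx fun ε hε => ?_
  have h0 : 0 < c + ‖h‖ * ‖J‖ + 1 := by positivity
  obtain ⟨g, hg, hgh⟩ := Metric.mem_closure_iff.mp hh (ε / (c + ‖h‖ * ‖J‖ + 1)) (by positivity)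
  refine ⟨_, hD g hg, fun t => ?_⟩
  rw [norm_sub_rev]
  refine (norm_interactionWeyl_sub_le hU he hW hJU hJW hc h g t).trans ?_
  rw [dist_comm, dist_eq_norm, lt_div_iff₀ h0] at hgh
  nlinarith [norm_nonneg (g - h)]

end

lemma pow_apply_comm {S T : E →L[ℂ] E} (h : ∀ u, S (T u) = T (S u)) (n : ℕ) (u : E) :
    (S ^ n) (T u) = T ((S ^ n) u) := by
  induction n with
  | zero => rfl
  | succ n ih => rw [pow_succ', mul_apply_eq_comp, ih, h, mul_apply_eq_comp]

/-- Existence and properties of the asymptotic Weyl operators, given the norm convergence on a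
dense set of test vectors. -/
theorem exists_asymptotic_weyl (hU : IsUnitaryGroup U) (he : IsUnitaryGroup e)
    (hW : IsWeylSystem W) {K : E →L[ℂ] E} (hK : DenseRange K)
    (hKU : ∀ t u, K (U t u) = U t (K u)) {n₀ : ℕ} {c : ℝ} (hc : 0 ≤ c)
    (hKW : ∀ h x, ‖W h ((K ^ n₀) x) - (K ^ n₀) x‖ ≤ c * ‖h‖ * ‖x‖)
    {S : Submodule ℂ 𝔥} (heS : ∀ t, ∀ h ∈ S, e t h ∈ S) {D : Set 𝔥} (hSD : (S : Set 𝔥) ⊆ closure D)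
    (hD : ∀ h ∈ D, CauchySeq fun t => interactionWeyl U e W h t * K ^ n₀) :
    ∃ Wp : S → E →L[ℂ] E,
      (∀ (h : S) (u : E), Tendsto (fun t : ℝ => U t (W (e (-t) h) (U (-t) u))) atTop
        (𝓝 (Wp h u))) ∧
      (∀ n ≥ n₀,
        (∀ h : S, Tendsto (fun t : ℝ => U t * W (e (-t) h) * K ^ n * U (-t)) atTop
          (𝓝 (Wp h * K ^ n))) ∧
        Continuous fun h => Wp h * K ^ n) ∧
      (∀ u, Continuous fun h => Wp h u) ∧
      (∀ h, Wp h ∈ unitary (E →L[ℂ] E)) ∧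
      (∀ h g, Wp h * Wp g =
        Complex.exp (-Complex.I * (1 / 2) * ((inner ℂ (h : 𝔥) (g : 𝔥)).im : ℂ)) • Wp (h + g)) ∧
      (∀ (t : ℝ) (h : S), ∃ g : S, (g : 𝔥) = e t h ∧ U t * Wp h * U (-t) = Wp g) := by
  have hKnU : ∀ n t u, (K ^ n) (U t u) = U t ((K ^ n) u) := fun n t => pow_apply_comm (hKU t) n
  have hJ := denseRange_pow hK n₀
  set J := K ^ n₀ with hJdef
  have hlim : ∀ h : S, ∃ L : E →L[ℂ] E,
      (∀ u, Tendsto (fun t => interactionWeyl U e W h t u) atTop (𝓝 (L u))) ∧ ‖L‖ ≤ 1 ∧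
      Tendsto (fun t => interactionWeyl U e W h t * J) atTop (𝓝 (L * J)) := fun h =>
    exists_strong_limit (norm_interactionWeyl_le hU he hW (h : 𝔥)) hJ
      (cauchySeq_interactionWeyl_of_mem_closure hU he hW (hKnU n₀) hKW hc hD (hSD h.2))
  choose Wp hs hn hJlim using hlim
  have hdiff : ∀ h g : S, ‖Wp g * J - Wp h * J‖ ≤ (c + ‖(h : 𝔥)‖ * ‖J‖) * ‖g - h‖ := fun h g =>
    le_of_tendsto ((hJlim g).sub (hJlim h)).norm (Eventually.of_forall fun t =>
      norm_interactionWeyl_sub_le hU he hW (hKnU n₀) hKW hc (h : 𝔥) g t)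
  have hcont : Continuous fun h => Wp h * J := by
    refine continuous_iff_continuousAt.mpr fun h => ?_
    rw [ContinuousAt, tendsto_iff_norm_sub_tendsto_zero]
    refine squeeze_zero (fun _ => norm_nonneg _) (hdiff h) ?_
    exact Continuous.tendsto' (by fun_prop) _ _ (by simp)
  have hmul : ∀ h g, Wp h * Wp g =
      Complex.exp (-Complex.I * (1 / 2) * ((inner ℂ (h : 𝔥) (g : 𝔥)).im : ℂ)) • Wp (h + g) := by
    intro h g
    refine ContinuousLinearMap.ext fun u => ?_
    refine tendsto_nhds_unique (tendsto_apply_of_norm_le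
      (norm_interactionWeyl_le hU he hW (h : 𝔥)) (hs g u) (hs h (Wp g u))) ?_
    refine ((hs (h + g) u).const_smul
      (Complex.exp (-Complex.I * (1 / 2) * ((inner ℂ (h : 𝔥) (g : 𝔥)).im : ℂ)))).congr fun t => ?_
    exact (congrArg (fun T : E →L[ℂ] E => T u) (interactionWeyl_mul hU he hW (h : 𝔥) g t)).symm
  have hzero : Wp 0 = 1 := by
    refine ContinuousLinearMap.ext fun u => tendsto_nhds_unique (hs 0 u) ?_
    refine tendsto_const_nhds.congr fun t => ?_
    rw [Submodule.coe_zero, interactionWeyl_zero hU he hW]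
  refine ⟨Wp, hs, fun n hn₀ => ?_, ?_, fun h => ?_, hmul, fun s h => ?_⟩
  · obtain ⟨k, rfl⟩ := Nat.exists_eq_add_of_le hn₀
    constructor
    · intro h
      rw [pow_add, ← mul_assoc]
      -- Powers of K commute with U, so K^n may stand on either side of `U (-t)`.
      refine ((hJlim h).mul_const (K ^ k)).congr fun t => ContinuousLinearMap.ext fun u => ?_
      change U t (W _ (U (-t) (J ((K ^ k) u)))) = U t (W _ (J ((K ^ k) (U (-t) u))))
      rw [hKnU, hKnU]
    · simp only [pow_add, ← mul_assoc]
      exact hcont.mul_const _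
  · refine continuous_apply_of_dense_span hn (Z := Set.range J) ?_ ?_
    · exact hJ.mono Submodule.subset_span
    · rintro _ ⟨x, rfl⟩
      exact (ContinuousLinearMap.apply ℂ E x).continuous.comp hcont
  -- A strong limit of unitaries is a priori only isometric. The Weyl relation provides the right
  -- inverse, the phase being 1 because (h|h) is real.
  · refine mem_unitary_of_inner_of_mul_eq_one (T := Wp (-h)) (fun u v => ?_) ?_
    · refine tendsto_nhds_unique ((hs h u).inner (hs h v)) (tendsto_const_nhds.congr fun t => ?_)
      rw [interactionWeyl_apply, interactionWeyl_apply, inner_map_of_mem_unitary (hU.mem_unitary _),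
        inner_map_of_mem_unitary (hW.mem_unitary _), inner_map_of_mem_unitary (hU.mem_unitary _)]
    · rw [hmul, add_neg_cancel, hzero, Submodule.coe_neg, inner_neg_right,
        inner_self_eq_norm_sq_to_K]
      simp [← Complex.ofReal_pow]
  -- Conjugation with U_s shifts the time in the approximants by s, which does not affect the limit.
  · refine ⟨⟨e s h, heS s h h.2⟩, rfl, ContinuousLinearMap.ext fun u => ?_⟩
    refine tendsto_nhds_unique (((U s).continuous.tendsto _).comp (hs h (U (-s) u))) ?_
    refine ((hs ⟨e s h, heS s h h.2⟩ u).comp (tendsto_atTop_add_const_right _ s tendsto_id)).congr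
      fun t => ?_
    exact (congrArg (fun T : E →L[ℂ] E => T u) (conj_interactionWeyl hU he hW (h : 𝔥) s t)).symm

end AsymptoticWeyl

/-! ### Number bounds for powers of the resolvent -/

section NumberBounds

variable {ι : Type*}

lemma fockCoord_of_mem_numberFun {f : ℕ → ℂ} {u v : Fock ι} (h : (u, v) ∈ (numberFun f).graph)
    (l : List ι) : fockCoord v l = f l.length * fockCoord u l := by
  rw [numberFun, Submodule.toLinearPMap_graph_eq] at h
  · exact h l
  · rintro ⟨x, y⟩ hx hx0
    refine fock_ext fun l => ?_
    have h1 := hx l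
    simp only at hx0 h1
    rw [h1, hx0, fockCoord_zero, mul_zero]

lemma numberInv_zero : numberInv 0 = (1 : Fock ι →L[ℂ] Fock ι) :=
  ContinuousLinearMap.ext fun u => fock_ext fun l => by simp

lemma numberInv_add (p q : ℕ) :
    numberInv (p + q) = numberInv p * (numberInv q : Fock ι →L[ℂ] Fock ι) :=
  ContinuousLinearMap.ext fun u => fock_ext fun l => by
    simp only [fockCoord_numberInv, mul_apply_eq_comp, pow_add, mul_inv, mul_assoc]

/-- The weight `(n + 1)^{p + 1} / n^M`, which vanishes at `n = 0`. -/
noncomputable def numberQuot (p M n : ℕ) : ℂ := ((n : ℂ) + 1) ^ (p + 1) * ((n : ℂ) ^ M)⁻¹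

lemma norm_numberQuot_le {p M : ℕ} (h : p < M) (n : ℕ) : ‖numberQuot p M n‖ ≤ 2 ^ (p + 1) := by
  rw [numberQuot, norm_mul, norm_pow, norm_natCast_add_one, norm_inv, norm_pow, Complex.norm_natCast]
  rcases Nat.eq_zero_or_pos n with rfl | hn
  · rw [Nat.cast_zero, zero_pow (by omega), inv_zero, mul_zero]
    positivity
  · have h1 : (1 : ℝ) ≤ n := by exact_mod_cast hn
    rw [← div_eq_mul_inv, div_le_iff₀ (by positivity)]
    calc ((n : ℝ) + 1) ^ (p + 1) ≤ (2 * n) ^ (p + 1) := by gcongr; linarith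
      _ = 2 ^ (p + 1) * (n : ℝ) ^ (p + 1) := mul_pow _ _ _
      _ ≤ 2 ^ (p + 1) * (n : ℝ) ^ M := by
        gcongr
        exact h

lemma norm_vacuumWeight_le (n : ℕ) : ‖(if n = 0 then 1 else 0 : ℂ)‖ ≤ 1 := by
  split_ifs <;> simp

/-- Each further factor K gains one power of (N+1)⁻¹: as N^M K (N+1)^{-p} is bounded for some M > p,
K maps the range of (N+1)^{-p} into that of (N+1)^{-(p+1)}. -/
lemma exists_numberInv_mul_pow {K : Fock ι →L[ℂ] Fock ι}
    (h : ∀ P : ℕ, ∃ M : ℕ, P < M ∧ ∃ T : Fock ι →L[ℂ] Fock ι, ∀ u, ∃ v,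
      (u, v) ∈ (numberFun (ι := ι) fun k => ((k : ℂ) + 1)⁻¹ ^ P).graph ∧
        (K v, T u) ∈ (numberFun (ι := ι) fun k => (k : ℂ) ^ M).graph) (p : ℕ) :
    ∃ T : Fock ι →L[ℂ] Fock ι, K ^ p = numberInv p * T := by
  induction p with
  | zero => exact ⟨1, by rw [numberInv_zero, pow_zero, mul_one]⟩
  | succ p ih =>
    obtain ⟨T, hT⟩ := ih
    obtain ⟨M, hM, R, hR⟩ := h p
    -- N^M loses the vacuum component, which is restored by the second term; on the vacuum
    -- (N+1)^{-(p+1)} is 1.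
    refine ⟨(numberMul (numberQuot p M) (norm_numberQuot_le hM) * R +
      numberMul (fun n => if n = 0 then 1 else 0) norm_vacuumWeight_le * (K * numberInv p)) * T, ?_⟩
    rw [pow_succ', hT]
    refine ContinuousLinearMap.ext fun u => fock_ext fun l => ?_
    obtain ⟨v, hv, hRv⟩ := hR (T u)
    have h1 : v = numberInv p (T u) := fock_ext fun l => by
      rw [fockCoord_of_mem_numberFun hv, fockCoord_numberInv, inv_pow]
    have h2 := fockCoord_of_mem_numberFun hRv l
    rw [h1] at h2
    simp only [mul_apply_eq_comp, add_apply, fockCoord_numberInv, fockCoord_add,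
      fockCoord_numberMul, h2, numberQuot]
    have h3 := natCast_add_one_ne_zero l.length
    rcases eq_or_ne l.length 0 with h0 | h0
    · rw [h0]
      simp [show M ≠ 0 by omega]
    · have h4 : (l.length : ℂ) ≠ 0 := Nat.cast_ne_zero.mpr h0
      rw [if_neg h0]
      field_simp
      ring

lemma exists_numberInv_mul_pow_of_le {K : Fock ι →L[ℂ] Fock ι} {p : ℕ} {T : Fock ι →L[ℂ] Fock ι}
    (h : K ^ p = numberInv p * T) {d : ℕ} (hd : d ≤ p) :
    ∃ Q : Fock ι →L[ℂ] Fock ι, K ^ p = numberInv d * Q := by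
  obtain ⟨k, rfl⟩ := Nat.exists_eq_add_of_le hd
  exact ⟨numberInv k * T, by rw [h, numberInv_add, mul_assoc]⟩

end NumberBounds

/-! ### Resolvents along the group; sums of graphs -/

section Resolvent

variable {E : Type*} [NormedAddCommGroup E] [InnerProductSpace ℂ E] [CompleteSpace E]

lemma IsResolventAt.apply_unitaryGroup {A : E →ₗ.[ℂ] E} {z : ℂ} {T : E →L[ℂ] E}
    (hT : IsResolventAt A z T) {U : ℝ → E →L[ℂ] E} (hU : IsUnitaryGroupOf A U) (t : ℝ) (u : E) :
    T (U t u) = U t (T u) := by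
  have h1 := hT.mem_graph u
  rw [← hU.generatorGraph_eq] at h1
  have h2 := hU.isUnitaryGroup.apply_mem_generatorGraph h1 t
  rw [hU.generatorGraph_eq] at h2
  have h3 := hT.apply_graph h2
  rw [← map_smul (U t), ← map_sub (U t), add_sub_cancel_right] at h3
  exact h3

lemma add_mem_closure_graph {A B : E →ₗ.[ℂ] E} {u a c : E} (ha : (u, a) ∈ A.graph)
    (hc : (u, c) ∈ B.graph) : (u, a + c) ∈ (A + B).closure.graph := by
  refine LinearPMap.le_graph_of_le (A + B).le_closure ?_
  obtain ⟨p, hp1, hp2⟩ := (LinearPMap.mem_graph_iff A).mp ha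
  obtain ⟨q, hq1, hq2⟩ := (LinearPMap.mem_graph_iff B).mp hc
  simp only at hp1 hp2 hq1 hq2
  have hu : u ∈ (A + B).domain := ⟨hp1 ▸ p.2, hq1 ▸ q.2⟩
  refine (LinearPMap.mem_graph_iff _).mpr ⟨⟨u, hu⟩, rfl, ?_⟩
  rw [LinearPMap.add_apply, ← hp2, ← hq2]
  congr 2
  · exact Subtype.ext hp1.symm
  · exact Subtype.ext hq1.symm

end Resolvent

lemma exists_smooth_cutoff {ε : ℝ} (hε : 0 < ε) : ∃ j : ℝ → ℝ, ContDiff ℝ (⊤ : ℕ∞) j ∧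
    (∀ᶠ r in 𝓝 0, j r = 0) ∧ (∀ r, ε ≤ |r| → j r = 1) ∧ (∀ r, 0 ≤ j r) ∧ ∀ r, j r ≤ 1 := by
  let f : ContDiffBump (0 : ℝ) := ⟨ε / 2, ε, by positivity, by linarith⟩
  refine ⟨fun r => 1 - f r, contDiff_const.sub f.contDiff, ?_, fun r hr => ?_,
    fun r => sub_nonneg.mpr f.le_one, fun r => sub_le_self _ f.nonneg⟩
  · filter_upwards [f.eventuallyEq_one] with r hr
    rw [hr]
    simp
  · change 1 - f r = 1
    rw [f.zero_of_le_dist (by simpa [Real.dist_eq] using hr), sub_zero]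

/-! ### Decay of the commutator along the free evolution -/

section Scattering

variable {ι 𝔥 : Type*} [NormedAddCommGroup 𝔥] [InnerProductSpace ℂ 𝔥] [CompleteSpace 𝔥]
  (b : HilbertBasis ι ℂ 𝔥)

lemma norm_inner_weylShift_le (h v : 𝔥) : ‖(inner ℂ (weylShift h) v : ℂ)‖ ≤ ‖(inner ℂ h v : ℂ)‖ := by
  rw [weylShift, inner_smul_left, norm_mul]
  refine mul_le_of_le_one_left (norm_nonneg _) ?_
  rw [RCLike.norm_conj, norm_mul, Complex.norm_I, one_mul, norm_inv, Complex.norm_real,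
    Real.norm_of_nonneg (Real.sqrt_nonneg _)]
  exact inv_le_one_of_one_le₀ (Real.one_le_sqrt.mpr (by norm_num))

lemma norm_weylShift_le (h : 𝔥) : ‖weylShift h‖ ≤ ‖h‖ := by
  rw [weylShift, norm_smul]
  refine mul_le_of_le_one_left (norm_nonneg _) ?_
  rw [norm_mul, Complex.norm_I, one_mul, norm_inv, Complex.norm_real,
    Real.norm_of_nonneg (Real.sqrt_nonneg _)]
  exact inv_le_one_of_one_le₀ (Real.one_le_sqrt.mpr (by norm_num))

/-- The creation part of `W(h_t)` decouples from a short-range symbol `w`. -/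
lemma exists_norm_capCreate_mul_le {X : 𝔥 →ₗ.[ℂ] 𝔥} {w : Fock ι →L[ℂ] Fock ι} {s : ℝ}
    (hX : IsSelfAdjoint X) (hX1 : FormBoundedBelow X 1) (hs : 1 < s) (hIs : ShortRange b X w s)
    (d : ℕ) {e : ℝ → 𝔥 →L[ℂ] 𝔥} (he : IsUnitaryGroup e) {h : 𝔥} {ε μ C : ℝ} (hε : 0 < ε)
    (hμ : 1 < μ) (hC : ∀ t : ℝ, 1 ≤ t →
      ‖functionOf X (fun r => (Set.Icc (0 : ℝ) ε).indicator 1 (r / |t|)) (e (-t) h)‖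
        ≤ C * t ^ (-μ)) :
    ∃ M ν : ℝ, 0 ≤ M ∧ 1 < ν ∧ ∀ t, 1 ≤ t →
      ‖ContinuousLinearMap.adjoint (capCreate b d (weylShift (e (-t) h))) * w‖ ≤ M * t ^ (-ν) := by
  obtain ⟨j, hj, hj0, hj1, hjn, hjo⟩ := exists_smooth_cutoff hε
  obtain ⟨C', hC'⟩ := hIs j hj hj0
    ((eventually_ge_atTop ε).mono fun r hr => hj1 r (hr.trans (le_abs_self r)))
    ((eventually_le_atBot (-ε)).mono fun r hr => hj1 r (by
      have := neg_le_abs r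
      linarith))
  -- The two decay rates are those of the low-⟨x⟩ part of h_t and of the cut-off leg of w. Absolute
  -- values are taken since neither given constant is assumed nonnegative.
  refine ⟨2 * d * (|C| * ‖w‖ + ‖h‖ * |C'|), min μ s,
    mul_nonneg (by positivity) (add_nonneg (mul_nonneg (abs_nonneg _)
      (ContinuousLinearMap.opNorm_nonneg w)) (by positivity)), lt_min hμ hs, fun t ht => ?_⟩
  have ht0 : 0 < t := by linarith
  have h1 : ∀ {p : ℝ}, min μ s ≤ p → t ^ (-p) ≤ t ^ (-min μ s) := fun hp =>
    Real.rpow_le_rpow_of_exponent_le ht (neg_le_neg hp)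
  have h2 := norm_adjoint_capCreate_mul_le b d (weylShift (e (-t) h))
    (functionOf X fun r => (j (r / t) : ℂ)) w (A := |C| * t ^ (-min μ s)) (B := ‖h‖)
    (L := |C'| * t ^ (-min μ s)) (by positivity) (norm_nonneg _) (by positivity) (fun v => ?_) ?_
  · refine h2.trans (le_of_eq ?_)
    ring
  · refine (norm_inner_weylShift_le _ _).trans ((norm_inner_le_functionOf hX hX1
      hj.continuous.measurable hjn hjo ht0
      (fun r hr => hj1 r (hr.le.trans (le_abs_self r))) (e (-t) h) v).trans ?_)
    rw [he.norm_apply]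
    gcongr
    refine (hC t ht).trans ?_
    calc C * t ^ (-μ) ≤ |C| * t ^ (-μ) := by gcongr; exact le_abs_self C
      _ ≤ _ := by gcongr |C| * ?_; exact h1 (min_le_left _ _)
  · refine (le_add_right le_rfl : _ ≤ tripleNorm b _ w).trans ((hC' t ht).trans
      (ENNReal.ofReal_le_ofReal ?_))
    calc C' * t ^ (-s) ≤ |C'| * t ^ (-s) := by gcongr; exact le_abs_self C'
      _ ≤ _ := by gcongr |C'| * ?_; exact h1 (min_le_right _ _)

lemma isWeylSystem_weylOp : IsWeylSystem (E := Fock ι) (weylOp b) where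
  mem_unitary := weylOp_mem_unitary b
  zero := by rw [weylOp_eq_displacement, weylShift, smul_zero, displacement_zero]
  mul := weylOp_mul b

lemma secondQuant_conj_weylOp {e : ℝ → 𝔥 →L[ℂ] 𝔥} (he : IsUnitaryGroup e) (t : ℝ) (h : 𝔥)
    (u : Fock ι) : secondQuant b (e (-t)) (weylOp b h (secondQuant b (e t) u)) =
      weylOp b (e (-t) h) u := by
  have h1 := congrArg (fun T : Fock ι →L[ℂ] Fock ι => T (secondQuant b (e t) u))
    (secondQuant_mul_weylOp b (he.mem_unitary (-t)) h)
  simp only [mul_apply_eq_comp] at h1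
  rw [h1]
  congr 1
  exact (isUnitaryGroup_secondQuant b he).neg_apply t u

/-- Second quantization turns W(h_t) into a free conjugate of the fixed operator W(h), the form
required by Cook's estimate. Since J y = (N+1)^{-d} Q y, the commutator bound is already expressed
through ‖J y‖. -/
lemma cauchySeq_weylOp {w : Fock ι →L[ℂ] Fock ι} (hw : IsSelfAdjoint w) {d : ℕ}
    {e : ℝ → 𝔥 →L[ℂ] 𝔥} (he : IsUnitaryGroup e) {U : ℝ → Fock ι →L[ℂ] Fock ι}
    (hU : IsUnitaryGroup U) {J Q : Fock ι →L[ℂ] Fock ι} (hJQ : J = numberInv d * Q)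
    (hJ : DenseRange J) (hJU : ∀ t u, J (U t u) = U t (J u))
    (hgen : ∀ u, ∃ a, (J u, a) ∈ generatorGraph (fun t => secondQuant b (e t)) ∧
      (J u, a + wickReg d w (Q u)) ∈ generatorGraph U) {h : 𝔥} {M ν : ℝ} (hM : 0 ≤ M) (hν : 1 < ν)
    (hb : ∀ t, 1 ≤ t →
      ‖ContinuousLinearMap.adjoint (capCreate b d (weylShift (e (-t) h))) * w‖ ≤ M * t ^ (-ν)) :
    CauchySeq fun t => interactionWeyl U e (weylOp b) h t * J := by
  have hQ : 0 ≤ ‖Q‖ := ContinuousLinearMap.opNorm_nonneg Q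
  set c : ℝ := (((d : ℝ) + 1) ^ d * (d + 1)) ^ 2 * (2 * Real.exp (2 * (d * ‖h‖)) * M) * ‖Q‖ with hc
  have hc0 : 0 ≤ c := mul_nonneg (by positivity) hQ
  have h1 := cauchySeq_cook (E := Fock ι) hU (isUnitaryGroup_secondQuant b he) (V := wickReg d w)
    (W := weylOp b h) hJU hgen hJ hν hc0 ?_
  · convert! h1 using 2 with t
    refine ContinuousLinearMap.ext fun u => ?_
    exact congrArg (U t) (secondQuant_conj_weylOp b he t h (U (-t) (J u))).symm
  · intro t ht x y
    rw [secondQuant_conj_weylOp b he, secondQuant_conj_weylOp b he, hJQ, mul_apply_eq_comp,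
      mul_apply_eq_comp, weylOp_eq_displacement]
    refine (norm_commutator_le b d _ hw (Q x) (Q y)).trans ?_
    have h2 : ‖weylShift (e (-t) h)‖ ≤ ‖h‖ := (norm_weylShift_le _).trans (he.norm_apply _ _).le
    have h3 : ‖Q x‖ ≤ ‖Q‖ * ‖x‖ := Q.le_opNorm x
    calc _ ≤ (((d : ℝ) + 1) ^ d * (d + 1)) ^ 2 * (2 * Real.exp (2 * (d * ‖h‖)) * (M * t ^ (-ν))) *
          (‖Q‖ * ‖x‖) * ‖numberInv d (Q y)‖ := by
          gcongr
          exact hb t ht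
      _ = _ := by rw [hc]; ring

end Scattering

/-! ### Consequences of the axioms and the main theorem -/

section AbstractQFT

variable {ι 𝔥 : Type*} [NormedAddCommGroup 𝔥] [InnerProductSpace ℂ 𝔥] [CompleteSpace 𝔥]
  {b : HilbertBasis ι ℂ 𝔥} {ω : 𝔥 →ₗ.[ℂ] 𝔥} {w : Fock ι →L[ℂ] Fock ι} {d : ℕ} {β : ℝ}

namespace IsAbstractQFT

/-- The mass gap puts 0 in the resolvent set, a real point from which Stone's theorem starts. -/
lemma isUnitaryGroupOf_omega (hH : IsAbstractQFT b ω w d β) : IsUnitaryGroupOf ω (expI ω) := by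
  obtain ⟨m, hm, hglb⟩ := hH.mass_gap
  have h0 : ∃ T, IsResolventAt ω ((0 : ℝ) : ℂ) T := by
    by_contra h
    exact absurd (hglb.1 (show (0 : ℝ) ∈ realSpectrum ω from h)) (not_le.mpr hm)
  obtain ⟨T, hT⟩ := h0
  obtain ⟨U, hU⟩ := exists_isUnitaryGroupOf hH.omega_selfAdjoint hT
  exact hU.isUnitaryGroupOf_expI

lemma hamiltonian_selfAdjoint (hH : IsAbstractQFT b ω w d β) :
    IsSelfAdjoint (hamiltonian b ω w d) := hH.essSelfAdjoint

lemma isResolventAt (hH : IsAbstractQFT b ω w d β) : IsResolventAt (hamiltonian b ω w d)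
    ((-β : ℝ) : ℂ) (resolventOp (hamiltonian b ω w d) (-β)) := by
  obtain ⟨T, hT⟩ := exists_isResolventAt_of_formBoundedBelow (z := -β) hH.hamiltonian_selfAdjoint
    hH.shift (by linarith)
  have h := hT.resolventOp_eq
  rw [Complex.ofReal_neg] at h
  rwa [h]

lemma isUnitaryGroupOf_hamiltonian (hH : IsAbstractQFT b ω w d β) :
    IsUnitaryGroupOf (hamiltonian b ω w d) (expI (hamiltonian b ω w d)) := by
  obtain ⟨U, hU⟩ := exists_isUnitaryGroupOf hH.hamiltonian_selfAdjoint hH.isResolventAt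
  exact hU.isUnitaryGroupOf_expI

/-- A power of the resolvent maps into the domain of `H₀` and regularizes the number operator. -/
lemma exists_resolvent_pow (hH : IsAbstractQFT b ω w d β) :
    ∃ n : ℕ, (∀ u, ∃ v, ((resolventOp (hamiltonian b ω w d) (-β) ^ n) u, v) ∈ (dGamma b ω).graph) ∧
      (∃ Q, resolventOp (hamiltonian b ω w d) (-β) ^ n = numberInv d * Q) ∧
      ∃ Q, resolventOp (hamiltonian b ω w d) (-β) ^ n = numberInv 1 * Q := by
  obtain ⟨p, T, hT⟩ := hH.higherOrder₁ 0
  obtain ⟨R, hR⟩ := exists_numberInv_mul_pow hH.higherOrder₂ (p + (d + 1))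
  -- The first p factors reach D(H₀). The additional d + 1 make the total at least d and at least 1,
  -- also when d = 0.
  refine ⟨p + (d + 1), fun u => ?_, exists_numberInv_mul_pow_of_le hR (by omega),
    exists_numberInv_mul_pow_of_le hR (by omega)⟩
  obtain ⟨v, hv, -⟩ := hT ((resolventOp (hamiltonian b ω w d) (-β) ^ (d + 1)) u)
  exact ⟨v, by rw [pow_add]; exact hv⟩

end IsAbstractQFT

end AbstractQFT

theorem theorem4 {ι 𝔥 : Type*} [NormedAddCommGroup 𝔥] [InnerProductSpace ℂ 𝔥] [CompleteSpace 𝔥]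
    (b : HilbertBasis ι ℂ 𝔥)
    (ω X : 𝔥 →ₗ.[ℂ] 𝔥) (w : Fock ι →L[ℂ] Fock ι) (d : ℕ) (β s : ℝ)
    (hH : IsAbstractQFT b ω w d β)
    (hX : IsSelfAdjoint X) (hX1 : FormBoundedBelow X 1)
    (hs : 1 < s) (hIs : ShortRange b X w s) (hS : DynamicalEstimate ω X) :
    ∃ Wp : contSpectralSubspace ω → Fock ι →L[ℂ] Fock ι,
      (∀ (h : contSpectralSubspace ω) (u : Fock ι), Tendsto (fun t : ℝ => expI (hamiltonian b ω w d) t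
          (weylOp b (expI ω (-t) h) (expI (hamiltonian b ω w d) (-t) u))) atTop (𝓝 (Wp h u))) ∧
      (∃ n₀ : ℕ, ∀ n ≥ n₀,
        (∀ h : contSpectralSubspace ω, Tendsto (fun t : ℝ => expI (hamiltonian b ω w d) t * weylOp b (expI ω (-t) h) *
            resolventOp (hamiltonian b ω w d) (-β) ^ n * expI (hamiltonian b ω w d) (-t)) atTop
          (𝓝 (Wp h * resolventOp (hamiltonian b ω w d) (-β) ^ n))) ∧
        Continuous fun h => Wp h * resolventOp (hamiltonian b ω w d) (-β) ^ n) ∧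
      (∀ u, Continuous fun h => Wp h u) ∧
      (∀ h, Wp h ∈ unitary (Fock ι →L[ℂ] Fock ι)) ∧
      (∀ h g, Wp h * Wp g =
        Complex.exp (-Complex.I * (1 / 2) * ((inner ℂ (h : 𝔥) (g : 𝔥)).im : ℂ)) • Wp (h + g)) ∧
      (∀ (t : ℝ) (h : contSpectralSubspace ω), ∃ g : contSpectralSubspace ω,
        (g : 𝔥) = expI ω t h ∧
          expI (hamiltonian b ω w d) t * Wp h * expI (hamiltonian b ω w d) (-t) = Wp g) := by
  have heω := hH.isUnitaryGroupOf_omega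
  have he := heω.isUnitaryGroup
  have hUH := hH.isUnitaryGroupOf_hamiltonian
  have hU := hUH.isUnitaryGroup
  have hK := hH.isResolventAt.denseRange hH.hamiltonian_selfAdjoint
  have hKU := hH.isResolventAt.apply_unitaryGroup hUH
  obtain ⟨n₀, hdom, ⟨Q, hQ⟩, Q₁, hQ₁⟩ := hH.exists_resolvent_pow
  obtain ⟨𝔥₀, -, hdense, hdyn⟩ := hS
  set K := resolventOp (hamiltonian b ω w d) (-β) with hKdef
  have hJU : ∀ t u, (K ^ n₀) (expI (hamiltonian b ω w d) t u) =
      expI (hamiltonian b ω w d) t ((K ^ n₀) u) := fun t => pow_apply_comm (E := Fock ι) (hKU t) n₀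
  -- The range of K^{n₀} lies in D(H₀) ∩ D(V), where H is the honest sum H₀ + V and not merely its
  -- closure.
  have hgen : ∀ u, ∃ a, ((K ^ n₀) u, a) ∈ generatorGraph (fun t => secondQuant b (expI ω t)) ∧
      ((K ^ n₀) u, a + wickReg d w (Q u)) ∈ generatorGraph (expI (hamiltonian b ω w d)) := by
    intro u
    obtain ⟨a, ha⟩ := hdom u
    refine ⟨a, dGamma_graph_le b he heω.generatorGraph_eq.ge ha, ?_⟩
    rw [hUH.generatorGraph_eq]
    refine add_mem_closure_graph ha ?_
    rw [hQ]
    exact mem_graph_wickOp b hH.symbol_finOrder hH.symbol_selfAdjoint (Q u)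
  -- The factorization through (N+1)⁻¹ is what makes W(h) differ from 1 by O(‖h‖) on the range of
  -- K^{n₀}.
  have hKW : ∀ h x, ‖weylOp b h ((K ^ n₀) x) - (K ^ n₀) x‖ ≤ 2 * ‖Q₁‖ * ‖h‖ * ‖x‖ := by
    intro h x
    rw [hQ₁]
    refine (norm_weylOp_numberInv_sub_le b h (Q₁ x)).trans ?_
    have h4 : ‖Q₁ x‖ ≤ ‖Q₁‖ * ‖x‖ := Q₁.le_opNorm x
    calc 2 * ‖h‖ * ‖Q₁ x‖ ≤ 2 * ‖h‖ * (‖Q₁‖ * ‖x‖) := by gcongr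
      _ = _ := by ring
  have hcauchy : ∀ h ∈ (𝔥₀ : Set 𝔥), CauchySeq fun t =>
      interactionWeyl (expI (hamiltonian b ω w d)) (expI ω) (weylOp b) h t * K ^ n₀ := by
    intro h hh
    obtain ⟨ε, hε, μ, hμ, C, hC⟩ := hdyn h hh
    obtain ⟨M, ν, hM, hν, hb⟩ := exists_norm_capCreate_mul_le b hX hX1 hs hIs d he hε hμ hC
    exact cauchySeq_weylOp b hH.symbol_selfAdjoint he hU hQ
      (denseRange_pow (E := Fock ι) hK n₀) hJU hgen hM hν hb
  obtain ⟨Wp, h1, h2, h3⟩ := exists_asymptotic_weyl (E := Fock ι) hU he (isWeylSystem_weylOp b) hK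
    hKU (mul_nonneg zero_le_two (ContinuousLinearMap.opNorm_nonneg Q₁)) hKW
    (S := contSpectralSubspace ω) (fun t h hh => expI_apply_mem_contSpectralSubspace heω t hh)
    hdense hcauchy
  exact ⟨Wp, h1, ⟨n₀, h2⟩, h3⟩
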